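/- Let $0<a<b$, $c>1$, $\alpha_c=\sqrt{(c^2-1)/(bc^2-a)}$ and $\alpha\in(0,\alpha_c)$. Let $q_c(z)=\frac{c^2-1}{c}\,\mathrm{sech}^2(\alpha_c z/2)$, $r_c=-cq_c$, $A=I-a\Delta$, $B=I-b\Delta$, and consider the linearization of the Benney--Luke equation around the line solitary wave with speed $c$, in the moving frame $(z,y)\in\mathbb R^2$, $$\mathcal L\begin{pmatrix}\Phi\\ \Psi\end{pmatrix}=\begin{pmatrix} c\partial_z\Phi+\Psi\\ c\partial_z\Psi+B^{-1}\bigl(A\Delta\Phi-(2r_c'\partial_z+r_c\Delta)\Phi-(2q_c\partial_z+q_c')\Psi\bigr)\end{pmatrix},$$ as an operator with maximal domain in $X=H^1_\alpha(\mathbb R^2)\times L^2_\alpha(\mathbb R^2)$ (complex valued), where $L^2_\alpha=L^2(e^{2\alpha z}dz\,dy)$ and $\|u\|_{H^1_\alpha}^2=\|\partial_zu\|_{L^2_\alpha}^2+\|\partial_yu\|_{L^2_\alpha}^2+\|u\|_{L^2_\alpha}^2$. For $\eta\in\mathbb R$ let $\mathcal L(\eta)=e^{-iy\eta}\mathcal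 L e^{iy\eta}$, acting on functions of $z$ in $H^1_\alpha(\mathbb R)\times L^2_\alpha(\mathbb R)$, and let $\mathcal L(\eta)^*$ be its adjoint with respect to $\langle f,g\rangle=\sum_j\int_{\mathbb R} f_j\overline{g_j}\,dz$. Let $\eta_0>0$, and let $\lambda(\eta)\in\mathbb C$, $\zeta(\cdot,\eta)\in H^1_\alpha(\mathbb R)\times L^2_\alpha(\mathbb R)$ and $\zeta^*(\cdot,\eta)\in H^1_{-\alpha}(\mathbb R)\times L^2_{-\alpha}(\mathbb R)$, $\eta\in[-\eta_0,\eta_0]$, be the curve of resonant modes: they are $C^\infty$ in $\eta$, $$\mathcal L(\eta)\zeta(\cdot,\eta)=\lambda(\eta)\zeta(\cdot,\eta),\qquad \mathcal L(\eta)^*\zeta^*(\cdot,\eta)=\lambda(-\eta)\zeta^*(\cdot,\eta),$$ $\overline{\lambda(\eta)}=\lambda(-\eta)$, $\overline{\zeta(\cdot,\eta)}=\zeta(\cdot,-\eta)$, $\overline{\zeta^*(\cdot,\eta)}=\zeta^*(\cdot,-\eta)$, and for some $\lambda_1>0$ $$\lambda(\eta)=i\lambda_1\eta+O(\eta^2),\quad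 \zeta(\cdot,\eta)=\zeta_1+i\lambda_1\eta\,\zeta_2+O(\eta^2),\quad \zeta^*(\cdot,\eta)=\zeta_2^*-i\lambda_1\eta\,\zeta_1^*+O(\eta^2),$$ where, with $A_0=1-a\partial_z^2$ and $B_0=1-b\partial_z^2$, $$\zeta_1=\begin{pmatrix}q_c\\ r_c'\end{pmatrix},\quad \zeta_2=\begin{pmatrix}\int_z^\infty\partial_cq_c\\ -\partial_cr_c\end{pmatrix},\quad \zeta_1^*=c\begin{pmatrix}-B_0\partial_cr_c-2q_c\partial_cq_c-q_c'\int_{-\infty}^z\partial_cq_c\\ B_0\int_{-\infty}^z\partial_cq_c\end{pmatrix},\quad \zeta_2^*=\begin{pmatrix}A_0q_c'\\ -B_0r_c\end{pmatrix}.$$ Here $\eta_0$ is such that for $0<|\eta|\le\eta_0$ one has $\mathrm{Im}\,\lambda(\eta)\ne0$ and $\mathrm{Im}\langle\zeta(\cdot,\eta),\zeta^*(\cdot,\eta)\rangle\neq0$. Put $g=\bigl(1+i\tfrac{\mathrm{Re}\langle\zeta,\zeta^*\rangle}{\mathrm{Im}\langle\zeta,\zeta^*\rangle}\bigr)\zeta$,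 $g^*=\zeta^*$, $\kappa(\eta)=\frac12\mathrm{Im}\langle g(\cdot,\eta),g^*(\cdot,\eta)\rangle$, $$g_1(\cdot,\eta)=\tfrac12\{g(\cdot,\eta)+g(\cdot,-\eta)\},\quad g_2(\cdot,\eta)=\tfrac1{2i\kappa(\eta)}\{g(\cdot,\eta)-g(\cdot,-\eta)\},$$ $$g_1^*(\cdot,\eta)=\tfrac{i}{2\kappa(\eta)}\{g^*(\cdot,\eta)-g^*(\cdot,-\eta)\},\quad g_2^*(\cdot,\eta)=\tfrac12\{g^*(\cdot,\eta)+g^*(\cdot,-\eta)\}.$$ Let $\mathcal P(\eta_0)$ be the spectral projection onto the resonant modes, that is, with $\mathcal F_yf(z,\eta)=(2\pi)^{-1/2}\int_{\mathbb R} f(z,y)e^{-iy\eta}\,dy$, $$\mathcal P(\eta_0)f(z,y)=\frac1{\sqrt{2\pi}}\sum_{k=1,2}\int_{-\eta_0}^{\eta_0}\bigl\langle \mathcal F_yf(\cdot,\eta),g_k^*(\cdot,\eta)\bigr\rangle\, g_k(z,\eta)e^{iy\eta}\,d\eta ,$$ let $\mathcal Q(\eta_0)=I-\mathcal P(\eta_0)$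 and $Z=\mathcal Q(\eta_0)X$. Then $\mathcal P(\eta_0)$ is bounded on $X$, and $\mathcal L$ generates a $C^0$-semigroup $e^{t\mathcal L}$ on $X$. Moreover, if for some $\beta>0$ $$\sigma(\mathcal L|_Z)\subset\{\lambda\in\mathbb C\mid \mathrm{Re}\,\lambda\le-\beta\},$$ then for every $\beta'<\beta$ there exists a constant $C>0$ such that $$\|e^{t\mathcal L}\mathcal Q(\eta_0)\|_{B(X)}\le Ce^{-\beta' t}\qquad\text{for all } t\ge0.$$ -/

import Mathlib

open MeasureTheory Set Filter Topology
open scoped ContDiff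

noncomputable section

namespace BenneyLuke

/-! ### Test functions and distributional calculus -/

section Distributions

variable {E : Type*} [NormedAddCommGroup E] [NormedSpace ℝ E] [MeasureSpace E]

/-- Test functions: complex valued, smooth, compactly supported. -/
def IsTest (φ : E → ℂ) : Prop := ContDiff ℝ ∞ φ ∧ HasCompactSupport φ

/-- Functionals on functions; only their values on test functions are ever used. -/
abbrev Functional (E : Type*) := (E → ℂ) → ℂ

/-- The distribution `φ ↦ ∫ f φ` given by a (locally integrable) function `f`. -/
def ofFun (f : E → ℂ) : Functional E := fun φ => ∫ x, f x * φ x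

/-- Distributional derivative in the direction `v`. -/
def pd (v : E) (T : Functional E) : Functional E := fun φ => -T (fun x => fderiv ℝ φ x v)

/-- Multiplication of a distribution by a smooth real function. -/
def mulBy (g : E → ℝ) (T : Functional E) : Functional E := fun φ => T (fun x => (g x : ℂ) * φ x)

/-- Equality in the sense of distributions. -/
def EqDistr (S T : Functional E) : Prop := ∀ φ, IsTest φ → S φ = T φ

end Distributions

/-! ### Weighted Lebesgue and Sobolev spaces -/

section Spaces

variable {E : Type*} [NormedAddCommGroup E] [NormedSpace ℝ E] [MeasureSpace E]

/-- The measure `e^{2 w(x)} dx`. -/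
def weighted (w : E → ℝ) : Measure E :=
  (volume : Measure E).withDensity (fun x => ENNReal.ofReal (Real.exp (2 * w x)))

/-- `L²(e^{2w} dx)`, complex valued. -/
abbrev L2w (w : E → ℝ) := Lp ℂ 2 (weighted w)

/-- Pairing with a test function is a bounded functional on `L²(e^{2w} dx)`. -/
theorem exists_pairing [BorelSpace E] [IsFiniteMeasureOnCompacts (volume : Measure E)]
    {w : E → ℝ} (hw : Continuous w) {φ : E → ℂ} (hφ : Continuous φ) (hc : HasCompactSupport φ) :
    ∃ l : L2w w →L[ℂ] ℂ, ∀ f : L2w w, l f = ∫ x, f x * φ x := by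
  set ψ : E → ℂ := fun x => (starRingEnd ℂ) (φ x) * (Real.exp (-(2 * w x)) : ℂ) with hψ
  have hψc : Continuous ψ := by
    refine (Complex.continuous_conj.comp hφ).mul ?_
    exact Complex.continuous_ofReal.comp (Real.continuous_exp.comp (by fun_prop))
  have hψs : HasCompactSupport ψ := by
    refine HasCompactSupport.mul_right ?_
    exact hc.comp_left (g := starRingEnd ℂ) (map_zero _)
  have hm : Measurable (fun x => ENNReal.ofReal (Real.exp (2 * w x))) := by
    have : Continuous (fun x => Real.exp (2 * w x)) := by fun_prop
    exact this.measurable.ennreal_ofReal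
  have hloc : IsFiniteMeasureOnCompacts (weighted w) := by
    refine ⟨fun K hK => ?_⟩
    have hcont : ContinuousOn (fun x => Real.exp (2 * w x)) K := by fun_prop
    obtain ⟨M, hM⟩ := hK.exists_bound_of_continuousOn hcont
    have h1 : weighted w K ≤ ∫⁻ x in K, ENNReal.ofReal M := by
      rw [weighted, withDensity_apply _ hK.measurableSet]
      refine setLIntegral_mono' ?_ ?_
      · exact hK.measurableSet
      · intro x hx
        exact ENNReal.ofReal_le_ofReal ((le_abs_self _).trans (hM x hx))
    refine h1.trans_lt ?_
    rw [setLIntegral_const]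
    exact ENNReal.mul_lt_top ENNReal.ofReal_lt_top hK.measure_lt_top
  have hmem : MemLp ψ 2 (weighted w) := hψc.memLp_of_hasCompactSupport hψs
  refine ⟨innerSL ℂ (hmem.toLp ψ), fun f => ?_⟩
  rw [innerSL_apply_apply, L2.inner_def]
  have h1 : ∫ x, inner ℂ (hmem.toLp ψ x) (f x) ∂(weighted w)
      = ∫ x, inner ℂ (ψ x) (f x) ∂(weighted w) := by
    refine integral_congr_ae ?_
    filter_upwards [hmem.coeFn_toLp] with x hx
    rw [hx]
  rw [h1]
  refine (integral_withDensity_eq_integral_toReal_smul hm (by simp) _).trans ?_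
  refine integral_congr_ae (Eventually.of_forall fun x => ?_)
  have h2 : ((Real.exp (2 * w x) : ℝ) : ℂ) * ((Real.exp (-(2 * w x)) : ℝ) : ℂ) = 1 := by
    rw [← Complex.ofReal_mul, ← Real.exp_add]; simp
  simp only [ENNReal.toReal_ofReal (Real.exp_pos _).le, hψ, RCLike.inner_apply, map_mul,
    Complex.conj_conj, Complex.conj_ofReal, Complex.real_smul]
  calc _ = (f x * φ x) *
        (((Real.exp (2 * w x) : ℝ) : ℂ) * ((Real.exp (-(2 * w x)) : ℝ) : ℂ)) := by ring
    _ = _ := by rw [h2, mul_one]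

/-- For a given test function, weak differentiability relations are closed linear conditions. -/
theorem exists_weakDeriv_functional [BorelSpace E]
    [IsFiniteMeasureOnCompacts (volume : Measure E)]
    {w : E → ℝ} (hw : Continuous w) {n : ℕ} (e : Fin n → E) (i : Fin n) {φ : E → ℂ}
    (hφ : IsTest φ) :
    ∃ l : PiLp 2 (fun _ : Fin (n + 1) => L2w w) →L[ℂ] ℂ, ∀ U,
      l U = pd (e i) (ofFun (U 0)) φ - ofFun (U i.succ) φ := by
  have hd : Continuous (fun x => fderiv ℝ φ x (e i)) :=
    (hφ.1.continuous_fderiv (by simp)).clm_apply continuous_const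
  have hds : HasCompactSupport (fun x => fderiv ℝ φ x (e i)) :=
    (hφ.2.fderiv (𝕜 := ℝ)).comp_left (g := fun L : E →L[ℝ] ℂ => L (e i)) (by simp)
  obtain ⟨l1, h1⟩ := exists_pairing hw hd hds
  obtain ⟨l2, h2⟩ := exists_pairing hw hφ.1.continuous hφ.2
  refine ⟨-(l1.comp (PiLp.proj 2 (fun _ : Fin (n + 1) => L2w w) 0))
    - l2.comp (PiLp.proj 2 (fun _ : Fin (n + 1) => L2w w) i.succ), fun U => ?_⟩
  simp [pd, ofFun, h1, h2]

/-- The weighted Sobolev space of those `u ∈ L²(e^{2w} dx)` whose weak derivatives in the directions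
`e 0, …, e (n-1)` are in `L²(e^{2w} dx)`. An element is the tuple `(u, ∂_{e 0} u, …)`, so that the
norm inherited from `PiLp 2` is `(‖u‖² + ∑ ‖∂_{e i} u‖²)^{1/2}`. -/
def H1w [BorelSpace E] [IsFiniteMeasureOnCompacts (volume : Measure E)]
    (w : C(E, ℝ)) {n : ℕ} (e : Fin n → E) :
    Submodule ℂ (PiLp 2 (fun _ : Fin (n + 1) => L2w w)) where
  carrier := {U | ∀ i : Fin n, EqDistr (pd (e i) (ofFun (U 0))) (ofFun (U i.succ))}
  add_mem' := by
    intro U V hU hV i φ hφ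
    obtain ⟨l, hl⟩ := exists_weakDeriv_functional w.continuous e i hφ
    rw [← sub_eq_zero, ← hl, map_add, hl, hl, hU i φ hφ, hV i φ hφ]; simp
  zero_mem' := by
    intro i φ hφ
    obtain ⟨l, hl⟩ := exists_weakDeriv_functional w.continuous e i hφ
    rw [← sub_eq_zero, ← hl, map_zero]
  smul_mem' := by
    intro k U hU i φ hφ
    obtain ⟨l, hl⟩ := exists_weakDeriv_functional w.continuous e i hφ
    rw [← sub_eq_zero, ← hl, map_smul, hl, hU i φ hφ]; simp

theorem isClosed_H1w [BorelSpace E] [IsFiniteMeasureOnCompacts (volume : Measure E)]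
    (w : C(E, ℝ)) {n : ℕ} (e : Fin n → E) :
    IsClosed (H1w w e : Set (PiLp 2 (fun _ : Fin (n + 1) => L2w w))) := by
  have : (H1w w e : Set (PiLp 2 (fun _ : Fin (n + 1) => L2w w))) =
      ⋂ (i : Fin n), ⋂ (φ : E → ℂ), ⋂ (_ : IsTest φ),
        {U | pd (e i) (ofFun (U 0)) φ - ofFun (U i.succ) φ = 0} := by
    ext U
    simp only [mem_iInter, mem_ofPred_eq, sub_eq_zero]
    rfl
  rw [this]
  refine isClosed_iInter fun i => isClosed_iInter fun φ => isClosed_iInter fun hφ => ?_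
  obtain ⟨l, hl⟩ := exists_weakDeriv_functional w.continuous e i hφ
  simp only [← hl]
  exact isClosed_eq l.continuous continuous_const

instance [BorelSpace E] [IsFiniteMeasureOnCompacts (volume : Measure E)]
    (w : C(E, ℝ)) {n : ℕ} (e : Fin n → E) : CompleteSpace (H1w w e) :=
  (isClosed_H1w w e).completeSpace_coe

end Spaces

/-- The weight exponent `α z` on the line. -/
def wt1 (α : ℝ) : C(ℝ, ℝ) := ⟨fun z => α * z, by fun_prop⟩

/-- The weight exponent `α z` on the plane with coordinates `(z, y)`. -/
def wt2 (α : ℝ) : C(ℝ × ℝ, ℝ) := ⟨fun p => α * p.1, by fun_prop⟩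

/-- `H¹_α(ℝ)`. -/
abbrev H1line (α : ℝ) := H1w (wt1 α) (fun _ : Fin 1 => (1 : ℝ))

/-- `H¹_α(ℝ²)`. -/
abbrev H1plane (α : ℝ) := H1w (wt2 α) (![((1 : ℝ), (0 : ℝ)), (0, 1)])

/-- `H¹_α(ℝ) × L²_α(ℝ)`. -/
abbrev Xline (α : ℝ) := WithLp 2 (H1line α × L2w (wt1 α))

/-- `X = H¹_α(ℝ²) × L²_α(ℝ²)`. -/
abbrev Xplane (α : ℝ) := WithLp 2 (H1plane α × L2w (wt2 α))

/-- First component, as a function (defined almost everywhere). -/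
def Xline.fn1 {α : ℝ} (u : Xline α) : ℝ → ℂ := u.fst.1 0

/-- Second component, as a function (defined almost everywhere). -/
def Xline.fn2 {α : ℝ} (u : Xline α) : ℝ → ℂ := u.snd

/-- First component, as a function (defined almost everywhere). -/
def Xplane.fn1 {α : ℝ} (u : Xplane α) : ℝ × ℝ → ℂ := u.fst.1 0

/-- Second component, as a function (defined almost everywhere). -/
def Xplane.fn2 {α : ℝ} (u : Xplane α) : ℝ × ℝ → ℂ := u.snd

/-! ### The line solitary wave -/

/-- `α_c = ((c² - 1) / (b c² - a))^{1/2}`. -/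
def alphaC (a b c : ℝ) : ℝ := Real.sqrt ((c ^ 2 - 1) / (b * c ^ 2 - a))

/-- `q_c(z) = ((c² - 1) / c) sech² (α_c z / 2)`. -/
def qc (a b c z : ℝ) : ℝ := (c ^ 2 - 1) / c * (1 / Real.cosh (alphaC a b c * z / 2)) ^ 2

/-- `r_c = - c q_c`. -/
def rc (a b c z : ℝ) : ℝ := -c * qc a b c z

/-- `∂_c q_c`. -/
def dcq (a b c z : ℝ) : ℝ := deriv (fun s => qc a b s z) c

/-- `∂_c r_c`. -/
def dcr (a b c z : ℝ) : ℝ := deriv (fun s => rc a b s z) c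

/-! ### The linearized operator -/

section Operator

variable {E : Type*} [NormedAddCommGroup E] [NormedSpace ℝ E] [MeasureSpace E]

/-- `(I - k Δ) T`; this is `A` for `k = a` and `B` for `k = b`. -/
def helm (k : ℝ) (lap : Functional E → Functional E) (T : Functional E) : Functional E :=
  T - k • lap T

/-- The relation `𝓛 (Φ, Ψ) = (F, G)`, where
`𝓛 (Φ, Ψ) = (c ∂_z Φ + Ψ, c ∂_z Ψ + B⁻¹ (A Δ Φ - v₁ Φ - v₂ Ψ))` with
`v₁ = 2 r_c' ∂_z + r_c Δ` and `v₂ = 2 q_c ∂_z + q_c'`, in the sense of distributions. The second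
equation is written as `B (G - c ∂_z Ψ) = A Δ Φ - v₁ Φ - v₂ Ψ`. The operators `∂_z` and `Δ`
and the coordinate `z` are parameters. -/
def LinRel (a b c : ℝ) (dz lap : Functional E → Functional E) (z : E → ℝ)
    (Φ Ψ F G : E → ℂ) : Prop :=
  EqDistr (ofFun F) (c • dz (ofFun Φ) + ofFun Ψ) ∧
  EqDistr (helm b lap (ofFun G - c • dz (ofFun Ψ)))
    (helm a lap (lap (ofFun Φ))
      - ((2 : ℝ) • mulBy (fun x => deriv (rc a b c) (z x)) (dz (ofFun Φ))
          + mulBy (fun x => rc a b c (z x)) (lap (ofFun Φ)))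
      - ((2 : ℝ) • mulBy (fun x => qc a b c (z x)) (dz (ofFun Ψ))
          + mulBy (fun x => deriv (qc a b c) (z x)) (ofFun Ψ)))

end Operator

/-- The graph of `𝓛` in `X = H¹_α(ℝ²) × L²_α(ℝ²)`; the domain is the maximal one, that is, all
`u ∈ X` for which `𝓛 u`, computed in the sense of distributions, is in `X`. -/
def LGraph (a b c α : ℝ) (u f : Xplane α) : Prop :=
  LinRel a b c (pd ((1 : ℝ), (0 : ℝ)))
    (fun T => pd ((1 : ℝ), (0 : ℝ)) (pd ((1 : ℝ), (0 : ℝ)) T)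
      + pd ((0 : ℝ), (1 : ℝ)) (pd ((0 : ℝ), (1 : ℝ)) T))
    Prod.fst u.fn1 u.fn2 f.fn1 f.fn2

/-- The graph of `𝓛(η) = e^{-iyη} 𝓛 e^{iyη}` in `H¹_α(ℝ) × L²_α(ℝ)`, in which `Δ` is replaced by
`∂_z² - η²`. -/
def LEtaGraph (a b c α η : ℝ) (u f : Xline α) : Prop :=
  LinRel a b c (pd (1 : ℝ)) (fun T => pd (1 : ℝ) (pd (1 : ℝ) T) - η ^ 2 • T)
    id u.fn1 u.fn2 f.fn1 f.fn2

/-- The pairing `⟨f, g⟩ = ∑ⱼ ∫ fⱼ(z) conj(gⱼ(z)) dz`. -/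
def pairing (f₁ f₂ g₁ g₂ : ℝ → ℂ) : ℂ :=
  (∫ z, f₁ z * (starRingEnd ℂ) (g₁ z)) + ∫ z, f₂ z * (starRingEnd ℂ) (g₂ z)

/-- The pairing of `H¹_α(ℝ) × L²_α(ℝ)` with `H¹_{-α}(ℝ) × L²_{-α}(ℝ)`. -/
def pairX {α : ℝ} (u : Xline α) (v : Xline (-α)) : ℂ := pairing u.fn1 u.fn2 v.fn1 v.fn2

/-- The graph of the adjoint `𝓛(η)^*` with respect to `⟨·, ·⟩`, within
`H¹_{-α}(ℝ) × L²_{-α}(ℝ)`. -/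
def LEtaAdjGraph (a b c α η : ℝ) (v g : Xline (-α)) : Prop :=
  ∀ u f : Xline α, LEtaGraph a b c α η u f → pairX f v = pairX u g

/-! ### The resonant modes and the projection onto them -/

/-- `u` is the element with the (real) components `f₁`, `f₂`. -/
def Represents {α : ℝ} (u : Xline α) (f₁ f₂ : ℝ → ℝ) : Prop :=
  (u.fn1 =ᵐ[volume] fun z => (f₁ z : ℂ)) ∧ (u.fn2 =ᵐ[volume] fun z => (f₂ z : ℂ))

/-- `v` is the complex conjugate of `u`. -/
def IsConj {α : ℝ} (u v : Xline α) : Prop :=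
  (v.fn1 =ᵐ[volume] fun z => (starRingEnd ℂ) (u.fn1 z)) ∧
  (v.fn2 =ᵐ[volume] fun z => (starRingEnd ℂ) (u.fn2 z))

/-- `(λ(η), ζ(·, η), ζ^*(·, η))`, `|η| ≤ η₀`, is the smooth curve of resonant eigenvalues of `𝓛(η)`
bifurcating from the eigenvalue `0` of `𝓛(0)`, with its eigenfunctions and adjoint eigenfunctions.
The last two clauses say that for `η ≠ 0` in this range the two eigenvalues `λ(η)`,
`λ(-η) = conj λ(η)` are distinct and that the normalization of the modes is possible, so that the
projection below is meaningful. -/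
structure IsResonantCurve (a b c α η₀ : ℝ) (lam : ℝ → ℂ) (ζ : ℝ → Xline α)
    (ζs : ℝ → Xline (-α)) : Prop where
  lam_smooth : ContDiffOn ℝ ∞ lam (Icc (-η₀) η₀)
  zeta_smooth : ContDiffOn ℝ ∞ ζ (Icc (-η₀) η₀)
  zetaStar_smooth : ContDiffOn ℝ ∞ ζs (Icc (-η₀) η₀)
  eigen : ∀ η ∈ Icc (-η₀) η₀, LEtaGraph a b c α η (ζ η) (lam η • ζ η)
  eigenStar : ∀ η ∈ Icc (-η₀) η₀, LEtaAdjGraph a b c α η (ζs η) (lam (-η) • ζs η)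
  lam_conj : ∀ η ∈ Icc (-η₀) η₀, (starRingEnd ℂ) (lam η) = lam (-η)
  zeta_conj : ∀ η ∈ Icc (-η₀) η₀, IsConj (ζ η) (ζ (-η))
  zetaStar_conj : ∀ η ∈ Icc (-η₀) η₀, IsConj (ζs η) (ζs (-η))
  /-- `λ(η) = i λ₁ η + O(η²)`, `ζ(η) = ζ₁ + i λ₁ η ζ₂ + O(η²)` and
  `ζ^*(η) = ζ₂^* - i λ₁ η ζ₁^* + O(η²)` with `λ₁ > 0`. -/
  asymp : ∃ (lam₁ K : ℝ) (ζ₁ ζ₂ : Xline α) (ζs₁ ζs₂ : Xline (-α)), 0 < lam₁ ∧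
    Represents ζ₁ (qc a b c) (deriv (rc a b c)) ∧
    Represents ζ₂ (fun z => ∫ s in Ioi z, dcq a b c s) (fun z => -dcr a b c z) ∧
    Represents ζs₁
      (fun z => c * (-(dcr a b c z - b * iteratedDeriv 2 (dcr a b c) z)
        - 2 * qc a b c z * dcq a b c z
        - deriv (qc a b c) z * ∫ s in Iic z, dcq a b c s))
      (fun z => c * ((∫ s in Iic z, dcq a b c s)
        - b * iteratedDeriv 2 (fun x => ∫ s in Iic x, dcq a b c s) z)) ∧
    Represents ζs₂
      (fun z => deriv (qc a b c) z - a * iteratedDeriv 3 (qc a b c) z)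
      (fun z => -(rc a b c z - b * iteratedDeriv 2 (rc a b c) z)) ∧
    ∀ η ∈ Icc (-η₀) η₀,
      ‖lam η - Complex.I * lam₁ * η‖ ≤ K * η ^ 2 ∧
      ‖ζ η - (ζ₁ + (Complex.I * lam₁ * η) • ζ₂)‖ ≤ K * η ^ 2 ∧
      ‖ζs η - (ζs₂ - (Complex.I * lam₁ * η) • ζs₁)‖ ≤ K * η ^ 2
  lam_im_ne : ∀ η ∈ Icc (-η₀) η₀, η ≠ 0 → (lam η).im ≠ 0
  pairing_im_ne : ∀ η ∈ Icc (-η₀) η₀, η ≠ 0 → (pairX (ζ η) (ζs η)).im ≠ 0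

section Modes

variable {α : ℝ} (ζ : ℝ → Xline α) (ζs : ℝ → Xline (-α))

/-- `g(·, η) = (1 + i Re⟨ζ, ζ^*⟩ / Im⟨ζ, ζ^*⟩) ζ(·, η)`; moreover `g^* = ζ^*`. -/
def gMode (η : ℝ) : Xline α :=
  (1 + Complex.I * (((pairX (ζ η) (ζs η)).re / (pairX (ζ η) (ζs η)).im : ℝ) : ℂ)) • ζ η

/-- `κ(η) = Im⟨g, g^*⟩ / 2`. -/
def kappa (η : ℝ) : ℝ := (pairX (gMode ζ ζs η) (ζs η)).im / 2

/-- The modes `g₁`, `g₂`. -/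
def gk (k : Fin 2) (η : ℝ) : Xline α :=
  if k = 0 then (1 / 2 : ℂ) • (gMode ζ ζs η + gMode ζ ζs (-η))
  else (1 / (2 * Complex.I * (kappa ζ ζs η : ℂ))) • (gMode ζ ζs η - gMode ζ ζs (-η))

/-- The adjoint modes `g₁^*`, `g₂^*`. -/
def gkStar (k : Fin 2) (η : ℝ) : Xline (-α) :=
  if k = 0 then (Complex.I / (2 * (kappa ζ ζs η : ℂ))) • (ζs η - ζs (-η))
  else (1 / 2 : ℂ) • (ζs η + ζs (-η))

/-- The Fourier transform in `y` of a test function,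
`(2π)^{-1/2} ∫ φ(z, y) e^{-iyη} dy`. -/
def fourierY (φ : ℝ × ℝ → ℂ) (η z : ℝ) : ℂ :=
  ((1 / Real.sqrt (2 * Real.pi) : ℝ) : ℂ)
    * ∫ y : ℝ, φ (z, y) * Complex.exp (-(Complex.I * y * η))

/-- The coefficient `c_k(η) = ⟨(𝓕_y f)(·, η), g_k^*(·, η)⟩` of `f = (φ₁, φ₂)`. -/
def coeff (φ₁ φ₂ : ℝ × ℝ → ℂ) (k : Fin 2) (η : ℝ) : ℂ :=
  pairing (fourierY φ₁ η) (fourierY φ₂ η) (gkStar ζ ζs k η).fn1 (gkStar ζ ζs k η).fn2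

/-- `(2π)^{-1/2} ∑_k ∫_{-η₀}^{η₀} c_k(η) g_k(·, η) e^{iyη} dη`, as an element of
`H¹_α(ℝ) × L²_α(ℝ)` for each `y`. -/
def modeSum (η₀ : ℝ) (φ₁ φ₂ : ℝ × ℝ → ℂ) (y : ℝ) : Xline α :=
  ((1 / Real.sqrt (2 * Real.pi) : ℝ) : ℂ) •
    ∑ k : Fin 2, ∫ η in (-η₀)..η₀,
      (coeff ζ ζs φ₁ φ₂ k η * Complex.exp (Complex.I * y * η)) • gk ζ ζs k η

/-- `P` is the spectral projection `𝓟(η₀)` onto the resonant modes: the bounded operator on `X`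
given on the (dense) set of pairs of test functions by the formula
`(𝓟(η₀) f)(z, y) = (2π)^{-1/2} ∑_k ∫_{-η₀}^{η₀} c_k(η) g_k(z, η) e^{iyη} dη`. -/
def IsResonantProjection (η₀ : ℝ) (P : Xplane α →L[ℂ] Xplane α) : Prop :=
  ∀ (f : Xplane α) (φ₁ φ₂ : ℝ × ℝ → ℂ), IsTest φ₁ → IsTest φ₂ →
    f.fn1 =ᵐ[volume] φ₁ → f.fn2 =ᵐ[volume] φ₂ →
    ∀ᵐ y : ℝ, ∀ᵐ z : ℝ,
      (P f).fn1 (z, y) = (modeSum ζ ζs η₀ φ₁ φ₂ y).fn1 z ∧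
      (P f).fn2 (z, y) = (modeSum ζ ζs η₀ φ₁ φ₂ y).fn2 z

end Modes

/-! ### Semigroups and spectra -/

section Abstract

variable {X : Type*} [NormedAddCommGroup X] [NormedSpace ℂ X]

/-- `T t = e^{tL}`, `t ≥ 0`: a strongly continuous semigroup whose infinitesimal generator is the
operator with graph `L`. -/
structure IsSemigroupGeneratedBy (L : X → X → Prop) (T : ℝ → X →L[ℂ] X) : Prop where
  zero : T 0 = ContinuousLinearMap.id ℂ X
  add : ∀ s t : ℝ, 0 ≤ s → 0 ≤ t → T (s + t) = (T s).comp (T t)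
  continuous : ∀ u : X, Tendsto (fun t => T t u) (𝓝[>] 0) (𝓝 u)
  generator : ∀ u f : X,
    L u f ↔ Tendsto (fun t : ℝ => ((1 / t : ℝ) : ℂ) • (T t u - u)) (𝓝[>] 0) (𝓝 f)

/-- The resolvent set of the restriction of the operator with graph `L` to the subspace `Z`:
`l - L|_Z` is a bijection from its domain onto `Z` with bounded inverse `R`. -/
def restrictedResolventSet (L : X → X → Prop) (Z : Submodule ℂ X) : Set ℂ :=
  {l | ∃ R : Z →L[ℂ] Z, ∀ f u : Z, R f = u ↔ L (u : X) (l • (u : X) - (f : X))}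

/-- The spectrum `σ(L|_Z)`. -/
def restrictedSpectrum (L : X → X → Prop) (Z : Submodule ℂ X) : Set ℂ :=
  (restrictedResolventSet L Z)ᶜ

end Abstract

end BenneyLuke

end

open BenneyLuke

/-!
Multiplication by `e^{α z}` followed by the Fourier transform (`U`) turns `X` into a product of
two `L²` spaces (`symX`) and `∂_z`, `∂_y` into the symbols `sz = 2 π i ξ₁ - α`, `sy = 2 π i ξ₂`.
There (`Params.LGraph_iff`) `𝓛` is the wave operator `(φ, ψ) ↦ (c sz φ + ψ, c sz ψ - sS φ)`, plus
the terms with variable coefficients, `varOp`. Since `B⁻¹` gains two derivatives, these are bounded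
on `X`; moreover `sS` equals `(a / b) sp` up to a bounded symbol, where `sp` is the symbol of `-Δ`.
Up to a bounded operator the wave operator can be diagonalized to a multiplication operator, so `𝓛`
generates a semigroup by the bounded perturbation theorem (`Params.exists_semigroup`).

The projection acts on each fiber, that is, for each frequency `η` in `y`, as an operator of rank
two (`FiberFamily`, `IsResonantCurve.fiberFamily`). It is bounded uniformly in `η` although `g₂` and
`g₁*` contain the factor `1 / κ(η)`: the pairing of `ζ` and `ζ*` is `i θ η + O(η²)` with `θ > 0`,
because the pairing of `ζ₂` and `ζ₂*` is positive (`pairX_zeta_pos`), so `κ` vanishes only to first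
order, like the differences that it divides. On each fiber the operator is idempotent and commutes
with `𝓛(η)`; hence the operator on `X` is a projection that commutes with `𝓛`. As test functions are
dense, it is the only operator given by the formula for `𝓟(η₀)` (`IsResonantProjection.unique`).

The decay estimate is the theorem of Gearhart and Prüss
(`IsSemigroupGeneratedBy.exists_decay`), which follows from Plancherel's theorem for rescaled orbits
and needs a bound on the range of `𝓠(η₀)` for the resolvent on `Re λ ≥ -β'`. For bounded `λ` the
bound is a matter of compactness (`exists_bound_of_isCompact`). For large `λ` it holds on all of `X`
(`Params.exists_bound_of_large`), provided that `β' < α (c - (a / b)^{1/2})`: the wave operator is a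
product of two transport operators whose symbols have real parts bounded below in this range, and
`varOp` is a lower order term there because it maps `L²_α × H⁻¹_α` to `L²_α`.

The proviso is satisfied, as the spectral hypothesis forces `β ≤ α (c - (a / b)^{1/2})`
(`Params.le_of_resolvent`). The constant coefficient operator has spectrum arbitrarily close to the
line `Re λ = -α (c - (a / b)^{1/2})`. Wave packets with such frequencies remain approximate
eigenvectors of `𝓛` when shifted to infinity in `z`, where the variable coefficients vanish; with
frequencies in `y` outside `[-η₀, η₀]`, they lie in the range of `𝓠(η₀)`.
-/

noncomputable section

namespace BenneyLuke

set_option linter.unusedSectionVars false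

open scoped FourierTransform Real ComplexConjugate
open Complex (I norm_real norm_I ofReal_mul real_smul normSq_eq_norm_sq conj_conj I_sq ofReal_pow
  conj_ofReal norm_exp_ofReal_mul_I ofRealCLM normSq_apply re_le_norm continuous_ofReal
  measurable_ofReal)
open Real (exp tanh cosh norm_eq_abs norm_of_nonneg fourierInv_eq fourier_eq exp_add exp_pos sqrt
  sq_sqrt fourierChar continuous_fourierChar cosh_pos sqrt_pos)
open ContinuousLinearMap (le_opNorm opNorm_comp_le opNorm_le_bound)
open Lp (memLp coeFn_smul coeFn_add coeFn_sub stronglyMeasurable norm_le_norm_of_ae_le)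
open WithLp (toLp volume_preserving_ofLp volume_preserving_toLp prodContinuousLinearEquiv)

variable {a b c α : ℝ}

/-! ### Strongly continuous semigroups -/

/-- A locally bounded submultiplicative function on `[0, ∞)` that is at most `e^{στ}` at some time
`τ` grows at most at the rate `σ`. -/
theorem exists_exp_bound_of_submul {N : ℝ → ℝ} (hN : ∀ t, 0 ≤ N t)
    (hmul : ∀ s t, 0 ≤ s → 0 ≤ t → N (s + t) ≤ N s * N t) {τ K σ : ℝ} (hτ : 0 < τ)
    (hK : ∀ t ∈ Icc 0 τ, N t ≤ K) (h : N τ ≤ exp (σ * τ)) :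
    ∃ C, 0 < C ∧ ∀ t, 0 ≤ t → N t ≤ C * exp (σ * t) := by
  have hK0 : 0 ≤ K := (hN 0).trans (hK 0 ⟨le_rfl, hτ.le⟩)
  have hn : ∀ (n : ℕ) (s : ℝ), 0 ≤ s → N (n * τ + s) ≤ exp (σ * τ) ^ n * N s := by
    intro n
    induction n with
    | zero => intro s _; simp
    | succ n ih =>
      intro s hs
      have e : ((n + 1 : ℕ) : ℝ) * τ + s = τ + (n * τ + s) := by push_cast; ring
      rw [e, pow_succ']
      calc N (τ + (n * τ + s)) ≤ N τ * N (n * τ + s) := hmul _ _ hτ.le (by positivity)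
        _ ≤ exp (σ * τ) * (exp (σ * τ) ^ n * N s) :=
            mul_le_mul h (ih s hs) (hN _) (exp_pos _).le
        _ = _ := by ring
  refine ⟨K * exp (|σ| * τ) + 1, by positivity, fun t ht => ?_⟩
  set n := ⌊t / τ⌋₊
  have h1 : (n : ℝ) * τ ≤ t := by
    have := Nat.floor_le (div_nonneg ht hτ.le)
    rwa [le_div_iff₀ hτ] at this
  have h2 : t < n * τ + τ := by
    have := Nat.lt_floor_add_one (t / τ)
    rw [div_lt_iff₀ hτ] at this
    linarith
  have h3 := hn n (t - n * τ) (by linarith)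
  rw [show (n : ℝ) * τ + (t - n * τ) = t by ring] at h3
  have h4 : exp (σ * τ) ^ n = exp (σ * (n * τ)) := by
    rw [← Real.exp_nat_mul]; ring_nf
  have h5 : σ * (n * τ) ≤ |σ| * τ + σ * t := by
    have : σ * (n * τ - t) ≤ |σ| * τ := by
      calc σ * (n * τ - t) ≤ |σ * (n * τ - t)| := le_abs_self _
        _ = |σ| * |n * τ - t| := abs_mul _ _
        _ ≤ |σ| * τ := by
          gcongr
          rw [abs_le]; constructor <;> linarith
    linarith
  calc N t ≤ exp (σ * (n * τ)) * K := by
        rw [← h4]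
        exact h3.trans (by gcongr; exact hK _ ⟨by linarith, by linarith⟩)
    _ ≤ exp (|σ| * τ + σ * t) * K := by gcongr
    _ = K * exp (|σ| * τ) * exp (σ * t) := by rw [exp_add]; ring
    _ ≤ _ := by gcongr; linarith

section Semigroup

variable {X : Type*} [NormedAddCommGroup X] [NormedSpace ℂ X] [CompleteSpace X]
variable {L : X → X → Prop} {T : ℝ → X →L[ℂ] X}

namespace IsSemigroupGeneratedBy

theorem exists_local_bound (h : IsSemigroupGeneratedBy L T) :
    ∃ δ M : ℝ, 0 < δ ∧ 1 ≤ M ∧ ∀ t ∈ Icc 0 δ, ‖T t‖ ≤ M := by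
  by_contra! hcon
  have hex : ∀ n : ℕ, ∃ t ∈ Icc (0 : ℝ) (1 / (n + 1)), (n : ℝ) + 1 < ‖T t‖ := fun n =>
    hcon (1 / (n + 1)) (n + 1) (by positivity) (by simp)
  choose t ht hT using hex
  have hpos : ∀ n, 0 < t n := by
    intro n
    refine lt_of_le_of_ne (ht n).1 fun h0 => ?_
    have h1 := hT n
    rw [← h0, h.zero] at h1
    have := ContinuousLinearMap.norm_id_le (𝕜 := ℂ) (E := X)
    have : (0 : ℝ) ≤ n := Nat.cast_nonneg n
    linarith
  have htend : Tendsto t atTop (𝓝[>] 0) := by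
    refine tendsto_nhdsWithin_iff.2 ⟨?_, Eventually.of_forall hpos⟩
    exact squeeze_zero (fun n => (ht n).1) (fun n => (ht n).2) tendsto_one_div_add_atTop_nhds_zero_nat
  obtain ⟨C, hC⟩ := banach_steinhaus (g := fun n => T (t n)) (fun x => by
    have h1 := ((h.continuous x).comp htend).norm.bddAbove_range
    obtain ⟨C, hC⟩ := h1
    exact ⟨C, fun n => hC ⟨n, rfl⟩⟩)
  obtain ⟨n, hn⟩ := exists_nat_gt C
  have := hC n
  have := hT n
  linarith

theorem exists_growth (h : IsSemigroupGeneratedBy L T) :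
    ∃ C σ : ℝ, 1 ≤ C ∧ 0 ≤ σ ∧ ∀ t, 0 ≤ t → ‖T t‖ ≤ C * exp (σ * t) := by
  obtain ⟨δ, M, hδ, hM, hb⟩ := h.exists_local_bound
  obtain ⟨C, hC, hC'⟩ := exists_exp_bound_of_submul (N := fun t => ‖T t‖) (fun _ => norm_nonneg _)
    (fun s t hs ht => by
      simp only [h.add s t hs ht]; exact opNorm_comp_le _ _) (σ := Real.log M / δ)
    hδ hb (by
      rw [div_mul_cancel₀ _ hδ.ne', Real.exp_log (by linarith)]
      exact hb δ ⟨hδ.le, le_rfl⟩)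
  refine ⟨C + 1, Real.log M / δ, by linarith, by have := Real.log_nonneg hM; positivity,
    fun t ht => (hC' t ht).trans ?_⟩
  gcongr; linarith

theorem apply_add (h : IsSemigroupGeneratedBy L T) {s t : ℝ} (hs : 0 ≤ s) (ht : 0 ≤ t) (x : X) :
    T (s + t) x = T s (T t x) := by
  rw [h.add s t hs ht]; rfl

theorem zero_apply (h : IsSemigroupGeneratedBy L T) (x : X) : T 0 x = x := by
  rw [h.zero]; rfl

/-- Orbits are continuous; they are extended to negative times by a constant. -/
theorem continuous_orbit (h : IsSemigroupGeneratedBy L T) (x : X) :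
    Continuous fun t : ℝ => T (max t 0) x := by
  obtain ⟨C, σ, hC, hσ, hb⟩ := h.exists_growth
  rw [continuous_iff_continuousAt]
  intro t₀
  have h0 : Tendsto (fun t => T t x) (𝓝[≥] 0) (𝓝 x) := by
    rw [← Ioi_insert, nhdsWithin_insert]
    refine Tendsto.sup ?_ (h.continuous x)
    rw [tendsto_pure_left]
    intro s hs
    rw [h.zero_apply]; exact mem_of_mem_nhds hs
  have key : ∀ s t : ℝ, 0 ≤ s → s ≤ t →
      ‖T t x - T s x‖ ≤ C * exp (σ * s) * ‖T |t - s| x - x‖ := by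
    intro s t hs hst
    have : T t x - T s x = T s (T |t - s| x - x) := by
      rw [map_sub, ← h.apply_add hs (abs_nonneg _), abs_of_nonneg (by linarith)]
      congr 3; ring
    rw [this]
    exact (T s).le_of_opNorm_le (hb s hs) _
  have key2 : ∀ t : ℝ, t ≤ t₀ + 1 → ‖T (max t 0) x - T (max t₀ 0) x‖ ≤
      C * exp (σ * (max t₀ 0 + 1)) * ‖T |max t 0 - max t₀ 0| x - x‖ := by
    intro t ht
    rcases le_total (max t₀ 0) (max t 0) with hle | hle
    · refine (key _ _ (le_max_right _ _) hle).trans ?_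
      gcongr; linarith
    · rw [norm_sub_rev, abs_sub_comm]
      refine (key _ _ (le_max_right _ _) hle).trans ?_
      gcongr; linarith
  have hlim : Tendsto (fun t : ℝ => C * exp (σ * (max t₀ 0 + 1)) *
      ‖T |max t 0 - max t₀ 0| x - x‖) (𝓝 t₀) (𝓝 0) := by
    have h1 : Tendsto (fun t : ℝ => |max t 0 - max t₀ 0|) (𝓝 t₀) (𝓝[≥] 0) := by
      refine tendsto_nhdsWithin_iff.2 ⟨?_, Eventually.of_forall fun t => mem_Ici.2 (abs_nonneg _)⟩
      have : Continuous fun t : ℝ => |max t 0 - max t₀ 0| := by fun_prop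
      simpa using this.tendsto t₀
    have h2 := ((h0.comp h1).sub_const x).norm.const_mul (C * exp (σ * (max t₀ 0 + 1)))
    simpa using h2
  rw [ContinuousAt, tendsto_iff_norm_sub_tendsto_zero]
  refine squeeze_zero' (.of_forall fun _ => norm_nonneg _) ?_ hlim
  filter_upwards [eventually_le_nhds (show t₀ < t₀ + 1 by linarith)] with t ht using key2 t ht

theorem continuous_joint (h : IsSemigroupGeneratedBy L T) :
    Continuous fun p : ℝ × X => T (max p.1 0) p.2 := by
  obtain ⟨C, σ, hC, hσ, hb⟩ := h.exists_growth
  rw [continuous_iff_continuousAt]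
  rintro ⟨t₀, x₀⟩
  have h1 : Tendsto (fun p : ℝ × X => T (max p.1 0) x₀) (𝓝 (t₀, x₀)) (𝓝 (T (max t₀ 0) x₀)) :=
    ((h.continuous_orbit x₀).comp continuous_fst).tendsto (t₀, x₀)
  have h2 : Tendsto (fun p : ℝ × X => T (max p.1 0) (p.2 - x₀)) (𝓝 (t₀, x₀)) (𝓝 0) := by
    have hc : Continuous fun p : ℝ × X => C * exp (σ * max p.1 0) * ‖p.2 - x₀‖ := by fun_prop
    have hc' := hc.tendsto (t₀, x₀)
    simp only [sub_self, norm_zero, mul_zero] at hc'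
    exact squeeze_zero_norm
      (fun p => (T (max p.1 0)).le_of_opNorm_le (hb _ (le_max_right _ _)) _) hc'
  have h3 := h1.add h2
  rw [add_zero] at h3
  exact h3.congr fun p => by simp

theorem domain_orbit (h : IsSemigroupGeneratedBy L T) {u f : X} (hu : L u f) {t : ℝ} (ht : 0 ≤ t) :
    L (T t u) (T t f) := by
  rw [h.generator] at hu ⊢
  have h1 := ((T t).continuous.tendsto f).comp hu
  refine h1.congr' ?_
  filter_upwards [self_mem_nhdsWithin] with s hs
  simp only [Function.comp, map_smul, map_sub]
  rw [← h.apply_add ht (le_of_lt hs), ← h.apply_add (le_of_lt hs) ht, add_comm]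

theorem unique (h : IsSemigroupGeneratedBy L T) {u f g : X} (hf : L u f) (hg : L u g) : f = g :=
  tendsto_nhds_unique ((h.generator u f).1 hf) ((h.generator u g).1 hg)

/-- The domain of the generator is dense: averages of orbits lie in it. -/
theorem exists_domain_seq (h : IsSemigroupGeneratedBy L T) (x : X) :
    ∃ u : ℕ → X, (∀ n, ∃ f, L (u n) f) ∧ Tendsto u atTop (𝓝 x) := by
  set o : ℝ → X := fun t => T (max t 0) x with ho
  have hoc : Continuous o := h.continuous_orbit x
  have hoi : ∀ a b, IntervalIntegrable o volume a b := fun a b => hoc.intervalIntegrable a b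
  have hder : ∀ t, HasDerivAt (fun s => ∫ r in (0 : ℝ)..s, o r) (o t) t := fun t =>
    intervalIntegral.integral_hasDerivAt_right (hoi _ _) (hoc.stronglyMeasurableAtFilter _ _)
      hoc.continuousAt
  have quot : ∀ t, Tendsto (fun k : ℝ => ((1 / k : ℝ) : ℂ) • ∫ r in t..(t + k), o r) (𝓝[>] 0)
      (𝓝 (o t)) := by
    intro t
    have h1 := (hasDerivAt_iff_tendsto_slope_zero.1 (hder t)).mono_left
      (nhdsWithin_mono 0 (fun k (hk : 0 < k) => hk.ne'))
    refine h1.congr fun k => ?_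
    rw [intervalIntegral.integral_interval_sub_left (hoi _ _) (hoi _ _), one_div,
      Complex.coe_smul]
  refine ⟨fun n => (((1 / (1 / ((n : ℝ) + 1)) : ℝ)) : ℂ) • ∫ r in (0 : ℝ)..(0 + 1 / ((n : ℝ) + 1)), o r,
    fun n => ?_, ?_⟩
  · set d : ℝ := 1 / ((n : ℝ) + 1) with hd
    have hd0 : 0 < d := by positivity
    refine ⟨((1 / d : ℝ) : ℂ) • (o d - o 0), ?_⟩
    rw [h.generator]
    have h2 := (((quot d).sub (quot 0))).const_smul ((1 / d : ℝ) : ℂ)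
    refine h2.congr' ?_
    filter_upwards [self_mem_nhdsWithin] with k hk
    have hk : 0 < k := hk
    have hTk : T k (∫ r in (0 : ℝ)..(0 + d), o r) = ∫ r in k..(k + d), o r := by
      rw [← ContinuousLinearMap.intervalIntegral_comp_comm _ (hoi _ _)]
      have : ∀ r ∈ uIcc 0 (0 + d), T k (o r) = o (k + r) := by
        intro r hr
        rw [uIcc_of_le (by linarith)] at hr
        simp only [ho]
        rw [max_eq_left hr.1, max_eq_left (by linarith [hr.1]), h.apply_add hk.le hr.1]
      rw [intervalIntegral.integral_congr this, intervalIntegral.integral_comp_add_left]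
      simp
    rw [map_smul, hTk, ← smul_sub, ← smul_sub, smul_comm]
    congr 2
    rw [zero_add, zero_add]
    have e1 := intervalIntegral.integral_add_adjacent_intervals (hoi 0 k) (hoi k (k + d))
    have e2 := intervalIntegral.integral_add_adjacent_intervals (hoi 0 d) (hoi d (k + d))
    rw [add_comm d k]
    rw [← e2] at e1
    rw [sub_eq_sub_iff_add_eq_add]
    rw [add_comm] at e1
    rw [e1, add_comm]
  · have h1 : Tendsto (fun n : ℕ => 1 / ((n : ℝ) + 1)) atTop (𝓝[>] 0) :=
      tendsto_nhdsWithin_iff.2 ⟨tendsto_one_div_add_atTop_nhds_zero_nat,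
        Eventually.of_forall fun n => by simp only [mem_Ioi]; positivity⟩
    have h2 := (quot 0).comp h1
    simp only [ho, max_self, h.zero_apply] at h2
    exact h2

/-- A bounded operator that commutes with the generator commutes with the semigroup: for `u` in the
domain, `s ↦ T(t - s) P T(s) u` has vanishing right derivative. -/
theorem commute (h : IsSemigroupGeneratedBy L T) (P : X →L[ℂ] X)
    (hP : ∀ u f, L u f → L (P u) (P f)) {t : ℝ} (ht : 0 ≤ t) (x : X) : P (T t x) = T t (P x) := by
  obtain ⟨C, σ, hC, hσ, hb⟩ := h.exists_growth
  have main : ∀ u f, L u f → P (T t u) = T t (P u) := by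
    intro u f huf
    set w : ℝ → X := fun s => T (max (t - s) 0) (P (T (max s 0) u)) with hw
    have hcont : ContinuousOn w (Icc 0 t) :=
      (h.continuous_joint.comp ((continuous_const.sub continuous_id).prodMk
        (P.continuous.comp (h.continuous_orbit u)))).continuousOn
    have hder : ∀ s ∈ Ico 0 t, HasDerivWithinAt w 0 (Ici s) s := by
      intro s hs
      rw [← hasDerivWithinAt_Ioi_iff_Ici, hasDerivWithinAt_iff_tendsto_slope' (by simp)]
      set y : X := T s u with hy
      have hyf := h.domain_orbit huf hs.1
      have hk : Tendsto (fun r : ℝ => r - s) (𝓝[>] s) (𝓝[>] 0) := by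
        refine tendsto_nhdsWithin_iff.2 ⟨?_, ?_⟩
        · have : Continuous fun r : ℝ => r - s := by fun_prop
          simpa using (this.tendsto s).mono_left nhdsWithin_le_nhds
        · filter_upwards [self_mem_nhdsWithin] with r hr
          simpa using hr
      have b1 := ((P.continuous.tendsto _).comp ((h.generator _ _).1 hyf)).sub
        ((h.generator _ _).1 (hP _ _ hyf))
      rw [sub_self] at b1
      have b2 := ((b1.comp hk).norm.const_mul (C * exp (σ * t)))
      rw [norm_zero, mul_zero] at b2
      refine squeeze_zero_norm' ?_ b2
      filter_upwards [self_mem_nhdsWithin, Ioo_mem_nhdsGT hs.2] with r hr hr2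
      have hr0 : 0 ≤ r := hs.1.trans hr2.1.le
      have hrs : 0 ≤ r - s := by linarith [hr2.1]
      have hrt : 0 ≤ t - r := by linarith [hr2.2]
      have e : slope w s r = T (t - r) (P (((1 / (r - s) : ℝ) : ℂ) • (T (r - s) y - y)) -
          ((1 / (r - s) : ℝ) : ℂ) • (T (r - s) (P y) - P y)) := by
        have e1 : w r = T (t - r) (P (T (r - s) y)) := by
          simp only [hw, hy]
          rw [max_eq_left hrt, max_eq_left hr0, ← h.apply_add hrs hs.1, sub_add_cancel]
        have e2 : w s = T (t - r) (T (r - s) (P y)) := by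
          simp only [hw, hy]
          rw [max_eq_left (by linarith), max_eq_left hs.1, ← h.apply_add hrt hrs]
          congr 2; ring
        rw [slope_def_module, e1, e2, ← Complex.coe_smul, ← map_sub, ← map_smul, one_div]
        congr 1
        rw [map_smul, ← smul_sub, map_sub]
        congr 1
        abel
      rw [e]
      refine (T (t - r)).le_of_opNorm_le ((hb _ hrt).trans ?_) _
      gcongr
      linarith
    have := constant_of_has_deriv_right_zero hcont hder t ⟨ht, le_rfl⟩
    simpa [hw, ht, h.zero_apply] using this
  obtain ⟨u, hu, hux⟩ := h.exists_domain_seq x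
  have e1 : Tendsto (fun n => P (T t (u n))) atTop (𝓝 (P (T t x))) :=
    ((P.comp (T t)).continuous.tendsto x).comp hux
  have e2 : Tendsto (fun n => T t (P (u n))) atTop (𝓝 (T t (P x))) :=
    (((T t).comp P).continuous.tendsto x).comp hux
  refine tendsto_nhds_unique e1 (e2.congr fun n => ?_)
  obtain ⟨f, hf⟩ := hu n
  exact (main _ _ hf).symm

end IsSemigroupGeneratedBy

end Semigroup

/-! ### Perturbations, products and multiplication semigroups -/

section Perturbation

variable {X : Type*} [NormedAddCommGroup X] [NormedSpace ℂ X] [CompleteSpace X]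
variable {L L₀ : X → X → Prop} {T T₀ : ℝ → X →L[ℂ] X}

namespace IsSemigroupGeneratedBy

/-- The semigroup generated by `L + k`. -/
theorem rescale (h : IsSemigroupGeneratedBy L T) (k : ℝ) :
    IsSemigroupGeneratedBy (fun u f => L u (f - (k : ℂ) • u))
      (fun t => ((exp (k * t) : ℝ) : ℂ) • T t) where
  zero := by simp [h.zero]
  add s t hs ht := by
    rw [h.add s t hs ht, mul_add, exp_add]
    ext x
    simp [smul_smul, mul_comm]
  continuous u := by
    have h1 : Tendsto (fun t : ℝ => ((exp (k * t) : ℝ) : ℂ)) (𝓝[>] 0) (𝓝 1) := by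
      have : Continuous fun t : ℝ => ((exp (k * t) : ℝ) : ℂ) := by fun_prop
      simpa using (this.tendsto 0).mono_left nhdsWithin_le_nhds
    simpa using h1.smul (h.continuous u)
  generator u f := by
    have hc : ∀ l : ℝ, Tendsto (fun t : ℝ => ((exp (l * t) : ℝ) : ℂ)) (𝓝[>] 0) (𝓝 1) := by
      intro l
      have : Continuous fun t : ℝ => ((exp (l * t) : ℝ) : ℂ) := by fun_prop
      simpa using (this.tendsto 0).mono_left nhdsWithin_le_nhds
    have hd : Tendsto (fun t : ℝ => ((1 / t * (exp (k * t) - 1) : ℝ) : ℂ)) (𝓝[>] 0)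
        (𝓝 (k : ℂ)) := by
      have h1 : HasDerivAt (fun t : ℝ => exp (k * t)) (exp (k * 0) * (k * 1)) 0 :=
        ((hasDerivAt_id (0 : ℝ)).const_mul k).exp
      have h2 := (hasDerivAt_iff_tendsto_slope_zero.1 h1).mono_left
        (nhdsWithin_mono 0 (fun x (hx : x ∈ Ioi (0 : ℝ)) => ne_of_gt hx))
      have h3 := (continuous_ofReal.tendsto _).comp h2
      simpa [Function.comp_def] using h3
    rw [h.generator]
    constructor
    · intro hA
      have h1 := ((hc k).smul hA).add (hd.smul_const u)
      simp only [one_smul, sub_add_cancel] at h1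
      refine h1.congr fun t => ?_
      simp only [smul_apply, smul_sub, smul_smul, ofReal_mul,
        Complex.ofReal_sub, mul_sub, sub_smul, mul_one]
      rw [mul_comm ((exp (k * t) : ℝ) : ℂ)]
      abel
    · intro hB
      have h1 := (hc (-k)).smul (hB.sub (hd.smul_const u))
      simp only [one_smul] at h1
      refine h1.congr fun t => ?_
      have e : ((exp (-k * t) : ℝ) : ℂ) * ((exp (k * t) : ℝ) : ℂ) = 1 := by
        rw [← ofReal_mul, ← exp_add]; simp
      have e2 : ((1 / t : ℝ) : ℂ) • (((exp (k * t) : ℝ) : ℂ) • T t u - u)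
          - ((1 / t * (exp (k * t) - 1) : ℝ) : ℂ) • u =
          ((exp (k * t) : ℝ) : ℂ) • (((1 / t : ℝ) : ℂ) • (T t u - u)) := by
        simp only [smul_sub, smul_smul, ofReal_mul,
          Complex.ofReal_sub, mul_sub, sub_smul, mul_one]
        rw [mul_comm ((exp (k * t) : ℝ) : ℂ)]
        abel
      change _ • (((1 / t : ℝ) : ℂ) • (((exp (k * t) : ℝ) : ℂ) • T t u - u)
          - ((1 / t * (exp (k * t) - 1) : ℝ) : ℂ) • u) = _
      rw [e2, smul_smul, e, one_smul]

theorem congr_graph (h : IsSemigroupGeneratedBy L T) {L' : X → X → Prop}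
    (hL : ∀ u f, L' u f ↔ L u f) : IsSemigroupGeneratedBy L' T :=
  ⟨h.zero, h.add, h.continuous, fun u f => (hL u f).trans (h.generator u f)⟩

theorem convolution_continuous (h : IsSemigroupGeneratedBy L T) {g : ℝ → X} (hg : Continuous g) :
    Continuous fun t : ℝ => ∫ s in (0 : ℝ)..max t 0, T (max (max t 0 - s) 0) (g s) := by
  refine intervalIntegral.continuous_parametric_intervalIntegral_of_continuous
    (f := fun t s => T (max (max t 0 - s) 0) (g s)) ?_ (by fun_prop)
  exact h.continuous_joint.comp (by fun_prop :
    Continuous fun p : ℝ × ℝ => (max p.1 0 - p.2, g p.2))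

/-- Bounded perturbation of an exponentially decaying semigroup, when the perturbation is smaller
than the decay rate: the integral equation `v(t) = T₀(t) x + ∫₀ᵗ T₀(t - s) V v(s) ds` is solved by a
Neumann series in the space of bounded continuous functions. -/
theorem exists_perturbation_of_decay (h : IsSemigroupGeneratedBy L₀ T₀) {M k : ℝ}
    (hb : ∀ t, 0 ≤ t → ‖T₀ t‖ ≤ M * exp (-k * t)) (V : X →L[ℂ] X) (hk : 0 < k)
    (hMV : M * ‖V‖ < k) :
    ∃ T, IsSemigroupGeneratedBy (fun u f => L₀ u (f - V u)) T := by
  have hM : 0 ≤ M := by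
    have := (norm_nonneg _).trans (hb 0 le_rfl)
    simpa using this
  have hM' : ∀ t, 0 ≤ t → ‖T₀ t‖ ≤ M := fun t ht => (hb t ht).trans (by
    have : exp (-k * t) ≤ 1 := Real.exp_le_one_iff.2 (by nlinarith)
    nlinarith)
  let E : X →L[ℂ] BoundedContinuousFunction ℝ X := LinearMap.mkContinuous
    { toFun := fun x => BoundedContinuousFunction.ofNormedAddCommGroup (fun t => T₀ (max t 0) x)
        (h.continuous_orbit x) (M * ‖x‖)
        (fun t => (T₀ _).le_of_opNorm_le (hM' _ (le_max_right _ _)) x)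
      map_add' := fun x y => by ext t; simp
      map_smul' := fun c x => by ext t; simp } M
    (fun x => (BoundedContinuousFunction.norm_le (by positivity)).2
      (fun t => (T₀ _).le_of_opNorm_le (hM' _ (le_max_right _ _)) x))
  have hE : ∀ x t, E x t = T₀ (max t 0) x := fun _ _ => rfl
  have hbound : ∀ (v : BoundedContinuousFunction ℝ X) (t : ℝ),
      ‖∫ s in (0 : ℝ)..max t 0, T₀ (max (max t 0 - s) 0) (V (v s))‖ ≤ M * ‖V‖ / k * ‖v‖ := by
    intro v t
    have ht : 0 ≤ max t 0 := le_max_right _ _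
    set τ := max t 0
    have h1 : ‖∫ s in (0 : ℝ)..τ, T₀ (max (τ - s) 0) (V (v s))‖ ≤
        ∫ s in (0 : ℝ)..τ, M * ‖V‖ * ‖v‖ * exp (-k * (τ - s)) := by
      refine intervalIntegral.norm_integral_le_of_norm_le ht ?_
        (Continuous.intervalIntegrable (by fun_prop) _ _)
      refine Eventually.of_forall fun s hs => ?_
      rw [max_eq_left (by linarith [hs.2])]
      calc ‖T₀ (τ - s) (V (v s))‖ ≤ M * exp (-k * (τ - s)) * (‖V‖ * ‖v‖) := by
            refine (T₀ _).le_of_opNorm_le_of_le (hb _ (by linarith [hs.2])) ?_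
            exact V.le_of_opNorm_le_of_le le_rfl (v.norm_coe_le_norm s)
        _ = _ := by ring
    have h2 : ∫ s in (0 : ℝ)..τ, M * ‖V‖ * ‖v‖ * exp (-k * (τ - s)) =
        M * ‖V‖ * ‖v‖ * ((1 - exp (-k * τ)) / k) := by
      rw [intervalIntegral.integral_const_mul]
      congr 1
      have : ∀ s ∈ uIcc 0 τ, HasDerivAt (fun s => exp (-k * (τ - s)) / k)
          (exp (-k * (τ - s))) s := by
        intro s _
        have := ((((hasDerivAt_id s).const_sub τ).const_mul (-k)).exp).div_const k
        refine this.congr_deriv ?_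
        rw [show (-k) * (-1 : ℝ) = k by ring, mul_div_cancel_right₀ _ hk.ne']
        rfl
      rw [intervalIntegral.integral_eq_sub_of_hasDerivAt this
        (Continuous.intervalIntegrable (by fun_prop) _ _)]
      simp
      ring
    rw [h2] at h1
    refine h1.trans ?_
    have h3 : (1 - exp (-k * τ)) / k ≤ 1 / k := by
      gcongr; linarith [exp_pos (-k * τ)]
    calc _ ≤ M * ‖V‖ * ‖v‖ * (1 / k) := by gcongr
      _ = _ := by ring
  have hVc : ∀ v : BoundedContinuousFunction ℝ X, Continuous fun s => V (v s) :=
    fun v => V.continuous.comp v.continuous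
  have hint : ∀ (v : BoundedContinuousFunction ℝ X) (τ a b : ℝ),
      IntervalIntegrable (fun s => T₀ (max (τ - s) 0) (V (v s))) volume a b := fun v τ a b =>
    (h.continuous_joint.comp ((continuous_const.sub continuous_id).prodMk
      (hVc v))).intervalIntegrable a b
  let S : BoundedContinuousFunction ℝ X →L[ℂ] BoundedContinuousFunction ℝ X :=
    LinearMap.mkContinuous
    { toFun := fun v => BoundedContinuousFunction.ofNormedAddCommGroup
        (fun t => ∫ s in (0 : ℝ)..max t 0, T₀ (max (max t 0 - s) 0) (V (v s)))
        (h.convolution_continuous (hVc v)) (M * ‖V‖ / k * ‖v‖) (hbound v)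
      map_add' := fun v w => by
        ext t
        simp only [BoundedContinuousFunction.coe_ofNormedAddCommGroup,
          BoundedContinuousFunction.coe_add, Pi.add_apply, map_add]
        exact intervalIntegral.integral_add (hint v _ _ _) (hint w _ _ _)
      map_smul' := fun c v => by
        ext t
        simp only [BoundedContinuousFunction.coe_ofNormedAddCommGroup,
          BoundedContinuousFunction.coe_smul, map_smul, RingHom.id_apply]
        exact intervalIntegral.integral_smul _ _ } (M * ‖V‖ / k)
    (fun v => (BoundedContinuousFunction.norm_le (by positivity)).2 (hbound v))
  have hS : ∀ v t, S v t = ∫ s in (0 : ℝ)..max t 0, T₀ (max (max t 0 - s) 0) (V (v s)) :=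
    fun _ _ => rfl
  have hSn : ‖S‖ < 1 := by
    refine lt_of_le_of_lt (LinearMap.mkContinuous_norm_le _ (by positivity) _) ?_
    rwa [div_lt_one hk]
  set R : BoundedContinuousFunction ℝ X →L[ℂ] BoundedContinuousFunction ℝ X :=
    ((Units.oneSub S hSn)⁻¹).val
  have hR1 : (1 - S) * R = 1 := by
    simp [R]
  have hR2 : R * (1 - S) = 1 := by
    simp [R]
  have hfix : ∀ x t, R (E x) t = T₀ (max t 0) x +
      ∫ s in (0 : ℝ)..max t 0, T₀ (max (max t 0 - s) 0) (V (R (E x) s)) := by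
    intro x t
    have h1 := congrArg (fun A => A (E x) t) hR1
    simp only [mul_apply_eq_comp, sub_apply,
      one_apply_eq_self, BoundedContinuousFunction.sub_apply] at h1
    rw [sub_eq_iff_eq_add] at h1
    rw [h1, hE, hS]
  have huniq : ∀ v x, (∀ t, v t = T₀ (max t 0) x +
      ∫ s in (0 : ℝ)..max t 0, T₀ (max (max t 0 - s) 0) (V (v s))) → v = R (E x) := by
    intro v x hv
    have h1 : (1 - S) v = E x := by
      ext t
      simp only [sub_apply,
        one_apply_eq_self, BoundedContinuousFunction.sub_apply]
      rw [hE, hS, hv t, add_sub_cancel_right]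
    rw [← h1, ← mul_apply_eq_comp, hR2]; rfl
  refine ⟨fun t => (BoundedContinuousFunction.evalCLM ℂ t).comp (R.comp E), ?_, ?_, ?_, ?_⟩
  · ext x
    simp [hfix x 0, h.zero]
  · intro a b ha hb'
    ext x
    simp only [ContinuousLinearMap.comp_apply, BoundedContinuousFunction.evalCLM_apply]
    set v := R (E x) with hv
    let w : BoundedContinuousFunction ℝ X := v.compContinuous ⟨fun t => max t 0 + b, by fun_prop⟩
    have hw : ∀ t, w t = v (max t 0 + b) := fun _ => rfl
    have : w = R (E (v b)) := by
      refine huniq w (v b) fun t => ?_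
      have ht : 0 ≤ max t 0 := le_max_right _ _
      set τ := max t 0
      rw [hw, hv, hfix x (τ + b), max_eq_left (by linarith : 0 ≤ τ + b), ← hv]
      have e1 : v b = T₀ b x + ∫ s in (0 : ℝ)..b, T₀ (max (b - s) 0) (V (v s)) := by
        conv_lhs => rw [hv, hfix x b, max_eq_left hb']
      rw [e1, map_add, h.apply_add ht hb', add_assoc]
      congr 1
      rw [← intervalIntegral.integral_add_adjacent_intervals (hint v _ 0 b) (hint v _ b (τ + b)),
        ← ContinuousLinearMap.intervalIntegral_comp_comm _ (hint v _ _ _)]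
      congr 1
      · refine intervalIntegral.integral_congr fun s hs => ?_
        rw [uIcc_of_le hb'] at hs
        rw [max_eq_left (by linarith [hs.2]), max_eq_left (by linarith [hs.2]),
          ← h.apply_add ht (by linarith [hs.2])]
        congr 2; ring
      · have e2 := intervalIntegral.integral_comp_add_right (a := 0) (b := τ)
          (fun s => T₀ (max (τ + b - s) 0) (V (v s))) b
        rw [zero_add] at e2
        rw [← e2]
        refine intervalIntegral.integral_congr fun s hs => ?_
        rw [uIcc_of_le ht] at hs
        simp only [hw]
        rw [max_eq_left hs.1]
        congr 3; ring
    have := congrArg (fun f => f a) this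
    simp only [hw, max_eq_left ha] at this
    exact this
  · intro u
    have : Continuous fun t => R (E u) t := (R (E u)).continuous
    have h1 := (this.tendsto 0).mono_left (nhdsWithin_le_nhds (s := Ioi 0))
    have h2 : R (E u) 0 = u := by simp [hfix u 0, h.zero]
    rw [h2] at h1
    exact h1
  · intro u f
    rw [h.generator]
    set v := R (E u) with hv
    have hv0 : v 0 = u := by simp [hv, hfix u 0, h.zero]
    -- the difference of the two difference quotients tends to `V u`
    have hdiff : Tendsto (fun t : ℝ => ((1 / t : ℝ) : ℂ) •
        ∫ s in (0 : ℝ)..t, T₀ (max (t - s) 0) (V (v s))) (𝓝[>] 0) (𝓝 (V u)) := by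
      have hc : Continuous fun p : ℝ × ℝ => T₀ (max (p.1 * (1 - p.2)) 0) (V (v (p.1 * p.2))) :=
        h.continuous_joint.comp ((by fun_prop : Continuous fun p : ℝ × ℝ =>
          p.1 * (1 - p.2)).prodMk ((hVc v).comp (by fun_prop)))
      have hc2 : Continuous fun t : ℝ => ∫ s in (0 : ℝ)..1,
          T₀ (max (t * (1 - s)) 0) (V (v (t * s))) :=
        intervalIntegral.continuous_parametric_intervalIntegral_of_continuous
          (f := fun t s => T₀ (max (t * (1 - s)) 0) (V (v (t * s)))) hc continuous_const
      have h1 := (hc2.tendsto 0).mono_left (nhdsWithin_le_nhds (s := Ioi 0))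
      simp only [zero_mul, max_self, h.zero_apply, hv0, intervalIntegral.integral_const, sub_zero,
        one_smul] at h1
      refine h1.congr' ?_
      filter_upwards [self_mem_nhdsWithin] with t ht
      have ht : 0 < t := ht
      have e := intervalIntegral.smul_integral_comp_mul_left (a := 0) (b := 1)
        (fun s => T₀ (max (t - s) 0) (V (v s))) t
      simp only [mul_zero, mul_one] at e
      rw [← e, Complex.coe_smul, smul_smul, one_div, inv_mul_cancel₀ ht.ne', one_smul]
      congr 1
      ext s
      congr 3
      ring
    have hrel : ∀ᶠ t : ℝ in 𝓝[>] 0, ((1 / t : ℝ) : ℂ) • (v t - u) =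
        ((1 / t : ℝ) : ℂ) • (T₀ t u - u) + ((1 / t : ℝ) : ℂ) •
        ∫ s in (0 : ℝ)..t, T₀ (max (t - s) 0) (V (v s)) := by
      filter_upwards [self_mem_nhdsWithin] with t ht
      have ht : 0 ≤ t := le_of_lt ht
      rw [← smul_add]
      congr 1
      conv_lhs => rw [hv, hfix u t, max_eq_left ht]
      abel
    simp only [ContinuousLinearMap.comp_apply, BoundedContinuousFunction.evalCLM_apply]
    constructor
    · intro h1
      have h2 := h1.add hdiff
      rw [sub_add_cancel] at h2
      exact h2.congr' (hrel.mono fun t ht => ht.symm)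
    · intro h1
      refine (h1.sub hdiff).congr' (hrel.mono fun t ht => ?_)
      rw [ht, add_sub_cancel_right]

/-- The bounded perturbation theorem, for bounded semigroups. -/
theorem exists_perturbation (h : IsSemigroupGeneratedBy L₀ T₀) {M : ℝ}
    (hb : ∀ t, 0 ≤ t → ‖T₀ t‖ ≤ M) (V : X →L[ℂ] X) :
    ∃ T, IsSemigroupGeneratedBy (fun u f => L₀ u (f - V u)) T := by
  have hM : 0 ≤ M := (norm_nonneg _).trans (hb 0 le_rfl)
  set k : ℝ := M * ‖V‖ + 1 with hk
  have hk0 : 0 < k := by positivity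
  obtain ⟨T, hT⟩ := (h.rescale (-k)).exists_perturbation_of_decay (M := M) (k := k) (fun t ht => by
    rw [norm_smul, norm_real, norm_of_nonneg (exp_pos _).le, mul_comm]
    gcongr
    exact hb t ht) V hk0 (by rw [hk]; linarith)
  refine ⟨_, (hT.rescale k).congr_graph fun u f => ?_⟩
  have : f - (k : ℂ) • u - V u - ((-k : ℝ) : ℂ) • u = f - V u := by
    rw [Complex.ofReal_neg, neg_smul]; abel
  simp only [this]

/-- Transport of a semigroup along an isomorphism. -/
theorem transport {Y : Type*} [NormedAddCommGroup Y] [NormedSpace ℂ Y]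
    (h : IsSemigroupGeneratedBy L T) (e : Y ≃L[ℂ] X) :
    IsSemigroupGeneratedBy (fun u f => L (e u) (e f))
      (fun t => (e.symm : X →L[ℂ] Y).comp ((T t).comp (e : Y →L[ℂ] X))) where
  zero := by ext; simp [h.zero]
  add s t hs ht := by ext; simp [h.add s t hs ht]
  continuous u := by
    have := (e.symm.continuous.tendsto _).comp (h.continuous (e u))
    simpa [Function.comp_def] using this
  generator u f := by
    rw [h.generator]
    constructor
    · intro h1
      have := (e.symm.continuous.tendsto _).comp h1
      simpa [Function.comp_def] using this
    · intro h1
      have := (e.continuous.tendsto _).comp h1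
      simpa [Function.comp_def] using this

/-- The product of two semigroups. -/
theorem prodMap {Y : Type*} [NormedAddCommGroup Y] [NormedSpace ℂ Y] {L' : Y → Y → Prop}
    {T' : ℝ → Y →L[ℂ] Y}
    (h : IsSemigroupGeneratedBy L T) (h' : IsSemigroupGeneratedBy L' T') :
    IsSemigroupGeneratedBy (fun u f : X × Y => L u.1 f.1 ∧ L' u.2 f.2)
      (fun t => (T t).prodMap (T' t)) where
  zero := by ext <;> simp [h.zero, h'.zero]
  add s t hs ht := by ext <;> simp [h.add s t hs ht, h'.add s t hs ht]
  continuous u := (h.continuous u.1).prodMk_nhds (h'.continuous u.2)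
  generator u f := by
    rw [h.generator, h'.generator, Prod.tendsto_iff]
    rfl

end IsSemigroupGeneratedBy

end Perturbation

section Multiplication

variable {Ω : Type*} [MeasurableSpace Ω] {μ : Measure Ω}
variable {F : Type*} [NormedAddCommGroup F] [NormedSpace ℂ F]

/-- Multiplication by an essentially bounded function as an operator on `L²`. -/
def mulLp {g : Ω → ℂ} (hg : MemLp g ⊤ μ) : Lp F 2 μ →L[ℂ] Lp F 2 μ :=
  (ContinuousLinearMap.lsmul ℂ ℂ : ℂ →L[ℂ] F →L[ℂ] F).holderL μ ⊤ 2 2 (hg.toLp g)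

theorem coeFn_mulLp {g : Ω → ℂ} (hg : MemLp g ⊤ μ) (f : Lp F 2 μ) :
    mulLp hg f =ᵐ[μ] fun x => g x • f x := by
  have h1 := (ContinuousLinearMap.lsmul ℂ ℂ : ℂ →L[ℂ] F →L[ℂ] F).coeFn_holder (r := 2)
    (hg.toLp g) f
  filter_upwards [h1, hg.coeFn_toLp] with x hx hx'
  refine hx.trans ?_
  rw [hx']; rfl

theorem norm_mulLp_le {g : Ω → ℂ} (hg : MemLp g ⊤ μ) {C : ℝ} (hC : ∀ᵐ x ∂μ, ‖g x‖ ≤ C)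
    (f : Lp F 2 μ) : ‖mulLp hg f‖ ≤ C * ‖f‖ := by
  refine Lp.norm_le_mul_norm_of_ae_le_mul ?_
  filter_upwards [coeFn_mulLp hg f, hC] with x hx hx'
  rw [hx, norm_smul]
  gcongr

theorem memLp_top_exp {w : Ω → ℝ} (hw : Measurable w) (t : ℝ) :
    MemLp (fun x => Complex.exp (I * (t * w x : ℝ))) ⊤ μ := by
  refine memLp_top_of_bound (Measurable.aestronglyMeasurable (by fun_prop)) 1
    (.of_forall fun x => ?_)
  rw [mul_comm, norm_exp_ofReal_mul_I]

theorem Lp_norm_sq (f : Lp F 2 μ) : ‖f‖ ^ 2 = ∫ x, ‖f x‖ ^ 2 ∂μ := by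
  rw [Lp.norm_def, (memLp f).eLpNorm_eq_integral_rpow_norm (by simp) (by simp),
    ENNReal.toReal_ofReal (by positivity)]
  simp only [ENNReal.toReal_ofNat, Real.rpow_two]
  rw [← Real.rpow_natCast, ← Real.rpow_mul (by positivity)]
  norm_num

/-- Dominated convergence in `L²`. -/
theorem tendsto_Lp_of_dominated {ι : Type*} {l : Filter ι} [l.IsCountablyGenerated]
    {G : ι → Lp F 2 μ} {g : Lp F 2 μ} {G' : ι → Ω → F} {g' : Ω → F} (bound : Ω → ℝ)
    (hbound : MemLp bound 2 μ) (hG : ∀ᶠ i in l, G i =ᵐ[μ] G' i) (hg : g =ᵐ[μ] g')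
    (hle : ∀ᶠ i in l, ∀ᵐ x ∂μ, ‖G' i x - g' x‖ ≤ bound x)
    (hlim : ∀ᵐ x ∂μ, Tendsto (fun i => G' i x) l (𝓝 (g' x))) : Tendsto G l (𝓝 g) := by
  rw [tendsto_iff_norm_sub_tendsto_zero]
  have hsq : Tendsto (fun i => ‖G i - g‖ ^ 2) l (𝓝 0) := by
    have h1 : Tendsto (fun i => ∫ x, ‖(G i - g) x‖ ^ 2 ∂μ) l (𝓝 (∫ _, (0 : ℝ) ∂μ)) := by
      have h2 : Tendsto (fun i => ∫ x, ‖G' i x - g' x‖ ^ 2 ∂μ) l (𝓝 (∫ _, (0 : ℝ) ∂μ)) := by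
        refine tendsto_integral_filter_of_dominated_convergence (fun x => bound x ^ 2) ?_ ?_
          hbound.integrable_sq ?_
        · filter_upwards [hG] with i hi
          exact (((Lp.aestronglyMeasurable (G i)).congr hi).sub
            ((Lp.aestronglyMeasurable g).congr hg)).norm.pow 2
        · filter_upwards [hle] with i hi
          filter_upwards [hi] with x hx
          rw [norm_of_nonneg (by positivity)]
          gcongr
        · filter_upwards [hlim] with x hx
          have := ((hx.sub_const (g' x)).norm.pow 2)
          simpa using this
      refine h2.congr' ?_
      filter_upwards [hG] with i hi
      refine integral_congr_ae ?_
      filter_upwards [hi, hg, coeFn_sub (G i) g] with x h1 h2 h3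
      rw [h3, Pi.sub_apply, h1, h2]
    simp only [integral_zero] at h1
    exact h1.congr fun i => (Lp_norm_sq _).symm
  have := (Real.continuous_sqrt.tendsto 0).comp hsq
  simpa [Function.comp_def, Real.sqrt_sq] using this

/-- Multiplication by `e^{itw}` is a semigroup on `L²`, generated by multiplication by `iw` with its
maximal domain. -/
theorem isSemigroupGeneratedBy_exp {w : Ω → ℝ} (hw : Measurable w) :
    IsSemigroupGeneratedBy
      (fun f g : Lp ℂ 2 μ => g =ᵐ[μ] fun x => I * w x * f x)
      (fun t => mulLp (memLp_top_exp hw t)) where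
  zero := by
    ext1 f
    refine Lp.ext ?_
    filter_upwards [coeFn_mulLp (memLp_top_exp (μ := μ) hw 0) f] with x hx
    rw [hx]; simp
  add s t _ _ := by
    ext1 f
    refine Lp.ext ?_
    filter_upwards [coeFn_mulLp (memLp_top_exp (μ := μ) hw (s + t)) f,
      coeFn_mulLp (memLp_top_exp (μ := μ) hw t) f,
      coeFn_mulLp (memLp_top_exp (μ := μ) hw s) (mulLp (memLp_top_exp (μ := μ) hw t) f)]
      with x h1 h2 h3
    rw [h1, ContinuousLinearMap.comp_apply, h3, h2, smul_smul, ← Complex.exp_add]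
    congr 2
    push_cast; ring
  continuous f := by
    refine tendsto_Lp_of_dominated (fun x => 2 * ‖f x‖) ((memLp f).norm.const_mul 2)
      (.of_forall fun t => coeFn_mulLp (memLp_top_exp (μ := μ) hw t) f)
      EventuallyEq.rfl ?_ ?_
    · refine Eventually.of_forall fun t => Eventually.of_forall fun x => ?_
      refine (norm_sub_le _ _).trans ?_
      rw [norm_smul, mul_comm I, norm_exp_ofReal_mul_I]
      linarith
    · refine Eventually.of_forall fun x => ?_
      have : Continuous fun t : ℝ => Complex.exp (I * (t * w x : ℝ)) • f x := by fun_prop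
      simpa using (this.tendsto 0).mono_left nhdsWithin_le_nhds
  generator f g := by
    have hcoe : ∀ t : ℝ, ((1 / t : ℝ) : ℂ) • (mulLp (memLp_top_exp (μ := μ) hw t) f - f) =ᵐ[μ]
        fun x => ((1 / t : ℝ) : ℂ) * (Complex.exp (I * (t * w x : ℝ)) - 1) * f x := by
      intro t
      filter_upwards [coeFn_smul ((1 / t : ℝ) : ℂ) (mulLp (memLp_top_exp (μ := μ) hw t) f - f),
        coeFn_sub (mulLp (memLp_top_exp (μ := μ) hw t) f) f,
        coeFn_mulLp (memLp_top_exp (μ := μ) hw t) f] with x h1 h2 h3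
      rw [h1, Pi.smul_apply, h2, Pi.sub_apply, h3, smul_eq_mul, smul_eq_mul]
      ring
    have hlim : ∀ x, Tendsto (fun t : ℝ =>
        ((1 / t : ℝ) : ℂ) * (Complex.exp (I * (t * w x : ℝ)) - 1) * f x) (𝓝[>] 0)
        (𝓝 (I * w x * f x)) := by
      intro x
      have h1 : HasDerivAt (fun t : ℝ => Complex.exp (I * (t * w x : ℝ)))
          (Complex.exp (I * ((0 : ℝ) * w x : ℝ)) * (I * ((1 * w x : ℝ) : ℂ))) 0 :=
        ((((hasDerivAt_id (0 : ℝ)).mul_const (w x)).ofReal_comp).const_mul I).cexp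
      have h2 := (hasDerivAt_iff_tendsto_slope_zero.1 h1).mono_left
        (nhdsWithin_mono 0 (fun x (hx : x ∈ Ioi (0 : ℝ)) => ne_of_gt hx))
      have h3 := h2.mul_const (f x)
      simp only [zero_mul, Complex.ofReal_zero, mul_zero, Complex.exp_zero, one_mul] at h3
      refine h3.congr fun t => ?_
      rw [zero_add, one_div, real_smul]
    constructor
    · intro hg
      have hgm : MemLp (fun x => I * w x * f x) 2 μ := (memLp_congr_ae hg).1 (memLp g)
      refine tendsto_Lp_of_dominated (fun x => 2 * ‖I * w x * f x‖) (hgm.norm.const_mul 2)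
        (Eventually.of_forall hcoe) hg ?_ (Eventually.of_forall hlim)
      filter_upwards [self_mem_nhdsWithin] with t ht
      have ht : 0 < t := ht
      refine Eventually.of_forall fun x => ?_
      refine (norm_sub_le _ _).trans ?_
      have h4 : ‖Complex.exp (I * (t * w x : ℝ)) - 1‖ ≤ ‖t * w x‖ :=
        Real.norm_exp_I_mul_ofReal_sub_one_le
      have h5 : ‖((1 / t : ℝ) : ℂ) * (Complex.exp (I * (t * w x : ℝ)) - 1) * f x‖ ≤
          ‖I * w x * f x‖ := by
        rw [norm_mul, norm_mul, norm_mul, norm_mul, norm_I, one_mul, norm_real,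
          norm_real]
        gcongr
        calc _ ≤ ‖1 / t‖ * ‖t * w x‖ := by gcongr
          _ = ‖w x‖ := by
            rw [← norm_mul, one_div, inv_mul_cancel_left₀ ht.ne']
      linarith
    · intro hg
      have hs : Tendsto (fun n : ℕ => 1 / ((n : ℝ) + 1)) atTop (𝓝[>] 0) :=
        tendsto_nhdsWithin_iff.2 ⟨tendsto_one_div_add_atTop_nhds_zero_nat,
          Eventually.of_forall fun n => by simp only [mem_Ioi]; positivity⟩
      have h1 := tendstoInMeasure_of_tendsto_Lp (hg.comp hs)
      obtain ⟨ns, hns, hae⟩ := h1.exists_seq_tendsto_ae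
      have hall : ∀ᵐ x ∂μ, ∀ n : ℕ, (((1 / (1 / ((n : ℝ) + 1)) : ℝ) : ℂ) •
          (mulLp (memLp_top_exp (μ := μ) hw (1 / ((n : ℝ) + 1))) f - f) : Lp ℂ 2 μ) x =
          ((1 / (1 / ((n : ℝ) + 1)) : ℝ) : ℂ) *
            (Complex.exp (I * (1 / ((n : ℝ) + 1) * w x : ℝ)) - 1) * f x :=
        ae_all_iff.2 fun n => hcoe _
      filter_upwards [hae, hall] with x hx hx'
      refine tendsto_nhds_unique (hx.congr fun n => ?_) ((hlim x).comp (hs.comp hns.tendsto_atTop))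
      exact hx' (ns n)

end Multiplication

/-! ### Plancherel's theorem and the Gearhart–Prüss theorem -/

section FourierAgreement

open FourierTransform

variable {E F : Type*} [NormedAddCommGroup E] [MeasurableSpace E] [BorelSpace E]
  [NormedAddCommGroup F] [InnerProductSpace ℂ F] [CompleteSpace F]
  [InnerProductSpace ℝ E] [FiniteDimensional ℝ E]

/-- On `L¹ ∩ L²` the `L²` Fourier transform is given by the Fourier integral. -/
theorem fourier_toLp_ae {f : E → F} (h1 : Integrable f) (h2 : MemLp f 2) :
    (𝓕 (h2.toLp f) : Lp F 2 (volume : Measure E)) =ᵐ[volume] 𝓕 f := by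
  have hc : Continuous (𝓕 f) := VectorFourier.fourierIntegral_continuous continuous_fourierChar
    (innerSL ℝ).continuous₂ h1
  refine ae_eq_of_integral_contDiff_smul_eq
    ((memLp _).locallyIntegrable (by norm_num)) hc.locallyIntegrable fun g hg hgc => ?_
  have hg₁ : HasCompactSupport (ofRealCLM ∘ g) := hgc.comp_left rfl
  have hg₂ : ContDiff ℝ ∞ (ofRealCLM ∘ g) := by fun_prop
  set ψ := hg₁.toSchwartzMap hg₂ with hψ
  have e1 : ∫ x, g x • (𝓕 (h2.toLp f) : Lp F 2 (volume : Measure E)) x =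
      Lp.toTemperedDistribution (𝓕 (h2.toLp f) : Lp F 2 (volume : Measure E)) ψ := by
    rw [Lp.toTemperedDistribution_apply]
    simp [hψ]
  rw [e1, ← Lp.fourier_toTemperedDistribution_eq, TemperedDistribution.fourier_apply,
    Lp.toTemperedDistribution_apply]
  have e2 : ∫ x, (𝓕 ψ) x • (h2.toLp f) x = ∫ x, (𝓕 ψ) x • f x := by
    refine integral_congr_ae ?_
    filter_upwards [h2.coeFn_toLp] with x hx
    rw [hx]
  rw [e2]
  have e3 := VectorFourier.integral_fourierIntegral_smul_eq_flip (μ := (volume : Measure E))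
    (ν := (volume : Measure E)) (L := innerₗ E) (f := ψ) (g := f) continuous_fourierChar
    (innerSL ℝ).continuous₂ ψ.integrable h1
  rw [flip_innerₗ] at e3
  refine (Eq.trans ?_ e3).trans ?_
  · rfl
  · simp [hψ]
    rfl

theorem fourierInv_toLp_ae {f : E → F} (h1 : Integrable f) (h2 : MemLp f 2) :
    (𝓕⁻ (h2.toLp f) : Lp F 2 (volume : Measure E)) =ᵐ[volume] 𝓕⁻ f := by
  have hc : Continuous (𝓕⁻ f) := by
    rw [Real.fourierInv_eq_fourier_comp_neg]
    exact VectorFourier.fourierIntegral_continuous continuous_fourierChar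
      (innerSL ℝ).continuous₂ h1.comp_neg
  refine ae_eq_of_integral_contDiff_smul_eq
    ((memLp _).locallyIntegrable (by norm_num)) hc.locallyIntegrable fun g hg hgc => ?_
  have hg₁ : HasCompactSupport (ofRealCLM ∘ g) := hgc.comp_left rfl
  have hg₂ : ContDiff ℝ ∞ (ofRealCLM ∘ g) := by fun_prop
  set ψ := hg₁.toSchwartzMap hg₂ with hψ
  have e1 : ∫ x, g x • (𝓕⁻ (h2.toLp f) : Lp F 2 (volume : Measure E)) x =
      Lp.toTemperedDistribution (𝓕⁻ (h2.toLp f) : Lp F 2 (volume : Measure E)) ψ := by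
    rw [Lp.toTemperedDistribution_apply]
    simp [hψ]
  rw [e1, ← Lp.fourierInv_toTemperedDistribution_eq, TemperedDistribution.fourierInv_apply,
    Lp.toTemperedDistribution_apply]
  have e2 : ∫ x, (𝓕⁻ ψ) x • (h2.toLp f) x = ∫ x, (𝓕⁻ ψ) x • f x := by
    refine integral_congr_ae ?_
    filter_upwards [h2.coeFn_toLp] with x hx
    rw [hx]
  rw [e2]
  have e3 := VectorFourier.integral_fourierIntegral_smul_eq_flip (μ := (volume : Measure E))
    (ν := (volume : Measure E)) (L := -innerₗ E) (f := ψ) (g := f) continuous_fourierChar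
    ((innerSL ℝ).continuous₂.neg) ψ.integrable h1
  have e4 : (-innerₗ E).flip = -innerₗ E := by
    ext x y; simp [real_inner_comm]
  rw [e4] at e3
  refine (Eq.trans ?_ e3).trans ?_
  · simp only [SchwartzMap.fourierInv_coe]
    rfl
  · simp [hψ]
    rfl

/-- Plancherel's identity for the Fourier integral of a function in `L¹ ∩ L²`. -/
theorem lintegral_fourier_sq {f : E → F} (h1 : Integrable f) (h2 : MemLp f 2) :
    ∫⁻ x, ‖𝓕 f x‖ₑ ^ 2 = ∫⁻ x, ‖f x‖ₑ ^ 2 := by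
  have key : ∀ g : Lp F 2 (volume : Measure E), ∫⁻ x, ‖g x‖ₑ ^ 2 = ENNReal.ofReal (‖g‖ ^ 2) := by
    intro g
    rw [Lp_norm_sq, ofReal_integral_eq_lintegral_ofReal ((memLp_two_iff_integrable_sq_norm (Lp.aestronglyMeasurable g)).1 (memLp g))
      (.of_forall fun _ => by positivity)]
    refine lintegral_congr fun x => ?_
    rw [ENNReal.ofReal_pow (norm_nonneg _), ofReal_norm]
  have a1 : ∫⁻ x, ‖𝓕 f x‖ₑ ^ 2 = ∫⁻ x, ‖(𝓕 (h2.toLp f) : Lp F 2 (volume : Measure E)) x‖ₑ ^ 2 := by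
    refine lintegral_congr_ae ?_
    filter_upwards [fourier_toLp_ae h1 h2] with x hx
    rw [hx]
  have a2 : ∫⁻ x, ‖f x‖ₑ ^ 2 = ∫⁻ x, ‖(h2.toLp f) x‖ₑ ^ 2 := by
    refine lintegral_congr_ae ?_
    filter_upwards [h2.coeFn_toLp] with x hx
    rw [hx]
  rw [a1, a2, key, key, Lp.norm_fourier_eq]

end FourierAgreement

theorem memLp_two_of_bounded {α F : Type*} [MeasurableSpace α] {μ : Measure α}
    [NormedAddCommGroup F] {f : α → F} (hf : Integrable f μ) {C : ℝ} (hC : ∀ x, ‖f x‖ ≤ C) :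
    MemLp f 2 μ := by
  rw [memLp_two_iff_integrable_sq_norm hf.1]
  refine (hf.norm.const_mul C).mono' (hf.1.norm.pow 2) (.of_forall fun x => ?_)
  rw [norm_of_nonneg (by positivity), pow_two]
  gcongr
  exact hC x

section GearhartPruss

variable {X : Type*} [NormedAddCommGroup X] [InnerProductSpace ℂ X] [CompleteSpace X]
variable {L : X → X → Prop} {T : ℝ → X →L[ℂ] X}

/-- The cut-off `t ↦ min(t, 1)` for `t ≥ 0`, extended by zero. -/
def ramp (t : ℝ) : ℝ := max 0 (min t 1)

theorem continuous_ramp : Continuous ramp := by unfold ramp; fun_prop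

theorem ramp_of_nonpos {t : ℝ} (ht : t ≤ 0) : ramp t = 0 := by
  unfold ramp; exact max_eq_left ((min_le_left _ _).trans ht)

theorem ramp_nonneg (t : ℝ) : 0 ≤ ramp t := le_max_left _ _

theorem ramp_le_one (t : ℝ) : ramp t ≤ 1 := max_le zero_le_one (min_le_right _ _)

theorem ramp_of_one_le {t : ℝ} (ht : 1 ≤ t) : ramp t = 1 := by
  unfold ramp; rw [min_eq_right ht]; simp

theorem ramp_of_mem {t : ℝ} (ht : t ∈ Icc (0 : ℝ) 1) : ramp t = t := by
  unfold ramp; rw [min_eq_left ht.2, max_eq_right ht.1]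

theorem ramp_quot_bound {k : ℝ} (hk : 0 < k) (t : ℝ) :
    0 ≤ (ramp t - ramp (t - k)) / k ∧ (ramp t - ramp (t - k)) / k ≤ 1 := by
  have h1 : ramp (t - k) ≤ ramp t := by
    unfold ramp; gcongr; linarith
  have h2 : ramp t ≤ ramp (t - k) + k := by
    unfold ramp
    rcases max_cases 0 (min t 1) with h | h <;> rcases min_cases t 1 with h' | h' <;>
    rcases max_cases 0 (min (t - k) 1) with h3 | h3 <;> rcases min_cases (t - k) 1 with h4 | h4 <;>
    linarith
  exact ⟨div_nonneg (by linarith) hk.le, by rw [div_le_one hk]; linarith⟩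

theorem tendsto_ramp_quot {t : ℝ} (h0 : t ≠ 0) (h1 : t ≠ 1) :
    Tendsto (fun k => (ramp t - ramp (t - k)) / k) (𝓝[>] 0)
      (𝓝 (indicator (Ioc (0 : ℝ) 1) (fun _ => (1 : ℝ)) t)) := by
  refine tendsto_const_nhds.congr' ?_
  rcases lt_or_gt_of_ne h0 with ht | ht
  · filter_upwards [self_mem_nhdsWithin] with k hk
    have hk : 0 < k := hk
    rw [indicator_of_notMem (fun h => by linarith [h.1]), ramp_of_nonpos ht.le,
      ramp_of_nonpos (by linarith)]
    simp
  rcases lt_or_gt_of_ne h1 with ht1 | ht1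
  · filter_upwards [Ioo_mem_nhdsGT ht] with k hk
    rw [indicator_of_mem (show t ∈ Ioc (0 : ℝ) 1 from ⟨ht, ht1.le⟩), ramp_of_mem ⟨ht.le, ht1.le⟩,
      ramp_of_mem ⟨by linarith [hk.2], by linarith [hk.1]⟩]
    rw [sub_sub_cancel, div_self hk.1.ne']
  · filter_upwards [Ioo_mem_nhdsGT (show (0 : ℝ) < t - 1 by linarith)] with k hk
    rw [indicator_of_notMem (fun h => by linarith [h.2]), ramp_of_one_le ht1.le,
      ramp_of_one_le (by linarith [hk.2])]
    simp

namespace IsSemigroupGeneratedBy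

theorem integrableOn_laplace (h : IsSemigroupGeneratedBy L T) {y : X} {C σ : ℝ}
    (hb : ∀ t, 0 ≤ t → ‖T t y‖ ≤ C * exp (σ * t)) {l : ℂ} (hl : σ < l.re) :
    IntegrableOn (fun t : ℝ => Complex.exp (-l * t) • T (max t 0) y) (Ioi 0) := by
  have h1 : IntegrableOn (fun t : ℝ => C * exp (-(l.re - σ) * t)) (Ioi 0) :=
    (exp_neg_integrableOn_Ioi 0 (by linarith)).const_mul C
  refine h1.mono' ?_ ?_
  · exact (Continuous.aestronglyMeasurable
      ((by fun_prop : Continuous fun t : ℝ => Complex.exp (-l * t)).smul (h.continuous_orbit y)))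
  · refine (ae_restrict_mem measurableSet_Ioi).mono fun t ht => ?_
    have ht : 0 < t := ht
    rw [norm_smul, max_eq_left ht.le, Complex.norm_exp]
    calc _ ≤ exp (-l * t : ℂ).re * (C * exp (σ * t)) := by gcongr; exact hb t ht.le
      _ = _ := by
        have : (-l * t : ℂ).re = -l.re * t := by simp
        rw [this, mul_left_comm, ← exp_add]; congr 2; ring

theorem integrable_ramp (h : IsSemigroupGeneratedBy L T) {y : X} {C σ : ℝ}
    (hb : ∀ t, 0 ≤ t → ‖T t y‖ ≤ C * exp (σ * t)) {l : ℂ} (hl : σ < l.re) :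
    Integrable (fun t : ℝ => (ramp t : ℂ) • Complex.exp (-l * t) • T (max t 0) y) := by
  have h1 := (integrable_indicator_iff measurableSet_Ioi).2 (h.integrableOn_laplace hb hl)
  refine h1.norm.mono' ?_ (.of_forall fun t => ?_)
  · exact (Continuous.aestronglyMeasurable
      ((continuous_ofReal.comp continuous_ramp).smul
      ((by fun_prop : Continuous fun t : ℝ => Complex.exp (-l * t)).smul (h.continuous_orbit y))))
  · by_cases ht : 0 < t
    · rw [indicator_of_mem (mem_Ioi.2 ht), norm_smul, norm_real,
        norm_of_nonneg (ramp_nonneg t)]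
      exact mul_le_of_le_one_left (norm_nonneg _) (ramp_le_one t)
    · rw [ramp_of_nonpos (not_lt.1 ht)]; simp

/-- A smoothed Laplace transform of an orbit solves a resolvent equation whose right-hand side only
involves the orbit up to time `1`. -/
theorem resolvent_ramp (h : IsSemigroupGeneratedBy L T) {y : X} {C σ : ℝ}
    (hb : ∀ t, 0 ≤ t → ‖T t y‖ ≤ C * exp (σ * t)) {l : ℂ} (hl : σ < l.re) :
    L (∫ t : ℝ, (ramp t : ℂ) • Complex.exp (-l * t) • T (max t 0) y)
      (l • (∫ t : ℝ, (ramp t : ℂ) • Complex.exp (-l * t) • T (max t 0) y) -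
        ∫ t : ℝ, indicator (Ioc 0 1) (fun t : ℝ => Complex.exp (-l * t) • T (max t 0) y) t) := by
  set e : ℝ → X := fun t => Complex.exp (-l * t) • T (max t 0) y with he
  have hec : Continuous e :=
    (by fun_prop : Continuous fun t : ℝ => Complex.exp (-l * t)).smul (h.continuous_orbit y)
  have hv := h.integrable_ramp hb hl
  have hE := (integrable_indicator_iff measurableSet_Ioi).2 (h.integrableOn_laplace hb hl)
  set u : X := ∫ t : ℝ, (ramp t : ℂ) • e t with hu
  rw [h.generator]
  have hq : ∀ k : ℝ, 0 < k → Integrable (fun t => (((ramp t - ramp (t - k)) / k : ℝ) : ℂ) • e t) := by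
    intro k hk
    refine hE.norm.mono' ?_ (.of_forall fun t => ?_)
    · have : Continuous fun t => (((ramp t - ramp (t - k)) / k : ℝ) : ℂ) :=
        continuous_ofReal.comp ((continuous_ramp.sub (continuous_ramp.comp
          (by fun_prop))).div_const k)
      exact (this.smul hec).aestronglyMeasurable
    · by_cases ht : 0 < t
      · rw [indicator_of_mem (mem_Ioi.2 ht), norm_smul, norm_real,
          norm_of_nonneg (ramp_quot_bound hk t).1]
        exact mul_le_of_le_one_left (norm_nonneg _) (ramp_quot_bound hk t).2
      · rw [ramp_of_nonpos (not_lt.1 ht), ramp_of_nonpos (by linarith)]; simp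
  have hquot : ∀ k : ℝ, 0 < k → ((1 / k : ℝ) : ℂ) • (T k u - u) =
      (((k : ℂ)⁻¹ * (Complex.exp (l * k) - 1)) • u) - Complex.exp (l * k) •
        ∫ t, (((ramp t - ramp (t - k)) / k : ℝ) : ℂ) • e t := by
    intro k hk
    have a1 : T k u = Complex.exp (l * k) • ∫ t, (ramp (t - k) : ℂ) • e t := by
      rw [hu, ← ContinuousLinearMap.integral_comp_comm _ hv, ← integral_smul,
        ← integral_sub_right_eq_self _ k]
      refine integral_congr_ae (.of_forall fun t => ?_)
      simp only [he]
      by_cases ht : 0 ≤ t - k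
      · rw [map_smul, map_smul, max_eq_left ht, ← h.apply_add hk.le ht, max_eq_left (by linarith),
          smul_comm _ (ramp (t - k) : ℂ), smul_smul (Complex.exp (l * k)), ← Complex.exp_add]
        congr 3
        · push_cast; ring
        · ring_nf
      · rw [ramp_of_nonpos (not_le.1 ht).le]; simp
    have a2 : ∫ t, (ramp (t - k) : ℂ) • e t =
        u - (k : ℂ) • ∫ t, (((ramp t - ramp (t - k)) / k : ℝ) : ℂ) • e t := by
      have hq' : Integrable (fun t => (k : ℂ) • (((ramp t - ramp (t - k)) / k : ℝ) : ℂ) • e t) :=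
        (hq k hk).smul (k : ℂ)
      have hv' : Integrable (fun t => (ramp t : ℂ) • e t) := hv
      rw [hu, ← integral_smul, ← integral_sub hv' hq']
      refine integral_congr_ae (.of_forall fun t => ?_)
      simp only [smul_smul]
      rw [← sub_smul]
      congr 1
      have : (k : ℂ) ≠ 0 := by exact_mod_cast hk.ne'
      push_cast
      field_simp
      ring
    rw [a1, a2]
    have : (k : ℂ) ≠ 0 := by exact_mod_cast hk.ne'
    simp only [smul_sub, smul_smul, mul_sub, sub_smul, mul_one]
    rw [one_div, Complex.ofReal_inv, mul_left_comm, inv_mul_cancel₀ this, mul_one]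
    abel
  have hlim1 : Tendsto (fun k : ℝ => (k : ℂ)⁻¹ * (Complex.exp (l * k) - 1)) (𝓝[>] 0) (𝓝 l) := by
    have h1 : HasDerivAt (fun t : ℝ => Complex.exp (l * (t : ℂ)))
        (Complex.exp (l * ((0 : ℝ) : ℂ)) * (l * 1)) 0 :=
      (((hasDerivAt_id (0 : ℝ)).ofReal_comp).const_mul l).cexp
    have h2 := (hasDerivAt_iff_tendsto_slope_zero.1 h1).mono_left
      (nhdsWithin_mono 0 (fun x (hx : x ∈ Ioi (0 : ℝ)) => ne_of_gt hx))
    simpa [real_smul] using h2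
  have hlim2 : Tendsto (fun k : ℝ => Complex.exp (l * k)) (𝓝[>] 0) (𝓝 1) := by
    have : Continuous fun t : ℝ => Complex.exp (l * (t : ℂ)) := by fun_prop
    simpa using (this.tendsto 0).mono_left nhdsWithin_le_nhds
  have hlim3 : Tendsto (fun k : ℝ => ∫ t, (((ramp t - ramp (t - k)) / k : ℝ) : ℂ) • e t) (𝓝[>] 0)
      (𝓝 (∫ t, indicator (Ioc 0 1) e t)) := by
    refine tendsto_integral_filter_of_dominated_convergence (fun t => ‖indicator (Ioi 0) e t‖)
      ?_ ?_ hE.norm ?_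
    · filter_upwards [self_mem_nhdsWithin] with k hk using (hq k hk).1
    · filter_upwards [self_mem_nhdsWithin] with k hk
      have hk : 0 < k := hk
      refine Eventually.of_forall fun t => ?_
      by_cases ht : 0 < t
      · rw [indicator_of_mem (mem_Ioi.2 ht), norm_smul, norm_real,
          norm_of_nonneg (ramp_quot_bound hk t).1]
        exact mul_le_of_le_one_left (norm_nonneg _) (ramp_quot_bound hk t).2
      · rw [ramp_of_nonpos (not_lt.1 ht), ramp_of_nonpos (by linarith)]; simp
    · have hne : ∀ᵐ t : ℝ, t ≠ 0 ∧ t ≠ 1 := by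
        filter_upwards [compl_mem_ae_iff.2 (measure_singleton (μ := volume) (0 : ℝ)),
          compl_mem_ae_iff.2 (measure_singleton (μ := volume) (1 : ℝ))] with t h0 h1 using ⟨h0, h1⟩
      filter_upwards [hne] with t ht
      have h1 := ((continuous_ofReal.tendsto _).comp
        (tendsto_ramp_quot ht.1 ht.2)).smul_const (e t)
      refine h1.congr' (.of_forall fun k => rfl) |>.trans ?_
      by_cases hm : t ∈ Ioc (0 : ℝ) 1
      · simp [hm]
      · simp [hm]
  have := (hlim1.smul_const u).sub (hlim2.smul hlim3)
  rw [one_smul] at this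
  refine this.congr' ?_
  filter_upwards [self_mem_nhdsWithin] with k hk
  exact (hquot k hk).symm

/-- Plancherel's theorem bounds the `L²` norm in time of a rescaled orbit by its size on `[0, 1]`,
given a resolvent bound on a vertical line. -/
theorem integral_ramp_sq_le (h : IsSemigroupGeneratedBy L T) {y : X} {C σ w M B : ℝ}
    (hb : ∀ t, 0 ≤ t → ‖T t y‖ ≤ C * exp (σ * t)) (hw : σ < w) (hB0 : 0 ≤ B)
    (Q : X →L[ℂ] X) (hQy : Q y = y) (hcomm : ∀ t, 0 ≤ t → ∀ x, Q (T t x) = T t (Q x))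
    (hM : ∀ l : ℂ, l.re = w → ∀ u f, Q u = u → L u f → ‖u‖ ≤ M * ‖l • u - f‖)
    (hB : ∀ t ∈ Icc (0 : ℝ) 1, exp (-w * t) * ‖T t y‖ ≤ B) {a b : ℝ} (hab : a ≤ b) :
    ∫ t in a..b, (ramp t * (exp (-w * t) * ‖T (max t 0) y‖)) ^ 2 ≤ (M * B) ^ 2 := by
  have hwre : σ < (w : ℂ).re := by simpa using hw
  set e : ℝ → X := fun t => Complex.exp (-(w : ℂ) * t) • T (max t 0) y with he
  have hen : ∀ t, ‖e t‖ = exp (-w * t) * ‖T (max t 0) y‖ := by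
    intro t
    simp only [he]
    rw [norm_smul, Complex.norm_exp]
    simp
  set v : ℝ → X := fun t => (ramp t : ℂ) • e t with hv
  have hvn : ∀ t, ‖v t‖ = ramp t * (exp (-w * t) * ‖T (max t 0) y‖) := by
    intro t
    simp only [hv]
    rw [norm_smul, hen, norm_real, norm_of_nonneg (ramp_nonneg t)]
  set g : ℝ → X := indicator (Ioc 0 1) e with hg
  have hgn : ∀ t, ‖g t‖ ≤ indicator (Ioc (0 : ℝ) 1) (fun _ => B) t := by
    intro t
    by_cases ht : t ∈ Ioc (0 : ℝ) 1
    · rw [hg, indicator_of_mem ht, indicator_of_mem ht, hen, max_eq_left ht.1.le]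
      exact hB t ⟨ht.1.le, ht.2⟩
    · rw [hg, indicator_of_notMem ht, indicator_of_notMem ht, norm_zero]
  have hv1 : Integrable v := h.integrable_ramp hb hwre
  have hC0 : 0 ≤ C := by
    have := (norm_nonneg _).trans (hb 0 le_rfl)
    simpa using this
  have hv2 : MemLp v 2 := by
    refine memLp_two_of_bounded hv1 (C := C) fun t => ?_
    rw [hvn]
    rcases le_or_gt t 0 with ht | ht
    · rw [ramp_of_nonpos ht, zero_mul]; exact hC0
    · refine (mul_le_of_le_one_left (by positivity) (ramp_le_one t)).trans ?_
      rw [max_eq_left ht.le]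
      calc _ ≤ exp (-w * t) * (C * exp (σ * t)) := by gcongr; exact hb t ht.le
        _ = C * exp (-((w - σ) * t)) := by
          rw [mul_left_comm, ← exp_add]; congr 2; ring
        _ ≤ C * 1 := by
          gcongr
          rw [Real.exp_le_one_iff]
          have : 0 ≤ (w - σ) * t := mul_nonneg (by linarith) ht.le
          linarith
        _ = C := mul_one C
  have hec : Continuous e :=
    (by fun_prop : Continuous fun t : ℝ => Complex.exp (-(w : ℂ) * t)).smul (h.continuous_orbit y)
  have hg1 : Integrable g := by
    rw [hg, integrable_indicator_iff measurableSet_Ioc]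
    exact hec.continuousOn.integrableOn_Icc.mono_set Ioc_subset_Icc_self
  have hg2 : MemLp g 2 := memLp_two_of_bounded hg1 (C := B) fun t => (hgn t).trans
    (indicator_le_self' (fun _ _ => hB0) t)
  have hfour : ∀ τ, ‖FourierTransform.fourier v τ‖ ≤ M * ‖FourierTransform.fourier g τ‖ := by
    intro τ
    set l : ℂ := w + (2 * π * τ : ℝ) * I with hl
    have hlre : l.re = w := by simp [hl]
    have hexp : ∀ t : ℝ, Complex.exp (((-2 * π * t * τ : ℝ) : ℂ) * I) *
        Complex.exp (-(w : ℂ) * t) = Complex.exp (-l * t) := by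
      intro t
      rw [← Complex.exp_add, hl]
      congr 1
      push_cast; ring
    have e1 : FourierTransform.fourier v τ =
        ∫ t : ℝ, (ramp t : ℂ) • Complex.exp (-l * t) • T (max t 0) y := by
      rw [Real.fourier_real_eq_integral_exp_smul]
      refine integral_congr_ae (.of_forall fun t => ?_)
      simp only [hv, he]
      rw [smul_comm, smul_smul (Complex.exp _), hexp]
    have e2 : FourierTransform.fourier g τ = ∫ t : ℝ, indicator (Ioc 0 1)
        (fun t : ℝ => Complex.exp (-l * t) • T (max t 0) y) t := by
      rw [Real.fourier_real_eq_integral_exp_smul]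
      refine integral_congr_ae (.of_forall fun t => ?_)
      simp only [hg]
      by_cases ht : t ∈ Ioc (0 : ℝ) 1
      · simp only [indicator_of_mem ht, he]
        rw [smul_smul, hexp]
      · simp only [indicator_of_notMem ht, smul_zero]
    have hres := h.resolvent_ramp hb (l := l) (by rw [hlre]; exact hw)
    rw [← e1, ← e2] at hres
    have hQv : Q (FourierTransform.fourier v τ) = FourierTransform.fourier v τ := by
      rw [e1, ← ContinuousLinearMap.integral_comp_comm _ (h.integrable_ramp hb (l := l)
        (by rw [hlre]; exact hw))]
      refine integral_congr_ae (.of_forall fun t => ?_)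
      simp only [map_smul]
      rw [hcomm _ (le_max_right _ _), hQy]
    have := hM l hlre _ _ hQv hres
    rwa [sub_sub_cancel] at this
  have hlin : ∫⁻ t, ‖v t‖ₑ ^ 2 ≤ ENNReal.ofReal ((M * B) ^ 2) := by
    rw [← lintegral_fourier_sq hv1 hv2]
    calc ∫⁻ τ, ‖FourierTransform.fourier v τ‖ₑ ^ 2
        ≤ ∫⁻ τ, ENNReal.ofReal (M ^ 2) * ‖FourierTransform.fourier g τ‖ₑ ^ 2 := by
          refine lintegral_mono fun τ => ?_
          rw [← ofReal_norm, ← ofReal_norm, ← ENNReal.ofReal_pow (norm_nonneg _),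
            ← ENNReal.ofReal_pow (norm_nonneg _), ← ENNReal.ofReal_mul (by positivity), ← mul_pow]
          exact ENNReal.ofReal_le_ofReal (pow_le_pow_left₀ (norm_nonneg _) (hfour τ) 2)
      _ = ENNReal.ofReal (M ^ 2) * ∫⁻ t, ‖g t‖ₑ ^ 2 := by
          rw [lintegral_const_mul' _ _ ENNReal.ofReal_ne_top, lintegral_fourier_sq hg1 hg2]
      _ ≤ ENNReal.ofReal (M ^ 2) * ENNReal.ofReal (B ^ 2) := by
          gcongr
          calc ∫⁻ t, ‖g t‖ₑ ^ 2
              ≤ ∫⁻ t, indicator (Ioc (0 : ℝ) 1) (fun _ => ENNReal.ofReal (B ^ 2)) t := by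
                refine lintegral_mono fun t => ?_
                rw [← ofReal_norm, ← ENNReal.ofReal_pow (norm_nonneg _)]
                have := hgn t
                by_cases ht : t ∈ Ioc (0 : ℝ) 1
                · rw [indicator_of_mem ht] at this ⊢
                  exact ENNReal.ofReal_le_ofReal (pow_le_pow_left₀ (norm_nonneg _) this 2)
                · rw [indicator_of_notMem ht] at this ⊢
                  simp [le_antisymm this (norm_nonneg _)]
            _ = ENNReal.ofReal (B ^ 2) := by
                rw [lintegral_indicator measurableSet_Ioc, setLIntegral_const]
                simp
      _ = ENNReal.ofReal ((M * B) ^ 2) := by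
          rw [← ENNReal.ofReal_mul (by positivity), mul_pow]
  have hvsq : Integrable fun t => ‖v t‖ ^ 2 := (memLp_two_iff_integrable_sq_norm hv2.1).1 hv2
  have hint : ∫ t, ‖v t‖ ^ 2 ≤ (M * B) ^ 2 := by
    rw [integral_eq_lintegral_of_nonneg_ae (.of_forall fun _ => by positivity) hvsq.1]
    refine ENNReal.toReal_le_of_le_ofReal (by positivity) (le_trans (le_of_eq ?_) hlin)
    refine lintegral_congr fun t => ?_
    rw [ENNReal.ofReal_pow (norm_nonneg _), ofReal_norm]
  rw [intervalIntegral.integral_of_le hab]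
  simp only [← hvn]
  exact (setIntegral_le_integral hvsq (.of_forall fun _ => by positivity)).trans hint

/-- The Gearhart–Prüss theorem on the range of a bounded projection `Q` commuting with the
semigroup: a uniform lower bound for `l - L` on `Re l ≥ s₀` gives decay at the rate `s₀`. A bound
with growth rate `σ > s₀` improves, by the `L²` bound in time for orbits, to one with rate `σ - δ`
where `δ` does not depend on `σ`. -/
theorem exists_decay (h : IsSemigroupGeneratedBy L T) (Q : X →L[ℂ] X) (hQ : ∀ x, Q (Q x) = Q x)
    (hcomm : ∀ t, 0 ≤ t → ∀ x, Q (T t x) = T t (Q x)) {s₀ M : ℝ}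
    (hM : ∀ l : ℂ, s₀ ≤ l.re → ∀ u f, Q u = u → L u f → ‖u‖ ≤ M * ‖l • u - f‖) :
    ∃ C, 0 < C ∧ ∀ t, 0 ≤ t → ‖(T t).comp Q‖ ≤ C * exp (s₀ * t) := by
  wlog hM0 : 0 ≤ M generalizing M
  · refine this (M := |M|) (fun l hl u f hu huf => (hM l hl u f hu huf).trans ?_) (abs_nonneg M)
    gcongr
    exact le_abs_self M
  obtain ⟨C₀, σ₀, hC₀, hσ₀, hgr⟩ := h.exists_growth
  set B : ℝ := C₀ * exp (σ₀ + |s₀|) with hBdef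
  have hB1 : 1 ≤ B := by
    rw [hBdef]
    have : 1 ≤ exp (σ₀ + |s₀|) := Real.one_le_exp (by positivity)
    nlinarith
  have hB : ∀ w, s₀ ≤ w → ∀ t ∈ Icc (0 : ℝ) 1, ∀ y, exp (-w * t) * ‖T t y‖ ≤ B * ‖y‖ := by
    intro w hw t ht y
    calc exp (-w * t) * ‖T t y‖ ≤ exp |s₀| * (C₀ * exp σ₀ * ‖y‖) := by
          gcongr
          · have h1 : -w * t ≤ -s₀ * t := by nlinarith [ht.1]
            have h2 : -s₀ * t ≤ |s₀| * 1 := by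
              calc -s₀ * t ≤ |s₀| * t := by
                    have := neg_abs_le s₀; nlinarith [ht.1]
                _ ≤ |s₀| * 1 := by gcongr; exact ht.2
            linarith
          · refine (T t).le_of_opNorm_le ((hgr t ht.1).trans ?_) y
            gcongr
            nlinarith [ht.2]
      _ = B * ‖y‖ := by rw [hBdef, exp_add]; ring
  set K₁ : ℝ := B ^ 2 * (M + 1) with hK₁
  have hK₁0 : 0 ≤ K₁ := by positivity
  set E : ℝ := exp 1 * (‖Q‖ + 1) with hE
  have hE0 : 0 < E := by positivity
  set t₁ : ℝ := 2 + (E * (K₁ * (M * B))) ^ 2 with ht₁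
  have ht₁0 : 2 ≤ t₁ := by rw [ht₁]; nlinarith [sq_nonneg (E * (K₁ * (M * B)))]
  have hmul : ∀ s t : ℝ, 0 ≤ s → 0 ≤ t →
      ‖(T (s + t)).comp Q‖ ≤ ‖(T s).comp Q‖ * ‖(T t).comp Q‖ := by
    intro s t hs ht
    have : (T (s + t)).comp Q = ((T s).comp Q).comp ((T t).comp Q) := by
      ext x
      simp only [ContinuousLinearMap.comp_apply]
      rw [hcomm t ht, hQ, h.apply_add hs ht]
    rw [this]
    exact opNorm_comp_le _ _
  have step : ∀ σ, s₀ ≤ σ → (∃ C, ∀ t, 0 ≤ t → ‖(T t).comp Q‖ ≤ C * exp (σ * t)) →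
      ∃ C, 0 < C ∧ ∀ t, 0 ≤ t → ‖(T t).comp Q‖ ≤ C * exp ((σ - 1 / t₁) * t) := by
    rintro σ hσ ⟨C, hC⟩
    have hCy : ∀ y, Q y = y → ∀ t, 0 ≤ t → ‖T t y‖ ≤ (C * ‖y‖) * exp (σ * t) := by
      intro y hy t ht
      have := ((T t).comp Q).le_of_opNorm_le (hC t ht) y
      rw [ContinuousLinearMap.comp_apply, hy] at this
      linarith
    have hcont : ∀ (y : X) (w : ℝ), Continuous fun t =>
        (ramp t * (exp (-w * t) * ‖T (max t 0) y‖)) ^ 2 := by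
      intro y w
      exact (continuous_ramp.mul ((by fun_prop : Continuous fun t : ℝ => exp (-w * t)).mul
        (h.continuous_orbit y).norm)).pow 2
    have hL2 : ∀ y, Q y = y → ∀ w, σ < w → ∀ a b : ℝ, a ≤ b →
        ∫ t in a..b, (ramp t * (exp (-w * t) * ‖T (max t 0) y‖)) ^ 2 ≤
          (M * (B * ‖y‖)) ^ 2 := by
      intro y hy w hw a b hab
      exact h.integral_ramp_sq_le (hCy y hy) hw (by positivity) Q hy hcomm
        (fun l hl => hM l (by linarith)) (fun t ht => hB w (by linarith) t ht y) hab
    have hlimw : ∀ (y : X) (t : ℝ), Tendsto (fun w => exp (-w * t) * ‖T t y‖) (𝓝[>] σ)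
        (𝓝 (exp (-σ * t) * ‖T t y‖)) := by
      intro y t
      have : Continuous fun w : ℝ => exp (-w * t) * ‖T t y‖ := by fun_prop
      exact (this.tendsto σ).mono_left nhdsWithin_le_nhds
    have hshift : ∀ (y : X) (w s t : ℝ), 0 ≤ s → s ≤ t → exp (-w * t) * ‖T t y‖ =
        exp (-w * s) * (exp (-w * (t - s)) * ‖T (t - s) (T s y)‖) := by
      intro y w s t hs hst
      rw [← h.apply_add (by linarith) hs, sub_add_cancel, ← mul_assoc, ← exp_add]
      congr 2; ring
    have hone : ∀ (y : X) (w : ℝ), σ < w → ∀ s t, 0 ≤ s → s ≤ t → t ≤ s + 1 →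
        exp (-w * t) * ‖T t y‖ ≤ B * (exp (-w * s) * ‖T s y‖) := by
      intro y w hw s t hs hst hts
      rw [hshift y w s t hs hst]
      have := hB w (by linarith) (t - s) ⟨by linarith, by linarith⟩ (T s y)
      calc _ ≤ exp (-w * s) * (B * ‖T s y‖) := by gcongr
        _ = _ := by ring
    have hunif : ∀ y, Q y = y → ∀ t, 0 ≤ t → exp (-σ * t) * ‖T t y‖ ≤ K₁ * ‖y‖ := by
      intro y hy t ht
      refine le_of_tendsto (hlimw y t) ?_
      filter_upwards [self_mem_nhdsWithin] with w hw
      have hw : σ < w := hw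
      rcases le_or_gt t 2 with ht2 | ht2
      · have h1 := hone y w hw (t / 2) t (by linarith) (by linarith) (by linarith)
        have h2 := hB w (by linarith) (t / 2) ⟨by linarith, by linarith⟩ y
        calc _ ≤ B * (B * ‖y‖) := h1.trans (by gcongr)
          _ = B ^ 2 * 1 * ‖y‖ := by ring
          _ ≤ K₁ * ‖y‖ := by rw [hK₁]; gcongr; linarith
      · have h1 : ∫ s in (t - 1)..t, (exp (-w * t) * ‖T t y‖) ^ 2 ≤
            ∫ s in (t - 1)..t, B ^ 2 * (ramp s * (exp (-w * s) * ‖T (max s 0) y‖)) ^ 2 := by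
          refine intervalIntegral.integral_mono_on (by linarith) (by simp)
            ((continuous_const.mul (hcont y w)).intervalIntegrable _ _) fun s hs => ?_
          rw [ramp_of_one_le (by linarith [hs.1]), max_eq_left (by linarith [hs.1]), one_mul,
            ← mul_pow]
          refine pow_le_pow_left₀ (by positivity) ?_ 2
          exact hone y w hw s t (by linarith [hs.1]) hs.2 (by linarith [hs.1])
        rw [intervalIntegral.integral_const, intervalIntegral.integral_const_mul, sub_sub_cancel,
          one_smul] at h1
        have h2 := hL2 y hy w hw (t - 1) t (by linarith)
        have h3 : (exp (-w * t) * ‖T t y‖) ^ 2 ≤ (B * (M * (B * ‖y‖))) ^ 2 := by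
          rw [mul_pow B]
          exact h1.trans (by gcongr)
        have h4 := abs_le_of_sq_le_sq' h3 (by positivity)
        calc _ ≤ B * (M * (B * ‖y‖)) := h4.2
          _ = B ^ 2 * M * ‖y‖ := by ring
          _ ≤ K₁ * ‖y‖ := by rw [hK₁]; gcongr; linarith
    have hgain : ∀ y, Q y = y → (t₁ - 1) * (exp (-σ * t₁) * ‖T t₁ y‖) ^ 2 ≤
        (K₁ * (M * B) * ‖y‖) ^ 2 := by
      intro y hy
      refine le_of_tendsto (((hlimw y t₁).pow 2).const_mul (t₁ - 1)) ?_
      filter_upwards [self_mem_nhdsWithin] with w hw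
      have hw : σ < w := hw
      have h1 : ∫ s in (1 : ℝ)..t₁, (exp (-w * t₁) * ‖T t₁ y‖) ^ 2 ≤
          ∫ s in (1 : ℝ)..t₁, K₁ ^ 2 * (ramp s * (exp (-w * s) * ‖T (max s 0) y‖)) ^ 2 := by
        refine intervalIntegral.integral_mono_on (by linarith) (by simp)
          ((continuous_const.mul (hcont y w)).intervalIntegrable _ _) fun s hs => ?_
        have hs0 : 0 ≤ s := by linarith [hs.1]
        have hd : 0 ≤ t₁ - s := by linarith [hs.2]
        rw [ramp_of_one_le hs.1, max_eq_left hs0, one_mul, ← mul_pow]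
        refine pow_le_pow_left₀ (by positivity) ?_ 2
        rw [hshift y w s t₁ hs0 hs.2]
        have h2 := hunif (T s y) (by rw [hcomm s hs0, hy]) (t₁ - s) hd
        have h3 : exp (-w * (t₁ - s)) ≤ exp (-σ * (t₁ - s)) := by
          gcongr
        calc _ ≤ exp (-w * s) * (exp (-σ * (t₁ - s)) * ‖T (t₁ - s) (T s y)‖) := by
              gcongr
          _ ≤ exp (-w * s) * (K₁ * ‖T s y‖) := by gcongr
          _ = _ := by ring
      rw [intervalIntegral.integral_const, intervalIntegral.integral_const_mul, smul_eq_mul] at h1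
      have h2 := hL2 y hy w hw 1 t₁ (by linarith)
      calc _ ≤ K₁ ^ 2 * (M * (B * ‖y‖)) ^ 2 := h1.trans (by gcongr)
        _ = _ := by ring
    have hgain' : ∀ y, Q y = y → exp (-σ * t₁) * ‖T t₁ y‖ ≤ E⁻¹ * ‖y‖ := by
      intro y hy
      set n := exp (-σ * t₁) * ‖T t₁ y‖ with hn
      have hn0 : 0 ≤ n := by positivity
      have h1 := hgain y hy
      rw [← hn] at h1
      have h2 : (E * n) ^ 2 ≤ ‖y‖ ^ 2 := by
        by_contra! hcon
        have h3 : (K₁ * (M * B)) ^ 2 * ‖y‖ ^ 2 ≤ (K₁ * (M * B)) ^ 2 * (E * n) ^ 2 := by gcongr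
        have h4 : (t₁ - 1) * n ^ 2 = n ^ 2 + (K₁ * (M * B)) ^ 2 * (E * n) ^ 2 := by
          rw [ht₁]; ring
        have h5 : n ^ 2 ≤ 0 := by
          rw [mul_pow] at h1
          linarith
        have h6 : n = 0 := by nlinarith
        rw [h6] at hcon
        nlinarith [sq_nonneg ‖y‖]
      have h3 := (abs_le_of_sq_le_sq' h2 (norm_nonneg y)).2
      rw [inv_mul_eq_div, le_div_iff₀ hE0]
      linarith
    have hN1 : ‖(T t₁).comp Q‖ ≤ exp ((σ - 1 / t₁) * t₁) := by
      refine opNorm_le_bound _ (exp_pos _).le fun x => ?_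
      rw [ContinuousLinearMap.comp_apply]
      have h1 := hgain' (Q x) (hQ x)
      have e1 : ‖T t₁ (Q x)‖ = exp (σ * t₁) * (exp (-σ * t₁) * ‖T t₁ (Q x)‖) := by
        rw [← mul_assoc, ← exp_add]; simp
      have e2 : exp ((σ - 1 / t₁) * t₁) = exp (σ * t₁) * (exp 1)⁻¹ := by
        rw [← Real.exp_neg, ← exp_add]
        congr 1
        field_simp
        ring
      rw [e1, e2, mul_assoc]
      refine mul_le_mul_of_nonneg_left (h1.trans ?_) (exp_pos _).le
      calc E⁻¹ * ‖Q x‖ ≤ E⁻¹ * ((‖Q‖ + 1) * ‖x‖) := by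
            gcongr
            exact Q.le_of_opNorm_le (by linarith) x
        _ = (exp 1)⁻¹ * ‖x‖ := by
            rw [hE]
            have : ‖Q‖ + 1 ≠ 0 := by positivity
            field_simp
    refine exists_exp_bound_of_submul (N := fun t => ‖(T t).comp Q‖) (fun _ => norm_nonneg _) hmul
      (by linarith : 0 < t₁) (K := C₀ * exp (σ₀ * t₁) * ‖Q‖) (fun t ht => ?_) hN1
    refine (opNorm_comp_le _ _).trans ?_
    gcongr
    refine (hgr t ht.1).trans ?_
    gcongr
    exact ht.2
  have iter : ∀ n : ℕ, ∃ C, 0 < C ∧ ∀ t, 0 ≤ t →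
      ‖(T t).comp Q‖ ≤ C * exp (max (σ₀ + |s₀| - n * (1 / t₁)) s₀ * t) := by
    intro n
    induction n with
    | zero =>
      refine ⟨C₀ * (‖Q‖ + 1), by positivity, fun t ht => ?_⟩
      refine (opNorm_comp_le _ _).trans ?_
      calc _ ≤ C₀ * exp (σ₀ * t) * (‖Q‖ + 1) := by
            gcongr
            · exact hgr t ht
            · linarith
        _ ≤ C₀ * exp (max (σ₀ + |s₀| - (0 : ℕ) * (1 / t₁)) s₀ * t) * (‖Q‖ + 1) := by
            gcongr
            refine le_max_of_le_left ?_
            simp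
        _ = _ := by ring
    | succ n ih =>
      obtain ⟨C, hC, hC'⟩ := ih
      obtain ⟨C', hC1, hC2⟩ := step _ (le_max_right _ _) ⟨C, hC'⟩
      refine ⟨C', hC1, fun t ht => (hC2 t ht).trans ?_⟩
      have hpos : 0 < 1 / t₁ := by positivity
      gcongr
      rcases le_total (σ₀ + |s₀| - n * (1 / t₁)) s₀ with hle | hle
      · rw [max_eq_right hle]
        exact le_max_of_le_right (by linarith)
      · rw [max_eq_left hle]
        refine le_max_of_le_left ?_
        push_cast; linarith
  obtain ⟨n, hn⟩ := exists_nat_ge ((σ₀ + |s₀| - s₀) * t₁)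
  obtain ⟨C, hC, hC'⟩ := iter n
  refine ⟨C, hC, fun t ht => (hC' t ht).trans (le_of_eq ?_)⟩
  congr 3
  refine max_eq_right ?_
  have : σ₀ + |s₀| - s₀ ≤ n * (1 / t₁) := by
    rw [mul_one_div, le_div_iff₀ (by linarith)]
    exact hn
  linarith

end IsSemigroupGeneratedBy

end GearhartPruss

/-! ### Slices of square integrable functions -/

section Curry

theorem measurable_of_measurable_dist {B H : Type*} [MeasurableSpace B] [PseudoMetricSpace H]
    [SecondCountableTopology H] [MeasurableSpace H] [BorelSpace H] {f : B → H}
    (hf : ∀ h, Measurable fun y => dist (f y) h) : Measurable f := by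
  rcases isEmpty_or_nonempty H with hH | hH
  · have : IsEmpty B := ⟨fun b => hH.false (f b)⟩
    exact measurable_of_empty f
  refine measurable_of_isOpen fun U hU => ?_
  set d := TopologicalSpace.denseSeq H
  have hUeq : f ⁻¹' U = ⋃ (n : ℕ) (m : ℕ) (_ : Metric.ball (d n) (1 / ((m : ℝ) + 1)) ⊆ U),
      {y | dist (f y) (d n) < 1 / ((m : ℝ) + 1)} := by
    ext y
    simp only [mem_preimage, mem_iUnion, mem_ofPred_eq]
    constructor
    · intro hy
      obtain ⟨ε, hε, hball⟩ := Metric.isOpen_iff.1 hU _ hy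
      obtain ⟨m, hm⟩ := exists_nat_one_div_lt (half_pos hε)
      obtain ⟨n, hn⟩ := (TopologicalSpace.denseRange_denseSeq H).exists_dist_lt (f y)
        (show (0 : ℝ) < 1 / ((m : ℝ) + 1) by positivity)
      refine ⟨n, m, fun z hz => hball ?_, hn⟩
      rw [Metric.mem_ball] at hz ⊢
      have := dist_triangle z (d n) (f y)
      rw [dist_comm (d n)] at this
      linarith
    · rintro ⟨n, m, hsub, hlt⟩
      exact hsub hlt
  rw [hUeq]
  exact MeasurableSet.iUnion fun n => MeasurableSet.iUnion fun m => MeasurableSet.iUnion fun _ =>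
    measurableSet_lt (hf _) measurable_const

variable {A B : Type*} [MeasurableSpace A] [MeasurableSpace B] {μ : Measure A} {ν : Measure B}
  [SigmaFinite μ] [SigmaFinite ν] [MeasurableSpace.CountablyGenerated A]

theorem ae_slice {P : A × B → Prop} (h : ∀ᵐ p ∂(μ.prod ν), P p) : ∀ᵐ y ∂ν, ∀ᵐ z ∂μ, P (z, y) := by
  have h1 : ∀ᵐ p ∂(ν.prod μ), P p.swap :=
    Measure.measurePreserving_swap.quasiMeasurePreserving.ae h
  exact Measure.ae_ae_of_ae_prod h1

open Classical in
/-- The slices `y ↦ F(·, y)` with values in `L²(μ)`. -/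
def sliceFun (μ : Measure A) (F : A × B → ℂ) (y : B) : Lp ℂ 2 μ :=
  if h : MemLp (fun z => F (z, y)) 2 μ then h.toLp _ else 0

theorem memLp_two_iff_lintegral {α E : Type*} [MeasurableSpace α] {μ : Measure α}
    [NormedAddCommGroup E] {f : α → E} (hf : AEStronglyMeasurable f μ) :
    MemLp f 2 μ ↔ ∫⁻ x, ‖f x‖ₑ ^ 2 ∂μ < ⊤ := by
  rw [MemLp, and_iff_right hf, eLpNorm_lt_top_iff_lintegral_rpow_enorm_lt_top (by simp) (by simp)]
  simp

theorem ofReal_norm_sq_eq_lintegral {α E : Type*} [MeasurableSpace α] {μ : Measure α}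
    [NormedAddCommGroup E] [NormedSpace ℂ E] (f : Lp E 2 μ) :
    ENNReal.ofReal (‖f‖ ^ 2) = ∫⁻ x, ‖f x‖ₑ ^ 2 ∂μ := by
  rw [Lp_norm_sq, ofReal_integral_eq_lintegral_ofReal
    ((memLp_two_iff_integrable_sq_norm (Lp.aestronglyMeasurable f)).1 (memLp f))
      (.of_forall fun _ => by positivity)]
  refine lintegral_congr fun x => ?_
  rw [ENNReal.ofReal_pow (norm_nonneg _), ofReal_norm]

theorem aestronglyMeasurable_sliceFun {F : A × B → ℂ} (hF : Measurable F) :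
    AEStronglyMeasurable (sliceFun μ F) ν := by
  classical
  let _ : MeasurableSpace (Lp ℂ 2 μ) := borel _
  have : BorelSpace (Lp ℂ 2 μ) := ⟨rfl⟩
  have : Fact ((2 : ENNReal) ≠ ⊤) := ⟨by simp⟩
  have hsm : ∀ y, AEStronglyMeasurable (fun z => F (z, y)) μ := fun y =>
    (hF.comp (measurable_id.prodMk measurable_const)).aestronglyMeasurable
  refine Measurable.aestronglyMeasurable (measurable_of_measurable_dist fun h => ?_)
  have hS : MeasurableSet {y | ∫⁻ z, ‖F (z, y)‖ₑ ^ 2 ∂μ < ⊤} :=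
    measurableSet_lt (Measurable.lintegral_prod_left' (f := fun p : A × B => ‖F p‖ₑ ^ 2)
      (by fun_prop)) measurable_const
  have hh : Measurable (h : A → ℂ) := (stronglyMeasurable h).measurable
  have hM : Measurable fun y => sqrt (∫⁻ z, ‖F (z, y) - h z‖ₑ ^ 2 ∂μ).toReal := by
    have : Measurable fun y => ∫⁻ z, ‖F (z, y) - h z‖ₑ ^ 2 ∂μ :=
      Measurable.lintegral_prod_left' (f := fun p : A × B => ‖F p - h p.1‖ₑ ^ 2) (by fun_prop)
    fun_prop
  have heq : (fun y => dist (sliceFun μ F y) h) =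
      ({y | ∫⁻ z, ‖F (z, y)‖ₑ ^ 2 ∂μ < ⊤}).piecewise
        (fun y => sqrt (∫⁻ z, ‖F (z, y) - h z‖ₑ ^ 2 ∂μ).toReal)
        (fun _ => dist (0 : Lp ℂ 2 μ) h) := by
    ext y
    by_cases hy : ∫⁻ z, ‖F (z, y)‖ₑ ^ 2 ∂μ < ⊤
    · have hy' : y ∈ {y | ∫⁻ z, ‖F (z, y)‖ₑ ^ 2 ∂μ < ⊤} := hy
      rw [piecewise_eq_of_mem _ _ _ hy']
      have hm := (memLp_two_iff_lintegral (hsm y)).2 hy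
      rw [sliceFun, dif_pos hm, dist_eq_norm]
      have e1 : ∫⁻ z, ‖F (z, y) - h z‖ₑ ^ 2 ∂μ = ∫⁻ z, ‖(hm.toLp _ - h) z‖ₑ ^ 2 ∂μ := by
        refine lintegral_congr_ae ?_
        filter_upwards [hm.coeFn_toLp, coeFn_sub (hm.toLp _) h] with z h1 h2
        rw [h2, Pi.sub_apply, h1]
      rw [e1, ← ofReal_norm_sq_eq_lintegral, ENNReal.toReal_ofReal (by positivity),
        Real.sqrt_sq (norm_nonneg _)]
    · have hy' : y ∉ {y | ∫⁻ z, ‖F (z, y)‖ₑ ^ 2 ∂μ < ⊤} := hy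
      rw [piecewise_eq_of_notMem _ _ _ hy']
      have hm : ¬ MemLp (fun z => F (z, y)) 2 μ := fun hm =>
        hy ((memLp_two_iff_lintegral (hsm y)).1 hm)
      rw [sliceFun, dif_neg hm]
  rw [heq]
  exact Measurable.piecewise hS hM measurable_const

theorem ae_memLp_slice {F : A × B → ℂ} (hF : Measurable F) (hF2 : MemLp F 2 (μ.prod ν)) :
    ∀ᵐ y ∂ν, MemLp (fun z => F (z, y)) 2 μ := by
  have h1 := (memLp_two_iff_lintegral hF2.1).1 hF2
  rw [lintegral_prod_symm _ (by fun_prop)] at h1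
  filter_upwards [ae_lt_top (Measurable.lintegral_prod_left' (f := fun p : A × B => ‖F p‖ₑ ^ 2)
    (by fun_prop)) h1.ne] with y hy
  exact (memLp_two_iff_lintegral
    (hF.comp (measurable_id.prodMk measurable_const)).aestronglyMeasurable).2 hy

theorem sliceFun_ae {F : A × B → ℂ} (hF : Measurable F) (hF2 : MemLp F 2 (μ.prod ν)) :
    ∀ᵐ y ∂ν, sliceFun μ F y =ᵐ[μ] fun z => F (z, y) := by
  filter_upwards [ae_memLp_slice hF hF2] with y hy
  rw [sliceFun, dif_pos hy]
  exact hy.coeFn_toLp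

theorem lintegral_sliceFun {F : A × B → ℂ} (hF : Measurable F) (hF2 : MemLp F 2 (μ.prod ν)) :
    ∫⁻ y, ‖sliceFun μ F y‖ₑ ^ 2 ∂ν = ∫⁻ p, ‖F p‖ₑ ^ 2 ∂(μ.prod ν) := by
  rw [lintegral_prod_symm _ (by fun_prop)]
  refine lintegral_congr_ae ?_
  filter_upwards [sliceFun_ae hF hF2] with y hy
  rw [← ofReal_norm, ← ENNReal.ofReal_pow (norm_nonneg _), ofReal_norm_sq_eq_lintegral]
  refine lintegral_congr_ae ?_
  filter_upwards [hy] with z hz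
  rw [hz]

theorem memLp_sliceFun {F : A × B → ℂ} (hF : Measurable F) (hF2 : MemLp F 2 (μ.prod ν)) :
    MemLp (sliceFun μ F) 2 ν := by
  rw [memLp_two_iff_lintegral (aestronglyMeasurable_sliceFun hF), lintegral_sliceFun hF hF2]
  exact (memLp_two_iff_lintegral hF2.1).1 hF2

variable (μ ν) in
/-- The isometric embedding `L²(μ ⊗ ν) → L²(ν; L²(μ))`, `f ↦ (y ↦ f(·, y))`. -/
def curryLI : Lp ℂ 2 (μ.prod ν) →ₗᵢ[ℂ] Lp (Lp ℂ 2 μ) 2 ν where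
  toFun f := (memLp_sliceFun (stronglyMeasurable f).measurable (memLp f)).toLp _
  map_add' f g := by
    refine Lp.ext ?_
    have hm := fun f : Lp ℂ 2 (μ.prod ν) => memLp_sliceFun (stronglyMeasurable f).measurable (memLp f)
    have hs := fun f : Lp ℂ 2 (μ.prod ν) => sliceFun_ae (stronglyMeasurable f).measurable (memLp f)
    filter_upwards [(hm (f + g)).coeFn_toLp, (hm f).coeFn_toLp, (hm g).coeFn_toLp,
      coeFn_add ((hm f).toLp _) ((hm g).toLp _), hs f, hs g, hs (f + g),
      ae_slice (coeFn_add f g)] with y h1 h2 h3 h4 h5 h6 h7 h8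
    rw [h1, h4, Pi.add_apply, h2, h3]
    refine Lp.ext ?_
    filter_upwards [h5, h6, h7, h8, coeFn_add (sliceFun μ f y) (sliceFun μ g y)]
      with z e1 e2 e3 e4 e5
    rw [e3, e5, Pi.add_apply, e1, e2, e4, Pi.add_apply]
  map_smul' c f := by
    refine Lp.ext ?_
    have hm := fun f : Lp ℂ 2 (μ.prod ν) => memLp_sliceFun (stronglyMeasurable f).measurable (memLp f)
    have hs := fun f : Lp ℂ 2 (μ.prod ν) => sliceFun_ae (stronglyMeasurable f).measurable (memLp f)
    filter_upwards [(hm (c • f)).coeFn_toLp, (hm f).coeFn_toLp,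
      coeFn_smul c ((hm f).toLp _), hs f, hs (c • f),
      ae_slice (coeFn_smul c f)] with y h1 h2 h4 h5 h7 h8
    rw [RingHom.id_apply, h1, h4, Pi.smul_apply, h2]
    refine Lp.ext ?_
    filter_upwards [h5, h7, h8, coeFn_smul c (sliceFun μ f y)]
      with z e1 e3 e4 e5
    rw [e3, e5, Pi.smul_apply, e1, e4, Pi.smul_apply]
  norm_map' f := by
    have hm := memLp_sliceFun (stronglyMeasurable f).measurable (memLp f)
    have h1 : ENNReal.ofReal (‖hm.toLp _‖ ^ 2) = ENNReal.ofReal (‖f‖ ^ 2) := by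
      rw [ofReal_norm_sq_eq_lintegral, ofReal_norm_sq_eq_lintegral f,
        ← lintegral_sliceFun (stronglyMeasurable f).measurable (memLp f)]
      refine lintegral_congr_ae ?_
      filter_upwards [hm.coeFn_toLp] with y hy
      rw [hy]
    rw [ENNReal.ofReal_eq_ofReal_iff (by positivity) (by positivity)] at h1
    exact (pow_left_inj₀ (norm_nonneg _) (norm_nonneg _) two_ne_zero).1 h1

theorem curryLI_ae (f : Lp ℂ 2 (μ.prod ν)) :
    ∀ᵐ y ∂ν, curryLI μ ν f y =ᵐ[μ] fun z => f (z, y) := by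
  have hm := memLp_sliceFun (stronglyMeasurable f).measurable (memLp f)
  filter_upwards [hm.coeFn_toLp, sliceFun_ae (stronglyMeasurable f).measurable (memLp f)]
    with y h1 h2
  change (hm.toLp _) y =ᵐ[μ] _
  rw [h1]
  exact h2

/-- A product `c(z) b(y)` is square integrable. -/
theorem memLp_tensor {c : A → ℂ} {b : B → ℂ} (hc : MemLp c 2 μ) (hb : MemLp b 2 ν) :
    MemLp (fun p : A × B => b p.2 * c p.1) 2 (μ.prod ν) := by
  have hm : AEStronglyMeasurable (fun p : A × B => b p.2 * c p.1) (μ.prod ν) :=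
    hb.1.comp_snd.mul hc.1.comp_fst
  rw [memLp_two_iff_lintegral hm]
  have h1 := (memLp_two_iff_lintegral hc.1).1 hc
  have h2 := (memLp_two_iff_lintegral hb.1).1 hb
  have : ∫⁻ p : A × B, ‖b p.2 * c p.1‖ₑ ^ 2 ∂(μ.prod ν) =
      (∫⁻ z, ‖c z‖ₑ ^ 2 ∂μ) * ∫⁻ y, ‖b y‖ₑ ^ 2 ∂ν := by
    rw [← lintegral_prod_mul (hc.1.enorm.pow_const 2) (hb.1.enorm.pow_const 2)]
    refine lintegral_congr fun p => ?_
    rw [enorm_mul, mul_pow, mul_comm]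
  rw [this]
  exact ENNReal.mul_lt_top h1 h2

theorem surjective_curryLI : Function.Surjective (curryLI μ ν) := by
  have hclosed : IsClosed (LinearMap.range (curryLI μ ν).toLinearMap : Set (Lp (Lp ℂ 2 μ) 2 ν)) :=
    (curryLI μ ν).isometry.isClosedEmbedding.isClosed_range
  have key : ∀ f : Lp (Lp ℂ 2 μ) 2 ν, f ∈ LinearMap.range (curryLI μ ν).toLinearMap := by
    intro f
    refine Lp.induction (by simp) (motive := fun f => f ∈ LinearMap.range (curryLI μ ν).toLinearMap)
      ?_ ?_ hclosed f
    · intro c s hs hνs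
      have hb : MemLp (indicator s fun _ => (1 : ℂ)) 2 ν := memLp_indicator_const 2 hs 1 (Or.inr hνs.ne)
      have hm := memLp_tensor (memLp c) hb
      refine ⟨hm.toLp _, ?_⟩
      refine Lp.ext ?_
      rw [Lp.simpleFunc.coe_indicatorConst]
      filter_upwards [curryLI_ae (hm.toLp _), ae_slice hm.coeFn_toLp,
        indicatorConstLp_coeFn (p := 2) (hs := hs) (hμs := hνs.ne) (c := c)] with y h1 h2 h3
      rw [h3]
      refine Lp.ext ?_
      refine EventuallyEq.trans h1 ?_
      by_cases hy : y ∈ s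
      · filter_upwards [h2] with z hz
        rw [hz]; simp [hy]
      · filter_upwards [h2, Lp.coeFn_zero ℂ 2 μ] with z hz hz0
        rw [hz, indicator_of_notMem hy, indicator_of_notMem hy, hz0]; simp
    · intro f g hf hg _ h1 h2
      exact add_mem h1 h2
  intro f
  exact key f

/-- The isometric isomorphism `L²(ρ) ≃ L²(ν; L²(μ))` for a product measure `ρ = μ ⊗ ν`. -/
def curryL2 {ρ : Measure (A × B)} (hρ : ρ = μ.prod ν) : Lp ℂ 2 ρ ≃ₗᵢ[ℂ] Lp (Lp ℂ 2 μ) 2 ν :=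
  hρ ▸ LinearIsometryEquiv.ofSurjective (curryLI μ ν) surjective_curryLI

theorem curryL2_ae {ρ : Measure (A × B)} (hρ : ρ = μ.prod ν) (f : Lp ℂ 2 ρ) :
    ∀ᵐ y ∂ν, curryL2 hρ f y =ᵐ[μ] fun z => f (z, y) := by
  subst hρ
  exact curryLI_ae f

end Curry

/-! ### Fourier transforms of test functions -/

section Fourier

variable {V : Type*} [NormedAddCommGroup V] [InnerProductSpace ℝ V] [FiniteDimensional ℝ V]
  [MeasurableSpace V] [BorelSpace V]

/-- Injectivity of the Fourier transform on `L¹`. -/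
theorem ae_eq_zero_of_fourier_eq_zero {k : V → ℂ} (hk : Integrable k) (h0 : ∀ ξ, 𝓕 k ξ = 0) :
    k =ᵐ[volume] 0 := by
  refine ae_eq_zero_of_integral_contDiff_smul_eq_zero hk.locallyIntegrable fun g hg hgs => ?_
  have hgc : ContDiff ℝ ∞ (fun x => (g x : ℂ)) := ofRealCLM.contDiff.comp hg
  have hgs' : HasCompactSupport (fun x => (g x : ℂ)) :=
    hgs.comp_left (g := fun r : ℝ => (r : ℂ)) (by simp)
  set G : SchwartzMap V ℂ := hgs'.toSchwartzMap hgc with hG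
  set S : SchwartzMap V ℂ := 𝓕⁻ G with hS
  have h1 : (𝓕 (S : V → ℂ)) = fun x => (g x : ℂ) := by
    rw [← SchwartzMap.fourier_coe, hS, FourierTransform.fourier_fourierInv_eq]
    rfl
  have h2 := VectorFourier.integral_fourierIntegral_smul_eq_flip (L := innerₗ V) (μ := volume)
    (ν := volume) continuous_fourierChar continuous_inner S.integrable hk
  have h3 : ∀ x, VectorFourier.fourierIntegral fourierChar volume (innerₗ V) S x = g x :=
    fun x => congrFun h1 x
  have h4 : ∀ x, VectorFourier.fourierIntegral fourierChar volume (innerₗ V).flip k x = 0 := by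
    intro x
    rw [flip_innerₗ]
    exact h0 x
  simp only [h3, h4, smul_zero, integral_zero] at h2
  rw [← h2]
  refine integral_congr_ae (.of_forall fun x => ?_)
  simp

/-- A function whose product with the inverse Fourier transform of every member of a translation
invariant class `C` of test functions is integrable with vanishing integral is zero, if the
transforms of the members of `C` have no common zero. No growth condition is needed. -/
theorem ae_eq_zero_of_forall_mem {h : V → ℂ} (C : (V → ℂ) → Prop) (hC : ∀ φ, C φ → IsTest φ)
    (htrans : ∀ φ, C φ → ∀ t, C fun x => φ (x + t)) (hne : ∀ ξ₀, ∃ φ, C φ ∧ 𝓕⁻ φ ξ₀ ≠ 0)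
    (hh : ∀ φ, C φ → Integrable (fun ξ => h ξ * 𝓕⁻ φ ξ) ∧ ∫ ξ, h ξ * 𝓕⁻ φ ξ = 0) :
    h =ᵐ[volume] 0 := by
  have key : ∀ φ, C φ → (fun ξ => h ξ * 𝓕⁻ φ ξ) =ᵐ[volume] 0 := by
    intro φ hφ
    refine ae_eq_zero_of_fourier_eq_zero (hh φ hφ).1 fun t => ?_
    rw [← (hh _ (htrans φ hφ t)).2, fourier_eq]
    refine integral_congr_ae (.of_forall fun ξ => ?_)
    have e : 𝓕⁻ (fun x => φ (x + t)) ξ = fourierChar (-inner ℝ ξ t) • 𝓕⁻ φ ξ := by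
      rw [fourierInv_eq, fourierInv_eq, Circle.smul_def, smul_eq_mul,
        ← integral_const_mul, ← integral_sub_right_eq_self _ t]
      refine integral_congr_ae (.of_forall fun x => ?_)
      simp only [sub_add_cancel]
      rw [inner_sub_left, sub_eq_add_neg, AddChar.map_add_eq_mul, mul_comm, mul_smul,
        real_inner_comm t ξ]
      rfl
    change _ = h ξ * 𝓕⁻ (fun x => φ (x + t)) ξ
    rw [e]
    exact (mul_smul_comm _ _ _).symm
  have hnull : volume {ξ | h ξ ≠ 0} = 0 := by
    refine measure_null_of_locally_null _ fun ξ₀ _ => ?_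
    obtain ⟨φ, hφ, h0⟩ := hne ξ₀
    have hcont : Continuous (𝓕⁻ φ) := by
      have hi : Integrable φ :=
        (hC φ hφ).1.continuous.integrable_of_hasCompactSupport (hC φ hφ).2
      have : 𝓕⁻ φ = fun w => 𝓕 φ (-w) := by
        ext w; rw [Real.fourierInv_eq_fourier_neg]
      rw [this]
      exact (VectorFourier.fourierIntegral_continuous continuous_fourierChar
        (L := innerₗ V) continuous_inner hi).comp continuous_neg
    have hnhds : {ξ | 𝓕⁻ φ ξ ≠ 0} ∈ 𝓝 ξ₀ := hcont.continuousAt.eventually_ne h0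
    refine ⟨{ξ | h ξ ≠ 0} ∩ {ξ | 𝓕⁻ φ ξ ≠ 0}, ?_, ?_⟩
    · exact inter_mem self_mem_nhdsWithin (mem_nhdsWithin_of_mem_nhds hnhds)
    · refine measure_mono_null ?_ (key φ hφ)
      rintro ξ ⟨h1, h2⟩
      exact mul_ne_zero h1 h2
  exact hnull

theorem IsTest.comp_add_right {φ : V → ℂ} (hφ : IsTest φ) (t : V) : IsTest fun x => φ (x + t) :=
  ⟨hφ.1.comp (by fun_prop), hφ.2.comp_homeomorph (Homeomorph.addRight t)⟩

/-- Modulated bump functions: the transforms of test functions have no common zero. -/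
theorem exists_test_fourierInv_ne_zero (ξ₀ : V) : ∃ φ : V → ℂ, IsTest φ ∧ 𝓕⁻ φ ξ₀ ≠ 0 := by
  let B : ContDiffBump (0 : V) := ⟨1, 2, one_pos, one_lt_two⟩
  set φ : V → ℂ := fun x => (B x : ℂ) * Complex.exp (-(2 * π * inner ℝ x ξ₀ : ℝ) * I)
    with hφd
  refine ⟨φ, ⟨?_, ?_⟩, ?_⟩
  · refine (ofRealCLM.contDiff.comp B.contDiff).mul (Complex.contDiff_exp.comp ?_)
    refine ContDiff.mul (ContDiff.neg ?_) contDiff_const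
    exact ofRealCLM.contDiff.comp (contDiff_const.mul (contDiff_id.inner ℝ contDiff_const))
  · refine HasCompactSupport.mul_right ?_
    exact B.hasCompactSupport.comp_left (g := fun r : ℝ => (r : ℂ)) (by simp)
  · have : 𝓕⁻ φ ξ₀ = ((∫ x, B x : ℝ) : ℂ) := by
      rw [fourierInv_eq, ← integral_complex_ofReal]
      refine integral_congr_ae (.of_forall fun x => ?_)
      simp only [hφd, Circle.smul_def, Real.fourierChar_apply, smul_eq_mul]
      rw [mul_comm (B x : ℂ), ← mul_assoc, ← Complex.exp_add]
      simp
    rw [this]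
    exact_mod_cast B.integral_pos.ne'

theorem ae_eq_zero_of_forall_test {h : V → ℂ}
    (hh : ∀ φ : V → ℂ, IsTest φ →
      Integrable (fun ξ => h ξ * 𝓕⁻ φ ξ) ∧ ∫ ξ, h ξ * 𝓕⁻ φ ξ = 0) :
    h =ᵐ[volume] 0 :=
  ae_eq_zero_of_forall_mem IsTest (fun _ h => h) (fun _ hφ t => hφ.comp_add_right t)
    exists_test_fourierInv_ne_zero hh

variable {H : Type*} [NormedAddCommGroup H] [InnerProductSpace ℂ H] [CompleteSpace H]

theorem integrable_inner_Lp {α : Type*} [MeasurableSpace α] {μ : Measure α} {Φ F : α → H}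
    (h1 : MemLp Φ 2 μ) (h2 : MemLp F 2 μ) : Integrable (fun x => inner ℂ (Φ x) (F x)) μ := by
  have := L2.integrable_inner (𝕜 := ℂ) (h1.toLp Φ) (h2.toLp F)
  refine this.congr ?_
  filter_upwards [h1.coeFn_toLp, h2.coeFn_toLp] with x e1 e2
  rw [e1, e2]

theorem memLp_fourier {Φ : V → H} (h1 : Integrable Φ) (h2 : MemLp Φ 2) : MemLp (𝓕 Φ) 2 :=
  (memLp (𝓕 (h2.toLp Φ) : Lp H 2 (volume : Measure V))).ae_eq (fourier_toLp_ae h1 h2)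

/-- Parseval's identity, for one factor given by an integrable function. -/
theorem integral_inner_fourier {Φ : V → H} (h1 : Integrable Φ) (h2 : MemLp Φ 2)
    (F : Lp H 2 (volume : Measure V)) :
    ∫ x, inner ℂ (Φ x) (F x) = ∫ ξ, inner ℂ (𝓕 Φ ξ) ((𝓕 F : Lp H 2 (volume : Measure V)) ξ) := by
  have h := Lp.inner_fourier_eq (h2.toLp Φ) F
  rw [L2.inner_def, L2.inner_def] at h
  refine Eq.trans ?_ (h.symm.trans ?_)
  · refine integral_congr_ae ?_
    filter_upwards [h2.coeFn_toLp] with x e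
    rw [e]
  · refine integral_congr_ae ?_
    filter_upwards [fourier_toLp_ae h1 h2] with x e
    rw [e]

end Fourier

/-! ### Weighted square integrable functions -/

section Weights

variable {E : Type*} [NormedAddCommGroup E] [NormedSpace ℝ E] [MeasureSpace E] [BorelSpace E]

theorem measurable_weight {w : E → ℝ} (hw : Continuous w) :
    Measurable fun x => ENNReal.ofReal (exp (2 * w x)) :=
  (Real.measurable_exp.comp (hw.measurable.const_mul 2)).ennreal_ofReal

theorem ae_weighted_iff {w : E → ℝ} (hw : Continuous w) {p : E → Prop} :
    (∀ᵐ x ∂(weighted w), p x) ↔ ∀ᵐ x, p x := by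
  rw [weighted, ae_withDensity_iff (measurable_weight hw)]
  have : ∀ x, ENNReal.ofReal (exp (2 * w x)) ≠ 0 := fun x => by
    simp [exp_pos]
  simp [this]

theorem ae_eq_weighted_iff {F : Type*} {w : E → ℝ} (hw : Continuous w) {f g : E → F} :
    f =ᵐ[weighted w] g ↔ f =ᵐ[volume] g := ae_weighted_iff hw

theorem lintegral_weighted {w : E → ℝ} (hw : Continuous w) (f : E → ENNReal) :
    ∫⁻ x, f x ∂(weighted w) = ∫⁻ x, ENNReal.ofReal (exp (2 * w x)) * f x := by
  rw [weighted, lintegral_withDensity_eq_lintegral_mul_non_measurable _ (measurable_weight hw)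
    (.of_forall fun x => ENNReal.ofReal_lt_top)]
  rfl

theorem lintegral_exp_mul_sq {w : E → ℝ} (hw : Continuous w) (f : E → ℂ) :
    ∫⁻ x, ‖(exp (w x) : ℂ) * f x‖ₑ ^ 2 = ∫⁻ x, ‖f x‖ₑ ^ 2 ∂(weighted w) := by
  rw [lintegral_weighted hw]
  refine lintegral_congr fun x => ?_
  rw [enorm_mul, mul_pow]
  congr 1
  rw [← ofReal_norm, norm_real, norm_eq_abs, abs_of_pos (exp_pos _),
    ← ENNReal.ofReal_pow (exp_pos _).le, ← Real.exp_nat_mul]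
  norm_num

theorem aestronglyMeasurable_weighted_iff {w : E → ℝ} (hw : Continuous w) {f : E → ℂ} :
    AEStronglyMeasurable f (weighted w) ↔ AEStronglyMeasurable f volume := by
  constructor
  · rintro ⟨g, hg, h⟩
    exact ⟨g, hg, (ae_eq_weighted_iff hw).1 h⟩
  · rintro ⟨g, hg, h⟩
    exact ⟨g, hg, (ae_eq_weighted_iff hw).2 h⟩

/-- `f ∈ L²(e^{2w} dx)` if and only if `e^w f ∈ L²(dx)`. -/
theorem memLp_weighted_iff {w : E → ℝ} (hw : Continuous w) {f : E → ℂ} :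
    MemLp f 2 (weighted w) ↔ MemLp (fun x => (exp (w x) : ℂ) * f x) 2 volume := by
  have hwm : Continuous fun x => (exp (w x) : ℂ) := by fun_prop
  have hwm' : Continuous fun x => (exp (-w x) : ℂ) := by fun_prop
  have hm : AEStronglyMeasurable f (weighted w) ↔
      AEStronglyMeasurable (fun x => (exp (w x) : ℂ) * f x) volume := by
    rw [aestronglyMeasurable_weighted_iff hw]
    constructor
    · intro h
      exact hwm.aestronglyMeasurable.mul h
    · intro h
      refine (hwm'.aestronglyMeasurable.mul h).congr (.of_forall fun x => ?_)
      simp only [Pi.mul_apply]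
      rw [← mul_assoc, ← ofReal_mul, ← exp_add]
      simp
  by_cases h : AEStronglyMeasurable f (weighted w)
  · rw [memLp_two_iff_lintegral h, memLp_two_iff_lintegral (hm.1 h), lintegral_exp_mul_sq hw]
  · exact iff_of_false (fun h' => h h'.1) (fun h' => h (hm.2 h'.1))

/-- The isometry `f ↦ e^w f` of `L²(e^{2w} dx)` into `L²(dx)`. -/
def expMulLI (w : C(E, ℝ)) : L2w w →ₗᵢ[ℂ] Lp ℂ 2 (volume : Measure E) where
  toFun f := ((memLp_weighted_iff w.continuous).1 (memLp f)).toLp _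
  map_add' f g := by
    refine Lp.ext ?_
    filter_upwards [((memLp_weighted_iff w.continuous).1 (memLp (f + g))).coeFn_toLp,
      ((memLp_weighted_iff w.continuous).1 (memLp f)).coeFn_toLp,
      ((memLp_weighted_iff w.continuous).1 (memLp g)).coeFn_toLp,
      (ae_eq_weighted_iff w.continuous).1 (coeFn_add f g),
      coeFn_add (((memLp_weighted_iff w.continuous).1 (memLp f)).toLp _)
        (((memLp_weighted_iff w.continuous).1 (memLp g)).toLp _)] with x h1 h2 h3 h4 h5
    rw [h1, h5, Pi.add_apply, h2, h3, h4, Pi.add_apply, mul_add]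
  map_smul' c f := by
    refine Lp.ext ?_
    filter_upwards [((memLp_weighted_iff w.continuous).1 (memLp (c • f))).coeFn_toLp,
      ((memLp_weighted_iff w.continuous).1 (memLp f)).coeFn_toLp,
      (ae_eq_weighted_iff w.continuous).1 (coeFn_smul c f),
      coeFn_smul c (((memLp_weighted_iff w.continuous).1 (memLp f)).toLp _)]
      with x h1 h2 h4 h5
    rw [h1, RingHom.id_apply, h5, Pi.smul_apply, h2, h4, Pi.smul_apply, smul_eq_mul, smul_eq_mul]
    ring
  norm_map' f := by
    have hm := (memLp_weighted_iff w.continuous).1 (memLp f)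
    have h1 : ENNReal.ofReal (‖hm.toLp _‖ ^ 2) = ENNReal.ofReal (‖f‖ ^ 2) := by
      rw [ofReal_norm_sq_eq_lintegral, ofReal_norm_sq_eq_lintegral f,
        ← lintegral_exp_mul_sq w.continuous]
      refine lintegral_congr_ae ?_
      filter_upwards [hm.coeFn_toLp] with y hy
      rw [hy]
    rw [ENNReal.ofReal_eq_ofReal_iff (by positivity) (by positivity)] at h1
    exact (pow_left_inj₀ (norm_nonneg _) (norm_nonneg _) two_ne_zero).1 h1

theorem expMulLI_ae (w : C(E, ℝ)) (f : L2w w) :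
    expMulLI w f =ᵐ[volume] fun x => (exp (w x) : ℂ) * f x :=
  ((memLp_weighted_iff w.continuous).1 (memLp f)).coeFn_toLp

theorem surjective_expMulLI (w : C(E, ℝ)) : Function.Surjective (expMulLI w) := by
  intro g
  have he : ∀ x, (exp (w x) : ℂ) * ((exp (-w x) : ℂ) * g x) = g x := fun x => by
    rw [← mul_assoc, ← ofReal_mul, ← exp_add]; simp
  have hm : MemLp (fun x => (exp (-w x) : ℂ) * g x) 2 (weighted w) := by
    rw [memLp_weighted_iff w.continuous]
    simp only [he]
    exact memLp g
  refine ⟨hm.toLp _, Lp.ext ?_⟩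
  filter_upwards [expMulLI_ae w (hm.toLp _), (ae_eq_weighted_iff w.continuous).1 hm.coeFn_toLp]
    with x h1 h2
  rw [h1, h2, he]

end Weights

/-! ### The Fourier representation of weighted functions on the plane -/

/-- The Euclidean plane, used for frequencies. -/
abbrev E2 := WithLp 2 (ℝ × ℝ)

/-- Transport of `L²(ℝ × ℝ)` to the Euclidean plane. -/
def toE2 : Lp ℂ 2 (volume : Measure (ℝ × ℝ)) ≃ₗᵢ[ℂ] Lp ℂ 2 (volume : Measure E2) :=
  LinearIsometryEquiv.ofSurjective
    (Lp.compMeasurePreservingₗᵢ ℂ (WithLp.ofLp : E2 → ℝ × ℝ) (volume_preserving_ofLp ℝ ℝ)) (by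
      intro g
      refine ⟨Lp.compMeasurePreserving (toLp 2 : ℝ × ℝ → E2)
        (volume_preserving_toLp ℝ ℝ) g, Lp.ext ?_⟩
      have h1 := Lp.coeFn_compMeasurePreserving g (volume_preserving_toLp ℝ ℝ)
      have h2 := Lp.coeFn_compMeasurePreserving (Lp.compMeasurePreserving (toLp 2 : ℝ × ℝ → E2)
        (volume_preserving_toLp ℝ ℝ) g) (volume_preserving_ofLp ℝ ℝ)
      refine h2.trans ?_
      filter_upwards [(volume_preserving_ofLp ℝ ℝ).quasiMeasurePreserving.ae h1] with x hx
      rw [Function.comp_apply, hx]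
      rfl)

theorem toE2_ae (f : Lp ℂ 2 (volume : Measure (ℝ × ℝ))) :
    toE2 f =ᵐ[volume] fun x => f (WithLp.ofLp x) :=
  Lp.coeFn_compMeasurePreserving f (volume_preserving_ofLp ℝ ℝ)

/-- The unitary map `f ↦ 𝓕 (e^{α z} f)` on `L²_α(ℝ²)`. -/
def U (α : ℝ) : L2w (wt2 α) ≃ₗᵢ[ℂ] Lp ℂ 2 (volume : Measure E2) :=
  ((LinearIsometryEquiv.ofSurjective (expMulLI (wt2 α)) (surjective_expMulLI _)).trans toE2).trans
    (Lp.fourierTransformₗᵢ E2 ℂ)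

/-- The transform of test functions dual to `U α`. -/
def hat (α : ℝ) (φ : ℝ × ℝ → ℂ) : E2 → ℂ :=
  𝓕⁻ fun x : E2 => (exp (-(α * x.ofLp.1)) : ℂ) * φ x.ofLp

theorem isTest_comp_ofLp {φ : ℝ × ℝ → ℂ} (hφ : IsTest φ) : IsTest fun x : E2 => φ x.ofLp := by
  refine ⟨hφ.1.comp (prodContinuousLinearEquiv 2 ℝ ℝ ℝ).contDiff, ?_⟩
  exact hφ.2.comp_homeomorph (prodContinuousLinearEquiv 2 ℝ ℝ ℝ).toHomeomorph

theorem isTest_comp_toLp {φ : E2 → ℂ} (hφ : IsTest φ) :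
    IsTest fun x : ℝ × ℝ => φ (toLp 2 x) := by
  refine ⟨hφ.1.comp (prodContinuousLinearEquiv 2 ℝ ℝ ℝ).symm.contDiff, ?_⟩
  exact hφ.2.comp_homeomorph (prodContinuousLinearEquiv 2 ℝ ℝ ℝ).symm.toHomeomorph

section TestRules

variable {E : Type*} [NormedAddCommGroup E] [NormedSpace ℝ E]

theorem IsTest.smooth_mul {φ : E → ℂ} (hφ : IsTest φ) {g : E → ℂ} (hg : ContDiff ℝ ∞ g) :
    IsTest fun x => g x * φ x := ⟨hg.mul hφ.1, hφ.2.mul_left⟩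

theorem IsTest.conj {φ : E → ℂ} (hφ : IsTest φ) : IsTest fun x => conj (φ x) :=
  ⟨Complex.conjCLE.contDiff.comp hφ.1, hφ.2.comp_left (map_zero _)⟩

theorem IsTest.fderiv {φ : E → ℂ} (hφ : IsTest φ) (v : E) : IsTest fun x => fderiv ℝ φ x v := by
  refine ⟨(hφ.1.fderiv_right (by simp)).clm_apply contDiff_const, ?_⟩
  exact (hφ.2.fderiv (𝕜 := ℝ)).comp_left (g := fun L : E →L[ℝ] ℂ => L v) (by simp)

theorem IsTest.memLp [MeasureSpace E] [BorelSpace E] [SecondCountableTopology E]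
    {φ : E → ℂ} (hφ : IsTest φ) {p : ENNReal} {μ : Measure E} [IsFiniteMeasureOnCompacts μ] :
    MemLp φ p μ := hφ.1.continuous.memLp_of_hasCompactSupport hφ.2

theorem IsTest.integrable [MeasureSpace E] [BorelSpace E] [SecondCountableTopology E]
    {φ : E → ℂ} (hφ : IsTest φ) {μ : Measure E} [IsFiniteMeasureOnCompacts μ] :
    Integrable φ μ := hφ.1.continuous.integrable_of_hasCompactSupport hφ.2

end TestRules

theorem contDiff_exp_fst (α : ℝ) : ContDiff ℝ ∞ fun x : ℝ × ℝ => (exp (α * x.1) : ℂ) := by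
  refine ofRealCLM.contDiff.comp (Real.contDiff_exp.comp ?_)
  fun_prop

theorem isTest_weight {φ : ℝ × ℝ → ℂ} (α : ℝ) (hφ : IsTest φ) :
    IsTest fun x : E2 => (exp (-(α * x.ofLp.1)) : ℂ) * φ x.ofLp := by
  have h := isTest_comp_ofLp (hφ.smooth_mul (contDiff_exp_fst (-α)))
  simpa only [neg_mul] using h

theorem fourier_conj {V : Type*} [NormedAddCommGroup V] [InnerProductSpace ℝ V]
    [FiniteDimensional ℝ V] [MeasurableSpace V] [BorelSpace V] (ψ : V → ℂ) (ξ : V) :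
    𝓕 (fun x => conj (ψ x)) ξ = conj (𝓕⁻ ψ ξ) := by
  rw [fourier_eq, fourierInv_eq, ← integral_conj]
  refine integral_congr_ae (.of_forall fun x => ?_)
  simp only [Circle.smul_def, smul_eq_mul, map_mul]
  rw [AddChar.map_neg_eq_inv, Circle.coe_inv_eq_conj]

theorem memLp_hat {φ : ℝ × ℝ → ℂ} (α : ℝ) (hφ : IsTest φ) : MemLp (hat α φ) 2 := by
  have h := (isTest_weight α hφ).conj
  have h2 := (memLp_fourier h.integrable h.memLp).star
  refine h2.ae_eq (.of_forall fun ξ => ?_)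
  refine (congrArg (starRingEnd ℂ) (fourier_conj _ ξ)).trans ?_
  rw [conj_conj]
  rfl

theorem integrable_U_mul_hat (f : L2w (wt2 α)) {φ : ℝ × ℝ → ℂ} (hφ : IsTest φ) :
    Integrable fun ξ => U α f ξ * hat α φ ξ :=
  (memLp (U α f)).integrable_mul (memLp_hat α hφ)

/-- Parseval's identity in the weighted space. -/
theorem integral_mul_test (f : L2w (wt2 α)) {φ : ℝ × ℝ → ℂ} (hφ : IsTest φ) :
    ∫ x, f x * φ x = ∫ ξ, U α f ξ * hat α φ ξ := by
  have h := (isTest_weight α hφ).conj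
  have h1 := integral_inner_fourier h.integrable h.memLp (toE2 (expMulLI (wt2 α) f))
  have e1 : ∫ x : ℝ × ℝ, f x * φ x = ∫ x : E2, f x.ofLp * φ x.ofLp :=
    ((volume_preserving_ofLp ℝ ℝ).integral_comp
      (MeasurableEquiv.toLp 2 (ℝ × ℝ)).symm.measurableEmbedding (fun x => f x * φ x)).symm
  rw [e1]
  refine Eq.trans ?_ (h1.trans ?_)
  · refine integral_congr_ae ?_
    have h2 := (volume_preserving_ofLp ℝ ℝ).quasiMeasurePreserving.ae (expMulLI_ae (wt2 α) f)
    filter_upwards [toE2_ae (expMulLI (wt2 α) f), h2] with x hx1 hx2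
    have he : ((exp (α * x.ofLp.1) : ℝ) : ℂ) * ((exp (-(α * x.ofLp.1)) : ℝ) : ℂ) = 1 := by
      rw [← ofReal_mul, ← exp_add]; simp
    rw [hx1, hx2, RCLike.inner_apply, conj_conj]
    calc _ = (((exp (α * x.ofLp.1) : ℝ) : ℂ) * ((exp (-(α * x.ofLp.1)) : ℝ) : ℂ)) *
          (f x.ofLp * φ x.ofLp) := by rw [he, one_mul]
      _ = _ := by
        change _ = ((exp (α * x.ofLp.1) : ℝ) : ℂ) * f x.ofLp *
          (((exp (-(α * x.ofLp.1)) : ℝ) : ℂ) * φ x.ofLp)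
        ring
  · refine integral_congr_ae (.of_forall fun ξ => ?_)
    simp only [fourier_conj, RCLike.inner_apply, conj_conj]
    rfl

/-! ### Symbols of distributions -/

/-- The symbol of `∂_z` conjugated by the weight `e^{α z}`. -/
def sz (α : ℝ) (ξ : E2) : ℂ := 2 * π * ξ.ofLp.1 * I - α

/-- The symbol of `∂_y`. -/
def sy (ξ : E2) : ℂ := 2 * π * ξ.ofLp.2 * I

/-- The exponent of the kernel of `hat α`. -/
def hatExponent (α : ℝ) (ξ : E2) : ℝ × ℝ →L[ℝ] ℂ :=
  (ContinuousLinearMap.fst ℝ ℝ ℝ).smulRight (sz α ξ) + (ContinuousLinearMap.snd ℝ ℝ ℝ).smulRight (sy ξ)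

theorem hatExponent_apply (α : ℝ) (ξ : E2) (x : ℝ × ℝ) :
    hatExponent α ξ x = x.1 * sz α ξ + x.2 * sy ξ := by
  simp [hatExponent]

theorem hat_eq (α : ℝ) (φ : ℝ × ℝ → ℂ) (ξ : E2) :
    hat α φ ξ = ∫ x : ℝ × ℝ, Complex.exp (hatExponent α ξ x) * φ x := by
  rw [hat, fourierInv_eq]
  rw [← (volume_preserving_ofLp ℝ ℝ).integral_comp
      (MeasurableEquiv.toLp 2 (ℝ × ℝ)).symm.measurableEmbedding]
  refine integral_congr_ae (.of_forall fun x => ?_)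
  simp only [Circle.smul_def, smul_eq_mul, Real.fourierChar_apply]
  rw [← mul_assoc, Complex.ofReal_exp, ← Complex.exp_add, hatExponent_apply, WithLp.prod_inner_apply]
  congr 2
  simp only [sz, sy, RCLike.inner_apply, conj_trivial]
  push_cast
  ring

theorem hat_fderiv {φ : ℝ × ℝ → ℂ} (hφ : IsTest φ) (v : ℝ × ℝ) (ξ : E2) :
    hat α (fun x => fderiv ℝ φ x v) ξ = -(hatExponent α ξ v * hat α φ ξ) := by
  have hc : Continuous fun x => Complex.exp (hatExponent α ξ x) := by fun_prop
  have hd : ∀ x, HasFDerivAt (fun x => Complex.exp (hatExponent α ξ x))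
      (Complex.exp (hatExponent α ξ x) • hatExponent α ξ) x := fun x =>
    ((hatExponent α ξ).hasFDerivAt).cexp
  have hd' : ∀ x, fderiv ℝ (fun x => Complex.exp (hatExponent α ξ x)) x v =
      hatExponent α ξ v * Complex.exp (hatExponent α ξ x) := fun x => by
    rw [(hd x).fderiv]; simp [mul_comm]
  have hi : ∀ ψ : ℝ × ℝ → ℂ, IsTest ψ →
      Integrable fun x => Complex.exp (hatExponent α ξ x) * ψ x := fun ψ hψ =>
    (hc.mul hψ.1.continuous).integrable_of_hasCompactSupport hψ.2.mul_left
  rw [hat_eq, hat_eq, integral_mul_fderiv_eq_neg_fderiv_mul_of_integrable, ← integral_const_mul]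
  · congr 1
    refine integral_congr_ae (.of_forall fun x => ?_)
    simp only [hd', mul_assoc]
  · simp only [hd', mul_assoc]
    exact (hi φ hφ).const_mul _
  · exact hi _ (hφ.fderiv v)
  · exact hi φ hφ
  · exact fun x _ => (hd x).differentiableAt
  · exact fun x _ => (hφ.1.differentiable (by simp)).differentiableAt

/-- The distribution `T` is represented by the function `h` of the frequency:
`T φ = ∫ h (hat φ)`. -/
def HasSym (α : ℝ) (T : Functional (ℝ × ℝ)) (h : E2 → ℂ) : Prop :=
  ∀ φ, IsTest φ → Integrable (fun ξ => h ξ * hat α φ ξ) ∧ T φ = ∫ ξ, h ξ * hat α φ ξ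

section Calculus

variable {S T : Functional (ℝ × ℝ)} {h k : E2 → ℂ}

theorem hasSym_ofFun (f : L2w (wt2 α)) : HasSym α (ofFun f) (U α f) := fun _ hφ =>
  ⟨integrable_U_mul_hat f hφ, integral_mul_test f hφ⟩

theorem ofFun_congr {E : Type*} [NormedAddCommGroup E] [NormedSpace ℝ E] [MeasureSpace E]
    {f g : E → ℂ} (hfg : f =ᵐ[volume] g) : ofFun f = ofFun g := by
  ext φ
  refine integral_congr_ae ?_
  filter_upwards [hfg] with x hx
  rw [hx]

namespace HasSym

theorem pd (hT : HasSym α T h) (v : ℝ × ℝ) :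
    HasSym α (BenneyLuke.pd v T) fun ξ => hatExponent α ξ v * h ξ := by
  intro φ hφ
  obtain ⟨h1, h2⟩ := hT _ (hφ.fderiv v)
  have e : (fun ξ => h ξ * hat α (fun x => fderiv ℝ φ x v) ξ) =
      fun ξ => -(hatExponent α ξ v * h ξ * hat α φ ξ) := by
    ext ξ; rw [hat_fderiv hφ]; ring
  rw [e] at h1 h2
  refine ⟨by simpa using h1.neg, ?_⟩
  rw [BenneyLuke.pd, h2, integral_neg, neg_neg]

theorem dz (hT : HasSym α T h) :
    HasSym α (BenneyLuke.pd ((1 : ℝ), (0 : ℝ)) T) fun ξ => sz α ξ * h ξ := by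
  simpa [hatExponent_apply] using hT.pd ((1 : ℝ), (0 : ℝ))

theorem dy (hT : HasSym α T h) :
    HasSym α (BenneyLuke.pd ((0 : ℝ), (1 : ℝ)) T) fun ξ => sy ξ * h ξ := by
  simpa [hatExponent_apply] using hT.pd ((0 : ℝ), (1 : ℝ))

theorem add (hT : HasSym α T h) (hS : HasSym α S k) : HasSym α (T + S) fun ξ => h ξ + k ξ := by
  intro φ hφ
  obtain ⟨h1, h2⟩ := hT φ hφ
  obtain ⟨h3, h4⟩ := hS φ hφ
  simp only [add_mul]
  exact ⟨h1.add h3, by rw [Pi.add_apply, h2, h4, ← integral_add h1 h3]⟩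

theorem sub (hT : HasSym α T h) (hS : HasSym α S k) : HasSym α (T - S) fun ξ => h ξ - k ξ := by
  intro φ hφ
  obtain ⟨h1, h2⟩ := hT φ hφ
  obtain ⟨h3, h4⟩ := hS φ hφ
  simp only [sub_mul]
  exact ⟨h1.sub h3, by rw [Pi.sub_apply, h2, h4, ← integral_sub h1 h3]⟩

theorem smul (hT : HasSym α T h) (r : ℝ) : HasSym α (r • T) fun ξ => r * h ξ := by
  intro φ hφ
  obtain ⟨h1, h2⟩ := hT φ hφ
  simp only [mul_assoc]
  refine ⟨h1.const_mul _, ?_⟩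
  rw [integral_const_mul, ← h2]
  simp

theorem congr (hT : HasSym α T h) (hST : EqDistr T S) : HasSym α S h := fun φ hφ =>
  ⟨(hT φ hφ).1, by rw [← hST φ hφ, (hT φ hφ).2]⟩

theorem congr_sym (hT : HasSym α T h) (hhk : ∀ ξ, h ξ = k ξ) : HasSym α T k := by
  rwa [← funext hhk]

/-- Two distributions with symbols are equal if and only if their symbols are. -/
theorem eqDistr_iff (hT : HasSym α T h) (hS : HasSym α S k) : EqDistr T S ↔ h =ᵐ[volume] k := by
  constructor
  · intro hTS
    have key : (fun ξ => h ξ - k ξ) =ᵐ[volume] 0 := by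
      refine ae_eq_zero_of_forall_test fun φ hφ => ?_
      set ψ : ℝ × ℝ → ℂ := fun x => (exp (α * x.1) : ℂ) * φ (toLp 2 x) with hψd
      have hψ : IsTest ψ := (isTest_comp_toLp hφ).smooth_mul (contDiff_exp_fst α)
      have e : hat α ψ = 𝓕⁻ φ := by
        rw [hat]
        congr 1
        ext x
        simp only [hψd]
        rw [← mul_assoc, ← ofReal_mul, ← exp_add]
        simp
      obtain ⟨h1, h2⟩ := (hT.sub hS) ψ hψ
      rw [e] at h1 h2
      refine ⟨h1, ?_⟩
      rw [← h2, Pi.sub_apply, hTS ψ hψ, sub_self]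
    filter_upwards [key] with ξ hξ
    exact sub_eq_zero.1 hξ
  · intro hhk φ hφ
    rw [(hT φ hφ).2, (hS φ hφ).2]
    refine integral_congr_ae ?_
    filter_upwards [hhk] with ξ hξ
    rw [hξ]

end HasSym

end Calculus

/-! ### Multiplication by functions of `z` -/

/-- Smooth bounded real functions on the line. -/
def IsMult (g : ℝ → ℝ) : Prop := ContDiff ℝ ∞ g ∧ ∃ C, ∀ z, |g z| ≤ C

theorem IsMult.memLp_top {Ω : Type*} [MeasurableSpace Ω] {μ : Measure Ω} {g : ℝ → ℝ} (hg : IsMult g)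
    {p : Ω → ℝ} (hp : Measurable p) : MemLp (fun x => (g (p x) : ℂ)) ⊤ μ := by
  obtain ⟨C, hC⟩ := hg.2
  refine memLp_top_of_bound (Measurable.aestronglyMeasurable ?_) C (.of_forall fun x => ?_)
  · exact measurable_ofReal.comp (hg.1.continuous.measurable.comp hp)
  · simpa using hC (p x)

open Classical in
/-- Multiplication by `g(z)` on `L²_α(ℝ²)`. -/
def mulZ (α : ℝ) (g : ℝ → ℝ) : L2w (wt2 α) →L[ℂ] L2w (wt2 α) :=
  if hg : IsMult g then mulLp (hg.memLp_top measurable_fst) else 0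

theorem mulZ_ae {g : ℝ → ℝ} (hg : IsMult g) (f : L2w (wt2 α)) :
    mulZ α g f =ᵐ[volume] fun x => (g x.1 : ℂ) * f x := by
  rw [mulZ, dif_pos hg]
  exact (ae_eq_weighted_iff (wt2 α).continuous).1 (coeFn_mulLp _ f)

theorem contDiff_fst_ofReal {g : ℝ → ℝ} (hg : ContDiff ℝ ∞ g) :
    ContDiff ℝ ∞ fun x : ℝ × ℝ => (g x.1 : ℂ) :=
  ofRealCLM.contDiff.comp (hg.comp contDiff_fst)

theorem hasSym_mulBy_ofFun {g : ℝ → ℝ} (hg : IsMult g) (f : L2w (wt2 α)) :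
    HasSym α (mulBy (fun x => g x.1) (ofFun f)) (U α (mulZ α g f)) := by
  have e : ofFun (mulZ α g f) = mulBy (fun x : ℝ × ℝ => g x.1) (ofFun f) := by
    rw [ofFun_congr (mulZ_ae hg f)]
    ext φ
    refine integral_congr_ae (.of_forall fun x => ?_)
    simp only
    ring
  rw [← e]
  exact hasSym_ofFun _

/-- The Leibniz rule `g ∂_v f = ∂_v (g f) - (∂_v g) f`. -/
theorem hasSym_mulBy_pd {g : ℝ → ℝ} (hg : IsMult g) (hg' : IsMult (deriv g))
    (f : L2w (wt2 α)) (v : ℝ × ℝ) :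
    HasSym α (mulBy (fun x => g x.1) (pd v (ofFun f)))
      (fun ξ => hatExponent α ξ v * U α (mulZ α g f) ξ - v.1 * U α (mulZ α (deriv g) f) ξ) := by
  refine (((hasSym_mulBy_ofFun hg f).pd v).sub ((hasSym_mulBy_ofFun hg' f).smul v.1)).congr ?_
  intro φ hφ
  have hd : ∀ x : ℝ × ℝ, fderiv ℝ (fun x : ℝ × ℝ => (g x.1 : ℂ) * φ x) x v =
      (g x.1 : ℂ) * fderiv ℝ φ x v + v.1 * (((deriv g x.1 : ℝ) : ℂ) * φ x) := by
    intro x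
    have h1 : HasDerivAt g (deriv g x.1) x.1 :=
      (hg.1.differentiable (by simp)).differentiableAt.hasDerivAt
    have h2 : HasFDerivAt (fun x : ℝ × ℝ => (g x.1 : ℂ))
        ((ContinuousLinearMap.fst ℝ ℝ ℝ).smulRight ((deriv g x.1 : ℝ) : ℂ)) x := by
      have := (h1.ofReal_comp.hasFDerivAt.comp x (ContinuousLinearMap.fst ℝ ℝ ℝ).hasFDerivAt)
      refine this.congr_fderiv ?_
      ext <;> simp
    have h3 := h2.mul ((hφ.1.differentiable (by simp)).differentiableAt (x := x)).hasFDerivAt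
    rw [show fderiv ℝ (fun x : ℝ × ℝ => (g x.1 : ℂ) * φ x) x = _ from h3.fderiv]
    simp
    ring
  have hi : ∀ ψ : ℝ × ℝ → ℂ, IsTest ψ → Integrable fun x => f x * ψ x := by
    intro ψ hψ
    have h1 := (memLp_weighted_iff (wt2 α).continuous).1 (memLp f)
    have h2 : IsTest fun x : ℝ × ℝ => (exp (-α * x.1) : ℂ) * ψ x :=
      hψ.smooth_mul (contDiff_exp_fst (-α))
    refine (h1.integrable_mul (h2.memLp (p := 2) (μ := volume))).congr (.of_forall fun x => ?_)
    have he : ((exp (wt2 α x) : ℝ) : ℂ) * ((exp (-α * x.1) : ℝ) : ℂ) = 1 := by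
      rw [← ofReal_mul, ← exp_add]; simp [wt2]
    simp only [Pi.mul_apply]
    calc _ = (((exp (wt2 α x) : ℝ) : ℂ) * ((exp (-α * x.1) : ℝ) : ℂ)) * (f x * ψ x) := by
          ring
      _ = _ := by rw [he, one_mul]
  have h1 := hi _ ((hφ.fderiv v).smooth_mul (contDiff_fst_ofReal hg.1))
  have h2 := (hi _ (hφ.smooth_mul (contDiff_fst_ofReal hg'.1))).const_mul (v.1 : ℂ)
  simp only [mulBy, pd, ofFun, Pi.sub_apply, Pi.smul_apply, hd]
  rw [real_smul, ← integral_const_mul, ← neg_add', ← integral_add h1 h2]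
  congr 1
  refine integral_congr_ae (.of_forall fun x => ?_)
  simp only
  ring

theorem hasSym_mulBy_dz {g : ℝ → ℝ} (hg : IsMult g) (hg' : IsMult (deriv g))
    (f : L2w (wt2 α)) :
    HasSym α (mulBy (fun x => g x.1) (pd ((1 : ℝ), (0 : ℝ)) (ofFun f)))
      (fun ξ => sz α ξ * U α (mulZ α g f) ξ - U α (mulZ α (deriv g) f) ξ) := by
  simpa [hatExponent_apply] using hasSym_mulBy_pd hg hg' f ((1 : ℝ), (0 : ℝ))

theorem hasSym_mulBy_dy {g : ℝ → ℝ} (hg : IsMult g) (hg' : IsMult (deriv g))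
    (f : L2w (wt2 α)) :
    HasSym α (mulBy (fun x => g x.1) (pd ((0 : ℝ), (1 : ℝ)) (ofFun f)))
      (fun ξ => sy ξ * U α (mulZ α g f) ξ) := by
  simpa [hatExponent_apply] using hasSym_mulBy_pd hg hg' f ((0 : ℝ), (1 : ℝ))

theorem eqDistr_mulBy {g : ℝ → ℝ} (hg : ContDiff ℝ ∞ g) {S T : Functional (ℝ × ℝ)}
    (h : EqDistr S T) : EqDistr (mulBy (fun x => g x.1) S) (mulBy (fun x => g x.1) T) :=
  fun _ hφ => h _ (hφ.smooth_mul (contDiff_fst_ofReal hg))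

theorem eqDistr_pd {E : Type*} [NormedAddCommGroup E] [NormedSpace ℝ E]
    {S T : Functional E} (v : E) (h : EqDistr S T) : EqDistr (pd v S) (pd v T) := fun φ hφ => by
  rw [pd, pd, h _ (hφ.fderiv v)]

/-- `U` turns a weak derivative `k = ∂_z f` into `U(g k) = s_z U(g f) - U(g' f)`. -/
theorem U_mulZ_dz {g : ℝ → ℝ} (hg : IsMult g) (hg' : IsMult (deriv g)) {f k : L2w (wt2 α)}
    (h : U α k =ᵐ[volume] fun ξ => sz α ξ * U α f ξ) :
    U α (mulZ α g k) =ᵐ[volume] fun ξ => sz α ξ * U α (mulZ α g f) ξ - U α (mulZ α (deriv g) f) ξ :=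
  ((hasSym_mulBy_ofFun hg k).eqDistr_iff (hasSym_mulBy_dz hg hg' f)).1
    (eqDistr_mulBy hg.1 (((hasSym_ofFun k).eqDistr_iff (hasSym_ofFun f).dz).2 h))

theorem U_mulZ_dy {g : ℝ → ℝ} (hg : IsMult g) (hg' : IsMult (deriv g)) {f k : L2w (wt2 α)}
    (h : U α k =ᵐ[volume] fun ξ => sy ξ * U α f ξ) :
    U α (mulZ α g k) =ᵐ[volume] fun ξ => sy ξ * U α (mulZ α g f) ξ :=
  ((hasSym_mulBy_ofFun hg k).eqDistr_iff (hasSym_mulBy_dy hg hg' f)).1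
    (eqDistr_mulBy hg.1 (((hasSym_ofFun k).eqDistr_iff (hasSym_ofFun f).dy).2 h))

theorem mem_H1plane_iff (W : PiLp 2 (fun _ : Fin 3 => L2w (wt2 α))) :
    W ∈ H1plane α ↔ (U α (W 1) =ᵐ[volume] fun ξ => sz α ξ * U α (W 0) ξ) ∧
      U α (W 2) =ᵐ[volume] fun ξ => sy ξ * U α (W 0) ξ := by
  have h1 := (hasSym_ofFun (W 1)).eqDistr_iff (hasSym_ofFun (W 0)).dz
  have h2 := (hasSym_ofFun (W 2)).eqDistr_iff (hasSym_ofFun (W 0)).dy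
  rw [← h1, ← h2]
  change (∀ i : Fin 2, _) ↔ _
  rw [Fin.forall_fin_two]
  exact and_congr ⟨fun h φ hφ => (h φ hφ).symm, fun h φ hφ => (h φ hφ).symm⟩
    ⟨fun h φ hφ => (h φ hφ).symm, fun h φ hφ => (h φ hφ).symm⟩

/-! ### The solitary wave profile is a multiplier -/

theorem hasDerivAt_tanh (x : ℝ) : HasDerivAt tanh (1 - tanh x ^ 2) x := by
  have h := (Real.hasDerivAt_sinh x).div (Real.hasDerivAt_cosh x) (cosh_pos x).ne'
  have e : tanh = fun y => Real.sinh y / cosh y := by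
    ext y; exact Real.tanh_eq_sinh_div_cosh y
  rw [e]
  refine h.congr_deriv ?_
  have := (cosh_pos x).ne'
  field_simp

theorem contDiff_tanh : ContDiff ℝ ∞ tanh := by
  have e : tanh = fun y => Real.sinh y / cosh y := by
    ext y; exact Real.tanh_eq_sinh_div_cosh y
  rw [e]
  exact Real.contDiff_sinh.div Real.contDiff_cosh fun x => (cosh_pos x).ne'

/-- Polynomials in `tanh (k z)`: a class of bounded functions which is closed under
differentiation. -/
def IsTanhPoly (k : ℝ) (f : ℝ → ℝ) : Prop :=
  ∃ P : Polynomial ℝ, f = fun z => P.eval (tanh (k * z))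

theorem IsTanhPoly.isMult {k : ℝ} {f : ℝ → ℝ} (hf : IsTanhPoly k f) : IsMult f := by
  obtain ⟨P, rfl⟩ := hf
  refine ⟨(show ContDiff ℝ ∞ fun x => P.eval x by simpa using P.contDiff_aeval (𝕜 := ℝ) ∞).comp (contDiff_tanh.comp (by fun_prop)), ?_⟩
  obtain ⟨C, hC⟩ := (isCompact_Icc (a := (-1 : ℝ)) (b := 1)).exists_bound_of_continuousOn
    P.continuous.continuousOn
  refine ⟨C, fun z => hC _ ?_⟩
  exact ⟨(Real.neg_one_lt_tanh _).le, (Real.tanh_lt_one _).le⟩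

theorem IsTanhPoly.deriv {k : ℝ} {f : ℝ → ℝ} (hf : IsTanhPoly k f) : IsTanhPoly k (deriv f) := by
  obtain ⟨P, rfl⟩ := hf
  refine ⟨Polynomial.C k * P.derivative * (1 - Polynomial.X ^ 2), ?_⟩
  ext z
  have h1 := (hasDerivAt_tanh (k * z)).comp z ((hasDerivAt_id z).const_mul k)
  have h2 := (P.hasDerivAt (tanh (k * z))).comp z h1
  refine h2.deriv.trans ?_
  simp
  ring

theorem isTanhPoly_qc (a b c : ℝ) : IsTanhPoly (alphaC a b c / 2) (qc a b c) := by
  refine ⟨Polynomial.C ((c ^ 2 - 1) / c) * (1 - Polynomial.X ^ 2), ?_⟩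
  ext z
  have h : cosh (alphaC a b c * z / 2) ^ 2 ≠ 0 := pow_ne_zero _ (cosh_pos _).ne'
  simp only [qc, Polynomial.eval_mul, Polynomial.eval_C, Polynomial.eval_sub, Polynomial.eval_one,
    Polynomial.eval_pow, Polynomial.eval_X]
  rw [show alphaC a b c / 2 * z = alphaC a b c * z / 2 by ring, Real.tanh_eq_sinh_div_cosh, div_pow,
    div_pow, one_pow]
  congr 1
  field_simp
  rw [Real.cosh_sq]; ring

theorem isTanhPoly_rc (a b c : ℝ) : IsTanhPoly (alphaC a b c / 2) (rc a b c) := by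
  obtain ⟨P, hP⟩ := isTanhPoly_qc a b c
  refine ⟨Polynomial.C (-c) * P, ?_⟩
  ext z
  simp [rc, hP]

/-! ### The linearized operator on the Fourier side -/

/-- The symbol of `-Δ`. -/
def sp (α : ℝ) (ξ : E2) : ℂ := -(sz α ξ ^ 2 + sy ξ ^ 2)

/-- The symbol of the terms of the operator with variable coefficients, before inversion of `B`. -/
def varSym (a b c : ℝ) (u : Xplane α) (ξ : E2) : ℂ :=
  U α (mulZ α (deriv (rc a b c)) (u.fst.1 1) - mulZ α (deriv (qc a b c)) u.snd) ξ
    + sz α ξ * U α (mulZ α (rc a b c) (u.fst.1 1) + (2 : ℂ) • mulZ α (qc a b c) u.snd) ξ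
    + sy ξ * U α (mulZ α (rc a b c) (u.fst.1 2)) ξ

theorem Xplane.U_dz (u : Xplane α) :
    U α (u.fst.1 1) =ᵐ[volume] fun ξ => sz α ξ * U α (u.fst.1 0) ξ :=
  ((mem_H1plane_iff _).1 u.fst.2).1

theorem Xplane.U_dy (u : Xplane α) :
    U α (u.fst.1 2) =ᵐ[volume] fun ξ => sy ξ * U α (u.fst.1 0) ξ :=
  ((mem_H1plane_iff _).1 u.fst.2).2

theorem eqDistr_ofFun_dz (u : Xplane α) :
    EqDistr (pd ((1 : ℝ), (0 : ℝ)) (ofFun u.fn1)) (ofFun (u.fst.1 1)) :=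
  u.fst.2 0

theorem eqDistr_ofFun_dy (u : Xplane α) :
    EqDistr (pd ((0 : ℝ), (1 : ℝ)) (ofFun u.fn1)) (ofFun (u.fst.1 2)) :=
  u.fst.2 1

theorem EqDistr.add {E : Type*} [NormedAddCommGroup E] [NormedSpace ℝ E]
    {S T S' T' : Functional E} (h : EqDistr S T) (h' : EqDistr S' T') :
    EqDistr (S + S') (T + T') := fun φ hφ => by
  rw [Pi.add_apply, Pi.add_apply, h φ hφ, h' φ hφ]

theorem EqDistr.symm {E : Type*} [NormedAddCommGroup E] [NormedSpace ℝ E]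
    {S T : Functional E} (h : EqDistr S T) : EqDistr T S := fun φ hφ => (h φ hφ).symm

/-- The Laplacian on functionals on the plane. -/
abbrev lap2 (T : Functional (ℝ × ℝ)) : Functional (ℝ × ℝ) :=
  pd ((1 : ℝ), (0 : ℝ)) (pd ((1 : ℝ), (0 : ℝ)) T) + pd ((0 : ℝ), (1 : ℝ)) (pd ((0 : ℝ), (1 : ℝ)) T)

theorem HasSym.lap {T : Functional (ℝ × ℝ)} {h : E2 → ℂ} (hT : HasSym α T h) :
    HasSym α (lap2 T) (fun ξ => sz α ξ * (sz α ξ * h ξ) + sy ξ * (sy ξ * h ξ)) :=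
  hT.dz.dz.add hT.dy.dy

/-- The symbol of the left hand side of the second equation. -/
theorem hasSym_lhs (b c : ℝ) (u f : Xplane α) :
    HasSym α (helm b lap2 (ofFun f.fn2 - c • pd ((1 : ℝ), (0 : ℝ)) (ofFun u.fn2)))
      (fun ξ => (1 + b * sp α ξ) * (U α f.snd ξ - c * (sz α ξ * U α u.snd ξ))) := by
  have hΨ : HasSym α (ofFun u.fn2) (U α u.snd) := hasSym_ofFun _
  have hG : HasSym α (ofFun f.fn2) (U α f.snd) := hasSym_ofFun _
  have hL := (hG.sub (hΨ.dz.smul c)).sub ((hG.sub (hΨ.dz.smul c)).lap.smul b)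
  refine hL.congr_sym fun ξ => ?_
  rw [sp]; ring

/-- The symbol of the right hand side of the second equation. -/
theorem hasSym_rhs (a b c : ℝ) (u : Xplane α) :
    ∃ h, HasSym α (helm a lap2 (lap2 (ofFun u.fn1))
      - ((2 : ℝ) • mulBy (fun x => deriv (rc a b c) x.1) (pd ((1 : ℝ), (0 : ℝ)) (ofFun u.fn1))
          + mulBy (fun x => rc a b c x.1) (lap2 (ofFun u.fn1)))
      - ((2 : ℝ) • mulBy (fun x => qc a b c x.1) (pd ((1 : ℝ), (0 : ℝ)) (ofFun u.fn2))
          + mulBy (fun x => deriv (qc a b c) x.1) (ofFun u.fn2))) h ∧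
      h =ᵐ[volume] fun ξ =>
        -((1 + a * sp α ξ) * sp α ξ * U α (u.fst.1 0) ξ) - varSym a b c u ξ := by
  have hr := isTanhPoly_rc a b c
  have hq := isTanhPoly_qc a b c
  have hΦ : HasSym α (ofFun u.fn1) (U α (u.fst.1 0)) := hasSym_ofFun _
  have hm1 : HasSym α (mulBy (fun x : ℝ × ℝ => deriv (rc a b c) x.1)
      (pd ((1 : ℝ), (0 : ℝ)) (ofFun u.fn1))) (U α (mulZ α (deriv (rc a b c)) (u.fst.1 1))) :=
    (hasSym_mulBy_ofFun hr.deriv.isMult _).congr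
      (eqDistr_mulBy hr.deriv.isMult.1 (eqDistr_ofFun_dz u).symm)
  have hm2 : HasSym α (mulBy (fun x : ℝ × ℝ => rc a b c x.1) (lap2 (ofFun u.fn1))) _ :=
    ((hasSym_mulBy_dz hr.isMult hr.deriv.isMult (u.fst.1 1)).add
      (hasSym_mulBy_dy hr.isMult hr.deriv.isMult (u.fst.1 2))).congr
      ((eqDistr_mulBy hr.isMult.1 (eqDistr_pd _ (eqDistr_ofFun_dz u).symm)).add
        (eqDistr_mulBy hr.isMult.1 (eqDistr_pd _ (eqDistr_ofFun_dy u).symm)))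
  have hm3 := hasSym_mulBy_dz hq.isMult hq.deriv.isMult u.snd
  have hm4 := hasSym_mulBy_ofFun hq.deriv.isMult u.snd
  refine ⟨_, (hΦ.lap.sub (hΦ.lap.lap.smul a)).sub ((hm1.smul 2).add hm2)
    |>.sub ((hm3.smul 2).add hm4), ?_⟩
  filter_upwards [coeFn_sub (U α (mulZ α (deriv (rc a b c)) (u.fst.1 1)))
    (U α (mulZ α (deriv (qc a b c)) u.snd)), coeFn_add (U α (mulZ α (rc a b c) (u.fst.1 1)))
    ((2 : ℂ) • U α (mulZ α (qc a b c) u.snd)), coeFn_smul (2 : ℂ) (U α (mulZ α (qc a b c) u.snd))]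
    with ξ a1 a2 a3
  simp only [varSym, map_sub, map_add, map_smul, sp]
  rw [a1, a2, Pi.add_apply, Pi.sub_apply, a3, Pi.smul_apply, smul_eq_mul]
  push_cast
  ring

/-- The symbols of the two sides of the first equation. -/
theorem hasSym_first (c : ℝ) (u : Xplane α) :
    HasSym α (c • pd ((1 : ℝ), (0 : ℝ)) (ofFun u.fn1) + ofFun u.fn2)
      (fun ξ => c * (sz α ξ * U α (u.fst.1 0) ξ) + U α u.snd ξ) := by
  have hΦ : HasSym α (ofFun u.fn1) (U α (u.fst.1 0)) := hasSym_ofFun _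
  have hΨ : HasSym α (ofFun u.fn2) (U α u.snd) := hasSym_ofFun _
  exact (hΦ.dz.smul c).add hΨ

/-- The graph of the linearized operator in terms of symbols. -/
theorem LGraph_iff_symbol (a b c α : ℝ) (u f : Xplane α) : LGraph a b c α u f ↔
    (U α (f.fst.1 0) =ᵐ[volume] fun ξ => c * (sz α ξ * U α (u.fst.1 0) ξ) + U α u.snd ξ) ∧
    ((fun ξ => (1 + b * sp α ξ) * (U α f.snd ξ - c * (sz α ξ * U α u.snd ξ))) =ᵐ[volume] fun ξ =>
      -((1 + a * sp α ξ) * sp α ξ * U α (u.fst.1 0) ξ) - varSym a b c u ξ) := by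
  have hF : HasSym α (ofFun f.fn1) (U α (f.fst.1 0)) := hasSym_ofFun _
  obtain ⟨h, hR, hh⟩ := hasSym_rhs a b c u
  refine and_congr (hF.eqDistr_iff (hasSym_first c u))
    (((hasSym_lhs b c u f).eqDistr_iff hR).trans ⟨fun e => e.trans hh, fun e => e.trans hh.symm⟩)

/-! ### Bounds for symbols -/

/-- Square integrable functions of the frequency. -/
abbrev Hh := Lp ℂ 2 (volume : Measure E2)

open Classical in
/-- The Fourier multiplier with bounded symbol `g` (and zero if `g` is not essentially bounded). -/
def fm (g : E2 → ℂ) : Hh →L[ℂ] Hh := if hg : MemLp g ⊤ volume then mulLp hg else 0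

theorem fm_ae {g : E2 → ℂ} (hg : MemLp g ⊤ volume) (f : Hh) :
    fm g f =ᵐ[volume] fun ξ => g ξ * f ξ := by
  rw [fm, dif_pos hg]
  exact coeFn_mulLp hg f

theorem norm_fm_le {g : E2 → ℂ} {C : ℝ} (hC0 : 0 ≤ C) (hC : ∀ ξ, ‖g ξ‖ ≤ C) (f : Hh) :
    ‖fm g f‖ ≤ C * ‖f‖ := by
  rw [fm]
  split_ifs with hg
  · exact norm_mulLp_le hg (Eventually.of_forall hC) f
  · simpa using by positivity

theorem measurable_sz (α : ℝ) : Measurable (sz α) := by unfold sz; fun_prop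

theorem measurable_sy : Measurable sy := by unfold sy; fun_prop

theorem measurable_sp (α : ℝ) : Measurable (sp α) :=
  (((measurable_sz α).pow_const 2).add (measurable_sy.pow_const 2)).neg

/-- `(1 + |s_z|² + |s_y|²)^{1/2}`, the symbol which defines the norm of `H¹_α`. -/
def N0 (α : ℝ) (ξ : E2) : ℝ := sqrt (1 + ‖sz α ξ‖ ^ 2 + ‖sy ξ‖ ^ 2)

theorem N0_sq (α : ℝ) (ξ : E2) : N0 α ξ ^ 2 = 1 + ‖sz α ξ‖ ^ 2 + ‖sy ξ‖ ^ 2 :=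
  sq_sqrt (by positivity)

theorem one_le_N0 (α : ℝ) (ξ : E2) : 1 ≤ N0 α ξ := by
  rw [N0, Real.one_le_sqrt]
  nlinarith [sq_nonneg ‖sz α ξ‖, sq_nonneg ‖sy ξ‖]

theorem N0_pos (α : ℝ) (ξ : E2) : 0 < N0 α ξ := one_pos.trans_le (one_le_N0 α ξ)

theorem norm_sz_le (α : ℝ) (ξ : E2) : ‖sz α ξ‖ ≤ N0 α ξ :=
  Real.le_sqrt_of_sq_le (by nlinarith [sq_nonneg ‖sy ξ‖])

theorem norm_sy_le (α : ℝ) (ξ : E2) : ‖sy ξ‖ ≤ N0 α ξ :=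
  Real.le_sqrt_of_sq_le (by nlinarith [sq_nonneg ‖sz α ξ‖])

theorem measurable_N0 (α : ℝ) : Measurable (N0 α) :=
  ((((measurable_sz α).norm.pow_const 2).const_add 1).add (measurable_sy.norm.pow_const 2)).sqrt

theorem norm_sp_le (α : ℝ) (ξ : E2) : ‖sp α ξ‖ ≤ N0 α ξ ^ 2 := by
  rw [sp, norm_neg, N0_sq]
  refine (norm_add_le _ _).trans ?_
  rw [norm_pow, norm_pow]
  linarith

/-- The angular frequency dual to `z`. -/
def fx (ξ : E2) : ℝ := 2 * π * ξ.ofLp.1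

/-- The angular frequency dual to `y`. -/
def fy (ξ : E2) : ℝ := 2 * π * ξ.ofLp.2

theorem measurable_fx : Measurable fx := by unfold fx; fun_prop

theorem sz_eq (α : ℝ) (ξ : E2) : sz α ξ = fx ξ * I - α := by simp [sz, fx]

theorem sy_eq (ξ : E2) : sy ξ = fy ξ * I := by simp [sy, fy]

theorem norm_sz_sq (α : ℝ) (ξ : E2) : ‖sz α ξ‖ ^ 2 = fx ξ ^ 2 + α ^ 2 := by
  rw [sz_eq, ← normSq_eq_norm_sq, normSq_apply]
  simp; ring

theorem norm_sy_sq (ξ : E2) : ‖sy ξ‖ ^ 2 = fy ξ ^ 2 := by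
  rw [sy_eq, ← normSq_eq_norm_sq, normSq_apply]
  simp; ring

theorem N0_sq' (α : ℝ) (ξ : E2) : N0 α ξ ^ 2 = 1 + fx ξ ^ 2 + α ^ 2 + fy ξ ^ 2 := by
  rw [N0_sq, norm_sz_sq, norm_sy_sq]; ring

theorem sp_eq (α : ℝ) (ξ : E2) :
    sp α ξ = ((fx ξ ^ 2 + fy ξ ^ 2 - α ^ 2 : ℝ) : ℂ) + ((2 * α * fx ξ : ℝ) : ℂ) * I := by
  rw [sp, sz_eq, sy_eq]
  push_cast
  linear_combination -((fx ξ : ℂ) ^ 2 + (fy ξ : ℂ) ^ 2) * I_sq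

theorem abs_fx_le (α : ℝ) (ξ : E2) : |fx ξ| ≤ N0 α ξ := by
  refine abs_le_of_sq_le_sq ?_ (N0_pos α ξ).le
  rw [N0_sq']
  nlinarith [sq_nonneg α, sq_nonneg (fy ξ)]

/-- Standing assumptions on the parameters. -/
structure Params (a b c α : ℝ) : Prop where
  a_pos : 0 < a
  a_lt_b : a < b
  one_lt_c : 1 < c
  alpha_pos : 0 < α
  alpha_lt : α < alphaC a b c

namespace Params

variable (hp : Params a b c α)
include hp

theorem b_pos : 0 < b := hp.a_pos.trans hp.a_lt_b

theorem den_pos : 0 < b * c ^ 2 - a := by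
  have h1 := hp.one_lt_c
  have h2 := hp.a_lt_b
  have h3 := hp.b_pos
  nlinarith [mul_pos h3 (show 0 < c ^ 2 - 1 by nlinarith)]

theorem b_mul_alpha_sq : b * α ^ 2 < 1 := by
  have h0 := hp.den_pos
  have hc := hp.one_lt_c
  have h1 : α ^ 2 < (c ^ 2 - 1) / (b * c ^ 2 - a) := by
    have h2 : alphaC a b c ^ 2 = (c ^ 2 - 1) / (b * c ^ 2 - a) :=
      sq_sqrt (div_nonneg (by nlinarith) h0.le)
    rw [← h2]
    exact pow_lt_pow_left₀ hp.alpha_lt hp.alpha_pos.le two_ne_zero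
  have h2 : b * ((c ^ 2 - 1) / (b * c ^ 2 - a)) < 1 := by
    rw [← mul_div_assoc, div_lt_one h0]
    linarith [hp.a_lt_b]
  exact (mul_lt_mul_of_pos_left h1 hp.b_pos).trans h2

/-- The symbol of `B` is bounded below, since `b α² < 1`. -/
theorem exists_symB_bound : ∃ δ > 0, ∀ ξ, δ * N0 α ξ ^ 2 ≤ ‖1 + b * sp α ξ‖ := by
  have h1 := hp.b_mul_alpha_sq
  have hb := hp.b_pos
  have ha : 0 < 1 + α ^ 2 := by positivity
  refine ⟨min ((1 - b * α ^ 2) / (1 + α ^ 2)) b, lt_min (div_pos (by linarith) ha) hb, fun ξ => ?_⟩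
  have hre : (1 + b * sp α ξ).re = 1 - b * α ^ 2 + b * (fx ξ ^ 2 + fy ξ ^ 2) := by
    rw [sp_eq]
    simp only [Complex.add_re, Complex.one_re, Complex.mul_re, Complex.ofReal_re, Complex.ofReal_im,
      Complex.I_re, Complex.I_im, Complex.add_im, Complex.mul_im]
    ring
  refine le_trans ?_ (re_le_norm _)
  rw [hre, N0_sq']
  have e1 : min ((1 - b * α ^ 2) / (1 + α ^ 2)) b * (1 + α ^ 2) ≤ 1 - b * α ^ 2 := by
    refine (mul_le_mul_of_nonneg_right (min_le_left _ _) ha.le).trans ?_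
    rw [div_mul_cancel₀ _ ha.ne']
  have e2 : min ((1 - b * α ^ 2) / (1 + α ^ 2)) b * (fx ξ ^ 2 + fy ξ ^ 2) ≤
      b * (fx ξ ^ 2 + fy ξ ^ 2) :=
    mul_le_mul_of_nonneg_right (min_le_right _ _) (by positivity)
  linarith

theorem symB_ne_zero (ξ : E2) : 1 + b * sp α ξ ≠ 0 := by
  obtain ⟨δ, hδ, h⟩ := hp.exists_symB_bound
  have := (mul_pos hδ (pow_pos (N0_pos α ξ) 2)).trans_le (h ξ)
  exact norm_pos_iff.1 this

/-- Quotients of symbols of order at most `2` by the symbol of `B` are bounded multipliers. -/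
theorem exists_div_symB_bound {g : E2 → ℂ} {C : ℝ} (hC : ∀ ξ, ‖g ξ‖ ≤ C * N0 α ξ ^ 2) :
    ∃ K, 0 ≤ K ∧ ∀ ξ, ‖g ξ / (1 + b * sp α ξ)‖ ≤ K := by
  obtain ⟨δ, hδ, h⟩ := hp.exists_symB_bound
  refine ⟨|C| / δ, by positivity, fun ξ => ?_⟩
  rw [norm_div, div_le_div_iff₀ (norm_pos_iff.2 (hp.symB_ne_zero ξ)) hδ]
  have := h ξ
  have h2 := hC ξ
  calc ‖g ξ‖ * δ ≤ |C| * N0 α ξ ^ 2 * δ := by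
        gcongr; exact h2.trans (by gcongr; exact le_abs_self C)
    _ = |C| * (δ * N0 α ξ ^ 2) := by ring
    _ ≤ _ := by gcongr

theorem memLp_div_symB {g : E2 → ℂ} {C : ℝ} (hg : Measurable g)
    (hC : ∀ ξ, ‖g ξ‖ ≤ C * N0 α ξ ^ 2) :
    MemLp (fun ξ => g ξ / (1 + b * sp α ξ)) ⊤ volume := by
  obtain ⟨K, _, hK⟩ := hp.exists_div_symB_bound hC
  refine memLp_top_of_bound (Measurable.aestronglyMeasurable ?_) K (Eventually.of_forall hK)
  exact hg.div (((measurable_sp α).const_mul _).const_add _)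

end Params

theorem memLp_div_N0 {g : E2 → ℂ} {C : ℝ} (hg : Measurable g)
    (hC : ∀ ξ, ‖g ξ‖ ≤ C * N0 α ξ) : MemLp (fun ξ => g ξ / (N0 α ξ : ℂ)) ⊤ volume := by
  refine memLp_top_of_bound (Measurable.aestronglyMeasurable ?_) C (.of_forall fun ξ => ?_)
  · exact hg.div (measurable_ofReal.comp (measurable_N0 α))
  · rw [norm_div, norm_real, norm_eq_abs, abs_of_pos (N0_pos α ξ),
      div_le_iff₀ (N0_pos α ξ)]
    exact hC ξ

theorem memLp_one_div_N0 (α : ℝ) : MemLp (fun ξ => 1 / (N0 α ξ : ℂ)) ⊤ volume :=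
  memLp_div_N0 (C := 1) measurable_const fun ξ => by simpa using one_le_N0 α ξ

theorem memLp_sz_div_N0 (α : ℝ) : MemLp (fun ξ => sz α ξ / (N0 α ξ : ℂ)) ⊤ volume :=
  memLp_div_N0 (C := 1) (measurable_sz α) fun ξ => by simpa using norm_sz_le α ξ

theorem memLp_sy_div_N0 (α : ℝ) : MemLp (fun ξ => sy ξ / (N0 α ξ : ℂ)) ⊤ volume :=
  memLp_div_N0 (C := 1) measurable_sy fun ξ => by simpa using norm_sy_le α ξ

theorem memLp_csz_div_N0 (α : ℝ) :
    MemLp (fun ξ => conj (sz α ξ) / (N0 α ξ : ℂ)) ⊤ volume :=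
  memLp_div_N0 (C := 1) (Complex.continuous_conj.measurable.comp (measurable_sz α))
    fun ξ => by simpa using norm_sz_le α ξ

theorem memLp_csy_div_N0 (α : ℝ) :
    MemLp (fun ξ => conj (sy ξ) / (N0 α ξ : ℂ)) ⊤ volume :=
  memLp_div_N0 (C := 1) (Complex.continuous_conj.measurable.comp measurable_sy)
    fun ξ => by simpa using norm_sy_le α ξ

/-! ### The energy space on the Fourier side -/

/-- The components `Φ`, `∂_z Φ`, `∂_y Φ` of an element of `X`. -/
def cmp (α : ℝ) (i : Fin 3) : Xplane α →L[ℂ] L2w (wt2 α) :=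
  (PiLp.proj 2 (fun _ : Fin 3 => L2w (wt2 α)) i).comp ((H1plane α).subtypeL.comp
    ((ContinuousLinearMap.fst ℂ _ _).comp
      (prodContinuousLinearEquiv 2 ℂ (H1plane α) (L2w (wt2 α))).toContinuousLinearMap))

/-- The component `Ψ` of an element of `X`. -/
def cmpS (α : ℝ) : Xplane α →L[ℂ] L2w (wt2 α) :=
  (ContinuousLinearMap.snd ℂ _ _).comp
      (prodContinuousLinearEquiv 2 ℂ (H1plane α) (L2w (wt2 α))).toContinuousLinearMap

theorem Xplane.ext_U {u v : Xplane α}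
    (h1 : U α (u.fst.1 0) =ᵐ[volume] U α (v.fst.1 0)) (h2 : u.snd = v.snd) : u = v := by
  have e0 : u.fst.1 0 = v.fst.1 0 := (U α).injective (Lp.ext h1)
  have e1 : u.fst.1 1 = v.fst.1 1 := (U α).injective (Lp.ext (by
    filter_upwards [u.U_dz, v.U_dz, h1] with ξ a1 a2 a3
    rw [a1, a2, a3]))
  have e2 : u.fst.1 2 = v.fst.1 2 := (U α).injective (Lp.ext (by
    filter_upwards [u.U_dy, v.U_dy, h1] with ξ a1 a2 a3
    rw [a1, a2, a3]))
  have e : u.fst = v.fst := by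
    refine Subtype.ext (PiLp.ext fun i => ?_)
    fin_cases i
    · exact e0
    · exact e1
    · exact e2
  exact WithLp.ofLp_injective 2 (Prod.ext e h2)

/-- The element of `H¹_α(ℝ²)` with Fourier representation `w / N₀`. -/
def symH1 (α : ℝ) : Hh →L[ℂ] H1plane α :=
  ((PiLp.continuousLinearEquiv 2 ℂ (fun _ : Fin 3 => L2w (wt2 α))).symm.toContinuousLinearMap.comp
    (ContinuousLinearMap.pi fun i : Fin 3 =>
      (U α).symm.toContinuousLinearEquiv.toContinuousLinearMap.comp
        (![fm fun ξ => 1 / (N0 α ξ : ℂ), fm fun ξ => sz α ξ / (N0 α ξ : ℂ),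
          fm fun ξ => sy ξ / (N0 α ξ : ℂ)] i))).codRestrict (H1plane α) (by
    intro w
    rw [mem_H1plane_iff]
    have e0 : U α ((U α).symm (fm (fun ξ => 1 / (N0 α ξ : ℂ)) w)) = fm (fun ξ => 1 / (N0 α ξ : ℂ)) w :=
      (U α).apply_symm_apply _
    have e1 : U α ((U α).symm (fm (fun ξ => sz α ξ / (N0 α ξ : ℂ)) w)) = fm (fun ξ => sz α ξ / (N0 α ξ : ℂ)) w :=
      (U α).apply_symm_apply _
    have e2 : U α ((U α).symm (fm (fun ξ => sy ξ / (N0 α ξ : ℂ)) w)) = fm (fun ξ => sy ξ / (N0 α ξ : ℂ)) w :=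
      (U α).apply_symm_apply _
    constructor
    · change U α ((U α).symm (fm (fun ξ => sz α ξ / (N0 α ξ : ℂ)) w)) =ᵐ[volume]
        fun ξ => sz α ξ * U α ((U α).symm (fm (fun ξ => 1 / (N0 α ξ : ℂ)) w)) ξ
      rw [e0, e1]
      filter_upwards [fm_ae (memLp_one_div_N0 α) w, fm_ae (memLp_sz_div_N0 α) w] with ξ h1 h2
      rw [h1, h2]; ring
    · change U α ((U α).symm (fm (fun ξ => sy ξ / (N0 α ξ : ℂ)) w)) =ᵐ[volume]
        fun ξ => sy ξ * U α ((U α).symm (fm (fun ξ => 1 / (N0 α ξ : ℂ)) w)) ξ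
      rw [e0, e2]
      filter_upwards [fm_ae (memLp_one_div_N0 α) w, fm_ae (memLp_sy_div_N0 α) w] with ξ h1 h2
      rw [h1, h2]; ring)

theorem U_symH1 (α : ℝ) (w : Hh) :
    U α ((symH1 α w).1 0) =ᵐ[volume] fun ξ => 1 / (N0 α ξ : ℂ) * w ξ := by
  have : U α ((symH1 α w).1 0) = fm (fun ξ => 1 / (N0 α ξ : ℂ)) w :=
    (U α).apply_symm_apply _
  rw [this]
  exact fm_ae (memLp_one_div_N0 α) w

/-- The element of `X` with Fourier representation `(w₁ / N₀, w₂)`. -/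
def symXfun (α : ℝ) : Hh × Hh →L[ℂ] Xplane α :=
  (prodContinuousLinearEquiv 2 ℂ (H1plane α) (L2w (wt2 α))).symm.toContinuousLinearMap.comp
    ((symH1 α).prodMap (U α).symm.toContinuousLinearEquiv.toContinuousLinearMap)

theorem symXfun_fst (α : ℝ) (w : Hh × Hh) : (symXfun α w).fst = symH1 α w.1 := rfl

theorem symXfun_snd (α : ℝ) (w : Hh × Hh) : (symXfun α w).snd = (U α).symm w.2 := rfl

theorem bijective_symXfun (α : ℝ) : Function.Bijective (symXfun α) := by
  constructor
  · intro v w hvw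
    have h1 : symH1 α v.1 = symH1 α w.1 := by
      rw [← symXfun_fst, ← symXfun_fst, hvw]
    have h2 : (U α).symm v.2 = (U α).symm w.2 := by
      rw [← symXfun_snd, ← symXfun_snd, hvw]
    refine Prod.ext (Lp.ext ?_) ((U α).symm.injective h2)
    have h3 := U_symH1 α v.1
    rw [h1] at h3
    filter_upwards [h3, U_symH1 α w.1] with ξ a1 a2
    have hN : (N0 α ξ : ℂ) ≠ 0 := by exact_mod_cast (N0_pos α ξ).ne'
    rw [a2] at a1
    exact (mul_left_cancel₀ (one_div_ne_zero hN) a1).symm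
  · intro u
    refine ⟨(fm (fun ξ => 1 / (N0 α ξ : ℂ)) (U α (u.fst.1 0))
      + fm (fun ξ => conj (sz α ξ) / (N0 α ξ : ℂ)) (U α (u.fst.1 1))
      + fm (fun ξ => conj (sy ξ) / (N0 α ξ : ℂ)) (U α (u.fst.1 2)), U α u.snd), ?_⟩
    refine Xplane.ext_U ?_ ?_
    · rw [symXfun_fst]
      refine (U_symH1 α _).trans ?_
      filter_upwards [coeFn_add (fm (fun ξ => 1 / (N0 α ξ : ℂ)) (U α (u.fst.1 0))
          + fm (fun ξ => conj (sz α ξ) / (N0 α ξ : ℂ)) (U α (u.fst.1 1)))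
          (fm (fun ξ => conj (sy ξ) / (N0 α ξ : ℂ)) (U α (u.fst.1 2))),
        coeFn_add (fm (fun ξ => 1 / (N0 α ξ : ℂ)) (U α (u.fst.1 0)))
          (fm (fun ξ => conj (sz α ξ) / (N0 α ξ : ℂ)) (U α (u.fst.1 1))),
        fm_ae (memLp_one_div_N0 α) (U α (u.fst.1 0)),
        fm_ae (memLp_csz_div_N0 α) (U α (u.fst.1 1)),
        fm_ae (memLp_csy_div_N0 α) (U α (u.fst.1 2)), u.U_dz, u.U_dy] with ξ a1 a2 a3 a4 a5 a6 a7
      have hN : (N0 α ξ : ℂ) ≠ 0 := by exact_mod_cast (N0_pos α ξ).ne'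
      have hNs : (N0 α ξ : ℂ) ^ 2 = 1 + conj (sz α ξ) * sz α ξ
          + conj (sy ξ) * sy ξ := by
        rw [← ofReal_pow, N0_sq, ← Complex.normSq_eq_conj_mul_self,
          ← Complex.normSq_eq_conj_mul_self, normSq_eq_norm_sq, normSq_eq_norm_sq]
        push_cast; ring
      rw [a1, Pi.add_apply, a2, Pi.add_apply, a3, a4, a5, a6, a7]
      field_simp
      rw [hNs]
      ring
    · rw [symXfun_snd]
      exact (U α).symm_apply_apply _

/-- `X` is isomorphic to a space of pairs of square integrable functions of the frequency, by
`(Φ, Ψ) ↦ (N₀ U Φ, U Ψ)`. -/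
def symX (α : ℝ) : Xplane α ≃L[ℂ] Hh × Hh :=
  (ContinuousLinearEquiv.ofBijective (symXfun α)
    (LinearMap.ker_eq_bot.2 (bijective_symXfun α).1)
    (LinearMap.range_eq_top.2 (bijective_symXfun α).2)).symm

theorem symXfun_symX (u : Xplane α) : symXfun α (symX α u) = u :=
  ContinuousLinearEquiv.ofBijective_apply_symm_apply (symXfun α) _ _ u

theorem symX_fst (u : Xplane α) :
    (symX α u).1 =ᵐ[volume] fun ξ => (N0 α ξ : ℂ) * U α (u.fst.1 0) ξ := by
  have h := U_symH1 α (symX α u).1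
  rw [← symXfun_fst, symXfun_symX] at h
  filter_upwards [h] with ξ hξ
  have hN : (N0 α ξ : ℂ) ≠ 0 := by exact_mod_cast (N0_pos α ξ).ne'
  rw [hξ]
  field_simp

theorem symX_snd (u : Xplane α) : (symX α u).2 = U α u.snd := by
  conv_rhs => rw [← symXfun_symX u, symXfun_snd]
  exact ((U α).apply_symm_apply _).symm

/-! ### Generation of the semigroup -/

/-- The symbol of `-B⁻¹ A Δ`. -/
def sS (a b α : ℝ) (ξ : E2) : ℂ := sp α ξ * (1 + a * sp α ξ) / (1 + b * sp α ξ)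

/-- The part of `-B⁻¹ A Δ` which is bounded from `H¹_α` to `L²_α`, as a multiplier of `N₀ U Φ`. -/
def sR (a b α : ℝ) (ξ : E2) : ℂ := (sS a b α ξ - (a / b : ℝ) * (N0 α ξ : ℂ) ^ 2) / (N0 α ξ : ℂ)

/-- The terms of the operator with variable coefficients. -/
def varOp (a b c α : ℝ) : Xplane α →L[ℂ] Hh :=
  (fm fun ξ => 1 / (1 + b * sp α ξ)).comp
      ((U α).toContinuousLinearEquiv.toContinuousLinearMap.comp
        ((mulZ α (deriv (rc a b c))).comp (cmp α 1) - (mulZ α (deriv (qc a b c))).comp (cmpS α)))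
    + (fm fun ξ => sz α ξ / (1 + b * sp α ξ)).comp
      ((U α).toContinuousLinearEquiv.toContinuousLinearMap.comp
        ((mulZ α (rc a b c)).comp (cmp α 1) + (2 : ℂ) • (mulZ α (qc a b c)).comp (cmpS α)))
    + (fm fun ξ => sy ξ / (1 + b * sp α ξ)).comp
      ((U α).toContinuousLinearEquiv.toContinuousLinearMap.comp
        ((mulZ α (rc a b c)).comp (cmp α 2)))

theorem N0_le_sq (α : ℝ) (ξ : E2) : N0 α ξ ≤ N0 α ξ ^ 2 := by
  have := one_le_N0 α ξ
  nlinarith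

theorem one_le_N0_sq (α : ℝ) (ξ : E2) : 1 ≤ N0 α ξ ^ 2 := (one_le_N0 α ξ).trans (N0_le_sq α ξ)

namespace Params

variable (hp : Params a b c α)
include hp

theorem memLp_one_div_symB : MemLp (fun ξ => 1 / (1 + b * sp α ξ)) ⊤ volume :=
  hp.memLp_div_symB (C := 1) measurable_const fun ξ => by simpa using one_le_N0_sq α ξ

theorem memLp_sz_div_symB : MemLp (fun ξ => sz α ξ / (1 + b * sp α ξ)) ⊤ volume :=
  hp.memLp_div_symB (C := 1) (measurable_sz α) fun ξ => by
    simpa using (norm_sz_le α ξ).trans (N0_le_sq α ξ)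

theorem memLp_sy_div_symB : MemLp (fun ξ => sy ξ / (1 + b * sp α ξ)) ⊤ volume :=
  hp.memLp_div_symB (C := 1) measurable_sy fun ξ => by
    simpa using (norm_sy_le α ξ).trans (N0_le_sq α ξ)

theorem varOp_ae (u : Xplane α) :
    varOp a b c α u =ᵐ[volume] fun ξ => varSym a b c u ξ / (1 + b * sp α ξ) := by
  set f1 := U α (mulZ α (deriv (rc a b c)) (u.fst.1 1) - mulZ α (deriv (qc a b c)) u.snd)
  set f2 := U α (mulZ α (rc a b c) (u.fst.1 1) + (2 : ℂ) • mulZ α (qc a b c) u.snd)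
  set f3 := U α (mulZ α (rc a b c) (u.fst.1 2))
  have e : varOp a b c α u = fm (fun ξ => 1 / (1 + b * sp α ξ)) f1
      + fm (fun ξ => sz α ξ / (1 + b * sp α ξ)) f2 + fm (fun ξ => sy ξ / (1 + b * sp α ξ)) f3 := rfl
  rw [e]
  filter_upwards [fm_ae hp.memLp_one_div_symB f1, fm_ae hp.memLp_sz_div_symB f2,
    fm_ae hp.memLp_sy_div_symB f3, coeFn_add (fm (fun ξ => 1 / (1 + b * sp α ξ)) f1
      + fm (fun ξ => sz α ξ / (1 + b * sp α ξ)) f2) (fm (fun ξ => sy ξ / (1 + b * sp α ξ)) f3),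
    coeFn_add (fm (fun ξ => 1 / (1 + b * sp α ξ)) f1)
      (fm (fun ξ => sz α ξ / (1 + b * sp α ξ)) f2)] with ξ a1 a2 a3 a4 a5
  rw [a4, Pi.add_apply, a5, Pi.add_apply, a1, a2, a3]
  change _ = (f1 ξ + sz α ξ * f2 ξ + sy ξ * f3 ξ) / _
  ring

/-- The graph of the linearized operator on the Fourier side, solved for the image. -/
theorem LGraph_iff (u f : Xplane α) : LGraph a b c α u f ↔
    (U α (f.fst.1 0) =ᵐ[volume] fun ξ => c * (sz α ξ * U α (u.fst.1 0) ξ) + U α u.snd ξ) ∧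
    (U α f.snd =ᵐ[volume] fun ξ =>
      c * (sz α ξ * U α u.snd ξ) - sS a b α ξ * U α (u.fst.1 0) ξ - varOp a b c α u ξ) := by
  rw [LGraph_iff_symbol]
  refine and_congr_right fun _ => ?_
  constructor
  · intro h
    filter_upwards [h, hp.varOp_ae u] with ξ h1 h2
    have hB := hp.symB_ne_zero ξ
    rw [h2, sS]
    have : U α f.snd ξ - c * (sz α ξ * U α u.snd ξ) =
      (-((1 + a * sp α ξ) * sp α ξ * U α (u.fst.1 0) ξ) - varSym a b c u ξ) / (1 + b * sp α ξ) := by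
      rw [eq_div_iff hB, ← h1]; ring
    linear_combination this
  · intro h
    filter_upwards [h, hp.varOp_ae u] with ξ h1 h2
    have hB := hp.symB_ne_zero ξ
    rw [h1, h2, sS]
    field_simp
    ring

/-- Up to a bounded term, `sS` is `a / b` times the symbol of `-Δ`. -/
theorem exists_sS_eq_add : ∃ R, 0 ≤ R ∧ ∀ ξ, ∃ ρ : ℂ, ‖ρ‖ ≤ R ∧
    sS a b α ξ = (a / b : ℝ) * sp α ξ + ρ := by
  obtain ⟨R, hR0, hR⟩ := hp.exists_div_symB_bound (g := sp α) (C := 1)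
    (fun ξ => by simpa using norm_sp_le α ξ)
  refine ⟨|1 - a / b| * R, by positivity, fun ξ =>
    ⟨(1 - a / b : ℝ) * (sp α ξ / (1 + b * sp α ξ)), ?_, ?_⟩⟩
  · rw [norm_mul, norm_real, norm_eq_abs]
    gcongr
    exact hR ξ
  · have hB := hp.symB_ne_zero ξ
    have hb : (b : ℂ) ≠ 0 := by exact_mod_cast hp.b_pos.ne'
    rw [sS]
    push_cast
    generalize sp α ξ = s at hB ⊢
    have hB' : 1 + s * b ≠ 0 := by rwa [mul_comm]
    field_simp
    ring

theorem norm_sS_sub_le : ∃ C, 0 ≤ C ∧ ∀ ξ, ‖sS a b α ξ - (a / b : ℝ) * (N0 α ξ : ℂ) ^ 2‖ ≤ C * N0 α ξ := by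
  obtain ⟨R, hR0, hR⟩ := hp.exists_sS_eq_add
  refine ⟨|a / b| * (1 + 2 * α ^ 2 + 2 * |α|) + R, by positivity, fun ξ => ?_⟩
  obtain ⟨ρ, hρ, e⟩ := hR ξ
  have e1 : sS a b α ξ - (a / b : ℝ) * (N0 α ξ : ℂ) ^ 2 =
      (a / b : ℝ) * (sp α ξ - (N0 α ξ : ℂ) ^ 2) + ρ := by rw [e]; ring
  have e2 : sp α ξ - (N0 α ξ : ℂ) ^ 2 = ((-(1 + 2 * α ^ 2) : ℝ) : ℂ) + ((2 * α * fx ξ : ℝ) : ℂ) * I := by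
    rw [← ofReal_pow, N0_sq', sp_eq]; push_cast; ring
  have hN := one_le_N0 α ξ
  have h2 : ‖sp α ξ - (N0 α ξ : ℂ) ^ 2‖ ≤ (1 + 2 * α ^ 2 + 2 * |α|) * N0 α ξ := by
    rw [e2]
    refine (norm_add_le _ _).trans ?_
    rw [norm_mul, norm_I, mul_one, norm_real, norm_real, norm_eq_abs,
      norm_eq_abs, abs_neg, abs_of_pos (show 0 < 1 + 2 * α ^ 2 by positivity), abs_mul, abs_mul,
      abs_two]
    have h5 : 2 * |α| * |fx ξ| ≤ 2 * |α| * N0 α ξ := by gcongr; exact abs_fx_le α ξ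
    nlinarith [sq_nonneg α]
  rw [e1]
  refine (norm_add_le _ _).trans ?_
  rw [norm_mul, norm_real, norm_eq_abs, add_mul, mul_assoc]
  gcongr
  exact hρ.trans (le_mul_of_one_le_right hR0 hN)

theorem measurable_sS : Measurable (sS a b α) :=
  ((measurable_sp α).mul (((measurable_sp α).const_mul _).const_add _)).div
    (((measurable_sp α).const_mul _).const_add _)

theorem memLp_sR : MemLp (sR a b α) ⊤ volume := by
  obtain ⟨C, _, hC⟩ := hp.norm_sS_sub_le
  exact memLp_div_N0 (hp.measurable_sS.sub (measurable_const.mul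
    ((measurable_ofReal.comp (measurable_N0 α)).pow_const 2))) hC

end Params

/-- The bounded part of the operator, in the variables `(N₀ U Φ, U Ψ)`. -/
def bddPart (a b c α : ℝ) : Xplane α →L[ℂ] Hh × Hh :=
  (-(c * α : ℂ)) • (symX α : Xplane α →L[ℂ] Hh × Hh) +
    (0 : Xplane α →L[ℂ] Hh).prod
      (-((fm (sR a b α)).comp
        ((ContinuousLinearMap.fst ℂ Hh Hh).comp (symX α : Xplane α →L[ℂ] Hh × Hh)))
        - varOp a b c α)

/-- The change of variables `(w₁, w₂) ↦ (γ w₁ + i w₂, γ w₁ - i w₂)`, which diagonalizes the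
principal part. -/
def rotCLE (γ : ℝ) (hγ : γ ≠ 0) : (Hh × Hh) ≃L[ℂ] Hh × Hh :=
  ContinuousLinearEquiv.equivOfInverse
    (((γ : ℂ) • ContinuousLinearMap.fst ℂ Hh Hh + I • ContinuousLinearMap.snd ℂ Hh Hh).prod
      ((γ : ℂ) • ContinuousLinearMap.fst ℂ Hh Hh - I • ContinuousLinearMap.snd ℂ Hh Hh))
    (((1 / (2 * γ) : ℂ) • (ContinuousLinearMap.fst ℂ Hh Hh + ContinuousLinearMap.snd ℂ Hh Hh)).prod
      ((1 / (2 * I) : ℂ) • (ContinuousLinearMap.fst ℂ Hh Hh - ContinuousLinearMap.snd ℂ Hh Hh)))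
    (by
      have hγ' : (γ : ℂ) ≠ 0 := by exact_mod_cast hγ
      have e1 : (1 / (2 * γ) : ℂ) * γ * 2 = 1 := by field_simp
      have e2 : (1 / (2 * I) : ℂ) * I * 2 = 1 := by field_simp
      rintro ⟨x, y⟩
      refine Prod.ext ?_ ?_
      · change (1 / (2 * γ) : ℂ) • (((γ : ℂ) • x + I • y) + ((γ : ℂ) • x - I • y)) = x
        rw [show ((γ : ℂ) • x + I • y) + ((γ : ℂ) • x - I • y) = (γ * 2 : ℂ) • x by
          module, smul_smul, ← mul_assoc, e1, one_smul]
      · change (1 / (2 * I) : ℂ) • (((γ : ℂ) • x + I • y) - ((γ : ℂ) • x - I • y)) = y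
        rw [show ((γ : ℂ) • x + I • y) - ((γ : ℂ) • x - I • y) =
          (I * 2 : ℂ) • y by module, smul_smul, ← mul_assoc, e2, one_smul])
    (by
      have hγ' : (γ : ℂ) ≠ 0 := by exact_mod_cast hγ
      have e1 : (γ : ℂ) * (1 / (2 * γ) : ℂ) = 1 / 2 := by field_simp
      have e2 : I * (1 / (2 * I) : ℂ) = 1 / 2 := by field_simp
      rintro ⟨x, y⟩
      refine Prod.ext ?_ ?_
      · change (γ : ℂ) • ((1 / (2 * γ) : ℂ) • (x + y)) + I • ((1 / (2 * I) : ℂ) • (x - y)) = x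
        rw [smul_smul, smul_smul, e1, e2]
        module
      · change (γ : ℂ) • ((1 / (2 * γ) : ℂ) • (x + y)) - I • ((1 / (2 * I) : ℂ) • (x - y)) = y
        rw [smul_smul, smul_smul, e1, e2]
        module)

theorem rotCLE_fst {γ : ℝ} (hγ : γ ≠ 0) (w : Hh × Hh) :
    (rotCLE γ hγ w).1 =ᵐ[volume] fun ξ => γ * w.1 ξ + I * w.2 ξ := by
  change ((γ : ℂ) • w.1 + I • w.2 : Hh) =ᵐ[volume] _
  filter_upwards [coeFn_add ((γ : ℂ) • w.1) (I • w.2), coeFn_smul (γ : ℂ) w.1,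
    coeFn_smul I w.2] with ξ h1 h2 h3
  rw [h1, Pi.add_apply, h2, h3]; rfl

theorem rotCLE_snd {γ : ℝ} (hγ : γ ≠ 0) (w : Hh × Hh) :
    (rotCLE γ hγ w).2 =ᵐ[volume] fun ξ => γ * w.1 ξ - I * w.2 ξ := by
  change ((γ : ℂ) • w.1 - I • w.2 : Hh) =ᵐ[volume] _
  filter_upwards [coeFn_sub ((γ : ℂ) • w.1) (I • w.2), coeFn_smul (γ : ℂ) w.1,
    coeFn_smul I w.2] with ξ h1 h2 h3
  rw [h1, Pi.sub_apply, h2, h3]; rfl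

theorem bddPart_fst (u : Xplane α) :
    (bddPart a b c α u).1 =ᵐ[volume] fun ξ => -(c * α * (symX α u).1 ξ) := by
  have e : (bddPart a b c α u).1 = (-(c * α : ℂ)) • (symX α u).1 := by simp [bddPart]
  rw [e]
  filter_upwards [coeFn_smul (-(c * α : ℂ)) (symX α u).1] with ξ h1
  rw [h1, Pi.smul_apply, smul_eq_mul]; ring

theorem Params.bddPart_snd (hp : Params a b c α) (u : Xplane α) :
    (bddPart a b c α u).2 =ᵐ[volume] fun ξ => -(c * α * (symX α u).2 ξ)
      - sR a b α ξ * (symX α u).1 ξ - varOp a b c α u ξ := by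
  have e : (bddPart a b c α u).2 = (-(c * α : ℂ)) • (symX α u).2
      - (fm (sR a b α) (symX α u).1 + varOp a b c α u) := by
    change (-(c * α : ℂ)) • (symX α u).2 + (-(fm (sR a b α) (symX α u).1) - varOp a b c α u) = _
    abel
  rw [e]
  generalize varOp a b c α u = V
  generalize symX α u = w
  filter_upwards [coeFn_smul (-(c * α : ℂ)) w.2,
    coeFn_sub ((-(c * α : ℂ)) • w.2) (fm (sR a b α) w.1 + V),
    coeFn_add (fm (sR a b α) w.1) V, fm_ae hp.memLp_sR w.1]
    with ξ h1 h2 h3 h4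
  rw [h2, Pi.sub_apply, h1, Pi.smul_apply, smul_eq_mul, h3, Pi.add_apply, h4]
  ring

/-- Multiplication by the imaginary functions `i (c ξ ∓ γ N₀)`, as a graph. -/
def DiagGraph (c γ α : ℝ) (w v : Hh × Hh) : Prop :=
  (v.1 =ᵐ[volume] fun ξ => I * (c * fx ξ - γ * N0 α ξ : ℝ) * w.1 ξ) ∧
  (v.2 =ᵐ[volume] fun ξ => I * (c * fx ξ + γ * N0 α ξ : ℝ) * w.2 ξ)

/-- A bounded perturbation of an operator similar to `DiagGraph` generates a semigroup. -/
theorem exists_semigroup_diag {X : Type*} [NormedAddCommGroup X] [NormedSpace ℂ X] [CompleteSpace X]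
    (c γ α : ℝ) (e : X ≃L[ℂ] Hh × Hh) (V : X →L[ℂ] X) :
    ∃ T : ℝ → X →L[ℂ] X,
      IsSemigroupGeneratedBy (fun u f => DiagGraph c γ α (e u) (e (f - V u))) T := by
  have hw1 : Measurable fun ξ => c * fx ξ - γ * N0 α ξ :=
    (measurable_fx.const_mul c).sub ((measurable_N0 α).const_mul γ)
  have hw2 : Measurable fun ξ => c * fx ξ + γ * N0 α ξ :=
    (measurable_fx.const_mul c).add ((measurable_N0 α).const_mul γ)
  have hs := ((isSemigroupGeneratedBy_exp (μ := (volume : Measure E2)) hw1).prodMap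
    (isSemigroupGeneratedBy_exp (μ := (volume : Measure E2)) hw2))
  refine (hs.transport e).exists_perturbation
    (M := ‖(e.symm : (Hh × Hh) →L[ℂ] X)‖ * (1 * ‖(e : X →L[ℂ] Hh × Hh)‖)) (fun t _ => ?_) V
  refine (opNorm_comp_le _ _).trans ?_
  gcongr
  refine (opNorm_comp_le _ _).trans ?_
  gcongr
  refine opNorm_le_bound _ zero_le_one fun w => ?_
  have hb : ∀ (θ : E2 → ℝ) (ξ : E2), ‖Complex.exp (I * (t * θ ξ : ℝ))‖ ≤ 1 := fun θ ξ => by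
    rw [mul_comm, norm_exp_ofReal_mul_I]
  rw [Prod.norm_def, Prod.norm_def, one_mul]
  refine max_le_max ?_ ?_
  · simpa using norm_mulLp_le (memLp_top_exp (μ := (volume : Measure E2)) hw1 t) (C := 1)
      (Eventually.of_forall (hb _)) w.1
  · simpa using norm_mulLp_le (memLp_top_exp (μ := (volume : Measure E2)) hw2 t) (C := 1)
      (Eventually.of_forall (hb _)) w.2

/-- Pointwise form of the diagonalization: `A`, `P` stand for `N₀ U Φ`, `U Ψ`. -/
theorem diag_pointwise {c α γ x n S M A P A' P' : ℂ} (hγ : γ ≠ 0) (hn : n ≠ 0) :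
    (n⁻¹ * A' = c * ((x * I - α) * (n⁻¹ * A)) + P ∧
      P' = c * ((x * I - α) * P) - S * (n⁻¹ * A) - M) ↔
    (γ * (A' + c * α * A) + I * (P' + (c * α * P + (S - γ ^ 2 * n ^ 2) / n * A + M)) =
        I * (c * x - γ * n) * (γ * A + I * P) ∧
      γ * (A' + c * α * A) - I * (P' + (c * α * P + (S - γ ^ 2 * n ^ 2) / n * A + M)) =
        I * (c * x + γ * n) * (γ * A - I * P)) := by
  have hI := I_sq
  constructor
  · rintro ⟨h1, h2⟩
    have h3 : A' = c * ((x * I - α) * A) + n * P := by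
      field_simp at h1
      linear_combination h1
    subst h2 h3
    constructor
    · field_simp
      linear_combination (γ * n ^ 2 * P) * hI
    · field_simp
      linear_combination (γ * n ^ 2 * P) * hI
  · rintro ⟨h1, h2⟩
    have k1 : A' = c * ((x * I - α) * A) + n * P := by
      refine mul_left_cancel₀ (mul_ne_zero two_ne_zero hγ) ?_
      linear_combination h1 + h2 - (2 * γ * n * P) * hI
    constructor
    · rw [k1]; field_simp
    · have k2 : P' + (c * α * P + (S - γ ^ 2 * n ^ 2) / n * A + M) =
          c * x * I * P - γ ^ 2 * n * A := by
        refine mul_left_cancel₀ (mul_ne_zero two_ne_zero Complex.I_ne_zero) ?_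
        linear_combination h1 - h2
      field_simp at k2 ⊢
      linear_combination k2

/-- The diagonalization for functions of the frequency. -/
theorem diagGraph_rotCLE_iff {a b c α γ : ℝ} (hγ : γ ≠ 0) (hγ2 : γ ^ 2 = a / b)
    (v g d : Hh × Hh) (A0 A1 M : Hh)
    (s1 : v.1 =ᵐ[volume] fun ξ => (N0 α ξ : ℂ) * A0 ξ)
    (s3 : g.1 =ᵐ[volume] fun ξ => (N0 α ξ : ℂ) * A1 ξ)
    (s7 : d.1 =ᵐ[volume] fun ξ => -(c * α * v.1 ξ))
    (s8 : d.2 =ᵐ[volume] fun ξ => -(c * α * v.2 ξ) - sR a b α ξ * v.1 ξ - M ξ) :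
    ((A1 =ᵐ[volume] fun ξ => c * (sz α ξ * A0 ξ) + v.2 ξ) ∧
      g.2 =ᵐ[volume] fun ξ => c * (sz α ξ * v.2 ξ) - sS a b α ξ * A0 ξ - M ξ) ↔
    DiagGraph c γ α (rotCLE γ hγ v) (rotCLE γ hγ (g - d)) := by
  have hγC : (γ : ℂ) ≠ 0 := by exact_mod_cast hγ
  have hγ2C : ((a / b : ℝ) : ℂ) = (γ : ℂ) ^ 2 := by rw [← hγ2]; push_cast; ring
  have s5 := coeFn_sub g.1 d.1
  have s6 := coeFn_sub g.2 d.2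
  have r1 := rotCLE_fst hγ v
  have r2 := rotCLE_snd hγ v
  have r3 := rotCLE_fst hγ (g - d)
  have r4 := rotCLE_snd hγ (g - d)
  unfold DiagGraph
  have key : ∀ᵐ ξ, (A1 ξ = c * (sz α ξ * A0 ξ) + v.2 ξ ∧
      g.2 ξ = c * (sz α ξ * v.2 ξ) - sS a b α ξ * A0 ξ - M ξ) ↔
      ((rotCLE γ hγ (g - d)).1 ξ = I * (c * fx ξ - γ * N0 α ξ : ℝ) * (rotCLE γ hγ v).1 ξ ∧
        (rotCLE γ hγ (g - d)).2 ξ =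
          I * (c * fx ξ + γ * N0 α ξ : ℝ) * (rotCLE γ hγ v).2 ξ) := by
    filter_upwards [s1, s3, s5, s6, s7, s8, r1, r2, r3, r4] with ξ s1 s3 s5 s6 s7 s8 r1 r2 r3 r4
    have hN : (N0 α ξ : ℂ) ≠ 0 := by exact_mod_cast (N0_pos α ξ).ne'
    have a0 : A0 ξ = (N0 α ξ : ℂ)⁻¹ * v.1 ξ := by rw [s1]; field_simp
    have a1 : A1 ξ = (N0 α ξ : ℂ)⁻¹ * g.1 ξ := by rw [s3]; field_simp
    have s5' : (g - d).1 ξ = g.1 ξ + c * α * v.1 ξ := by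
      rw [Prod.fst_sub, s5, Pi.sub_apply, s7]; ring
    have s6' : (g - d).2 ξ = g.2 ξ + (c * α * v.2 ξ + (sS a b α ξ - γ ^ 2 * (N0 α ξ : ℂ) ^ 2) /
        (N0 α ξ : ℂ) * v.1 ξ + M ξ) := by
      rw [Prod.snd_sub, s6, Pi.sub_apply, s8, sR, hγ2C]; ring
    rw [r1, r2, r3, r4, s5', s6', a0, a1, sz_eq]
    push_cast
    exact diag_pointwise hγC hN
  constructor
  · rintro ⟨h1, h2⟩
    have := (h1.and h2).mp (key.mono fun ξ h h' => h.1 h')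
    exact eventually_and.1 this
  · rintro ⟨h1, h2⟩
    have := (h1.and h2).mp (key.mono fun ξ h h' => h.2 h')
    exact eventually_and.1 this

theorem equiv_trans_sub_symm {X Y W : Type*} [NormedAddCommGroup X] [NormedSpace ℂ X]
    [NormedAddCommGroup Y] [NormedSpace ℂ Y] [NormedAddCommGroup W] [NormedSpace ℂ W]
    (e : X ≃L[ℂ] Y) (r : Y ≃L[ℂ] W) (f : X) (B : X →L[ℂ] Y) (u : X) :
    (e.trans r) (f - ((e.symm : Y →L[ℂ] X).comp B) u) = r (e f - B u) := by
  simp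

/-- The linearized operator generates a strongly continuous semigroup on `X`: up to a bounded
operator it is similar to multiplication by the imaginary functions `i (c ξ ∓ γ N₀)`, where
`γ² = a / b`. -/
theorem Params.exists_semigroup (hp : Params a b c α) :
    ∃ T : ℝ → Xplane α →L[ℂ] Xplane α, IsSemigroupGeneratedBy (LGraph a b c α) T := by
  set γ := sqrt (a / b) with hγd
  have hab : 0 < a / b := div_pos hp.a_pos hp.b_pos
  have hγ : γ ≠ 0 := (sqrt_pos.2 hab).ne'
  have hγ2 : γ ^ 2 = a / b := sq_sqrt hab.le
  obtain ⟨T, hT⟩ := exists_semigroup_diag c γ α ((symX α).trans (rotCLE γ hγ))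
    (((symX α).symm : (Hh × Hh) →L[ℂ] Xplane α).comp (bddPart a b c α))
  refine ⟨T, hT.congr_graph fun u f => ?_⟩
  rw [hp.LGraph_iff]
  have e := equiv_trans_sub_symm (symX α) (rotCLE γ hγ) f (bddPart a b c α) u
  have e' : ((symX α).trans (rotCLE γ hγ)) u = rotCLE γ hγ (symX α u) := rfl
  have key := diagGraph_rotCLE_iff (c := c) hγ hγ2 (symX α u) (symX α f) (bddPart a b c α u)
    (U α (u.fst.1 0)) (U α (f.fst.1 0)) (varOp a b c α u) (symX_fst u) (symX_fst f)
    (bddPart_fst u) (hp.bddPart_snd u)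
  rw [e, e', ← key, symX_snd, symX_snd]

/-! ### Fourier transform in the transverse variable -/

instance sigmaFinite_weighted {E : Type*} [NormedAddCommGroup E] [NormedSpace ℝ E] [MeasureSpace E]
    [SigmaFinite (volume : Measure E)] (w : E → ℝ) : SigmaFinite (weighted w) :=
  SigmaFinite.withDensity_ofReal _

theorem weighted_wt2 (α : ℝ) : weighted (wt2 α) = (weighted (wt1 α)).prod volume := by
  rw [weighted, weighted, prod_withDensity_left (measurable_weight (wt1 α).continuous)]
  rfl

/-- The Fourier transform in `y` on `L²_α(ℝ²)`, with values in `L²_α(ℝ)`. -/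
def fib (α : ℝ) : L2w (wt2 α) ≃ₗᵢ[ℂ] Lp (L2w (wt1 α)) 2 (volume : Measure ℝ) :=
  (curryL2 (weighted_wt2 α)).trans (Lp.fourierTransformₗᵢ ℝ (L2w (wt1 α)))

theorem fib_apply (α : ℝ) (f : L2w (wt2 α)) : fib α f = 𝓕 (curryL2 (weighted_wt2 α) f) := rfl

/-- The tensor product of two functions. -/
def tens (χ θ : ℝ → ℂ) : ℝ × ℝ → ℂ := fun p => χ p.1 * θ p.2

theorem IsTest.tens {χ θ : ℝ → ℂ} (hχ : IsTest χ) (hθ : IsTest θ) : IsTest (tens χ θ) := by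
  refine ⟨(hχ.1.comp contDiff_fst).mul (hθ.1.comp contDiff_snd), ?_⟩
  refine HasCompactSupport.intro (hχ.2.isCompact.prod hθ.2.isCompact) fun p hp => ?_
  rw [mem_prod, not_and_or] at hp
  rcases hp with h | h
  · simp [BenneyLuke.tens, image_eq_zero_of_notMem_tsupport h]
  · simp [BenneyLuke.tens, image_eq_zero_of_notMem_tsupport h]

theorem integrable_mul_test {E : Type*} [NormedAddCommGroup E] [NormedSpace ℝ E] [MeasureSpace E]
    [BorelSpace E] [SecondCountableTopology E] [IsFiniteMeasureOnCompacts (volume : Measure E)]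
    {w : C(E, ℝ)} (f : L2w w) {ψ : E → ℂ} (hψ : IsTest ψ) : Integrable fun x => f x * ψ x := by
  have h1 := (memLp_weighted_iff w.continuous).1 (memLp f)
  have h2 : MemLp (fun x => (exp (-w x) : ℂ) * ψ x) 2 (volume : Measure E) :=
    Continuous.memLp_of_hasCompactSupport (Continuous.mul (by fun_prop) hψ.1.continuous)
      hψ.2.mul_left
  refine (h1.integrable_mul h2).congr (.of_forall fun x => ?_)
  have he : ((exp (w x) : ℝ) : ℂ) * ((exp (-w x) : ℝ) : ℂ) = 1 := by
    rw [← ofReal_mul, ← exp_add]; simp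
  simp only [Pi.mul_apply]
  calc _ = (((exp (w x) : ℝ) : ℂ) * ((exp (-w x) : ℝ) : ℂ)) * (f x * ψ x) := by ring
    _ = _ := by rw [he, one_mul]

theorem exists_testVec (α : ℝ) {χ : ℝ → ℂ} (hχ : IsTest χ) :
    ∃ X : L2w (wt1 α), ∀ f : L2w (wt1 α), inner ℂ X f = ∫ z, f z * χ z := by
  obtain ⟨l, hl⟩ := exists_pairing (wt1 α).continuous hχ.1.continuous hχ.2
  refine ⟨(InnerProductSpace.toDual ℂ _).symm l, fun f => ?_⟩
  rw [InnerProductSpace.toDual_symm_apply, hl]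

/-- Parseval's identity in the transverse variable, for products of test functions. -/
theorem integral_mul_tens (f : L2w (wt2 α)) {χ θ : ℝ → ℂ} (hχ : IsTest χ) (hθ : IsTest θ) :
    Integrable (fun η => ofFun (fib α f η) χ * 𝓕⁻ θ η) ∧
      ofFun f (tens χ θ) = ∫ η, ofFun (fib α f η) χ * 𝓕⁻ θ η := by
  obtain ⟨X, hX⟩ := exists_testVec α hχ
  set Φ : ℝ → L2w (wt1 α) := fun y => conj (θ y) • X with hΦ
  have hc : Continuous Φ := (Complex.continuous_conj.comp hθ.1.continuous).smul continuous_const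
  have hs : HasCompactSupport Φ := hθ.conj.2.smul_right
  have h1 : Integrable Φ := hc.integrable_of_hasCompactSupport hs
  have h2 : MemLp Φ 2 := hc.memLp_of_hasCompactSupport hs
  have hF : ∀ η, 𝓕 Φ η = conj (𝓕⁻ θ η) • X := by
    intro η
    rw [← fourier_conj, fourier_eq, fourier_eq, ← integral_smul_const]
    refine integral_congr_ae (.of_forall fun y => ?_)
    simp only [hΦ, smul_assoc]
  have key := integral_inner_fourier h1 h2 (curryL2 (weighted_wt2 α) f)
  have e2 : ∀ η, inner ℂ (𝓕 Φ η) ((𝓕 (curryL2 (weighted_wt2 α) f) :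
      Lp (L2w (wt1 α)) 2 (volume : Measure ℝ)) η) = ofFun (fib α f η) χ * 𝓕⁻ θ η := by
    intro η
    rw [hF, inner_smul_left, conj_conj, hX, mul_comm]
    rfl
  have hi := integrable_inner_Lp (memLp_fourier h1 h2) (memLp (fib α f))
  refine ⟨hi.congr (Eventually.of_forall e2), ?_⟩
  rw [← integral_congr_ae (Eventually.of_forall e2), ← key]
  have hfi := integrable_mul_test f (hχ.tens hθ)
  rw [ofFun, Measure.volume_eq_prod, integral_prod_symm _ hfi]
  refine integral_congr_ae ?_
  filter_upwards [curryL2_ae (weighted_wt2 α) f] with y hy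
  rw [hΦ, inner_smul_left, conj_conj, hX, ← integral_const_mul]
  refine integral_congr_ae ?_
  filter_upwards [(ae_eq_weighted_iff (wt1 α).continuous).1 hy] with z hz
  rw [hz, tens]
  ring

theorem fourierInv_tens (χ θ : ℝ → ℂ) (ξ : E2) :
    𝓕⁻ (fun x : E2 => tens χ θ x.ofLp) ξ = 𝓕⁻ χ ξ.ofLp.1 * 𝓕⁻ θ ξ.ofLp.2 := by
  rw [fourierInv_eq, fourierInv_eq, fourierInv_eq, ← integral_prod_mul,
    ← Measure.volume_eq_prod, ← (volume_preserving_ofLp ℝ ℝ).integral_comp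
      (MeasurableEquiv.toLp 2 (ℝ × ℝ)).symm.measurableEmbedding]
  refine integral_congr_ae (.of_forall fun x => ?_)
  simp only [WithLp.prod_inner_apply, AddChar.map_add_eq_mul, tens, Circle.smul_def,
    Circle.coe_mul, smul_eq_mul]
  ring

/-- The tensor products of test functions separate functions of the frequency. -/
theorem HasSym.eqDistr_of_tens {S T : Functional (ℝ × ℝ)} {h k : E2 → ℂ}
    (hT : HasSym α T h) (hS : HasSym α S k)
    (hTS : ∀ χ θ, IsTest χ → IsTest θ → T (tens χ θ) = S (tens χ θ)) : EqDistr T S := by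
  rw [hT.eqDistr_iff hS]
  have key : (fun ξ => h ξ - k ξ) =ᵐ[volume] 0 := by
    refine ae_eq_zero_of_forall_mem
      (fun φ => ∃ χ θ, IsTest χ ∧ IsTest θ ∧ φ = fun x : E2 => tens χ θ x.ofLp) ?_ ?_ ?_ ?_
    · rintro φ ⟨χ, θ, hχ, hθ, rfl⟩
      exact isTest_comp_ofLp (hχ.tens hθ)
    · rintro φ ⟨χ, θ, hχ, hθ, rfl⟩ t
      exact ⟨_, _, hχ.comp_add_right t.ofLp.1, hθ.comp_add_right t.ofLp.2, rfl⟩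
    · intro ξ₀
      obtain ⟨χ, hχ, h1⟩ := exists_test_fourierInv_ne_zero ξ₀.ofLp.1
      obtain ⟨θ, hθ, h2⟩ := exists_test_fourierInv_ne_zero ξ₀.ofLp.2
      refine ⟨_, ⟨χ, θ, hχ, hθ, rfl⟩, ?_⟩
      rw [fourierInv_tens]
      exact mul_ne_zero h1 h2
    · rintro φ ⟨χ, θ, hχ, hθ, rfl⟩
      have hχ' : IsTest fun z => (exp (α * z) : ℂ) * χ z :=
        hχ.smooth_mul (ofRealCLM.contDiff.comp (Real.contDiff_exp.comp (by fun_prop)))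
      have e : hat α (tens (fun z => (exp (α * z) : ℂ) * χ z) θ) =
          𝓕⁻ fun x : E2 => tens χ θ x.ofLp := by
        rw [hat]
        congr 1
        ext x
        simp only [tens]
        rw [← mul_assoc, ← mul_assoc, ← ofReal_mul, ← exp_add]
        simp
      obtain ⟨h1, h2⟩ := (hT.sub hS) _ (hχ'.tens hθ)
      rw [e] at h1 h2
      refine ⟨h1, ?_⟩
      rw [← h2, Pi.sub_apply, hTS _ _ hχ' hθ, sub_self]
  filter_upwards [key] with ξ hξ
  exact sub_eq_zero.1 hξ

/-- The distribution `T` on the plane is the superposition of the distributions `R η` on the line,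
which depend on `L²_α(ℝ)` functions through finitely many pairings. -/
def FibSym (α : ℝ) (T : Functional (ℝ × ℝ)) (R : ℝ → Functional ℝ) : Prop :=
  (∀ χ θ : ℝ → ℂ, IsTest χ → IsTest θ → Integrable (fun η => R η χ * (𝓕⁻ θ : ℝ → ℂ) η) ∧
    T (tens χ θ) = ∫ η, R η χ * (𝓕⁻ θ : ℝ → ℂ) η) ∧
  ∃ (ι : Type) (_ : Fintype ι) (k : ι → ℝ → ℂ) (w : ι → ℝ → L2w (wt1 α))
    (A : ι → (ℝ → ℂ) → (ℝ → ℂ)), (∀ i χ, IsTest χ → IsTest (A i χ)) ∧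
      ∀ η χ, IsTest χ → R η χ = ∑ i, k i η * ∫ z, w i η z * A i χ z

theorem fibSym_ofFun (f : L2w (wt2 α)) : FibSym α (ofFun f) fun η => ofFun (fib α f η) := by
  refine ⟨fun χ θ hχ hθ => integral_mul_tens f hχ hθ, Unit, inferInstance, fun _ _ => 1,
    fun _ η => fib α f η, fun _ χ => χ, fun _ _ h => h, fun η χ _ => ?_⟩
  simp [ofFun]

theorem fderiv_tens_fst {χ θ : ℝ → ℂ} (hχ : IsTest χ) (hθ : IsTest θ) :
    (fun x => fderiv ℝ (tens χ θ) x ((1 : ℝ), (0 : ℝ))) = tens (fun z => fderiv ℝ χ z 1) θ := by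
  ext x
  have h1 := ((hχ.1.differentiable (by simp)).differentiableAt (x := x.1)).hasFDerivAt.comp x
    (hasFDerivAt_fst (𝕜 := ℝ) (p := x))
  have h2 := ((hθ.1.differentiable (by simp)).differentiableAt (x := x.2)).hasFDerivAt.comp x
    (hasFDerivAt_snd (𝕜 := ℝ) (p := x))
  rw [show fderiv ℝ (tens χ θ) x = _ from (h1.mul h2).fderiv]
  simp [tens]
  ring

theorem fderiv_tens_snd {χ θ : ℝ → ℂ} (hχ : IsTest χ) (hθ : IsTest θ) :
    (fun x => fderiv ℝ (tens χ θ) x ((0 : ℝ), (1 : ℝ))) = tens χ (fun z => fderiv ℝ θ z 1) := by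
  ext x
  have h1 := ((hχ.1.differentiable (by simp)).differentiableAt (x := x.1)).hasFDerivAt.comp x
    (hasFDerivAt_fst (𝕜 := ℝ) (p := x))
  have h2 := ((hθ.1.differentiable (by simp)).differentiableAt (x := x.2)).hasFDerivAt.comp x
    (hasFDerivAt_snd (𝕜 := ℝ) (p := x))
  rw [show fderiv ℝ (tens χ θ) x = _ from (h1.mul h2).fderiv]
  simp [tens]

theorem fourierInv_fderiv {θ : ℝ → ℂ} (hθ : IsTest θ) (η : ℝ) :
    𝓕⁻ (fun y => fderiv ℝ θ y 1) η = -((2 * π * η : ℝ) * I) * 𝓕⁻ θ η := by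
  have h := Real.fourier_deriv (f := θ) hθ.integrable (hθ.1.differentiable (by simp))
    ((hθ.fderiv 1).integrable.congr (.of_forall fun y => fderiv_apply_one_eq_deriv))
  rw [Real.fourierInv_eq_fourier_neg, Real.fourierInv_eq_fourier_neg]
  have e : (fun y => fderiv ℝ θ y 1) = deriv θ := by
    ext y; exact fderiv_apply_one_eq_deriv
  rw [e, h]
  simp only [smul_eq_mul]
  push_cast
  ring

namespace FibSym

variable {S T : Functional (ℝ × ℝ)} {R Q : ℝ → Functional ℝ}

theorem congr (hT : FibSym α T R) (h : ∀ η, R η = Q η) : FibSym α T Q := by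
  rwa [← funext h]

theorem dz (hT : FibSym α T R) :
    FibSym α (pd ((1 : ℝ), (0 : ℝ)) T) fun η => pd (1 : ℝ) (R η) := by
  obtain ⟨h1, ι, hι, k, w, A, hA, h2⟩ := hT
  refine ⟨fun χ θ hχ hθ => ?_, ι, hι, fun i η => -k i η, w, fun i χ => A i fun z => fderiv ℝ χ z 1,
    fun i χ hχ => hA i _ (hχ.fderiv 1), fun η χ hχ => ?_⟩
  · obtain ⟨a1, a2⟩ := h1 _ θ (hχ.fderiv 1) hθ
    simp only [pd, neg_mul]
    refine ⟨a1.neg, ?_⟩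
    rw [integral_neg, ← a2, fderiv_tens_fst hχ hθ]
  · change -(R η _) = _
    rw [h2 _ _ (hχ.fderiv 1), ← Finset.sum_neg_distrib]
    simp

theorem dy (hT : FibSym α T R) :
    FibSym α (pd ((0 : ℝ), (1 : ℝ)) T)
      fun η => fun χ => ((2 * π * η : ℝ) * I) * R η χ := by
  obtain ⟨h1, ι, hι, k, w, A, hA, h2⟩ := hT
  refine ⟨fun χ θ hχ hθ => ?_, ι, hι, fun i η => ((2 * π * η : ℝ) * I) * k i η, w, A,
    hA, fun η χ hχ => ?_⟩
  · obtain ⟨a1, a2⟩ := h1 χ _ hχ (hθ.fderiv 1)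
    simp only [fourierInv_fderiv hθ] at a1 a2
    have e : ∀ η, ((2 * π * η : ℝ) * I) * R η χ * 𝓕⁻ θ η =
        -(R η χ * (-((2 * π * η : ℝ) * I) * 𝓕⁻ θ η)) := fun η => by ring
    simp only [e]
    refine ⟨a1.neg, ?_⟩
    rw [integral_neg, ← a2, pd, fderiv_tens_snd hχ hθ]
  · simp only [h2 _ _ hχ, Finset.mul_sum, mul_assoc]

theorem add (hT : FibSym α T R) (hS : FibSym α S Q) : FibSym α (T + S) fun η => R η + Q η := by
  obtain ⟨h1, ι, hι, k, w, A, hA, h2⟩ := hT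
  obtain ⟨h1', ι', hι', k', w', A', hA', h2'⟩ := hS
  refine ⟨fun χ θ hχ hθ => ?_, ι ⊕ ι', inferInstance, Sum.elim k k', Sum.elim w w', Sum.elim A A',
    ?_, fun η χ hχ => ?_⟩
  · obtain ⟨a1, a2⟩ := h1 χ θ hχ hθ
    obtain ⟨b1, b2⟩ := h1' χ θ hχ hθ
    simp only [Pi.add_apply, add_mul]
    exact ⟨a1.add b1, by rw [a2, b2, ← integral_add a1 b1]⟩
  · rintro (i | i) χ hχ
    · exact hA i χ hχ
    · exact hA' i χ hχ
  · change R η χ + Q η χ = _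
    rw [h2 η χ hχ, h2' η χ hχ, Fintype.sum_sum_type]
    rfl

theorem smul (hT : FibSym α T R) (r : ℝ) : FibSym α (r • T) fun η => r • R η := by
  obtain ⟨h1, ι, hι, k, w, A, hA, h2⟩ := hT
  refine ⟨fun χ θ hχ hθ => ?_, ι, hι, fun i η => r * k i η, w, A, hA, fun η χ hχ => ?_⟩
  · obtain ⟨a1, a2⟩ := h1 χ θ hχ hθ
    simp only [Pi.smul_apply, real_smul, mul_assoc]
    exact ⟨a1.const_mul _, by rw [integral_const_mul, a2]⟩
  · simp only [Pi.smul_apply, real_smul, h2 _ _ hχ, Finset.mul_sum, mul_assoc]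

theorem sub (hT : FibSym α T R) (hS : FibSym α S Q) : FibSym α (T - S) fun η => R η - Q η := by
  have h := hT.add (hS.smul (-1))
  simpa only [neg_smul, one_smul, ← sub_eq_add_neg] using h

theorem mulBy (hT : FibSym α T R) {g : ℝ → ℝ} (hg : ContDiff ℝ ∞ g) :
    FibSym α (BenneyLuke.mulBy (fun x => g x.1) T) fun η => BenneyLuke.mulBy (fun x => g x) (R η) := by
  have hg' : ContDiff ℝ ∞ fun z => (g z : ℂ) := ofRealCLM.contDiff.comp hg
  obtain ⟨h1, ι, hι, k, w, A, hA, h2⟩ := hT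
  refine ⟨fun χ θ hχ hθ => ?_, ι, hι, k, w, fun i χ => A i fun z => (g z : ℂ) * χ z,
    fun i χ hχ => hA i _ (hχ.smooth_mul hg'), fun η χ hχ => ?_⟩
  · obtain ⟨a1, a2⟩ := h1 _ θ (hχ.smooth_mul hg') hθ
    refine ⟨a1, ?_⟩
    simp only [BenneyLuke.mulBy]
    rw [← a2]
    congr 1
    ext x
    simp only [tens]
    ring
  · exact h2 η _ (hχ.smooth_mul hg')

/-- Separability of the space of test functions with respect to finitely many square integrable
expressions: it suffices to test with a fixed countable set. -/
theorem exists_countable_tests {ι : Type} [Fintype ι] (A : ι → (ℝ → ℂ) → (ℝ → ℂ))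
    (hA : ∀ i χ, IsTest χ → IsTest (A i χ)) :
    ∃ D : ℕ → ℝ → ℂ, (∀ n, IsTest (D n)) ∧ ∀ (k : ι → ℂ) (w : ι → L2w (wt1 α)),
      (∀ n, ∑ i, k i * ∫ z, w i z * A i (D n) z = 0) →
      ∀ χ, IsTest χ → ∑ i, k i * ∫ z, w i z * A i χ z = 0 := by
  choose X hX using fun (i : ι) (χ : {χ : ℝ → ℂ // IsTest χ}) => exists_testVec α (hA i χ.1 χ.2)
  have : Fact ((2 : ENNReal) ≠ ⊤) := ⟨by simp⟩
  let J : {χ : ℝ → ℂ // IsTest χ} → (ι → L2w (wt1 α)) := fun χ i => X i χ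
  let tt : TopologicalSpace {χ : ℝ → ℂ // IsTest χ} := TopologicalSpace.induced J inferInstance
  have hJ : Continuous J := continuous_induced_dom
  have : SecondCountableTopology {χ : ℝ → ℂ // IsTest χ} :=
    TopologicalSpace.secondCountableTopology_induced _ _ J
  have : Nonempty {χ : ℝ → ℂ // IsTest χ} := ⟨⟨0, contDiff_const, HasCompactSupport.zero⟩⟩
  refine ⟨fun n => (TopologicalSpace.denseSeq {χ : ℝ → ℂ // IsTest χ} n).1,
    fun n => (TopologicalSpace.denseSeq {χ : ℝ → ℂ // IsTest χ} n).2, fun k w hw χ hχ => ?_⟩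
  have hc : Continuous fun χ : {χ : ℝ → ℂ // IsTest χ} => ∑ i, k i * inner ℂ (X i χ) (w i) := by
    refine continuous_finsetSum _ fun i _ => continuous_const.mul ?_
    exact ((continuous_apply i).comp hJ).inner continuous_const
  have hz : (fun χ : {χ : ℝ → ℂ // IsTest χ} => ∑ i, k i * inner ℂ (X i χ) (w i)) = fun _ => 0 := by
    refine Continuous.ext_on (TopologicalSpace.denseRange_denseSeq _) hc continuous_const ?_
    rintro _ ⟨n, rfl⟩
    simp only [hX]
    exact hw n
  have := congrFun hz ⟨χ, hχ⟩
  simpa only [hX] using this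

/-- Distributions on the plane are equal if and only if almost all their fibers are. -/
theorem eqDistr_iff (hT : FibSym α T R) (hS : FibSym α S Q) {h k : E2 → ℂ}
    (hT' : HasSym α T h) (hS' : HasSym α S k) :
    EqDistr T S ↔ ∀ᵐ η, EqDistr (R η) (Q η) := by
  constructor
  · intro hTS
    obtain ⟨h1, ι, hι, k, w, A, hA, h2⟩ := hT.sub hS
    obtain ⟨D, hD, hD2⟩ := exists_countable_tests (α := α) A hA
    have key : ∀ᵐ η, ∀ n, (R η - Q η) (D n) = 0 := by
      rw [ae_all_iff]
      intro n
      refine ae_eq_zero_of_forall_test (h := fun η => (R η - Q η) (D n)) fun θ hθ => ?_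
      obtain ⟨a1, a2⟩ := h1 (D n) θ (hD n) hθ
      refine ⟨a1, ?_⟩
      rw [← a2, Pi.sub_apply, hTS _ ((hD n).tens hθ), sub_self]
    filter_upwards [key] with η hη χ hχ
    have h3 := hD2 (fun i => k i η) (fun i => w i η) (fun n => by rw [← h2 η _ (hD n)]; exact hη n)
      χ hχ
    rw [← h2 η χ hχ] at h3
    exact sub_eq_zero.1 h3
  · intro hRQ
    refine hT'.eqDistr_of_tens hS' fun χ θ hχ hθ => ?_
    rw [(hT.1 χ θ hχ hθ).2, (hS.1 χ θ hχ hθ).2]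
    refine integral_congr_ae ?_
    filter_upwards [hRQ] with η hη
    rw [hη χ hχ]

theorem lap (hT : FibSym α T R) : FibSym α (lap2 T) fun η =>
    pd (1 : ℝ) (pd (1 : ℝ) (R η)) - (2 * π * η) ^ 2 • R η := by
  refine (hT.dz.dz.add hT.dy.dy).congr fun η => ?_
  ext χ
  simp only [Pi.add_apply, Pi.sub_apply, Pi.smul_apply, real_smul]
  push_cast
  linear_combination (2 * π * η : ℂ) ^ 2 * R η χ * I_sq

end FibSym

/-! ### Fibers of the spaces and of the operator -/

theorem eq_of_eqDistr {f g : L2w (wt1 α)} (h : EqDistr (ofFun f) (ofFun g)) : f = g := by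
  have hloc : ∀ f : L2w (wt1 α), LocallyIntegrable (expMulLI (wt1 α) f) := fun f =>
    (memLp (expMulLI (wt1 α) f)).locallyIntegrable (by norm_num)
  have key : expMulLI (wt1 α) f =ᵐ[volume] expMulLI (wt1 α) g := by
    refine ae_eq_of_integral_contDiff_smul_eq (hloc f) (hloc g) fun χ hχ hχs => ?_
    have hw : ContDiff ℝ ∞ fun z => (exp (α * z) : ℂ) * (χ z : ℂ) :=
      (ofRealCLM.contDiff.comp (Real.contDiff_exp.comp (by fun_prop))).mul
        (ofRealCLM.contDiff.comp hχ)
    have hs : HasCompactSupport fun z => (exp (α * z) : ℂ) * (χ z : ℂ) :=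
      HasCompactSupport.mul_left (hχs.comp_left (g := fun r : ℝ => (r : ℂ)) (by simp))
    have h1 := h _ ⟨hw, hs⟩
    have e : ∀ f : L2w (wt1 α), ∫ z, χ z • expMulLI (wt1 α) f z =
        ofFun f fun z => (exp (α * z) : ℂ) * (χ z : ℂ) := by
      intro f
      refine integral_congr_ae ?_
      filter_upwards [expMulLI_ae (wt1 α) f] with z hz
      rw [hz, real_smul]
      change _ * ((exp (α * z) : ℂ) * f z) = _
      ring
    rw [e, e, h1]
  exact (expMulLI (wt1 α)).injective (Lp.ext key)

theorem mem_H1line_iff (W : PiLp 2 (fun _ : Fin 2 => L2w (wt1 α))) :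
    W ∈ H1line α ↔ EqDistr (pd (1 : ℝ) (ofFun (W 0))) (ofFun (W 1)) := by
  change (∀ i : Fin 1, _) ↔ _
  rw [Fin.forall_fin_one]
  rfl

theorem mem_H1plane_iff_eqDistr (W : PiLp 2 (fun _ : Fin 3 => L2w (wt2 α))) :
    W ∈ H1plane α ↔ EqDistr (pd ((1 : ℝ), (0 : ℝ)) (ofFun (W 0))) (ofFun (W 1)) ∧
      EqDistr (pd ((0 : ℝ), (1 : ℝ)) (ofFun (W 0))) (ofFun (W 2)) := by
  change (∀ i : Fin 2, _) ↔ _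
  rw [Fin.forall_fin_two]
  rfl

/-- Membership in `H¹_α(ℝ²)` in terms of fibers. -/
theorem mem_H1plane_iff_fib (W : PiLp 2 (fun _ : Fin 3 => L2w (wt2 α))) :
    W ∈ H1plane α ↔
      (∀ᵐ η, EqDistr (pd (1 : ℝ) (ofFun (fib α (W 0) η))) (ofFun (fib α (W 1) η))) ∧
      ∀ᵐ η : ℝ, fib α (W 2) η = ((2 * π * η : ℝ) * I) • fib α (W 0) η := by
  rw [mem_H1plane_iff_eqDistr]
  refine and_congr ((fibSym_ofFun (W 0)).dz.eqDistr_iff (fibSym_ofFun (W 1))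
    (hasSym_ofFun (W 0)).dz (hasSym_ofFun (W 1))) (((fibSym_ofFun (W 0)).dy.eqDistr_iff
      (fibSym_ofFun (W 2)) (hasSym_ofFun (W 0)).dy (hasSym_ofFun (W 2))).trans ?_)
  have e : ∀ η : ℝ, (fun χ : ℝ → ℂ => ((2 * π * η : ℝ) * I) * ofFun (fib α (W 0) η) χ) =
      ofFun (((2 * π * η : ℝ) * I) • fib α (W 0) η : L2w (wt1 α)) := by
    intro η
    rw [ofFun_congr ((ae_eq_weighted_iff (wt1 α).continuous).1
      (coeFn_smul ((2 * π * η : ℝ) * I) (fib α (W 0) η)))]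
    ext χ
    rw [ofFun, ofFun, ← integral_const_mul]
    simp only [Pi.smul_apply, smul_eq_mul, mul_assoc]
  simp only [e]
  refine eventually_congr (.of_forall fun η => ⟨fun h => (eq_of_eqDistr h).symm, fun h => ?_⟩)
  rw [h]
  exact fun _ _ => rfl

/-- The Laplacian on the fiber over the frequency `η`. -/
abbrev lap1 (η : ℝ) (T : Functional ℝ) : Functional ℝ :=
  pd (1 : ℝ) (pd (1 : ℝ) T) - (2 * π * η) ^ 2 • T

/-- The linearized operator acts fiberwise. -/
theorem LGraph_iff_fib (a b c α : ℝ) (u f : Xplane α) : LGraph a b c α u f ↔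
    ∀ᵐ η : ℝ, LinRel a b c (pd (1 : ℝ)) (lap1 η) id (fib α (u.fst.1 0) η) (fib α u.snd η)
      (fib α (f.fst.1 0) η) (fib α f.snd η) := by
  have hΦ := fibSym_ofFun (u.fst.1 0)
  have hΨ := fibSym_ofFun u.snd
  have hF := fibSym_ofFun (f.fst.1 0)
  have hG := fibSym_ofFun f.snd
  have hr := isTanhPoly_rc a b c
  have hq := isTanhPoly_qc a b c
  obtain ⟨h, hR, _⟩ := hasSym_rhs a b c u
  have h1 := hF.eqDistr_iff ((hΦ.dz.smul c).add hΨ) (hasSym_ofFun _) (hasSym_first c u)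
  have hL := (hG.sub (hΨ.dz.smul c)).sub ((hG.sub (hΨ.dz.smul c)).lap.smul b)
  have hR' := ((hΦ.lap.sub (hΦ.lap.lap.smul a)).sub
    (((hΦ.dz.mulBy hr.deriv.isMult.1).smul 2).add (hΦ.lap.mulBy hr.isMult.1))).sub
    (((hΨ.dz.mulBy hq.isMult.1).smul 2).add (hΨ.mulBy hq.deriv.isMult.1))
  have h2 := hL.eqDistr_iff hR' (hasSym_lhs b c u f) hR
  exact (and_congr h1 h2).trans eventually_and.symm

/-- `x` is the fiber of `u` over the frequency `η`. -/
structure IsFiber (u : Xplane α) (η : ℝ) (x : Xline α) : Prop where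
  fst0 : x.fst.1 0 = fib α (u.fst.1 0) η
  fst1 : x.fst.1 1 = fib α (u.fst.1 1) η
  snd : x.snd = fib α u.snd η

theorem exists_isFiber (u : Xplane α) : ∀ᵐ η, ∃ x : Xline α, IsFiber u η x := by
  filter_upwards [((mem_H1plane_iff_fib _).1 u.fst.2).1] with η hη
  have hm : (toLp 2 ![fib α (u.fst.1 0) η, fib α (u.fst.1 1) η] :
      PiLp 2 (fun _ : Fin 2 => L2w (wt1 α))) ∈ H1line α := by
    rw [mem_H1line_iff]
    exact hη
  exact ⟨toLp 2 (⟨_, hm⟩, fib α u.snd η), rfl, rfl, rfl⟩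

theorem LGraph_iff_fiber {u f : Xplane α} {x y : ℝ → Xline α}
    (hx : ∀ᵐ η, IsFiber u η (x η)) (hy : ∀ᵐ η, IsFiber f η (y η)) :
    LGraph a b c α u f ↔ ∀ᵐ η : ℝ, LEtaGraph a b c α (2 * π * η) (x η) (y η) := by
  rw [LGraph_iff_fib]
  refine eventually_congr ?_
  filter_upwards [hx, hy] with η hxη hyη
  rw [LEtaGraph, Xline.fn1, Xline.fn2, Xline.fn1, Xline.fn2, hxη.fst0, hxη.snd, hyη.fst0, hyη.snd]

/-! ### Operators acting on fibers -/

/-- Operator valued multipliers on `L²`. -/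
def mulOp {H H' : Type*} [NormedAddCommGroup H] [NormedSpace ℂ H] [NormedAddCommGroup H']
    [NormedSpace ℂ H'] {M : ℝ → H →L[ℂ] H'} (hM : MemLp M ⊤ (volume : Measure ℝ)) :
    Lp H 2 (volume : Measure ℝ) →L[ℂ] Lp H' 2 (volume : Measure ℝ) :=
  (ContinuousLinearMap.id ℂ (H →L[ℂ] H')).holderL volume ⊤ 2 2 (hM.toLp M)

theorem coeFn_mulOp {H H' : Type*} [NormedAddCommGroup H] [NormedSpace ℂ H] [NormedAddCommGroup H']
    [NormedSpace ℂ H'] {M : ℝ → H →L[ℂ] H'} (hM : MemLp M ⊤ (volume : Measure ℝ))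
    (f : Lp H 2 (volume : Measure ℝ)) : mulOp hM f =ᵐ[volume] fun η => M η (f η) := by
  have h1 := (ContinuousLinearMap.id ℂ (H →L[ℂ] H')).coeFn_holder (r := 2) (hM.toLp M) f
  filter_upwards [h1, hM.coeFn_toLp] with x hx hx'
  refine hx.trans ?_
  rw [hx']; rfl

/-- The components of an element of `H¹_α(ℝ) × L²_α(ℝ)`. -/
def lcmp (α : ℝ) (i : Fin 2) : Xline α →L[ℂ] L2w (wt1 α) :=
  (PiLp.proj 2 (fun _ : Fin 2 => L2w (wt1 α)) i).comp ((H1line α).subtypeL.comp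
    ((ContinuousLinearMap.fst ℂ _ _).comp
      (prodContinuousLinearEquiv 2 ℂ (H1line α) (L2w (wt1 α))).toContinuousLinearMap))

/-- The second component of an element of `H¹_α(ℝ) × L²_α(ℝ)`. -/
def lcmpS (α : ℝ) : Xline α →L[ℂ] L2w (wt1 α) :=
  (ContinuousLinearMap.snd ℂ _ _).comp
      (prodContinuousLinearEquiv 2 ℂ (H1line α) (L2w (wt1 α))).toContinuousLinearMap

theorem lcmp_apply (i : Fin 2) (u : Xline α) : lcmp α i u = u.fst.1 i := rfl

/-- The functions of the frequency which vanish for `R < |η|`, times `2 π i η`. -/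
def truncDy (R η : ℝ) : ℂ := if |η| ≤ R then (2 * π * η : ℝ) * I else 0

theorem memLp_truncDy (R : ℝ) : MemLp (truncDy R) ⊤ volume := by
  refine memLp_top_of_bound (Measurable.aestronglyMeasurable ?_) (2 * π * |R|)
    (.of_forall fun η => ?_)
  · exact Measurable.ite (measurableSet_le (by fun_prop) measurable_const) (by fun_prop)
      measurable_const
  · rw [truncDy]
    split_ifs with h
    · rw [norm_mul, norm_I, mul_one, norm_real, norm_eq_abs, abs_mul,
        abs_of_pos (by positivity : 0 < 2 * π)]
      exact mul_le_mul_of_nonneg_left (h.trans (le_abs_self R)) (by positivity)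
    · simpa using by positivity

/-- A family of operators on the fibers: bounded, measurable, and zero for large frequencies.
The values on a fiber depend on `(Φ, Ψ)` only, through `M₁ Φ + M₂ Ψ`. -/
structure FiberFamily (α : ℝ) where
  /-- The action on the first component. -/
  M₁ : ℝ → L2w (wt1 α) →L[ℂ] Xline α
  /-- The action on the second component. -/
  M₂ : ℝ → L2w (wt1 α) →L[ℂ] Xline α
  memLp₁ : MemLp M₁ ⊤ (volume : Measure ℝ)
  memLp₂ : MemLp M₂ ⊤ (volume : Measure ℝ)
  /-- A bound for the frequencies involved. -/
  R : ℝ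
  zero₁ : ∀ η, R < |η| → M₁ η = 0
  zero₂ : ∀ η, R < |η| → M₂ η = 0

namespace FiberFamily

variable (A : FiberFamily α)

/-- The operator on the fiber over `η`. -/
def act (η : ℝ) (x : Xline α) : Xline α := A.M₁ η (x.fst.1 0) + A.M₂ η x.snd

/-- The fibers of the image of `u`, as a square integrable function of the frequency. -/
def img : Xplane α →L[ℂ] Lp (Xline α) 2 (volume : Measure ℝ) :=
  (mulOp A.memLp₁).comp ((fib α).toContinuousLinearEquiv.toContinuousLinearMap.comp (cmp α 0)) +
  (mulOp A.memLp₂).comp ((fib α).toContinuousLinearEquiv.toContinuousLinearMap.comp (cmpS α))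

theorem img_ae (u : Xplane α) : A.img u =ᵐ[volume] fun η =>
    A.M₁ η (fib α (u.fst.1 0) η) + A.M₂ η (fib α u.snd η) := by
  have e : A.img u = mulOp A.memLp₁ (fib α (u.fst.1 0)) + mulOp A.memLp₂ (fib α u.snd) := rfl
  rw [e]
  filter_upwards [coeFn_add (mulOp A.memLp₁ (fib α (u.fst.1 0))) (mulOp A.memLp₂ (fib α u.snd)),
    coeFn_mulOp A.memLp₁ (fib α (u.fst.1 0)), coeFn_mulOp A.memLp₂ (fib α u.snd)] with η h1 h2 h3
  rw [h1, Pi.add_apply, h2, h3]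

theorem img_fiber {u : Xplane α} {x : ℝ → Xline α} (hx : ∀ᵐ η, IsFiber u η (x η)) :
    A.img u =ᵐ[volume] fun η => A.act η (x η) := by
  filter_upwards [A.img_ae u, hx] with η h1 h2
  rw [h1, act, h2.fst0, h2.snd]

theorem img_eq_zero (u : Xplane α) : ∀ᵐ η, A.R < |η| → A.img u η = 0 := by
  filter_upwards [A.img_ae u] with η h1 h2
  rw [h1, A.zero₁ η h2, A.zero₂ η h2]
  simp

/-- The tuple `(Φ, ∂_z Φ, ∂_y Φ)` of the image. -/
def opFst (α : ℝ) (R : ℝ) : Lp (Xline α) 2 (volume : Measure ℝ) →L[ℂ]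
    PiLp 2 (fun _ : Fin 3 => L2w (wt2 α)) :=
  (PiLp.continuousLinearEquiv 2 ℂ (fun _ : Fin 3 => L2w (wt2 α))).symm.toContinuousLinearMap.comp
    (ContinuousLinearMap.pi fun i : Fin 3 =>
      (fib α).symm.toContinuousLinearEquiv.toContinuousLinearMap.comp
        (![(lcmp α 0).compLpL 2 volume, (lcmp α 1).compLpL 2 volume,
          (mulLp (memLp_truncDy R)).comp ((lcmp α 0).compLpL 2 volume)] i))

theorem fib_opFst0 (R : ℝ) (F : Lp (Xline α) 2 (volume : Measure ℝ)) :
    fib α (opFst α R F 0) =ᵐ[volume] fun η => (F η).fst.1 0 := by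
  have e : fib α (opFst α R F 0) = (lcmp α 0).compLpL 2 volume F := (fib α).apply_symm_apply _
  rw [e]
  exact ContinuousLinearMap.coeFn_compLpL _ _

theorem fib_opFst1 (R : ℝ) (F : Lp (Xline α) 2 (volume : Measure ℝ)) :
    fib α (opFst α R F 1) =ᵐ[volume] fun η => (F η).fst.1 1 := by
  have e : fib α (opFst α R F 1) = (lcmp α 1).compLpL 2 volume F := (fib α).apply_symm_apply _
  rw [e]
  exact ContinuousLinearMap.coeFn_compLpL _ _

theorem fib_opFst2 (R : ℝ) (F : Lp (Xline α) 2 (volume : Measure ℝ)) :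
    fib α (opFst α R F 2) =ᵐ[volume] fun η => truncDy R η • (F η).fst.1 0 := by
  have e : fib α (opFst α R F 2) =
    mulLp (memLp_truncDy R) ((lcmp α 0).compLpL 2 volume F) := (fib α).apply_symm_apply _
  rw [e]
  filter_upwards [coeFn_mulLp (memLp_truncDy R) ((lcmp α 0).compLpL 2 volume F),
    ContinuousLinearMap.coeFn_compLpL (p := 2) (μ := volume) (lcmp α 0) F] with η h1 h2
  rw [h1, h2, lcmp_apply]

theorem truncDy_smul {V : Type*} [AddCommGroup V] [Module ℂ V] {R η : ℝ} {v : V}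
    (h : R < |η| → v = 0) : truncDy R η • v = ((2 * π * η : ℝ) * I) • v := by
  rw [truncDy]
  split_ifs with h'
  · rfl
  · rw [h (not_le.1 h'), smul_zero, smul_zero]

theorem opFst_mem (u : Xplane α) : opFst α A.R (A.img u) ∈ H1plane α := by
  rw [mem_H1plane_iff_fib]
  refine ⟨?_, ?_⟩
  · filter_upwards [fib_opFst0 A.R (A.img u), fib_opFst1 A.R (A.img u)] with η e0 e1
    have := (mem_H1line_iff _).1 (A.img u η).fst.2
    rw [← e0, ← e1] at this
    exact this
  · filter_upwards [fib_opFst0 A.R (A.img u), fib_opFst2 A.R (A.img u), A.img_eq_zero u]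
      with η e0 e2 e3
    have e4 : A.R < |η| → (lcmp α 0) (A.img u η) = 0 := fun h => by
      rw [e3 h, map_zero]
    have e5 := truncDy_smul e4
    exact e2.trans (e5.trans (congrArg _ e0.symm))

/-- The first component of the image. -/
def opH1 : Xplane α →L[ℂ] H1plane α :=
  ((opFst α A.R).comp A.img).codRestrict (H1plane α) A.opFst_mem

/-- The second component of the image. -/
def opL2 : Xplane α →L[ℂ] L2w (wt2 α) :=
  (fib α).symm.toContinuousLinearEquiv.toContinuousLinearMap.comp
    (((lcmpS α).compLpL 2 volume).comp A.img)

/-- The operator on `X` which acts on fibers by the given family. -/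
def op : Xplane α →L[ℂ] Xplane α :=
  (prodContinuousLinearEquiv 2 ℂ (H1plane α) (L2w (wt2 α))).symm.toContinuousLinearMap.comp
    (A.opH1.prod A.opL2)

theorem isFiber_op (u : Xplane α) : ∀ᵐ η, IsFiber (A.op u) η (A.img u η) := by
  have e : fib α (A.op u).snd = (lcmpS α).compLpL 2 volume (A.img u) := (fib α).apply_symm_apply _
  have e2 : ∀ᵐ η, fib α (A.op u).snd η = (A.img u η).snd := by
    rw [e]
    exact ContinuousLinearMap.coeFn_compLpL _ _
  filter_upwards [fib_opFst0 A.R (A.img u), fib_opFst1 A.R (A.img u), e2] with η h0 h1 h2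
  exact ⟨h0.symm, h1.symm, h2.symm⟩

theorem Xplane.ext_fiber {u v : Xplane α} {x : ℝ → Xline α} (hu : ∀ᵐ η, IsFiber u η (x η))
    (hv : ∀ᵐ η, IsFiber v η (x η)) : u = v := by
  have e0 : u.fst.1 0 = v.fst.1 0 := (fib α).injective (Lp.ext (by
    filter_upwards [hu, hv] with η h1 h2
    rw [← h1.fst0, ← h2.fst0]))
  refine Xplane.ext_U (by rw [e0]) ((fib α).injective (Lp.ext ?_))
  filter_upwards [hu, hv] with η h1 h2
  rw [← h1.snd, ← h2.snd]

/-- The operator is idempotent if its fibers are. -/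
theorem op_op (h : ∀ᵐ η, ∀ x, A.act η (A.act η x) = A.act η x) (u : Xplane α) :
    A.op (A.op u) = A.op u := by
  refine Xplane.ext_fiber (A.isFiber_op (A.op u)) ?_
  filter_upwards [A.isFiber_op u, A.img_fiber (A.isFiber_op u), h, A.img_ae u, exists_isFiber u]
    with η h1 h2 h3 h4 h5
  obtain ⟨x, hx⟩ := h5
  have e : A.img u η = A.act η x := by rw [h4, act, hx.fst0, hx.snd]
  have : A.img (A.op u) η = A.img u η := by rw [h2, e, h3]
  rw [this]
  exact h1

/-- The operator commutes with the linearized operator if its fibers do. -/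
theorem LGraph_op
    (h : ∀ᵐ η : ℝ, ∀ x y, LEtaGraph a b c α (2 * π * η) x y →
      LEtaGraph a b c α (2 * π * η) (A.act η x) (A.act η y)) {u f : Xplane α}
    (huf : LGraph a b c α u f) : LGraph a b c α (A.op u) (A.op f) := by
  classical
  have hu := exists_isFiber u
  have hf := exists_isFiber f
  let x : ℝ → Xline α := fun η => if hx : ∃ x, IsFiber u η x then hx.choose else 0
  let y : ℝ → Xline α := fun η => if hx : ∃ x, IsFiber f η x then hx.choose else 0
  have hx : ∀ᵐ η, IsFiber u η (x η) := by
    filter_upwards [hu] with η hη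
    simp only [x, dif_pos hη]
    exact hη.choose_spec
  have hy : ∀ᵐ η, IsFiber f η (y η) := by
    filter_upwards [hf] with η hη
    simp only [y, dif_pos hη]
    exact hη.choose_spec
  rw [LGraph_iff_fiber (A.isFiber_op u) (A.isFiber_op f)]
  filter_upwards [(LGraph_iff_fiber hx hy).1 huf, h, A.img_fiber hx, A.img_fiber hy]
    with η h1 h2 h3 h4
  rw [h3, h4]
  exact h2 _ _ h1

end FiberFamily

/-! ### The pairing of the modes at zero frequency -/

theorem one_sub_tanh_sq (x : ℝ) : 1 - tanh x ^ 2 = 1 / cosh x ^ 2 := by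
  have := (cosh_pos x).ne'
  rw [Real.tanh_eq_sinh_div_cosh, div_pow, eq_div_iff (by positivity), sub_mul,
    div_mul_cancel₀ _ (by positivity)]
  linarith [Real.cosh_sq x]

theorem one_sub_tanh_sq_nonneg (x : ℝ) : 0 ≤ 1 - tanh x ^ 2 := by
  rw [one_sub_tanh_sq]; positivity

theorem one_add_sq_half_le_cosh (x : ℝ) : 1 + x ^ 2 / 2 ≤ cosh x := by
  have h1 : cosh x = 2 * Real.sinh (x / 2) ^ 2 + 1 := by
    have := Real.cosh_two_mul (x / 2)
    rw [show 2 * (x / 2) = x by ring] at this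
    linarith [Real.cosh_sq (x / 2)]
  have h2 : (x / 2) ^ 2 ≤ Real.sinh (x / 2) ^ 2 := by
    rw [sq_le_sq, Real.abs_sinh]
    exact Real.self_le_sinh_iff.2 (abs_nonneg _)
  nlinarith

theorem one_sub_tanh_sq_le (x : ℝ) : (1 + |x|) * (1 - tanh x ^ 2) ≤ 4 / (1 + x ^ 2) := by
  rw [one_sub_tanh_sq, mul_one_div, div_le_div_iff₀ (by positivity) (by positivity)]
  have h1 := one_add_sq_half_le_cosh x
  have h2 : (1 + x ^ 2 / 2) ^ 2 ≤ cosh x ^ 2 := pow_le_pow_left₀ (by positivity) h1 2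
  have h3 := sq_abs x
  have h4 := abs_nonneg x
  nlinarith [sq_nonneg (|x| - 1), sq_nonneg (|x| * (|x| - 1))]

theorem tendsto_four_div {k : ℝ} (hk : 0 < k) :
    Tendsto (fun z : ℝ => 4 / (1 + (k * z) ^ 2)) (cocompact ℝ) (𝓝 0) := by
  refine Tendsto.div_atTop tendsto_const_nhds (tendsto_atTop_add_const_left _ _ ?_)
  have h := (tendsto_norm_cocompact_atTop (E := ℝ)).const_mul_atTop hk
  refine (((tendsto_pow_atTop (α := ℝ) two_ne_zero).comp h)).congr fun z => ?_
  simp [mul_pow]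

/-- The quadratic form behind the pairing of `ζ₂` and `ζ₂^*`, with `q₁, q₂, q₃` the derivatives of
`q` and `Q' = -∂_c q`. Integration by parts turns it into a positive combination of `∫ q²` and
`∫ q₁²`. -/
theorem integral_pairing_pos {a b c m n : ℝ} {q q₁ q₂ q₃ Q : ℝ → ℝ}
    (h0 : ∀ z, HasDerivAt q (q₁ z) z) (h1 : ∀ z, HasDerivAt q₁ (q₂ z) z)
    (h2 : ∀ z, HasDerivAt q₂ (q₃ z) z) (hQ : ∀ z, HasDerivAt Q (-(m * q z + n * z * q₁ z)) z)
    (t0 : Tendsto q (cocompact ℝ) (𝓝 0)) (t1 : Tendsto q₁ (cocompact ℝ) (𝓝 0))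
    (t2 : Tendsto q₂ (cocompact ℝ) (𝓝 0)) (t3 : Tendsto (fun z => z * q z) (cocompact ℝ) (𝓝 0))
    (t4 : Tendsto (fun z => z * q₁ z) (cocompact ℝ) (𝓝 0)) {K : ℝ} (hK : ∀ z, |Q z| ≤ K)
    (i0 : Integrable fun z => q z ^ 2) (i1 : Integrable fun z => q₁ z ^ 2) (hq : ∀ z, 0 < q z)
    (hm : 0 < m - n / 2) (hm' : 0 < m + n / 2) (ha : 0 < a) (hb : 0 < b) (hc : 0 < c)
    (hJ : Integrable fun z => Q z * (q₁ z - a * q₃ z)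
      + c * (q z + c * (m * q z + n * z * q₁ z)) * (q z - b * q₂ z)) :
    0 < ∫ z, (Q z * (q₁ z - a * q₃ z)
      + c * (q z + c * (m * q z + n * z * q₁ z)) * (q z - b * q₂ z)) := by
  set J : ℝ → ℝ := fun z => Q z * (q₁ z - a * q₃ z)
      + c * (q z + c * (m * q z + n * z * q₁ z)) * (q z - b * q₂ z) with hJd
  set A : ℝ := (m - n / 2) * (1 + c ^ 2) + c with hA
  set B : ℝ := (m + n / 2) * (a + b * c ^ 2) + b * c with hB
  have hApos : 0 < A := by positivity
  have hBpos : 0 < B := by positivity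
  set W : ℝ → ℝ := fun z => Q z * (q z - a * q₂ z) - m * (a + b * c ^ 2) * (q z * q₁ z)
    + n * (1 + c ^ 2) / 2 * (z * q z * q z) - n * (a + b * c ^ 2) / 2 * (z * q₁ z * q₁ z)
    - b * c * (q z * q₁ z) with hW
  have hWd : ∀ z, HasDerivAt W (J z - (A * q z ^ 2 + B * q₁ z ^ 2)) z := by
    intro z
    have hz := hasDerivAt_id z
    have e := (((((hQ z).mul ((h0 z).sub ((h2 z).const_mul a))).sub
      (((h0 z).mul (h1 z)).const_mul (m * (a + b * c ^ 2)))).add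
      (((hz.mul (h0 z)).mul (h0 z)).const_mul (n * (1 + c ^ 2) / 2))).sub
      (((hz.mul (h1 z)).mul (h1 z)).const_mul (n * (a + b * c ^ 2) / 2))).sub
      (((h0 z).mul (h1 z)).const_mul (b * c))
    refine e.congr_deriv ?_
    simp only [hJd, hA, hB, id, Pi.mul_apply, Pi.sub_apply]
    ring
  have hWt : Tendsto W (cocompact ℝ) (𝓝 0) := by
    have hQt : Tendsto (fun z => Q z * (q z - a * q₂ z)) (cocompact ℝ) (𝓝 0) := by
      refine bdd_le_mul_tendsto_zero (b := -K) (B := K) (.of_forall fun z => (abs_le.1 (hK z)).1)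
        (.of_forall fun z => (abs_le.1 (hK z)).2) ?_
      simpa using t0.sub (t2.const_mul a)
    have := (((hQt.sub ((t0.mul t1).const_mul (m * (a + b * c ^ 2)))).add
      ((t3.mul t0).const_mul (n * (1 + c ^ 2) / 2))).sub
      ((t4.mul t1).const_mul (n * (a + b * c ^ 2) / 2))).sub ((t0.mul t1).const_mul (b * c))
    simpa using this
  have iP : Integrable fun z => A * q z ^ 2 + B * q₁ z ^ 2 := (i0.const_mul A).add (i1.const_mul B)
  have h := integral_of_hasDerivAt_of_tendsto hWd (hJ.sub iP)
    (hWt.mono_left atBot_le_cocompact) (hWt.mono_left atTop_le_cocompact)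
  rw [integral_sub hJ iP, sub_zero, sub_eq_zero] at h
  rw [h, integral_add (i0.const_mul A) (i1.const_mul B), integral_const_mul, integral_const_mul]
  have hp : 0 < ∫ z, q z ^ 2 := by
    rw [integral_pos_iff_support_of_nonneg (fun z => sq_nonneg _) i0]
    have : (Function.support fun z => q z ^ 2) = univ := by
      ext z; simp [(hq z).ne']
    rw [this]; simp
  have hp' : 0 ≤ ∫ z, q₁ z ^ 2 := integral_nonneg fun z => sq_nonneg _
  positivity

theorem qc_eq (a b s z : ℝ) :
    qc a b s z = (s ^ 2 - 1) / s * (1 - tanh (alphaC a b s / 2 * z) ^ 2) := by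
  rw [qc, one_sub_tanh_sq, div_pow, one_pow]
  congr 4
  ring

theorem hasDerivAt_alphaC (hab : a < b) (hc : 1 < c) (hb : 0 < b) :
    HasDerivAt (alphaC a b)
      (c * (b - a) / ((c ^ 2 - 1) * (b * c ^ 2 - a)) * alphaC a b c) c := by
  have h1 : 0 < c ^ 2 - 1 := by nlinarith
  have h2 : 0 < b * c ^ 2 - a := by nlinarith
  have hn : HasDerivAt (fun s : ℝ => s ^ 2 - 1) (2 * c) c := by
    simpa using (hasDerivAt_pow 2 c).sub_const 1
  have hd : HasDerivAt (fun s : ℝ => b * s ^ 2 - a) (b * (2 * c)) c := by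
    simpa using ((hasDerivAt_pow 2 c).const_mul b).sub_const a
  have h := (hn.div hd h2.ne').sqrt (div_pos h1 h2).ne'
  refine h.congr_deriv ?_
  have hs : 0 < sqrt ((c ^ 2 - 1) / (b * c ^ 2 - a)) := sqrt_pos.2 (div_pos h1 h2)
  have hs2 : sqrt ((c ^ 2 - 1) / (b * c ^ 2 - a)) ^ 2 * (b * c ^ 2 - a) = c ^ 2 - 1 := by
    rw [sq_sqrt (div_pos h1 h2).le, div_mul_cancel₀ _ h2.ne']
  change _ / (2 * sqrt ((c ^ 2 - 1) / (b * c ^ 2 - a))) = _ * sqrt ((c ^ 2 - 1) / (b * c ^ 2 - a))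
  set S := sqrt ((c ^ 2 - 1) / (b * c ^ 2 - a))
  rw [div_div, div_mul_eq_mul_div, div_eq_div_iff (by positivity) (by positivity)]
  linear_combination (-2 * c * (b-a)* (b * c ^ 2 - a)) * hs2

theorem hasDerivAt_sech_sq (z k : ℝ) :
    HasDerivAt (fun k : ℝ => 1 - tanh (k * z) ^ 2)
      (-2 * tanh (k * z) * (1 - tanh (k * z) ^ 2) * z) k := by
  have h := ((hasDerivAt_tanh (k * z)).comp k ((hasDerivAt_id k).mul_const z)).pow 2
  refine (h.const_sub 1).congr_deriv ?_
  simp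
  ring

theorem hasDerivAt_qc (a b c z : ℝ) : HasDerivAt (qc a b c) ((c ^ 2 - 1) / c *
    (-2 * tanh (alphaC a b c / 2 * z) * (1 - tanh (alphaC a b c / 2 * z) ^ 2) *
      (alphaC a b c / 2))) z := by
  have h := (hasDerivAt_sech_sq (alphaC a b c / 2) z).const_mul ((c ^ 2 - 1) / c)
  have e : (qc a b c) =
      fun z => (c ^ 2 - 1) / c * (1 - tanh (z * (alphaC a b c / 2)) ^ 2) := by
    ext z; rw [qc_eq, mul_comm z]
  rw [e, mul_comm _ z]
  exact h

theorem dcq_eq (hab : a < b) (hc : 1 < c) (hb : 0 < b) (z : ℝ) :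
    HasDerivAt (fun s => qc a b s z) ((c ^ 2 + 1) / (c * (c ^ 2 - 1)) * qc a b c z
      + c * (b - a) / ((c ^ 2 - 1) * (b * c ^ 2 - a)) * z * deriv (qc a b c) z) c := by
  have h1 : 0 < c ^ 2 - 1 := by nlinarith
  have h2 : 0 < b * c ^ 2 - a := by nlinarith
  have hc0 : 0 < c := by linarith
  have hA : HasDerivAt (fun s : ℝ => (s ^ 2 - 1) / s) ((c ^ 2 + 1) / c ^ 2) c := by
    have hn : HasDerivAt (fun s : ℝ => s ^ 2 - 1) (2 * c) c := by
      simpa using (hasDerivAt_pow 2 c).sub_const 1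
    refine (hn.div (hasDerivAt_id c) hc0.ne').congr_deriv ?_
    simp only [id]
    congr 1
    ring
  have h := hA.mul ((hasDerivAt_sech_sq z _).comp c
    ((hasDerivAt_alphaC hab hc hb).div_const 2))
  have e : (fun s => qc a b s z) = fun s =>
      (s ^ 2 - 1) / s * (1 - tanh (alphaC a b s / 2 * z) ^ 2) := funext fun s => qc_eq a b s z
  rw [e]
  refine h.congr_deriv ?_
  rw [(hasDerivAt_qc a b c z).deriv, qc_eq]
  simp only [Function.comp]
  field_simp

theorem hasDerivAt_qc_deriv (a b c z : ℝ) : HasDerivAt (deriv (qc a b c))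
    (-2 * ((c ^ 2 - 1) / c) * (alphaC a b c / 2) ^ 2 *
    ((1 - 3 * tanh (alphaC a b c / 2 * z) ^ 2) *
      (1 - tanh (alphaC a b c / 2 * z) ^ 2))) z := by
  have e : deriv (qc a b c) = fun z => (c ^ 2 - 1) / c *
    (-2 * tanh (alphaC a b c / 2 * z) * (1 - tanh (alphaC a b c / 2 * z) ^ 2) *
      (alphaC a b c / 2)) := funext fun z => (hasDerivAt_qc a b c z).deriv
  rw [e]
  have ht := (hasDerivAt_tanh (alphaC a b c / 2 * z)).comp z
    ((hasDerivAt_id z).const_mul (alphaC a b c / 2))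
  have h := (((ht.const_mul (-2)).mul ((ht.pow 2).const_sub 1)).mul_const
    (alphaC a b c / 2)).const_mul ((c ^ 2 - 1) / c)
  refine h.congr_deriv ?_
  simp only [Function.comp, Pi.pow_apply]
  push_cast
  ring

theorem abs_tanh_le (x : ℝ) : |tanh x| ≤ 1 :=
  abs_le.2 ⟨(Real.neg_one_lt_tanh x).le, (Real.tanh_lt_one x).le⟩

theorem tendsto_of_le_sech {k C : ℝ} (hk : 0 < k) (hC : 0 ≤ C) {f : ℝ → ℝ}
    (hf : ∀ z, |f z| ≤ C * ((1 + |k * z|) * (1 - tanh (k * z) ^ 2))) :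
    Tendsto f (cocompact ℝ) (𝓝 0) := by
  refine squeeze_zero_norm (fun z => (hf z).trans
    (mul_le_mul_of_nonneg_left (one_sub_tanh_sq_le (k * z)) hC)) ?_
  simpa using (tendsto_four_div hk).const_mul C

theorem integrable_of_le_sech {k C : ℝ} (hk : 0 < k) (hC : 0 ≤ C) {f : ℝ → ℝ}
    (hf : ∀ z, |f z| ≤ C * ((1 + |k * z|) * (1 - tanh (k * z) ^ 2))) (hm : Continuous f) :
    Integrable f := by
  have h := (((integrable_inv_one_add_sq).comp_mul_left' hk.ne').const_mul 4).const_mul C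
  refine h.mono' hm.aestronglyMeasurable (.of_forall fun z => (hf z).trans ?_)
  simpa [div_eq_mul_inv] using mul_le_mul_of_nonneg_left (one_sub_tanh_sq_le (k * z)) hC

/-- The pairing of `L²_α(ℝ)` with an element of `L²_{-α}(ℝ)`. -/
def prL (v : L2w (wt1 (-α))) : L2w (wt1 α) →L[ℂ] ℂ :=
  (innerSL ℂ (expMulLI (wt1 (-α)) v)).comp (expMulLI (wt1 α)).toContinuousLinearMap

theorem prL_apply (v : L2w (wt1 (-α))) (f : L2w (wt1 α)) :
    prL v f = inner ℂ (expMulLI (wt1 (-α)) v) (expMulLI (wt1 α) f) := rfl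

theorem inner_expMulLI_ae (v : L2w (wt1 (-α))) (f : L2w (wt1 α)) :
    (fun z => inner ℂ (expMulLI (wt1 (-α)) v z) (expMulLI (wt1 α) f z)) =ᵐ[volume]
      fun z => f z * conj (v z) := by
  filter_upwards [expMulLI_ae (wt1 (-α)) v, expMulLI_ae (wt1 α) f] with z h1 h2
  rw [h1, h2, RCLike.inner_apply, map_mul, conj_ofReal]
  have e : (exp (wt1 α z) : ℂ) * (exp (wt1 (-α) z) : ℂ) = 1 := by
    rw [← ofReal_mul, ← exp_add]
    simp [wt1]
  calc _ = ((exp (wt1 α z) : ℂ) * (exp (wt1 (-α) z) : ℂ)) *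
        (f z * conj (v z)) := by ring
    _ = _ := by rw [e, one_mul]

theorem integrable_mul_conj (v : L2w (wt1 (-α))) (f : L2w (wt1 α)) :
    Integrable fun z => f z * conj (v z) :=
  (L2.integrable_inner _ _).congr (inner_expMulLI_ae v f)

theorem prL_eq (v : L2w (wt1 (-α))) (f : L2w (wt1 α)) :
    prL v f = ∫ z, f z * conj (v z) := by
  rw [prL_apply, L2.inner_def]
  exact integral_congr_ae (inner_expMulLI_ae v f)

theorem norm_prL_le (v : L2w (wt1 (-α))) (f : L2w (wt1 α)) : ‖prL v f‖ ≤ ‖v‖ * ‖f‖ := by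
  rw [prL_apply, ← (expMulLI (wt1 α)).norm_map f, ← (expMulLI (wt1 (-α))).norm_map v]
  exact norm_inner_le_norm _ _

theorem pairX_eq (u : Xline α) (v : Xline (-α)) :
    pairX u v = prL (v.fst.1 0) (u.fst.1 0) + prL v.snd u.snd := by
  rw [prL_eq, prL_eq]; rfl

theorem pairX_add_left (u u' : Xline α) (v : Xline (-α)) :
    pairX (u + u') v = pairX u v + pairX u' v := by
  have e1 : (u + u').fst.1 0 = u.fst.1 0 + u'.fst.1 0 := rfl
  have e2 : (u + u').snd = u.snd + u'.snd := rfl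
  rw [pairX_eq, pairX_eq, pairX_eq, e1, e2, map_add, map_add]
  ring

theorem pairX_smul_left (k : ℂ) (u : Xline α) (v : Xline (-α)) :
    pairX (k • u) v = k * pairX u v := by
  have e1 : (k • u).fst.1 0 = k • u.fst.1 0 := rfl
  have e2 : (k • u).snd = k • u.snd := rfl
  rw [pairX_eq, pairX_eq, e1, e2, map_smul, map_smul, smul_eq_mul, smul_eq_mul]
  ring

theorem prL_add (v v' : L2w (wt1 (-α))) : prL (v + v') = prL v + prL v' := by
  ext f
  rw [add_apply, prL_apply, prL_apply, prL_apply, map_add, inner_add_left]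

theorem prL_smul (k : ℂ) (v : L2w (wt1 (-α))) :
    prL (k • v) = conj k • prL v := by
  ext f
  rw [smul_apply, prL_apply, prL_apply, map_smul, inner_smul_left, smul_eq_mul]

theorem pairX_add_right (u : Xline α) (v v' : Xline (-α)) :
    pairX u (v + v') = pairX u v + pairX u v' := by
  have e1 : (v + v').fst.1 0 = v.fst.1 0 + v'.fst.1 0 := rfl
  have e2 : (v + v').snd = v.snd + v'.snd := rfl
  rw [pairX_eq, pairX_eq, pairX_eq, e1, e2, prL_add, prL_add, add_apply,
    add_apply]
  ring

theorem pairX_smul_right (k : ℂ) (u : Xline α) (v : Xline (-α)) :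
    pairX u (k • v) = conj k * pairX u v := by
  have e1 : (k • v).fst.1 0 = k • v.fst.1 0 := rfl
  have e2 : (k • v).snd = k • v.snd := rfl
  rw [pairX_eq, pairX_eq, e1, e2, prL_smul, prL_smul, smul_apply,
    smul_apply, smul_eq_mul, smul_eq_mul]
  ring

theorem Xline.norm_fst0_le (u : Xline α) : ‖u.fst.1 0‖ ≤ ‖u‖ :=
  (PiLp.norm_apply_le u.fst.1 0).trans (WithLp.norm_fst_le _ u)

theorem norm_pairX_le (u : Xline α) (v : Xline (-α)) :
    ‖pairX u v‖ ≤ 2 * ‖u‖ * ‖v‖ := by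
  rw [pairX_eq]
  have h1 := norm_prL_le (v.fst.1 0) (u.fst.1 0)
  have h2 := norm_prL_le v.snd u.snd
  have h3 := mul_le_mul (Xline.norm_fst0_le v) (Xline.norm_fst0_le u) (norm_nonneg _) (norm_nonneg _)
  have h4 := mul_le_mul (WithLp.norm_snd_le _ v) (WithLp.norm_snd_le _ u) (norm_nonneg _) (norm_nonneg _)
  refine (norm_add_le _ _).trans ?_
  linarith

/-- The modes `ζ₂`, `ζ₂*` at zero frequency pair to a positive number. -/
theorem pairX_zeta_pos (hp : Params a b c α) {ζ₂ : Xline α} {ζs₂ : Xline (-α)}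
    (h : Represents ζ₂ (fun z => ∫ s in Ioi z, dcq a b c s) (fun z => -dcr a b c z))
    (hs : Represents ζs₂
      (fun z => deriv (qc a b c) z - a * iteratedDeriv 3 (qc a b c) z)
      (fun z => -(rc a b c z - b * iteratedDeriv 2 (rc a b c) z))) :
    ∃ θ : ℝ, 0 < θ ∧ pairX ζ₂ ζs₂ = θ := by
  obtain ⟨ha, hab, hc, -, -⟩ := hp
  have hb : 0 < b := ha.trans hab
  have h1 : 0 < c ^ 2 - 1 := by nlinarith
  have h2 : 0 < b * c ^ 2 - a := by nlinarith
  have hc0 : 0 < c := by linarith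
  -- `∂_c q = m q + n z q₁`: the speed enters `q` through the amplitude and the width
  set m : ℝ := (c ^ 2 + 1) / (c * (c ^ 2 - 1)) with hm
  set n : ℝ := c * (b - a) / ((c ^ 2 - 1) * (b * c ^ 2 - a)) with hn
  set k : ℝ := alphaC a b c / 2 with hk
  have hkpos : 0 < k := half_pos (sqrt_pos.2 (div_pos h1 h2))
  set q := qc a b c with hq
  set q₁ := deriv q with hq₁
  set q₂ := deriv q₁ with hq₂
  set q₃ := deriv q₂ with hq₃
  have T0 := isTanhPoly_qc a b c
  have T1 := T0.deriv
  have T2 := T1.deriv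
  have hdiff : ∀ {f}, IsTanhPoly k f → ∀ z, HasDerivAt f (deriv f z) z := fun hf z =>
    ((hf.isMult.1.differentiable (by simp)) z).hasDerivAt
  have hcont : ∀ {f}, IsTanhPoly k f → Continuous f := fun hf => hf.isMult.1.continuous
  have hd : ∀ z, dcq a b c z = m * q z + n * z * q₁ z := fun z => (dcq_eq hab hc hb z).deriv
  have hdr : ∀ z, dcr a b c z = -q z - c * (m * q z + n * z * q₁ z) := by
    intro z
    have := ((hasDerivAt_id c).neg.mul (dcq_eq hab hc hb z)).deriv
    refine Eq.trans (b := _) ?_ (this.trans ?_)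
    · rfl
    · simp only [Pi.neg_apply, id]
      ring
  have i2 : iteratedDeriv 2 q = q₂ := by
    rw [iteratedDeriv_succ, iteratedDeriv_one]
  have i3 : iteratedDeriv 3 q = q₃ := by rw [iteratedDeriv_succ, i2]
  have ir : ∀ z, iteratedDeriv 2 (rc a b c) z = -c * q₂ z := by
    have e : deriv (rc a b c) = fun z => -c * q₁ z := by
      ext z
      exact ((hdiff T0 z).const_mul (-c)).deriv
    intro z
    rw [iteratedDeriv_succ, iteratedDeriv_one, e]
    exact ((hdiff T1 z).const_mul (-c)).deriv
  have A0 : 0 < (c ^ 2 - 1) / c := div_pos h1 hc0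
  set A := (c ^ 2 - 1) / c with hA
  -- all functions that occur are bounded by multiples of `(1 + |k z|) sech²(k z)`
  have hs0 : ∀ z, 0 ≤ 1 - tanh (k * z) ^ 2 := fun z => one_sub_tanh_sq_nonneg _
  have hs1 : ∀ z, 1 - tanh (k * z) ^ 2 ≤ (1 + |k * z|) * (1 - tanh (k * z) ^ 2) :=
    fun z => le_mul_of_one_le_left (hs0 z) (le_add_of_nonneg_right (abs_nonneg _))
  have hs2 : ∀ z, |z| * (1 - tanh (k * z) ^ 2) ≤
      1 / k * ((1 + |k * z|) * (1 - tanh (k * z) ^ 2)) := by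
    intro z
    rw [abs_mul, abs_of_pos hkpos, ← mul_assoc]
    refine mul_le_mul_of_nonneg_right ?_ (hs0 z)
    have : 1 / k * (1 + k * |z|) = 1 / k + |z| := by field_simp
    rw [this]
    exact le_add_of_nonneg_left (by positivity)
  have b0 : ∀ z, |q z| = A * (1 - tanh (k * z) ^ 2) := fun z => by
    rw [hq, qc_eq, abs_mul, abs_of_pos A0, abs_of_nonneg (hs0 z)]
  have b1 : ∀ z, |q₁ z| ≤ A * (2 * k) * (1 - tanh (k * z) ^ 2) := fun z => by
    have e := (hasDerivAt_qc a b c z).deriv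
    rw [hq₁, hq, e, abs_mul, abs_of_pos A0, abs_mul, abs_mul, abs_mul, abs_of_pos hkpos,
      abs_of_nonneg (hs0 z), abs_neg, abs_two, mul_assoc A]
    refine mul_le_mul_of_nonneg_left ?_ A0.le
    have := abs_tanh_le (k * z)
    calc 2 * |tanh (k * z)| * (1 - tanh (k * z) ^ 2) * k
        ≤ 2 * 1 * (1 - tanh (k * z) ^ 2) * k := by
          gcongr
          exact hs0 z
      _ = _ := by ring
  have b2 : ∀ z, |q₂ z| ≤ A * (4 * k ^ 2) * (1 - tanh (k * z) ^ 2) := fun z => by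
    have e := (hasDerivAt_qc_deriv a b c z).deriv
    rw [hq₂, hq₁, hq, e, abs_mul, abs_mul, abs_mul, abs_mul, abs_of_pos A0, abs_neg, abs_two,
      abs_of_nonneg (hs0 z), abs_of_nonneg (sq_nonneg _)]
    have h3 : |1 - 3 * tanh (k * z) ^ 2| ≤ 2 := by
      have := hs0 z
      rw [abs_le]
      constructor <;> nlinarith [sq_nonneg (tanh (k * z))]
    calc 2 * A * k ^ 2 * (|1 - 3 * tanh (k * z) ^ 2| * (1 - tanh (k * z) ^ 2))
        ≤ 2 * A * k ^ 2 * (2 * (1 - tanh (k * z) ^ 2)) := by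
          gcongr
          exact hs0 z
      _ = _ := by ring
  have c0 : ∀ z, |q z| ≤ A * ((1 + |k * z|) * (1 - tanh (k * z) ^ 2)) := fun z =>
    (b0 z).le.trans (mul_le_mul_of_nonneg_left (hs1 z) A0.le)
  have c1 : ∀ z, |q₁ z| ≤ A * (2 * k) * ((1 + |k * z|) * (1 - tanh (k * z) ^ 2)) := fun z =>
    (b1 z).trans (mul_le_mul_of_nonneg_left (hs1 z) (by positivity))
  have c2 : ∀ z, |q₂ z| ≤ A * (4 * k ^ 2) * ((1 + |k * z|) * (1 - tanh (k * z) ^ 2)) :=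
    fun z => (b2 z).trans (mul_le_mul_of_nonneg_left (hs1 z) (by positivity))
  have c3 : ∀ z, |z * q z| ≤ A * (1 / k) * ((1 + |k * z|) * (1 - tanh (k * z) ^ 2)) := by
    intro z
    rw [abs_mul, b0, mul_left_comm, mul_assoc A]
    exact mul_le_mul_of_nonneg_left (hs2 z) A0.le
  have c4 : ∀ z, |z * q₁ z| ≤
      A * (2 * k) * (1 / k) * ((1 + |k * z|) * (1 - tanh (k * z) ^ 2)) := by
    intro z
    rw [abs_mul, mul_assoc (A * (2 * k))]
    refine (mul_le_mul_of_nonneg_left (b1 z) (abs_nonneg z)).trans ?_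
    rw [mul_left_comm]
    exact mul_le_mul_of_nonneg_left (hs2 z) (by positivity)
  have t0 := tendsto_of_le_sech hkpos A0.le c0
  have i0 := integrable_of_le_sech hkpos A0.le c0 (hcont T0)
  have i1 := integrable_of_le_sech hkpos (by positivity) c1 (hcont T1)
  have i4 := integrable_of_le_sech hkpos (by positivity) c4 (continuous_id.mul (hcont T1))
  have id' : Integrable (dcq a b c) := by
    have e : dcq a b c = fun z => m * q z + n * (z * q₁ z) := funext fun z => by
      rw [hd, mul_assoc]
    rw [e]
    exact (i0.const_mul m).add (i4.const_mul n)
  have cd : Continuous (dcq a b c) := by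
    rw [show dcq a b c = fun z => m * q z + n * z * q₁ z from funext hd]
    have := hcont T0
    have := hcont T1
    fun_prop
  have isq : ∀ {f : ℝ → ℝ}, IsTanhPoly k f → Integrable f → Integrable fun z => f z ^ 2 := by
    intro f hf hi
    obtain ⟨C, hC⟩ := hf.isMult.2
    have := hi.bdd_mul (c := C) (hcont hf).aestronglyMeasurable (Eventually.of_forall hC)
    simpa [sq] using this
  have hQ : ∀ z, HasDerivAt (fun z => ∫ s in Ioi z, dcq a b c s)
      (-(m * q z + n * z * q₁ z)) z := by
    intro z
    have e : (fun z => ∫ s in Ioi z, dcq a b c s) =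
        fun z => (∫ s in Ioi 0, dcq a b c s) - ∫ s in (0 : ℝ)..z, dcq a b c s := by
      ext z
      rw [← intervalIntegral.integral_Ioi_sub_Ioi' id'.integrableOn id'.integrableOn]
      ring
    rw [e, ← hd]
    exact (intervalIntegral.integral_hasDerivAt_right (cd.intervalIntegrable _ _)
      (cd.stronglyMeasurableAtFilter _ _) cd.continuousAt).const_sub _
  have hK : ∀ z, |∫ s in Ioi z, dcq a b c s| ≤ ∫ s, |dcq a b c s| := fun z =>
    (abs_integral_le_integral_abs).trans
      (setIntegral_le_integral id'.abs (.of_forall fun s => abs_nonneg _))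
  set J : ℝ → ℝ := fun z => (∫ s in Ioi z, dcq a b c s) * (q₁ z - a * q₃ z)
      + c * (q z + c * (m * q z + n * z * q₁ z)) * (q z - b * q₂ z) with hJ
  have hJC : Integrable (fun z => (J z : ℂ)) ∧ pairX ζ₂ ζs₂ = ∫ z, (J z : ℂ) := by
    have I1 := integrable_mul_conj (ζs₂.fst.1 0) (ζ₂.fst.1 0)
    have I2 := integrable_mul_conj ζs₂.snd ζ₂.snd
    have e : (fun z => ζ₂.fst.1 0 z * conj (ζs₂.fst.1 0 z) +
        ζ₂.snd z * conj (ζs₂.snd z)) =ᵐ[volume] fun z => (J z : ℂ) := by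
      filter_upwards [h.1, h.2, hs.1, hs.2] with z e1 e2 e3 e4
      rw [Xline.fn1] at e1 e3
      rw [Xline.fn2] at e2 e4
      rw [e1, e2, e3, e4, conj_ofReal, conj_ofReal, ← ofReal_mul,
        ← ofReal_mul, ← Complex.ofReal_add, hJ, i3, hdr, ir]
      simp only [rc]
      congr 1
      ring
    refine ⟨(I1.add I2).congr e, ?_⟩
    rw [pairX_eq, prL_eq, prL_eq, ← integral_add I1 I2]
    exact integral_congr_ae e
  refine ⟨∫ z, J z, ?_, by rw [hJC.2, integral_complex_ofReal]⟩
  have hn0 : 0 < n := by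
    have : 0 < b - a := by linarith
    positivity
  have hm0 : 0 < m - n / 2 := by
    have e : m - n / 2 = (2 * (c ^ 2 + 1) * (b * c ^ 2 - a) - c ^ 2 * (b - a)) /
        (2 * c * (c ^ 2 - 1) * (b * c ^ 2 - a)) := by
      rw [hm, hn]
      generalize b * c ^ 2 - a = D at h2
      field_simp
    rw [e]
    refine div_pos ?_ (by positivity)
    nlinarith [mul_pos hb h1, mul_pos (mul_pos hc0 hc0) h2]
  exact integral_pairing_pos (hdiff T0) (hdiff T1) (hdiff T2) hQ t0
    (tendsto_of_le_sech hkpos (by positivity) c1) (tendsto_of_le_sech hkpos (by positivity) c2)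
    (tendsto_of_le_sech hkpos (by positivity) c3) (tendsto_of_le_sech hkpos (by positivity) c4)
    hK (isq T0 i0) (isq T1 i1)
    (fun z => by
      rw [hq, qc]
      have := cosh_pos (alphaC a b c * z / 2)
      exact mul_pos A0 (by positivity)) hm0 (by linarith) ha hb hc0
    (by simpa using hJC.1.re)

/-! ### The resonant modes -/

/-- Distributions depending linearly on a parameter. -/
def IsLinearDistr {V : Type*} [AddCommGroup V] [Module ℂ V] (T : V → Functional ℝ) : Prop :=
  ∀ φ, IsTest φ → IsLinearMap ℂ fun u => T u φ

namespace IsLinearDistr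

variable {V : Type*} [AddCommGroup V] [Module ℂ V] {S T : V → Functional ℝ}

theorem ofLp (l : V →ₗ[ℂ] L2w (wt1 α)) : IsLinearDistr fun u => ofFun (l u) := by
  refine fun φ hφ => ⟨fun u v => ?_, fun k u => ?_⟩
  · beta_reduce
    rw [l.map_add, ofFun_congr ((ae_eq_weighted_iff (wt1 α).continuous).1
      (coeFn_add (l u) (l v)))]
    simp only [ofFun, Pi.add_apply, add_mul]
    exact integral_add (integrable_mul_test _ hφ) (integrable_mul_test _ hφ)
  · beta_reduce
    rw [l.map_smul, ofFun_congr ((ae_eq_weighted_iff (wt1 α).continuous).1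
      (coeFn_smul k (l u)))]
    simp only [ofFun, Pi.smul_apply, smul_eq_mul, mul_assoc]
    exact integral_const_mul _ _

theorem pd (h : IsLinearDistr T) : IsLinearDistr fun u => BenneyLuke.pd (1 : ℝ) (T u) := by
  intro φ hφ
  have h' := h _ (hφ.fderiv (1 : ℝ))
  refine ⟨fun u v => ?_, fun k u => ?_⟩
  · change -_ = -_ + -_
    rw [h'.map_add]; ring
  · change -_ = k • -_
    rw [h'.map_smul, smul_neg]

theorem mulBy (h : IsLinearDistr T) {g : ℝ → ℝ} (hg : ContDiff ℝ ∞ g) :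
    IsLinearDistr fun u => BenneyLuke.mulBy g (T u) :=
  fun _ hφ => h _ (hφ.smooth_mul (ofRealCLM.contDiff.comp hg))

theorem add (h : IsLinearDistr S) (h' : IsLinearDistr T) : IsLinearDistr fun u => S u + T u := by
  refine fun φ hφ => ⟨fun u v => ?_, fun k u => ?_⟩
  · simp only [Pi.add_apply, (h φ hφ).map_add, (h' φ hφ).map_add]; ring
  · simp only [Pi.add_apply, (h φ hφ).map_smul, (h' φ hφ).map_smul, smul_add]

theorem smul (h : IsLinearDistr T) (k : ℝ) : IsLinearDistr fun u => k • T u := by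
  refine fun φ hφ => ⟨fun u v => ?_, fun l u => ?_⟩
  · simp only [Pi.smul_apply, (h φ hφ).map_add, smul_add]
  · simp only [Pi.smul_apply, (h φ hφ).map_smul]
    exact smul_comm _ _ _

theorem sub (h : IsLinearDistr S) (h' : IsLinearDistr T) : IsLinearDistr fun u => S u - T u := by
  refine fun φ hφ => ⟨fun u v => ?_, fun k u => ?_⟩
  · simp only [Pi.sub_apply, (h φ hφ).map_add, (h' φ hφ).map_add]; ring
  · simp only [Pi.sub_apply, (h φ hφ).map_smul, (h' φ hφ).map_smul, smul_sub]

theorem eqDistr_comb (h : IsLinearDistr S) (h' : IsLinearDistr T) {u v : V}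
    (hu : EqDistr (S u) (T u)) (hv : EqDistr (S v) (T v)) (k l : ℂ) :
    EqDistr (S (k • u + l • v)) (T (k • u + l • v)) := by
  intro φ hφ
  have a1 := (h φ hφ).map_add (k • u) (l • v)
  have a2 := (h' φ hφ).map_add (k • u) (l • v)
  simp only [(h φ hφ).map_smul] at a1
  simp only [(h' φ hφ).map_smul] at a2
  rw [a1, a2, hu φ hφ, hv φ hφ]

end IsLinearDistr

theorem LinRel.comb {a b c α η : ℝ} {Φ Ψ F G Φ' Ψ' F' G' : L2w (wt1 α)}
    (h : LinRel a b c (pd (1 : ℝ)) (fun T => pd (1 : ℝ) (pd (1 : ℝ) T) - η ^ 2 • T) id Φ Ψ F G)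
    (h' : LinRel a b c (pd (1 : ℝ)) (fun T => pd (1 : ℝ) (pd (1 : ℝ) T) - η ^ 2 • T) id
      Φ' Ψ' F' G') (k l : ℂ) :
    LinRel a b c (pd (1 : ℝ)) (fun T => pd (1 : ℝ) (pd (1 : ℝ) T) - η ^ 2 • T) id
      (k • Φ + l • Φ' : L2w (wt1 α)) (k • Ψ + l • Ψ' : L2w (wt1 α))
      (k • F + l • F' : L2w (wt1 α)) (k • G + l • G' : L2w (wt1 α)) := by
  have hl : ∀ i : Fin 4, IsLinearDistr fun w : Fin 4 → L2w (wt1 α) => ofFun (w i) :=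
    fun i => IsLinearDistr.ofLp (LinearMap.proj (R := ℂ) (φ := fun _ : Fin 4 => L2w (wt1 α)) i)
  have hr := isTanhPoly_rc a b c
  have hq := isTanhPoly_qc a b c
  have lap : ∀ {T : (Fin 4 → L2w (wt1 α)) → Functional ℝ}, IsLinearDistr T →
      IsLinearDistr fun w => pd (1 : ℝ) (pd (1 : ℝ) (T w)) - η ^ 2 • T w :=
    fun h => h.pd.pd.sub (h.smul _)
  have s1 := ((hl 0).pd.smul c).add (hl 1)
  have s2 := (hl 3).sub ((hl 1).pd.smul c)
  have s3 := s2.sub ((lap s2).smul b)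
  have s4 := (((lap (hl 0)).sub ((lap (lap (hl 0))).smul a)).sub
    ((((hl 0).pd.mulBy hr.deriv.isMult.1).smul 2).add ((lap (hl 0)).mulBy hr.isMult.1))).sub
    ((((hl 1).pd.mulBy hq.isMult.1).smul 2).add ((hl 1).mulBy hq.deriv.isMult.1))
  exact ⟨(hl 2).eqDistr_comb s1 (u := ![Φ, Ψ, F, G]) (v := ![Φ', Ψ', F', G']) h.1 h'.1 k l,
    s3.eqDistr_comb s4 (u := ![Φ, Ψ, F, G]) (v := ![Φ', Ψ', F', G']) h.2 h'.2 k l⟩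

/-- The graph of `𝓛(η)` is a linear subspace. -/
theorem LEtaGraph.comb {a b c α η : ℝ} {u f v g : Xline α} (h : LEtaGraph a b c α η u f)
    (h' : LEtaGraph a b c α η v g) (k l : ℂ) :
    LEtaGraph a b c α η (k • u + l • v) (k • f + l • g) :=
  LinRel.comb (Φ := u.fst.1 0) (Ψ := u.snd) (F := f.fst.1 0) (G := f.snd) (Φ' := v.fst.1 0)
    (Ψ' := v.snd) (F' := g.fst.1 0) (G' := g.snd) h h' k l

theorem LEtaGraph.smul {a b c α η : ℝ} {u f : Xline α} (h : LEtaGraph a b c α η u f) (k : ℂ) :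
    LEtaGraph a b c α η (k • u) (k • f) := by
  simpa using h.comb h k 0

theorem LEtaGraph_neg {a b c α η : ℝ} {u f : Xline α} :
    LEtaGraph a b c α (-η) u f ↔ LEtaGraph a b c α η u f := by
  rw [LEtaGraph, LEtaGraph, neg_sq]

theorem pairX_isConj {u u' : Xline α} {v v' : Xline (-α)} (hu : IsConj u u')
    (hv : IsConj v v') : pairX u' v' = conj (pairX u v) := by
  rw [pairX, pairX, pairing, pairing, map_add, ← integral_conj, ← integral_conj]
  congr 1
  · refine integral_congr_ae ?_
    filter_upwards [hu.1, hv.1] with z h1 h2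
    rw [h1, h2, map_mul]
  · refine integral_congr_ae ?_
    filter_upwards [hu.2, hv.2] with z h1 h2
    rw [h1, h2, map_mul]

theorem continuous_prL {V : Type*} [TopologicalSpace V] {f : V → L2w (wt1 α)}
    {v : V → L2w (wt1 (-α))} {s : Set V} (hf : ContinuousOn f s) (hv : ContinuousOn v s) :
    ContinuousOn (fun x => prL (v x) (f x)) s :=
  ContinuousOn.inner ((expMulLI (wt1 (-α))).continuous.comp_continuousOn hv)
    ((expMulLI (wt1 α)).continuous.comp_continuousOn hf)

theorem continuousOn_pairX {V : Type*} [TopologicalSpace V] {u : V → Xline α}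
    {v : V → Xline (-α)} {s : Set V} (hu : ContinuousOn u s) (hv : ContinuousOn v s) :
    ContinuousOn (fun x => pairX (u x) (v x)) s := by
  simp only [pairX_eq]
  exact (continuous_prL ((lcmp α 0).continuous.comp_continuousOn hu)
    ((lcmp (-α) 0).continuous.comp_continuousOn hv)).add
    (continuous_prL ((lcmpS α).continuous.comp_continuousOn hu)
    ((lcmpS (-α)).continuous.comp_continuousOn hv))

theorem neg_mem_Icc {η₀ η : ℝ} (h : η ∈ Icc (-η₀) η₀) : -η ∈ Icc (-η₀) η₀ :=
  ⟨by linarith [h.2], by linarith [h.1]⟩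

section Curve

variable {η₀ : ℝ} {lam : ℝ → ℂ} {ζ : ℝ → Xline α} {ζs : ℝ → Xline (-α)}

namespace IsResonantCurve

theorem pairX_neg (h : IsResonantCurve a b c α η₀ lam ζ ζs) {η : ℝ} (hη : η ∈ Icc (-η₀) η₀) :
    pairX (ζ (-η)) (ζs (-η)) = conj (pairX (ζ η) (ζs η)) :=
  pairX_isConj (h.zeta_conj η hη) (h.zetaStar_conj η hη)

/-- The adjoint modes diagonalize `𝓛(η)` by duality. -/
theorem pairX_graph (h : IsResonantCurve a b c α η₀ lam ζ ζs) {η : ℝ} (hη : η ∈ Icc (-η₀) η₀)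
    {x y : Xline α} (hxy : LEtaGraph a b c α η x y) :
    pairX y (ζs η) = lam η * pairX x (ζs η) := by
  rw [h.eigenStar η hη x y hxy, pairX_smul_right, h.lam_conj _ (neg_mem_Icc hη), neg_neg]

theorem pairX_zeta_neg (h : IsResonantCurve a b c α η₀ lam ζ ζs) {η : ℝ}
    (hη : η ∈ Icc (-η₀) η₀) (h0 : η ≠ 0) : pairX (ζ η) (ζs (-η)) = 0 := by
  have e := h.pairX_graph (neg_mem_Icc hη) (LEtaGraph_neg.2 (h.eigen η hη))
  rw [pairX_smul_left, ← h.lam_conj η hη] at e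
  have e2 : (lam η - conj (lam η)) * pairX (ζ η) (ζs (-η)) = 0 := by
    rw [sub_mul, e, sub_self]
  refine (mul_eq_zero.1 e2).resolve_left fun h1 => h.lam_im_ne η hη h0 ?_
  exact Complex.conj_eq_iff_im.1 (sub_eq_zero.1 h1).symm

theorem continuousOn_pairX (h : IsResonantCurve a b c α η₀ lam ζ ζs) :
    ContinuousOn (fun η => pairX (ζ η) (ζs η)) (Icc (-η₀) η₀) :=
  BenneyLuke.continuousOn_pairX h.zeta_smooth.continuousOn h.zetaStar_smooth.continuousOn

end IsResonantCurve

end Curve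

/-- A function that vanishes off `0` and equals `A + B η + O(η²)` has `A = B = 0`. -/
theorem eq_zero_of_expansion {A B : ℂ} {C η₀ : ℝ} (hη₀ : 0 < η₀)
    (h : ∀ η ∈ Icc (-η₀) η₀, η ≠ 0 → ‖A + B * η‖ ≤ C * η ^ 2) : A = 0 ∧ B = 0 := by
  have hev : ∀ᶠ η : ℝ in 𝓝[>] 0, η ∈ Icc (-η₀) η₀ ∧ 0 < η := by
    filter_upwards [Ioo_mem_nhdsGT hη₀] with η hη
    exact ⟨⟨by linarith [hη.1], hη.2.le⟩, hη.1⟩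
  have hA : A = 0 := by
    have l1 : Tendsto (fun η : ℝ => A + B * η) (𝓝[>] 0) (𝓝 A) := by
      have : Continuous fun η : ℝ => A + B * η := by fun_prop
      simpa using (this.tendsto 0).mono_left nhdsWithin_le_nhds
    have l2 : Tendsto (fun η : ℝ => A + B * η) (𝓝[>] 0) (𝓝 0) := by
      refine squeeze_zero_norm' (hev.mono fun η hη => h η hη.1 hη.2.ne') ?_
      have : Continuous fun η : ℝ => C * η ^ 2 := by fun_prop
      simpa using (this.tendsto 0).mono_left nhdsWithin_le_nhds
    exact tendsto_nhds_unique l1 l2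
  refine ⟨hA, ?_⟩
  have l2 : Tendsto (fun _ : ℝ => B) (𝓝[>] 0) (𝓝 0) := by
    refine squeeze_zero_norm' (a := fun η => C * η) (hev.mono fun η hη => ?_) ?_
    · have := h η hη.1 hη.2.ne'
      rw [hA, zero_add, norm_mul, norm_real, norm_eq_abs, abs_of_pos hη.2, sq,
        ← mul_assoc] at this
      exact le_of_mul_le_mul_right this hη.2
    · have : Continuous fun η : ℝ => C * η := by fun_prop
      simpa using (this.tendsto 0).mono_left nhdsWithin_le_nhds
  exact tendsto_nhds_unique tendsto_const_nhds l2

/-- The pairing of two first order expansions. -/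
theorem norm_pairing_expansion_le {V W : Type*} [NormedAddCommGroup V] [NormedSpace ℂ V]
    [NormedAddCommGroup W] [NormedSpace ℂ W] {B : V → W → ℂ}
    (add_left : ∀ u u' v, B (u + u') v = B u v + B u' v)
    (add_right : ∀ u v v', B u (v + v') = B u v + B u v')
    (smul_left : ∀ (k : ℂ) u v, B (k • u) v = k * B u v)
    (smul_right : ∀ (k : ℂ) u v, B u (k • v) = conj k * B u v)
    (bound : ∀ u v, ‖B u v‖ ≤ 2 * ‖u‖ * ‖v‖) {u u₁ u₂ : V} {v v₁ v₂ : W} {s : ℂ}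
    {K E M : ℝ} (hM : ‖s‖ ≤ M) (hE : E ≤ M ^ 2) (hK : 0 ≤ K) (hE0 : 0 ≤ E)
    (hu : ‖u - (u₁ + s • u₂)‖ ≤ K * E) (hv : ‖v - (v₁ + s • v₂)‖ ≤ K * E)
    (hs : ‖s‖ ^ 2 ≤ K * E) :
    ‖B u v - (B u₁ v₁ + (s * B u₂ v₁ + conj s * B u₁ v₂))‖ ≤
      K * (2 * (‖u₁‖ + M * ‖u₂‖ + K * M ^ 2) + 2 * (‖v₁‖ + M * ‖v₂‖) + 2 * ‖u₂‖ * ‖v₂‖) * E := by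
  have hM0 : 0 ≤ M := (norm_nonneg s).trans hM
  set r := u - (u₁ + s • u₂) with hr
  set t := v - (v₁ + s • v₂) with ht
  have eu : u = u₁ + s • u₂ + r := by rw [hr]; abel
  have ev : v = v₁ + s • v₂ + t := by rw [ht]; abel
  have e : B u v - (B u₁ v₁ + (s * B u₂ v₁ + conj s * B u₁ v₂)) =
      B u t + B r (v₁ + s • v₂) + s * (conj s * B u₂ v₂) := by
    have e1 : B u v = B u (v₁ + s • v₂) + B u t := by rw [← add_right, ← ev]
    have e2 : B u (v₁ + s • v₂) = B (u₁ + s • u₂) (v₁ + s • v₂) + B r (v₁ + s • v₂) := by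
      rw [← add_left, ← eu]
    rw [e1, e2]
    simp only [add_left, add_right, smul_left, smul_right]
    ring
  have nu : ‖u‖ ≤ ‖u₁‖ + M * ‖u₂‖ + K * M ^ 2 := by
    rw [eu]
    refine (norm_add_le _ _).trans (add_le_add ((norm_add_le _ _).trans (add_le_add le_rfl ?_))
      (hu.trans (mul_le_mul_of_nonneg_left hE hK)))
    rw [norm_smul]
    exact mul_le_mul_of_nonneg_right hM (norm_nonneg _)
  have nv : ‖v₁ + s • v₂‖ ≤ ‖v₁‖ + M * ‖v₂‖ := by
    refine (norm_add_le _ _).trans (add_le_add le_rfl ?_)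
    rw [norm_smul]
    exact mul_le_mul_of_nonneg_right hM (norm_nonneg _)
  rw [e]
  have p1 : ‖B u t‖ ≤ 2 * (‖u₁‖ + M * ‖u₂‖ + K * M ^ 2) * (K * E) :=
    (bound u t).trans (mul_le_mul (by linarith) hv (norm_nonneg _) (by positivity))
  have p2 : ‖B r (v₁ + s • v₂)‖ ≤ 2 * (K * E) * (‖v₁‖ + M * ‖v₂‖) :=
    (bound _ _).trans (mul_le_mul (by linarith) nv (norm_nonneg _) (by positivity))
  have p3 : ‖s * (conj s * B u₂ v₂)‖ ≤ (K * E) * (2 * ‖u₂‖ * ‖v₂‖) := by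
    rw [norm_mul, norm_mul, RCLike.norm_conj, ← mul_assoc, ← sq]
    exact mul_le_mul hs (bound _ _) (norm_nonneg _) (by positivity)
  refine (norm_add₃_le).trans ?_
  linarith

section Expansion

variable {V : Type*} [NormedAddCommGroup V] [NormedSpace ℂ V]

/-- A function with an expansion `A + η B + O(η²)` differs at `η` and `-η` by `O(η)`. -/
theorem norm_sub_neg_le {f : ℝ → V}
    {f₀ f₁ : V} {l K η₀ : ℝ} (hK : 0 ≤ K)
    (h : ∀ η ∈ Icc (-η₀) η₀, ‖f η - (f₀ + (I * l * η) • f₁)‖ ≤ K * η ^ 2) {η : ℝ}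
    (hη : η ∈ Icc (-η₀) η₀) :
    ‖f η - f (-η)‖ ≤ (2 * |l| * ‖f₁‖ + 2 * K * η₀) * |η| := by
  have e : f η - f (-η) = (f η - (f₀ + (I * l * η) • f₁)) -
      (f (-η) - (f₀ + (I * l * (-η : ℝ)) • f₁)) + (2 * (I * l * η)) • f₁ := by
    push_cast
    module
  have h1 := h η hη
  have h2 := h _ (neg_mem_Icc hη)
  have h3 : |η| ≤ η₀ := abs_le.2 hη
  rw [neg_sq] at h2
  rw [e]
  refine (norm_add_le _ _).trans ((add_le_add (norm_sub_le _ _) le_rfl).trans ?_)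
  have h4 : ‖(2 * (I * l * η)) • f₁‖ = 2 * |l| * ‖f₁‖ * |η| := by
    rw [norm_smul, norm_mul, norm_mul, norm_mul, norm_I, norm_real,
      norm_real, Complex.norm_two, norm_eq_abs, norm_eq_abs]
    ring
  have h5 : K * η ^ 2 ≤ K * η₀ * |η| := by
    rw [← sq_abs, sq, mul_assoc]
    exact mul_le_mul_of_nonneg_left (mul_le_mul_of_nonneg_right h3 (abs_nonneg _)) hK
  rw [h4]
  linarith

theorem exists_norm_le_Icc {f : ℝ → V}
    {f₀ f₁ : V} {l K η₀ : ℝ} (hc : ContinuousOn f (Icc (-η₀) η₀))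
    (h : ∀ η ∈ Icc (-η₀) η₀, ‖f η - (f₀ + (I * l * η) • f₁)‖ ≤ K * η ^ 2) :
    ∃ C, 0 ≤ C ∧ ∀ η ∈ Icc (-η₀) η₀, ‖f η‖ ≤ C ∧ ‖f η - f (-η)‖ ≤ C * |η| := by
  obtain ⟨C, hC⟩ := isCompact_Icc.exists_bound_of_continuousOn hc
  refine ⟨max (max C 0) (2 * |l| * ‖f₁‖ + 2 * |K| * η₀), (le_max_right C 0).trans (le_max_left _ _),
    fun η hη => ⟨(hC η hη).trans ((le_max_left C 0).trans (le_max_left _ _)), ?_⟩⟩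
  exact (norm_sub_neg_le (abs_nonneg K) (fun η hη => (h η hη).trans
    (mul_le_mul_of_nonneg_right (le_abs_self K) (sq_nonneg _))) hη).trans
    (mul_le_mul_of_nonneg_right (le_max_right _ _) (abs_nonneg _))

theorem exists_norm_le_Icc' {f : ℝ → V}
    {f₀ f₁ : V} {l K η₀ : ℝ} (hc : ContinuousOn f (Icc (-η₀) η₀))
    (h : ∀ η ∈ Icc (-η₀) η₀, ‖f η - (f₀ - (I * l * η) • f₁)‖ ≤ K * η ^ 2) :
    ∃ C, 0 ≤ C ∧ ∀ η ∈ Icc (-η₀) η₀, ‖f η‖ ≤ C ∧ ‖f η - f (-η)‖ ≤ C * |η| :=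
  exists_norm_le_Icc (f₁ := -f₁) hc fun η hη => by
    rw [smul_neg, ← sub_eq_add_neg]
    exact h η hη

end Expansion

/-- A continuous function without zeros except possibly at `0`, which near `0` is bounded below by
a multiple of `|η|`, is bounded below by a multiple of `|η|`. -/
theorem exists_abs_lower_bound {f : ℝ → ℝ} {η₀ d δ : ℝ} (hη₀ : 0 < η₀) (hd : 0 < d) (hδ : 0 < δ)
    (hf : ContinuousOn f (Icc (-η₀) η₀)) (h0 : ∀ η ∈ Icc (-η₀) η₀, η ≠ 0 → f η ≠ 0)
    (h : ∀ η ∈ Icc (-η₀) η₀, |η| ≤ δ → d * |η| ≤ |f η|) :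
    ∃ d', 0 < d' ∧ ∀ η ∈ Icc (-η₀) η₀, d' * |η| ≤ |f η| := by
  have hc : IsCompact (Icc (-η₀) η₀ ∩ {η | δ ≤ |η|}) :=
    isCompact_Icc.inter_right (isClosed_le continuous_const continuous_abs)
  have hcont : ContinuousOn (fun η => |f η|) (Icc (-η₀) η₀ ∩ {η | δ ≤ |η|}) :=
    (hf.mono inter_subset_left).abs
  have hne : ∀ η ∈ Icc (-η₀) η₀ ∩ {η | δ ≤ |η|}, f η ≠ 0 := fun η hη =>
    h0 η hη.1 (abs_pos.1 (hδ.trans_le hη.2))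
  obtain ⟨e, he, hee⟩ : ∃ e, 0 < e ∧ ∀ η ∈ Icc (-η₀) η₀ ∩ {η | δ ≤ |η|}, e ≤ |f η| := by
    rcases (Icc (-η₀) η₀ ∩ {η | δ ≤ |η|}).eq_empty_or_nonempty with hemp | hnon
    · exact ⟨1, one_pos, fun η hη => by rw [hemp] at hη; exact hη.elim⟩
    · obtain ⟨x, hx, hmin⟩ := hc.exists_isMinOn hnon hcont
      exact ⟨|f x|, abs_pos.2 (hne x hx), fun η hη => hmin hη⟩
  refine ⟨min d (e / η₀), lt_min hd (div_pos he hη₀), fun η hη => ?_⟩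
  rcases le_total |η| δ with h1 | h1
  · exact (mul_le_mul_of_nonneg_right (min_le_left _ _) (abs_nonneg _)).trans (h η hη h1)
  · refine (mul_le_mul (min_le_right _ _) (abs_le.2 hη) (abs_nonneg _) (by positivity)).trans ?_
    rw [div_mul_cancel₀ _ hη₀.ne']
    exact hee η ⟨hη, h1⟩

section Curve

variable {η₀ : ℝ} {lam : ℝ → ℂ} {ζ : ℝ → Xline α} {ζs : ℝ → Xline (-α)}

/-- `⟨ζ(η), ζ^*(η)⟩ = i θ η + O(η²)` with `θ > 0`. -/
theorem IsResonantCurve.exists_pairX_expansion (hp : Params a b c α)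
    (hη₀ : 0 < η₀) (h : IsResonantCurve a b c α η₀ lam ζ ζs) :
    ∃ θ C : ℝ, 0 < θ ∧ ∀ η ∈ Icc (-η₀) η₀,
      ‖pairX (ζ η) (ζs η) - I * θ * η‖ ≤ C * η ^ 2 := by
  obtain ⟨l, K, ζ₁, ζ₂, ζs₁, ζs₂, hl, -, r2, -, r4, has⟩ := h.asymp
  obtain ⟨t, ht, het⟩ := pairX_zeta_pos hp r2 r4
  have hK : K ≤ |K| + l ^ 2 := (le_abs_self K).trans (le_add_of_nonneg_right (sq_nonneg _))
  set K' := |K| + l ^ 2 with hK'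
  have hK0 : 0 ≤ K' := by positivity
  have hEM : ∀ η ∈ Icc (-η₀) η₀, η ^ 2 ≤ ((l + 1) * η₀) ^ 2 ∧
      ‖I * l * η‖ ≤ (l + 1) * η₀ ∧ ‖I * l * η‖ ^ 2 ≤ K' * η ^ 2 := by
    intro η hη
    have h1 : |η| ≤ η₀ := abs_le.2 hη
    have h2 : ‖I * l * η‖ = l * |η| := by
      rw [norm_mul, norm_mul, norm_I, one_mul, norm_real, norm_real,
        norm_eq_abs, norm_eq_abs, abs_of_pos hl]
    refine ⟨?_, ?_, ?_⟩
    · rw [← sq_abs η]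
      exact pow_le_pow_left₀ (abs_nonneg _) (by nlinarith) 2
    · rw [h2]; nlinarith
    · rw [h2, mul_pow, sq_abs]
      exact mul_le_mul_of_nonneg_right (le_add_of_nonneg_left (abs_nonneg K)) (sq_nonneg _)
  have conj_s : ∀ η : ℝ, conj (I * l * η) = -(I * l * η) := by
    intro η
    simp
  have key : ∀ (v₂ : Xline (-α)) (v : ℝ → Xline (-α)),
      (∀ η ∈ Icc (-η₀) η₀, ‖v η - (ζs₂ + (I * l * η) • v₂)‖ ≤ K * η ^ 2) →
      ∃ C, ∀ η ∈ Icc (-η₀) η₀, ‖pairX (ζ η) (v η) - (pairX ζ₁ ζs₂ +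
        (I * l) * (pairX ζ₂ ζs₂ - pairX ζ₁ v₂) * η)‖ ≤ C * η ^ 2 := by
    intro v₂ v hv
    refine ⟨K' * (2 * (‖ζ₁‖ + (l + 1) * η₀ * ‖ζ₂‖ + K' * ((l + 1) * η₀) ^ 2) +
      2 * (‖ζs₂‖ + (l + 1) * η₀ * ‖v₂‖) + 2 * ‖ζ₂‖ * ‖v₂‖), fun η hη => ?_⟩
    obtain ⟨h1, h2, h3⟩ := hEM η hη
    have := norm_pairing_expansion_le (V := Xline α) (W := Xline (-α)) (B := pairX) pairX_add_left pairX_add_right pairX_smul_left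
      pairX_smul_right norm_pairX_le h2 h1 hK0 (sq_nonneg η)
      ((has η hη).2.1.trans (mul_le_mul_of_nonneg_right hK (sq_nonneg _)))
      ((hv η hη).trans (mul_le_mul_of_nonneg_right hK (sq_nonneg _))) h3
    rw [conj_s] at this
    refine le_trans (le_of_eq ?_) this
    congr 2
    ring
  obtain ⟨C₁, hC₁⟩ := key ζs₁ (fun η => ζs (-η)) (fun η hη => by
    have := (has _ (neg_mem_Icc hη)).2.2
    rw [neg_sq] at this
    refine le_trans (le_of_eq ?_) this
    congr 2
    push_cast
    module)
  obtain ⟨C₂, hC₂⟩ := key (-ζs₁) ζs (fun η hη => by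
    refine le_trans (le_of_eq ?_) (has η hη).2.2
    congr 2
    module)
  obtain ⟨hA, hB⟩ := eq_zero_of_expansion (C := C₁) hη₀ (fun η hη h0 => by
    have := hC₁ η hη
    rwa [h.pairX_zeta_neg hη h0, zero_sub, norm_neg] at this)
  have hll : (I * l : ℂ) ≠ 0 := mul_ne_zero Complex.I_ne_zero (by exact_mod_cast hl.ne')
  have h12 : pairX ζ₁ ζs₁ = t := by
    rw [← het]
    exact (sub_eq_zero.1 ((mul_eq_zero.1 hB).resolve_left hll)).symm
  refine ⟨2 * l * t, C₂, by positivity, fun η hη => ?_⟩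
  have := hC₂ η hη
  have e : pairX ζ₁ (-ζs₁) = -t := by
    have := pairX_smul_right (-1 : ℂ) ζ₁ ζs₁
    rw [neg_one_smul, h12] at this
    simpa using this
  rw [hA, het, e] at this
  refine le_trans (le_of_eq ?_) this
  congr 2
  push_cast
  ring

/-- The bounds for the curve of resonant modes near `η = 0` that make the modes bounded. -/
theorem IsResonantCurve.exists_bounds (hp : Params a b c α)
    (hη₀ : 0 < η₀) (h : IsResonantCurve a b c α η₀ lam ζ ζs) :
    ∃ d C : ℝ, 0 < d ∧ 0 ≤ C ∧ ∀ η ∈ Icc (-η₀) η₀,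
      d * |η| ≤ |(pairX (ζ η) (ζs η)).im| ∧ |(pairX (ζ η) (ζs η)).re| ≤ C * η ^ 2 ∧
      ‖ζ η‖ ≤ C ∧ ‖ζs η‖ ≤ C ∧ ‖ζ η - ζ (-η)‖ ≤ C * |η| ∧ ‖ζs η - ζs (-η)‖ ≤ C * |η| := by
  obtain ⟨θ, C, hθ, hC⟩ := h.exists_pairX_expansion hp hη₀
  have him : ∀ η : ℝ, (I * θ * η).im = θ * η ∧ (I * θ * η).re = 0 := by
    intro η
    simp
  have him' : ∀ η ∈ Icc (-η₀) η₀, |(pairX (ζ η) (ζs η)).im - θ * η| ≤ C * η ^ 2 := fun η hη => by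
    have := (Complex.abs_im_le_norm _).trans (hC η hη)
    rwa [Complex.sub_im, (him η).1] at this
  have hre' : ∀ η ∈ Icc (-η₀) η₀, |(pairX (ζ η) (ζs η)).re| ≤ C * η ^ 2 := fun η hη => by
    have := (Complex.abs_re_le_norm _).trans (hC η hη)
    rwa [Complex.sub_re, (him η).2, sub_zero] at this
  obtain ⟨d, hd, hdd⟩ := exists_abs_lower_bound (f := fun η => (pairX (ζ η) (ζs η)).im)
    (d := θ / 2) (δ := θ / (2 * (|C| + 1))) hη₀ (by positivity) (by positivity)
    (Complex.continuous_im.comp_continuousOn h.continuousOn_pairX)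
    (fun η hη h0 => h.pairing_im_ne η hη h0) (fun η hη hδ => by
      have h1 := him' η hη
      have h2 : θ * |η| = |θ * η| := by rw [abs_mul, abs_of_pos hθ]
      have h3 : |θ * η| ≤ |(pairX (ζ η) (ζs η)).im| + C * η ^ 2 := by
        have := abs_sub_abs_le_abs_sub (θ * η) ((pairX (ζ η) (ζs η)).im)
        rw [abs_sub_comm] at h1
        linarith
      have h4 : C * η ^ 2 ≤ θ / 2 * |η| := by
        rw [le_div_iff₀ (by positivity)] at hδ
        have : C * η ^ 2 ≤ (|C| + 1) * |η| * |η| := by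
          rw [mul_assoc, ← sq, sq_abs]
          exact mul_le_mul_of_nonneg_right (by linarith [le_abs_self C]) (sq_nonneg _)
        refine this.trans (mul_le_mul_of_nonneg_right ?_ (abs_nonneg _))
        linarith
      linarith)
  obtain ⟨l, K, ζ₁, ζ₂, ζs₁, ζs₂, hl, -, -, -, -, has⟩ := h.asymp
  obtain ⟨C₁, hC₁, b1⟩ := exists_norm_le_Icc h.zeta_smooth.continuousOn
    fun η hη => (has η hη).2.1
  obtain ⟨C₂, hC₂, b2⟩ := exists_norm_le_Icc' h.zetaStar_smooth.continuousOn
    fun η hη => (has η hη).2.2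
  have hCC := le_abs_self C
  have hC0 := abs_nonneg C
  refine ⟨d, |C| + C₁ + C₂, hd, by positivity, fun η hη => ⟨hdd η hη, (hre' η hη).trans ?_,
    (b1 η hη).1.trans (by linarith), (b2 η hη).1.trans (by linarith),
    (b1 η hη).2.trans ?_, (b2 η hη).2.trans ?_⟩⟩
  · exact mul_le_mul_of_nonneg_right (by linarith) (sq_nonneg _)
  · exact mul_le_mul_of_nonneg_right (by linarith) (abs_nonneg _)
  · exact mul_le_mul_of_nonneg_right (by linarith) (abs_nonneg _)

end Curve

/-! ### The projection on a fiber -/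

section Modes

variable {V : Type*} [NormedAddCommGroup V] [NormedSpace ℂ V]

theorem norm_mode_add_le {z w : V} {r C B : ℝ}
    (hz : ‖z‖ ≤ C) (hw : ‖w‖ ≤ C) (hr : |r| ≤ B) :
    ‖(1 / 2 : ℂ) • ((1 + I * (r : ℂ)) • z + (1 + I * ((-r : ℝ) : ℂ)) • w)‖ ≤
      (1 + B) * C := by
  have hr' : ∀ s : ℝ, |s| ≤ B → ‖(1 + I * (s : ℂ))‖ ≤ 1 + B := fun s hs => by
    refine (norm_add_le _ _).trans (add_le_add norm_one.le ?_)
    rwa [norm_mul, norm_I, one_mul, norm_real]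
  have hB : 0 ≤ B := (abs_nonneg _).trans hr
  rw [norm_smul]
  have h1 := norm_add_le ((1 + I * (r : ℂ)) • z) ((1 + I * ((-r : ℝ) : ℂ)) • w)
  rw [norm_smul, norm_smul] at h1
  have h2 := mul_le_mul (hr' r hr) hz (norm_nonneg _) (by positivity)
  have h3 := mul_le_mul (hr' (-r) (by rwa [abs_neg])) hw (norm_nonneg _) (by positivity)
  have h4 : ‖(1 / 2 : ℂ)‖ = 1 / 2 := by norm_num
  rw [h4]
  linarith

theorem norm_mode_sub_le {z w : V}
    {r C B t : ℝ} (hz : ‖z‖ ≤ C) (hw : ‖w‖ ≤ C) (hzw : ‖z - w‖ ≤ C * t) (hr : |r| ≤ B * t) :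
    ‖(1 + I * (r : ℂ)) • z - (1 + I * ((-r : ℝ) : ℂ)) • w‖ ≤
      (C + B * (2 * C)) * t := by
  have e : (1 + I * (r : ℂ)) • z - (1 + I * ((-r : ℝ) : ℂ)) • w =
      (z - w) + (I * (r : ℂ)) • (z + w) := by
    push_cast
    module
  rw [e]
  refine (norm_add_le _ _).trans ?_
  rw [norm_smul, norm_mul, norm_I, one_mul, norm_real, norm_eq_abs]
  have h1 : ‖z + w‖ ≤ 2 * C := (norm_add_le _ _).trans (by linarith)
  have h2 := mul_le_mul hr h1 (norm_nonneg _) ((abs_nonneg _).trans hr)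
  linarith

theorem norm_inv_smul_le {z : V}
    {d C t : ℝ} {k : ℂ} (ht : 0 < t) (hd : 0 < d) (hk : ‖k‖ ≤ 1 / (d * t)) (hz : ‖z‖ ≤ C * t) :
    ‖k • z‖ ≤ C / d := by
  rw [norm_smul]
  refine (mul_le_mul hk hz (norm_nonneg _) (by positivity)).trans (le_of_eq ?_)
  field_simp

theorem norm_half_add_le {z w : V} {C : ℝ}
    (hz : ‖z‖ ≤ C) (hw : ‖w‖ ≤ C) : ‖(1 / 2 : ℂ) • (z + w)‖ ≤ C := by
  rw [norm_smul]
  have h4 : ‖(1 / 2 : ℂ)‖ = 1 / 2 := by norm_num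
  rw [h4]
  have := norm_add_le z w
  linarith

end Modes

theorem continuousOn_smulRight {V W X : Type*} [NormedAddCommGroup V] [NormedSpace ℂ V]
    [NormedAddCommGroup W] [NormedSpace ℂ W] [TopologicalSpace X] {s : Set X} {f : X → W →L[ℂ] ℂ}
    {g : X → V} (hf : ContinuousOn f s) (hg : ContinuousOn g s) :
    ContinuousOn (fun x => (f x).smulRight (g x)) s :=
  (ContinuousLinearMap.smulRightL ℂ W V).continuous.comp_continuousOn hf |>.clm_apply hg

theorem continuousOn_prL {X : Type*} [TopologicalSpace X] {s : Set X}
    {v : X → L2w (wt1 (-α))} (hv : ContinuousOn v s) : ContinuousOn (fun x => prL (v x)) s :=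
  ((innerSL ℂ).continuous.comp_continuousOn
    ((expMulLI (wt1 (-α))).continuous.comp_continuousOn hv)).clm_comp continuousOn_const

theorem opNorm_prL_le (v : L2w (wt1 (-α))) : ‖prL v‖ ≤ ‖v‖ :=
  opNorm_le_bound _ (norm_nonneg _) (norm_prL_le v)

section Curve

variable {η₀ : ℝ} {lam : ℝ → ℂ} {ζ : ℝ → Xline α} {ζs : ℝ → Xline (-α)}

/-- The ratio of real and imaginary part of `⟨ζ, ζ^*⟩`. -/
def rho (ζ : ℝ → Xline α) (ζs : ℝ → Xline (-α)) (η : ℝ) : ℝ :=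
  (pairX (ζ η) (ζs η)).re / (pairX (ζ η) (ζs η)).im

theorem gMode_eq (η : ℝ) : gMode ζ ζs η = (1 + I * (rho ζ ζs η : ℂ)) • ζ η := rfl

namespace IsResonantCurve

theorem rho_neg (h : IsResonantCurve a b c α η₀ lam ζ ζs) {η : ℝ} (hη : η ∈ Icc (-η₀) η₀) :
    rho ζ ζs (-η) = -rho ζ ζs η := by
  rw [rho, rho, h.pairX_neg hη, Complex.conj_re, Complex.conj_im, div_neg]

/-- The factor `1 + i ρ` makes the pairing of `g` and `g*` purely imaginary. -/
theorem pairX_gMode_eq (h : IsResonantCurve a b c α η₀ lam ζ ζs) {η : ℝ}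
    (hη : η ∈ Icc (-η₀) η₀) (h0 : η ≠ 0) :
    pairX (gMode ζ ζs η) (ζs η) = 2 * I * (kappa ζ ζs η : ℂ) ∧
      kappa ζ ζs η = ((pairX (ζ η) (ζs η)).im +
        (pairX (ζ η) (ζs η)).re ^ 2 / (pairX (ζ η) (ζs η)).im) / 2 := by
  have h1 := h.pairing_im_ne η hη h0
  have e : pairX (gMode ζ ζs η) (ζs η) = I * (((pairX (ζ η) (ζs η)).im +
        (pairX (ζ η) (ζs η)).re ^ 2 / (pairX (ζ η) (ζs η)).im : ℝ) : ℂ) := by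
    rw [gMode, pairX_smul_left, sq]
    apply Complex.ext
    · simp
      field_simp
      ring
    · simp
      field_simp
  have e2 : kappa ζ ζs η = ((pairX (ζ η) (ζs η)).im +
        (pairX (ζ η) (ζs η)).re ^ 2 / (pairX (ζ η) (ζs η)).im) / 2 := by
    rw [kappa, e]
    congr 1
    simp only [Complex.mul_im, Complex.I_re, Complex.I_im, Complex.ofReal_re, Complex.ofReal_im]
    ring
  refine ⟨?_, e2⟩
  rw [e, e2]
  push_cast
  ring

theorem kappa_neg (h : IsResonantCurve a b c α η₀ lam ζ ζs) {η : ℝ} (hη : η ∈ Icc (-η₀) η₀)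
    (h0 : η ≠ 0) : kappa ζ ζs (-η) = -kappa ζ ζs η := by
  rw [(h.pairX_gMode_eq hη h0).2, (h.pairX_gMode_eq (neg_mem_Icc hη) (neg_ne_zero.2 h0)).2,
    h.pairX_neg hη, Complex.conj_re, Complex.conj_im]
  rw [div_neg]
  ring

theorem le_abs_kappa (h : IsResonantCurve a b c α η₀ lam ζ ζs) {η : ℝ} (hη : η ∈ Icc (-η₀) η₀)
    (h0 : η ≠ 0) : |(pairX (ζ η) (ζs η)).im| ≤ 2 * |kappa ζ ζs η| := by
  have h1 := h.pairing_im_ne η hη h0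
  rw [(h.pairX_gMode_eq hη h0).2]
  set m := (pairX (ζ η) (ζs η)).im
  set r := (pairX (ζ η) (ζs η)).re
  have e : (m + r ^ 2 / m) / 2 = (m ^ 2 + r ^ 2) / m / 2 := by
    field_simp
  rw [e, abs_div, abs_two, mul_div_cancel₀ _ two_ne_zero, abs_div,
    abs_of_nonneg (by positivity : 0 ≤ m ^ 2 + r ^ 2), le_div_iff₀ (abs_pos.2 h1), ← sq, sq_abs]
  exact le_add_of_nonneg_right (sq_nonneg r)

theorem kappa_ne_zero (h : IsResonantCurve a b c α η₀ lam ζ ζs) {η : ℝ} (hη : η ∈ Icc (-η₀) η₀)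
    (h0 : η ≠ 0) : (kappa ζ ζs η : ℂ) ≠ 0 := by
  have h1 := abs_pos.2 (h.pairing_im_ne η hη h0)
  have h2 := h.le_abs_kappa hη h0
  have : 0 < |kappa ζ ζs η| := by linarith
  exact_mod_cast abs_pos.1 this

/-- The modes are bounded uniformly in the frequency. -/
theorem exists_modes_bound (hp : Params a b c α) (hη₀ : 0 < η₀)
    (h : IsResonantCurve a b c α η₀ lam ζ ζs) :
    ∃ B : ℝ, ∀ η ∈ Icc (-η₀) η₀, η ≠ 0 → ∀ k, ‖gk ζ ζs k η‖ ≤ B ∧ ‖gkStar ζ ζs k η‖ ≤ B := by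
  obtain ⟨d, C, hd, hC, hb⟩ := h.exists_bounds hp hη₀
  refine ⟨(1 + C / d * η₀) * C + (C + C / d * (2 * C)) / d + C / d + C, fun η hη h0 => ?_⟩
  have ht : 0 < |η| := abs_pos.2 h0
  have htη : |η| ≤ η₀ := abs_le.2 hη
  obtain ⟨b1, b2, b3, b4, b5, b6⟩ := hb η hη
  have b3' := (hb _ (neg_mem_Icc hη)).2.2.1
  have b4' := (hb _ (neg_mem_Icc hη)).2.2.2.1
  have hr : |rho ζ ζs η| ≤ C / d * |η| := by
    rw [rho, abs_div, div_le_iff₀ (abs_pos.2 (h.pairing_im_ne η hη h0))]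
    refine b2.trans ?_
    calc C * η ^ 2 = C / d * |η| * (d * |η|) := by
          rw [← sq_abs]; field_simp
      _ ≤ _ := mul_le_mul_of_nonneg_left b1 (by positivity)
  have hk : d * |η| ≤ 2 * |kappa ζ ζs η| := b1.trans (h.le_abs_kappa hη h0)
  have n0 : 0 ≤ (1 + C / d * η₀) * C := by positivity
  have n1 : 0 ≤ (C + C / d * (2 * C)) / d := by positivity
  have n2 : 0 ≤ C / d := by positivity
  have k1 : ‖(1 / (2 * I * (kappa ζ ζs η : ℂ)))‖ ≤ 1 / (d * |η|) := by
    rw [norm_div, norm_one, norm_mul, norm_mul, norm_I, Complex.norm_two,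
      norm_real, mul_one, norm_eq_abs]
    exact one_div_le_one_div_of_le (by positivity) hk
  have k2 : ‖(I / (2 * (kappa ζ ζs η : ℂ)))‖ ≤ 1 / (d * |η|) := by
    rw [norm_div, norm_mul, norm_I, Complex.norm_two, norm_real, norm_eq_abs]
    exact one_div_le_one_div_of_le (by positivity) hk
  intro k
  fin_cases k
  · constructor
    · change ‖(1 / 2 : ℂ) • (gMode ζ ζs η + gMode ζ ζs (-η))‖ ≤ _
      rw [gMode_eq, gMode_eq, h.rho_neg hη]
      exact (norm_mode_add_le b3 b3' (hr.trans (mul_le_mul_of_nonneg_left htη n2))).trans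
        (by linarith)
    · change ‖(I / (2 * (kappa ζ ζs η : ℂ))) • (ζs η - ζs (-η))‖ ≤ _
      exact (norm_inv_smul_le ht hd k2 b6).trans (by linarith)
  · constructor
    · change ‖(1 / (2 * I * (kappa ζ ζs η : ℂ))) • (gMode ζ ζs η - gMode ζ ζs (-η))‖ ≤ _
      rw [gMode_eq, gMode_eq, h.rho_neg hη]
      exact (norm_inv_smul_le ht hd k1 (norm_mode_sub_le b3 b3' b5 hr)).trans (by linarith)
    · change ‖(1 / 2 : ℂ) • (ζs η + ζs (-η))‖ ≤ _
      exact (norm_half_add_le b4 b4').trans (by linarith)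

theorem continuousOn_gMode (h : IsResonantCurve a b c α η₀ lam ζ ζs) :
    ContinuousOn (gMode ζ ζs) (Icc (-η₀) η₀ \ {0}) := by
  have hp := h.continuousOn_pairX.mono (sdiff_subset (t := {(0 : ℝ)}))
  have hr : ContinuousOn (rho ζ ζs) (Icc (-η₀) η₀ \ {0}) :=
    (Complex.continuous_re.comp_continuousOn hp).div (Complex.continuous_im.comp_continuousOn hp)
      fun η hη => h.pairing_im_ne η hη.1 hη.2
  exact ((continuous_const.continuousOn).add (continuousOn_const.mul
    (continuous_ofReal.comp_continuousOn hr))).smul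
    (h.zeta_smooth.continuousOn.mono sdiff_subset)

theorem mapsTo_neg : MapsTo (fun η : ℝ => -η) (Icc (-η₀) η₀ \ {0}) (Icc (-η₀) η₀ \ {0}) :=
  fun _ hη => ⟨neg_mem_Icc hη.1, fun h => hη.2 (neg_eq_zero.1 h)⟩

theorem continuousOn_kappa (h : IsResonantCurve a b c α η₀ lam ζ ζs) :
    ContinuousOn (fun η => (kappa ζ ζs η : ℂ)) (Icc (-η₀) η₀ \ {0}) :=
  continuous_ofReal.comp_continuousOn ((Complex.continuous_im.comp_continuousOn
    (BenneyLuke.continuousOn_pairX h.continuousOn_gMode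
      (h.zetaStar_smooth.continuousOn.mono sdiff_subset))).div_const 2)

theorem continuousOn_gk (h : IsResonantCurve a b c α η₀ lam ζ ζs) (k : Fin 2) :
    ContinuousOn (gk ζ ζs k) (Icc (-η₀) η₀ \ {0}) := by
  have h1 := h.continuousOn_gMode
  have h2 := h1.comp continuous_neg.continuousOn mapsTo_neg
  have h3 := h.continuousOn_kappa
  fin_cases k
  · exact (h1.add h2).const_smul (1 / 2 : ℂ)
  · exact (continuousOn_const.div (continuousOn_const.mul h3) fun η hη =>
      mul_ne_zero (by simp) (h.kappa_ne_zero hη.1 hη.2)).smul (h1.sub h2)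

theorem continuousOn_gkStar (h : IsResonantCurve a b c α η₀ lam ζ ζs) (k : Fin 2) :
    ContinuousOn (gkStar ζ ζs k) (Icc (-η₀) η₀ \ {0}) := by
  have h1 : ContinuousOn ζs (Icc (-η₀) η₀ \ {0}) :=
    h.zetaStar_smooth.continuousOn.mono sdiff_subset
  have h2 := h1.comp continuous_neg.continuousOn mapsTo_neg
  have h3 := h.continuousOn_kappa
  fin_cases k
  · exact (continuousOn_const.div (continuousOn_const.mul h3) fun η hη =>
      mul_ne_zero (by simp) (h.kappa_ne_zero hη.1 hη.2)).smul (h1.sub h2)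
  · exact (h1.add h2).const_smul (1 / 2 : ℂ)

end IsResonantCurve

theorem gk_zero (η : ℝ) : gk ζ ζs 0 η = (1 / 2 : ℂ) • (gMode ζ ζs η + gMode ζ ζs (-η)) := rfl

theorem gk_one (η : ℝ) : gk ζ ζs 1 η =
    (1 / (2 * I * (kappa ζ ζs η : ℂ))) • (gMode ζ ζs η - gMode ζ ζs (-η)) := rfl

theorem gkStar_zero (η : ℝ) :
    gkStar ζ ζs 0 η = (I / (2 * (kappa ζ ζs η : ℂ))) • (ζs η - ζs (-η)) := rfl

theorem gkStar_one (η : ℝ) : gkStar ζ ζs 1 η = (1 / 2 : ℂ) • (ζs η + ζs (-η)) := rfl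

theorem pairX_sub_right (u : Xline α) (v v' : Xline (-α)) :
    pairX u (v - v') = pairX u v - pairX u v' := by
  rw [eq_sub_iff_add_eq, ← pairX_add_right, sub_add_cancel]

/-- The projection onto the modes with the frequency `η` is diagonal with respect to
`ζ(η)` and `ζ(-η)`. -/
theorem sum_pairX_gk (ζ : ℝ → Xline α) (ζs : ℝ → Xline (-α)) {η : ℝ}
    (hk : (kappa ζ ζs η : ℂ) ≠ 0) (x : Xline α) :
    ∑ k : Fin 2, pairX x (gkStar ζ ζs k η) • gk ζ ζs k η =
      (pairX x (ζs η) / (2 * I * (kappa ζ ζs η : ℂ))) • gMode ζ ζs η +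
      (-(pairX x (ζs (-η)) / (2 * I * (kappa ζ ζs η : ℂ)))) • gMode ζ ζs (-η) := by
  rw [Fin.sum_univ_two, gkStar_zero, gkStar_one, gk_zero, gk_one, pairX_smul_right,
    pairX_smul_right, pairX_sub_right, pairX_add_right]
  have e1 : conj (I / (2 * (kappa ζ ζs η : ℂ))) =
      1 / (2 * I * (kappa ζ ζs η : ℂ)) * 1 := by
    rw [map_div₀, map_mul, Complex.conj_I, conj_ofReal, map_ofNat]
    field_simp
    rw [I_sq, neg_neg]
  have e2 : conj (1 / 2 : ℂ) = 1 / 2 := by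
    rw [map_div₀, map_one, map_ofNat]
  rw [e1, e2, mul_one]
  have e3 : ∀ w : ℂ, w / (2 * I * (kappa ζ ζs η : ℂ)) =
    1 / (2 * I * (kappa ζ ζs η : ℂ)) * w := fun w => by ring
  rw [e3 (pairX x (ζs η)), e3 (pairX x (ζs (-η)))]
  generalize (1 / (2 * I * (kappa ζ ζs η : ℂ))) = s
  module

/-- The operator `f ↦ φ₀(f) g₀ + φ₁(f) g₁`. -/
def rankTwo {V W : Type*} [NormedAddCommGroup V] [NormedSpace ℂ V] [NormedAddCommGroup W]
    [NormedSpace ℂ W] (φ : Fin 2 → W →L[ℂ] ℂ) (g : Fin 2 → V) : W →L[ℂ] V :=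
  ∑ k : Fin 2, (φ k).smulRight (g k)

theorem rankTwo_apply {V W : Type*} [NormedAddCommGroup V] [NormedSpace ℂ V] [NormedAddCommGroup W]
    [NormedSpace ℂ W] (φ : Fin 2 → W →L[ℂ] ℂ) (g : Fin 2 → V) (f : W) :
    rankTwo φ g f = ∑ k : Fin 2, φ k f • g k := by
  rw [rankTwo, sum_apply]
  rfl

theorem norm_rankTwo_le {V W : Type*} [NormedAddCommGroup V] [NormedSpace ℂ V]
    [NormedAddCommGroup W] [NormedSpace ℂ W] {B : ℝ} {φ : Fin 2 → W →L[ℂ] ℂ} {g : Fin 2 → V}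
    (hv : ∀ k, ‖φ k‖ ≤ B) (hg : ∀ k, ‖g k‖ ≤ B) : ‖rankTwo φ g‖ ≤ 2 * (B * B) := by
  have hB : 0 ≤ B := (norm_nonneg _).trans (hv 0)
  refine (norm_sum_le _ _).trans ((Finset.sum_le_card_nsmul _ _ (B * B) fun k _ => ?_).trans
    (by simp))
  rw [ContinuousLinearMap.norm_smulRight_apply]
  exact mul_le_mul (hv k) (hg k) (norm_nonneg _) hB

theorem memLp_rankTwo {V W : Type*} [NormedAddCommGroup V] [NormedSpace ℂ V]
    [NormedAddCommGroup W] [NormedSpace ℂ W] {s : Set ℝ} (hs : MeasurableSet s) {B : ℝ}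
    {φ : Fin 2 → ℝ → W →L[ℂ] ℂ} {g : Fin 2 → ℝ → V}
    (hv : ∀ k, ContinuousOn (φ k) s) (hg : ∀ k, ContinuousOn (g k) s)
    (hv' : ∀ k, ∀ η ∈ s, ‖φ k η‖ ≤ B) (hg' : ∀ k, ∀ η ∈ s, ‖g k η‖ ≤ B) :
    MemLp (s.indicator fun η => rankTwo (fun k => φ k η) (fun k => g k η)) ⊤ volume := by
  refine memLp_top_of_bound (C := max (2 * (B * B)) 0) ?_ (.of_forall fun η => ?_)
  · rw [aestronglyMeasurable_indicator_iff hs]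
    refine ContinuousOn.aestronglyMeasurable ?_ hs
    exact continuousOn_finsetSum _ fun k _ => continuousOn_smulRight (hv k) (hg k)
  · by_cases h : η ∈ s
    · rw [indicator_of_mem h]
      exact (norm_rankTwo_le (fun k => hv' k η h) (fun k => hg' k η h)).trans (le_max_left _ _)
    · rw [indicator_of_notMem h, norm_zero]
      exact le_max_right _ _

/-- The frequencies (in the normalization of `fib`) of the resonant modes. -/
def modeSet (η₀ : ℝ) : Set ℝ := {η | 2 * π * η ∈ Icc (-η₀) η₀ \ {0}}

theorem measurableSet_modeSet (η₀ : ℝ) : MeasurableSet (modeSet η₀) :=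
  (measurableSet_Icc.diff (measurableSet_singleton 0)).preimage (by fun_prop)

theorem notMem_modeSet {η₀ η : ℝ} (h : η₀ < |η|) : η ∉ modeSet η₀ := fun hη => by
  have h1 : |2 * π * η| ≤ η₀ := abs_le.2 hη.1
  rw [abs_mul, abs_of_pos (by positivity)] at h1
  have h2 := Real.pi_gt_three
  nlinarith [abs_nonneg η]

namespace IsResonantCurve

/-- The fibers of the projection onto the resonant modes. -/
def fiberFamily (hp : Params a b c α) (hη₀ : 0 < η₀)
    (h : IsResonantCurve a b c α η₀ lam ζ ζs) : FiberFamily α where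
  M₁ := (modeSet η₀).indicator fun η => rankTwo
    (fun k => prL ((gkStar ζ ζs k (2 * π * η)).fst.1 0)) (fun k => gk ζ ζs k (2 * π * η))
  M₂ := (modeSet η₀).indicator fun η => rankTwo
    (fun k => prL (gkStar ζ ζs k (2 * π * η)).snd) (fun k => gk ζ ζs k (2 * π * η))
  memLp₁ := by
    obtain ⟨B, hB⟩ := h.exists_modes_bound hp hη₀
    have hm : MapsTo (fun η => 2 * π * η) (modeSet η₀) (Icc (-η₀) η₀ \ {0}) := fun η hη => hη
    have hcm : ContinuousOn (fun η => 2 * π * η) (modeSet η₀) := by fun_prop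
    exact memLp_rankTwo (measurableSet_modeSet η₀) (B := B)
      (φ := fun k η => prL ((gkStar ζ ζs k (2 * π * η)).fst.1 0))
      (fun k => continuousOn_prL ((lcmp (-α) 0).continuous.comp_continuousOn
        ((h.continuousOn_gkStar k).comp hcm hm)))
      (fun k => (h.continuousOn_gk k).comp hcm hm)
      (fun k η hη => (opNorm_prL_le _).trans <| (Xline.norm_fst0_le _).trans (hB _ hη.1 hη.2 k).2)
      (fun k η hη => (hB _ hη.1 hη.2 k).1)
  memLp₂ := by
    obtain ⟨B, hB⟩ := h.exists_modes_bound hp hη₀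
    have hm : MapsTo (fun η => 2 * π * η) (modeSet η₀) (Icc (-η₀) η₀ \ {0}) := fun η hη => hη
    have hcm : ContinuousOn (fun η => 2 * π * η) (modeSet η₀) := by fun_prop
    exact memLp_rankTwo (measurableSet_modeSet η₀) (B := B)
      (φ := fun k η => prL (gkStar ζ ζs k (2 * π * η)).snd)
      (fun k => continuousOn_prL ((lcmpS (-α)).continuous.comp_continuousOn
        ((h.continuousOn_gkStar k).comp hcm hm)))
      (fun k => (h.continuousOn_gk k).comp hcm hm)
      (fun k η hη => (opNorm_prL_le _).trans <| (WithLp.norm_snd_le _ _).trans (hB _ hη.1 hη.2 k).2)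
      (fun k η hη => (hB _ hη.1 hη.2 k).1)
  R := η₀
  zero₁ η hη := indicator_of_notMem (notMem_modeSet hη) _
  zero₂ η hη := indicator_of_notMem (notMem_modeSet hη) _

theorem pairX_gMode_neg (h : IsResonantCurve a b c α η₀ lam ζ ζs) {η : ℝ} (hη : η ∈ Icc (-η₀) η₀) (h0 : η ≠ 0) :
    pairX (gMode ζ ζs η) (ζs (-η)) = 0 := by
  rw [gMode_eq, pairX_smul_left, h.pairX_zeta_neg hη h0, mul_zero]

variable (hp : Params a b c α) (hη₀ : 0 < η₀)
  (h : IsResonantCurve a b c α η₀ lam ζ ζs)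

theorem act_of_mem {η : ℝ} (hη : η ∈ modeSet η₀) (x : Xline α) :
    (h.fiberFamily hp hη₀).act η x = ∑ k : Fin 2,
      pairX x (gkStar ζ ζs k (2 * π * η)) • gk ζ ζs k (2 * π * η) := by
  rw [FiberFamily.act]
  simp only [fiberFamily, indicator_of_mem hη]
  rw [rankTwo_apply, rankTwo_apply, ← Finset.sum_add_distrib]
  refine Finset.sum_congr rfl fun k _ => ?_
  rw [← add_smul, pairX_eq]

theorem act_of_notMem {η : ℝ} (hη : η ∉ modeSet η₀) (x : Xline α) :
    (h.fiberFamily hp hη₀).act η x = 0 := by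
  rw [FiberFamily.act]
  simp only [fiberFamily, indicator_of_notMem hη]
  rw [zero_apply, zero_apply, add_zero]

/-- On a fiber the projection is idempotent: the modes at `ν` and `-ν` are biorthogonal. -/
theorem act_act (η : ℝ) (x : Xline α) :
    (h.fiberFamily hp hη₀).act η ((h.fiberFamily hp hη₀).act η x) =
      (h.fiberFamily hp hη₀).act η x := by
  by_cases hη : η ∈ modeSet η₀
  · set ν := 2 * π * η with hν
    have hν1 : ν ∈ Icc (-η₀) η₀ := hη.1
    have hν0 : ν ≠ 0 := hη.2
    have hk := h.kappa_ne_zero hν1 hν0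
    have hk2 : 2 * I * (kappa ζ ζs ν : ℂ) ≠ 0 := mul_ne_zero (by simp) hk
    rw [h.act_of_mem hp hη₀ hη, h.act_of_mem hp hη₀ hη, ← hν,
      sum_pairX_gk ζ ζs hk x, sum_pairX_gk ζ ζs hk]
    have g1 := (h.pairX_gMode_eq hν1 hν0).1
    have g2 := (h.pairX_gMode_eq (neg_mem_Icc hν1) (neg_ne_zero.2 hν0)).1
    have g3 := h.pairX_gMode_neg hν1 hν0
    have g4 := h.pairX_gMode_neg (neg_mem_Icc hν1) (neg_ne_zero.2 hν0)
    rw [h.kappa_neg hν1 hν0] at g2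
    rw [neg_neg] at g4
    simp only [pairX_add_left, pairX_smul_left, g1, g2, g3, g4]
    congr 2
    · field_simp
      ring
    · push_cast
      field_simp
      ring
  · rw [h.act_of_notMem hp hη₀ hη, h.act_of_notMem hp hη₀ hη]

/-- On a fiber the projection commutes with `𝓛(η)`: pairing with `ζ*(±ν)` turns `𝓛(η)` into
multiplication by the eigenvalue. -/
theorem act_graph (η : ℝ) {x y : Xline α} (hxy : LEtaGraph a b c α (2 * π * η) x y) :
    LEtaGraph a b c α (2 * π * η) ((h.fiberFamily hp hη₀).act η x)
      ((h.fiberFamily hp hη₀).act η y) := by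
  by_cases hη : η ∈ modeSet η₀
  · set ν := 2 * π * η with hν
    have hν1 : ν ∈ Icc (-η₀) η₀ := hη.1
    have hν0 : ν ≠ 0 := hη.2
    have hk := h.kappa_ne_zero hν1 hν0
    rw [h.act_of_mem hp hη₀ hη, h.act_of_mem hp hη₀ hη, ← hν,
      sum_pairX_gk ζ ζs hk x, sum_pairX_gk ζ ζs hk y]
    have e1 := h.pairX_graph hν1 hxy
    have e2 := h.pairX_graph (neg_mem_Icc hν1) (LEtaGraph_neg.2 hxy)
    have m1 := (h.eigen ν hν1).smul (1 + I * (rho ζ ζs ν : ℂ))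
    have m2 := LEtaGraph_neg.1 ((h.eigen _ (neg_mem_Icc hν1)).smul
      (1 + I * (rho ζ ζs (-ν) : ℂ)))
    rw [smul_comm, ← gMode_eq] at m1 m2
    have := m1.comb m2 (pairX x (ζs ν) / (2 * I * (kappa ζ ζs ν : ℂ)))
      (-(pairX x (ζs (-ν)) / (2 * I * (kappa ζ ζs ν : ℂ))))
    rw [smul_smul, smul_smul] at this
    rw [e1, e2]
    convert this using 3
    · ring
    · ring
  · rw [h.act_of_notMem hp hη₀ hη, h.act_of_notMem hp hη₀ hη]
    simpa using hxy.smul 0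

end IsResonantCurve

end Curve

/-! ### The projection onto the resonant modes -/

theorem exists_isTest_eq_one (R : ℝ) : ∃ ψ : ℝ → ℂ, IsTest ψ ∧ ∀ z, |z| ≤ R → ψ z = 1 := by
  let f : ContDiffBump (0 : ℝ) := ⟨|R| + 1, |R| + 2, by positivity, by linarith⟩
  refine ⟨fun z => (f z : ℂ), ⟨ofRealCLM.contDiff.comp f.contDiff,
    f.hasCompactSupport.comp_left (g := fun r : ℝ => (r : ℂ)) (by simp)⟩, fun z hz => ?_⟩
  have : z ∈ Metric.closedBall (0 : ℝ) f.rIn := by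
    rw [mem_closedBall_zero_iff, norm_eq_abs]
    exact hz.trans ((le_abs_self R).trans (le_add_of_nonneg_right zero_le_one))
  simp [f.one_of_mem_closedBall this]

theorem IsTest.exists_bound_support {φ : ℝ × ℝ → ℂ} (hφ : IsTest φ) :
    ∃ R, ∀ z y, (R < |z| ∨ R < |y|) → φ (z, y) = 0 := by
  obtain ⟨R, hR⟩ := hφ.2.isCompact.isBounded.exists_norm_le
  refine ⟨R, fun z y h => image_eq_zero_of_notMem_tsupport fun hm => ?_⟩
  have := hR _ hm
  rw [Prod.norm_def] at this
  rcases h with h | h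
  · exact absurd ((le_max_left _ _).trans this) (not_le.2 h)
  · exact absurd ((le_max_right _ _).trans this) (not_le.2 h)

theorem integrable_of_memLp_of_support {V : Type*} [NormedAddCommGroup V] {f : ℝ → V}
    (hf : MemLp f 2 (volume : Measure ℝ)) {R : ℝ} (h : ∀ᵐ y, R < |y| → f y = 0) :
    Integrable f := by
  have h1 : IntegrableOn f (Icc (-R) R) := (hf.restrict _).integrable (by norm_num)
  refine (integrable_indicator_iff measurableSet_Icc).2 h1 |>.congr ?_
  filter_upwards [h] with y hy
  by_cases hm : y ∈ Icc (-R) R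
  · rw [indicator_of_mem hm]
  · rw [indicator_of_notMem hm, hy]
    rw [← not_le, abs_le]
    exact hm

theorem curryL2_test_ae {F : L2w (wt2 α)} {φ : ℝ × ℝ → ℂ} (hF : F =ᵐ[volume] φ) :
    ∀ᵐ y, ∀ᵐ z, curryL2 (weighted_wt2 α) F y z = φ (z, y) := by
  have h2 : ∀ᵐ y : ℝ, ∀ᵐ z : ℝ, F (z, y) = φ (z, y) := by
    have := Measure.ae_ae_of_ae_prod (μ := (volume : Measure ℝ)) (ν := (volume : Measure ℝ))
      ((Measure.measurePreserving_swap (μ := (volume : Measure ℝ))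
        (ν := (volume : Measure ℝ))).quasiMeasurePreserving.ae hF)
    exact this
  filter_upwards [curryL2_ae (weighted_wt2 α) F, h2] with y h1 h2
  filter_upwards [(ae_eq_weighted_iff (wt1 α).continuous).1 h1, h2] with z e1 e2
  rw [e1, e2]

/-- The fibers of test functions are given by the Fourier integral in the transverse variable. -/
theorem prL_fib_test {F : L2w (wt2 α)} {φ : ℝ × ℝ → ℂ} (hφ : IsTest φ)
    (hF : F =ᵐ[volume] φ) : ∀ᵐ η : ℝ, ∀ v : L2w (wt1 (-α)), prL v (fib α F η) =
      ∫ z, (∫ y, φ (z, y) * Complex.exp (-(I * y * (2 * π * η : ℝ)))) *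
        conj (v z) := by
  obtain ⟨R, hR⟩ := hφ.exists_bound_support
  have hc := curryL2_test_ae hF
  set f : Lp (L2w (wt1 α)) 2 (volume : Measure ℝ) := curryL2 (weighted_wt2 α) F with hf
  have hi : Integrable f := by
    refine integrable_of_memLp_of_support (memLp f) (R := R) ?_
    filter_upwards [hc] with y hy h
    refine Lp.ext ((ae_eq_weighted_iff (wt1 α).continuous).2 ?_)
    filter_upwards [hy, (ae_eq_weighted_iff (wt1 α).continuous).1
      (Lp.coeFn_zero ℂ 2 (weighted (wt1 α)))] with z e1 e2
    rw [e1, e2, hR z y (Or.inr h)]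
    rfl
  have hfib : fib α F =ᵐ[volume] 𝓕 (f : ℝ → L2w (wt1 α)) := by
    have := fourier_toLp_ae hi (memLp f)
    rwa [Lp.toLp_coeFn] at this
  obtain ⟨ψ, hψ, hψ1⟩ := exists_isTest_eq_one R
  obtain ⟨C, hC⟩ := hφ.2.exists_bound_of_continuous hφ.1.continuous
  filter_upwards [hfib] with η hη v
  have hfub : Integrable (fun p : ℝ × ℝ => φ p *
      Complex.exp (-(I * p.2 * (2 * π * η : ℝ))) * conj (v p.1))
      ((volume : Measure ℝ).prod volume) := by
    have h1 : Integrable (fun z => conj (v z) * ψ z) := by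
      have := Complex.conjCLE.toContinuousLinearMap.integrable_comp (integrable_mul_test v hψ.conj)
      refine this.congr (.of_forall fun z => ?_)
      simp
    have h2 := h1.mul_prod (show Integrable ψ (volume : Measure ℝ) from hψ.integrable)
    have h3 : Continuous fun p : ℝ × ℝ => φ p *
      Complex.exp (-(I * p.2 * (2 * π * η : ℝ))) :=
      hφ.1.continuous.mul (by fun_prop)
    refine (h2.bdd_mul (c := C) h3.aestronglyMeasurable (.of_forall fun p => ?_)).congr
      (.of_forall fun p => ?_)
    · have e : -(I * p.2 * (2 * π * η : ℝ)) =
          ((-(p.2 * (2 * π * η)) : ℝ) : ℂ) * I := by push_cast; ring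
      rw [norm_mul, e, norm_exp_ofReal_mul_I, mul_one]
      exact hC p
    · beta_reduce
      by_cases h : |p.1| ≤ R ∧ |p.2| ≤ R
      · rw [hψ1 _ h.1, hψ1 _ h.2, mul_one, mul_one]
      · have : φ p = 0 := by
          rw [not_and_or, not_le, not_le] at h
          exact hR p.1 p.2 h
        rw [this]; ring
  have hfi : Integrable fun y => fourierChar (-(inner ℝ y η)) • f y := by
    have := (Real.fourierIntegral_convergent_iff (μ := (volume : Measure ℝ)) η).2 hi
    exact this
  have e1 : prL v (fib α F η) = ∫ y, prL v (fourierChar (-(inner ℝ y η)) • f y) := by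
    rw [hη, fourier_eq]
    exact ((prL v).integral_comp_comm hfi).symm
  have e2 : ∀ᵐ y, prL v (fourierChar (-(inner ℝ y η)) • f y) = ∫ z, φ (z, y) *
      Complex.exp (-(I * y * (2 * π * η : ℝ))) * conj (v z) := by
    filter_upwards [hc] with y hy
    rw [Circle.smul_def, map_smul, prL_eq, smul_eq_mul, ← integral_const_mul]
    refine integral_congr_ae ?_
    filter_upwards [hy] with z hz
    rw [hz, Real.fourierChar_apply]
    have : Complex.exp (((2 * π * -(inner ℝ y η) : ℝ) : ℂ) * I) =
        Complex.exp (-(I * y * (2 * π * η : ℝ))) := by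
      congr 1
      have : inner ℝ y η = η * y := rfl
      rw [this]
      push_cast
      ring
    rw [this]
    ring
  rw [e1, integral_congr_ae e2]
  have h4 := integral_prod _ hfub
  have h5 := integral_prod_symm _ hfub
  rw [h4] at h5
  refine h5.symm.trans ?_
  refine integral_congr_ae (.of_forall fun z => ?_)
  exact integral_mul_const (conj (v z)) fun y : ℝ =>
    φ (z, y) * Complex.exp (-(I * y * (2 * π * η : ℝ)))

theorem pairing_fourierY {f : Xplane α} {φ₁ φ₂ : ℝ × ℝ → ℂ} (h₁ : IsTest φ₁)
    (h₂ : IsTest φ₂) (e₁ : f.fn1 =ᵐ[volume] φ₁) (e₂ : f.fn2 =ᵐ[volume] φ₂) :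
    ∀ᵐ η : ℝ, ∀ v : Xline (-α), prL (v.fst.1 0) (fib α (f.fst.1 0) η) + prL v.snd (fib α f.snd η) =
      (sqrt (2 * π) : ℂ) * pairing (fourierY φ₁ (2 * π * η))
        (fourierY φ₂ (2 * π * η)) v.fn1 v.fn2 := by
  filter_upwards [prL_fib_test h₁ (F := f.fst.1 0) e₁, prL_fib_test h₂ (F := f.snd) e₂]
    with η a1 a2 v
  have hs : (sqrt (2 * π) : ℂ) * ((1 / sqrt (2 * π) : ℝ) : ℂ) = 1 := by
    rw [← ofReal_mul, mul_one_div, div_self (by positivity), Complex.ofReal_one]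
  rw [a1, a2, pairing, mul_add, ← integral_const_mul, ← integral_const_mul]
  congr 1
  · refine integral_congr_ae (.of_forall fun z => ?_)
    simp only [fourierY]
    rw [← mul_assoc, ← mul_assoc, hs, one_mul]
    rfl
  · refine integral_congr_ae (.of_forall fun z => ?_)
    simp only [fourierY]
    rw [← mul_assoc, ← mul_assoc, hs, one_mul]
    rfl

theorem integral_modeSet {V : Type*} [NormedAddCommGroup V] [NormedSpace ℂ V] {η₀ : ℝ}
    (hη₀ : 0 < η₀) (H : ℝ → V) : ∫ η, (modeSet η₀).indicator (fun η => H (2 * π * η)) η =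
      ((1 / (2 * π) : ℝ) : ℂ) • ∫ η in (-η₀)..η₀, H η := by
  have e : (fun η => (modeSet η₀).indicator (fun η => H (2 * π * η)) η) =
      fun η => (Icc (-η₀) η₀ \ {0}).indicator H (2 * π * η) := by
    ext η
    rfl
  rw [e, Measure.integral_comp_mul_left (fun x => (Icc (-η₀) η₀ \ {0}).indicator H x),
    integral_indicator (measurableSet_Icc.diff (measurableSet_singleton 0)),
    intervalIntegral.integral_of_le (by linarith), abs_of_pos (by positivity), one_div,
    ← Complex.coe_smul]
  congr 1
  refine setIntegral_congr_set ?_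
  refine (sdiff_null_ae_eq_self (by simp)).trans Ioc_ae_eq_Icc.symm

namespace FiberFamily

variable (A : FiberFamily α)

theorem integrable_img (u : Xplane α) : Integrable (A.img u) :=
  integrable_of_memLp_of_support (memLp _) (A.img_eq_zero u)

theorem fourierInv_comp {H H' : Type*} [NormedAddCommGroup H] [InnerProductSpace ℂ H]
    [CompleteSpace H] [NormedAddCommGroup H'] [InnerProductSpace ℂ H'] [CompleteSpace H']
    (l : H →L[ℂ] H') {F : Lp H 2 (volume : Measure ℝ)} (hF : Integrable F) :
    ∀ᵐ y, (𝓕⁻ (l.compLpL 2 volume F) : Lp H' 2 (volume : Measure ℝ)) y = l ((𝓕⁻ (F : ℝ → H) : ℝ → H) y) := by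
  have h1 : Integrable fun η => l (F η) := l.integrable_comp hF
  have h2 : MemLp (fun η => l (F η)) 2 (volume : Measure ℝ) := l.comp_memLp' (memLp F)
  have e : l.compLpL 2 volume F = h2.toLp _ :=
    Lp.ext ((l.coeFn_compLpL F).trans h2.coeFn_toLp.symm)
  rw [e]
  filter_upwards [fourierInv_toLp_ae h1 h2] with y hy
  rw [hy, fourierInv_eq, fourierInv_eq, ← l.integral_comp_comm]
  · simp only [Circle.smul_def, map_smul]
  · have := (Real.fourierIntegral_convergent_iff (μ := (volume : Measure ℝ)) (-y)).2 hF
    simpa using this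

theorem curry_of_fib {H : Type*} [NormedAddCommGroup H] [InnerProductSpace ℂ H]
    [CompleteSpace H] (l : H →L[ℂ] L2w (wt1 α)) {F : Lp H 2 (volume : Measure ℝ)}
    (hF : Integrable F) {w : L2w (wt2 α)} (h : fib α w = l.compLpL 2 volume F) :
    ∀ᵐ y, curryL2 (weighted_wt2 α) w y = l ((𝓕⁻ (F : ℝ → H) : ℝ → H) y) := by
  have e : curryL2 (weighted_wt2 α) w = 𝓕⁻ (l.compLpL 2 volume F) := by
    rw [← h, fib_apply]
    exact ((Lp.fourierTransformₗᵢ ℝ (L2w (wt1 α))).symm_apply_apply _).symm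
  rw [e]
  exact fourierInv_comp l hF

theorem fib_op_fst (u : Xplane α) :
    fib α ((A.op u).fst.1 0) = (lcmp α 0).compLpL 2 volume (A.img u) := by
  change fib α (opFst α A.R (A.img u) 0) = _
  exact (fib α).apply_symm_apply _

theorem fib_op_snd (u : Xplane α) :
    fib α (A.op u).snd = (lcmpS α).compLpL 2 volume (A.img u) :=
  (fib α).apply_symm_apply _

theorem curry_op (u : Xplane α) : ∀ᵐ y,
    curryL2 (weighted_wt2 α) ((A.op u).fst.1 0) y =
      lcmp α 0 ((𝓕⁻ (A.img u : ℝ → Xline α) : ℝ → Xline α) y) ∧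
    curryL2 (weighted_wt2 α) (A.op u).snd y =
      lcmpS α ((𝓕⁻ (A.img u : ℝ → Xline α) : ℝ → Xline α) y) :=
  (curry_of_fib (lcmp α 0) (A.integrable_img u) (A.fib_op_fst u)).and
    (curry_of_fib (lcmpS α) (A.integrable_img u) (A.fib_op_snd u))

end FiberFamily

theorem integrable_rankOne {V W : Type*} [NormedAddCommGroup V] [NormedSpace ℂ V]
    [NormedAddCommGroup W] [NormedSpace ℂ W] {s : Set ℝ} (hs : MeasurableSet s) {R B : ℝ}
    (hR : ∀ η, R < |η| → η ∉ s) {φ : ℝ → W →L[ℂ] ℂ} {g : ℝ → V} (hv : ContinuousOn φ s)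
    (hg : ContinuousOn g s) (hv' : ∀ η ∈ s, ‖φ η‖ ≤ B) (hg' : ∀ η ∈ s, ‖g η‖ ≤ B)
    (F : Lp W 2 (volume : Measure ℝ)) :
    Integrable (s.indicator fun η => φ η (F η) • g η) := by
  have hB : ∀ η ∈ s, 0 ≤ B := fun η hη => (norm_nonneg _).trans (hv' η hη)
  have hM := memLp_rankTwo hs (B := B) (φ := ![φ, fun _ => 0]) (g := ![g, fun _ => 0])
    (fun k => by fin_cases k; exacts [hv, continuousOn_const])
    (fun k => by fin_cases k; exacts [hg, continuousOn_const])
    (fun k η hη => by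
      fin_cases k
      · exact hv' η hη
      · exact (norm_zero (E := W →L[ℂ] ℂ)).le.trans (hB η hη))
    (fun k η hη => by
      fin_cases k
      · exact hg' η hη
      · exact (norm_zero (E := V)).le.trans (hB η hη))
  have e : mulOp hM F =ᵐ[volume] s.indicator fun η => φ η (F η) • g η := by
    filter_upwards [coeFn_mulOp hM F] with η h1
    rw [h1]
    by_cases hη : η ∈ s
    · rw [indicator_of_mem hη, indicator_of_mem hη, rankTwo_apply, Fin.sum_univ_two]
      simp
    · rw [indicator_of_notMem hη, indicator_of_notMem hη]
      rfl
  refine integrable_of_memLp_of_support ((memLp_congr_ae e).1 (memLp _)) (R := R)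
    (.of_forall fun η hη => indicator_of_notMem (hR η hη) _)

section Modes

variable {V : Type*} [NormedAddCommGroup V] [NormedSpace ℂ V]

theorem fourierInv_sum {F : ℝ → V} {D : Fin 2 → ℝ → V} (hD : ∀ k, Integrable (D k))
    (hF : F =ᵐ[volume] fun η => ∑ k, D k η) (y : ℝ) :
    (𝓕⁻ F : ℝ → V) y = ∑ k, ∫ η, Complex.exp (I * y * (2 * π * η : ℝ)) • D k η := by
  have he : ∀ η : ℝ, (fourierChar (inner ℝ η y) : ℂ) =
      Complex.exp (I * y * (2 * π * η : ℝ)) := by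
    intro η
    rw [Real.fourierChar_apply]
    congr 1
    have : inner ℝ η y = y * η := rfl
    rw [this]
    push_cast
    ring
  have hi : ∀ k, Integrable fun η =>
      Complex.exp (I * y * (2 * π * η : ℝ)) • D k η := by
    intro k
    have := (Real.fourierIntegral_convergent_iff (μ := (volume : Measure ℝ)) (-y)).2 (hD k)
    refine this.congr (.of_forall fun η => ?_)
    beta_reduce
    rw [← he, Circle.smul_def, inner_neg_right, neg_neg]
  rw [fourierInv_eq, ← integral_finsetSum _ fun k _ => hi k]
  refine integral_congr_ae ?_
  filter_upwards [hF] with η h1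
  rw [h1, Circle.smul_def, he, Finset.smul_sum]

theorem integral_mode_eq {η₀ : ℝ}
    (hη₀ : 0 < η₀) {p c : ℝ → ℂ} {g : ℝ → V} {y : ℝ}
    (hp : ∀ᵐ η : ℝ, p η = (sqrt (2 * π) : ℂ) * c (2 * π * η)) :
    ∫ η, Complex.exp (I * y * (2 * π * η : ℝ)) •
      (modeSet η₀).indicator (fun η => p η • g (2 * π * η)) η =
    ((1 / sqrt (2 * π) : ℝ) : ℂ) •
      ∫ η in (-η₀)..η₀, (c η * Complex.exp (I * y * η)) • g η := by
  have e : (fun η => Complex.exp (I * y * (2 * π * η : ℝ)) •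
      (modeSet η₀).indicator (fun η => p η • g (2 * π * η)) η) =ᵐ[volume] fun η =>
      (sqrt (2 * π) : ℂ) • (modeSet η₀).indicator (fun η =>
        (fun η : ℝ => (c η * Complex.exp (I * y * η)) • g η) (2 * π * η)) η := by
    filter_upwards [hp] with η h1
    by_cases hη : η ∈ modeSet η₀
    · rw [indicator_of_mem hη, indicator_of_mem hη, h1, smul_smul, smul_smul]
      congr 1
      ring
    · rw [indicator_of_notMem hη, indicator_of_notMem hη, smul_zero, smul_zero]
  rw [integral_congr_ae e, integral_smul,
    integral_modeSet hη₀ fun η : ℝ => (c η * Complex.exp (I * y * η)) • g η, smul_smul]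
  congr 1
  rw [← ofReal_mul]
  congr 1
  have h := Real.mul_self_sqrt (show 0 ≤ 2 * π by positivity)
  have h' : sqrt (2 * π) ≠ 0 := by positivity
  rw [mul_one_div, div_eq_div_iff (by positivity) h', h, one_mul]

theorem indicator_smul_add {s : Set ℝ}
    {p q : ℝ → ℂ} {g : ℝ → V} (hp : Integrable (s.indicator fun η => p η • g η))
    (hq : Integrable (s.indicator fun η => q η • g η)) :
    Integrable (s.indicator fun η => (p η + q η) • g η) := by
  refine (hp.add hq).congr (.of_forall fun η => ?_)
  rw [← indicator_add']
  congr 1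
  ext η
  exact (add_smul _ _ _).symm

end Modes

theorem rankTwo_indicator_apply {V W : Type*} [NormedAddCommGroup V] [NormedSpace ℂ V]
    [NormedAddCommGroup W] [NormedSpace ℂ W] (s : Set ℝ) (φ ψ : Fin 2 → ℝ → W →L[ℂ] ℂ)
    (g : Fin 2 → ℝ → V) (F F' : ℝ → W) (η : ℝ) :
    (s.indicator fun η => rankTwo (fun k => φ k η) (fun k => g k η)) η (F η) +
      (s.indicator fun η => rankTwo (fun k => ψ k η) (fun k => g k η)) η (F' η) =
    ∑ k, s.indicator (fun η => (φ k η (F η) + ψ k η (F' η)) • g k η) η := by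
  by_cases hη : η ∈ s
  · simp only [indicator_of_mem hη]
    rw [rankTwo_apply, rankTwo_apply, ← Finset.sum_add_distrib]
    refine Finset.sum_congr rfl fun k _ => ?_
    rw [← add_smul]
  · simp only [indicator_of_notMem hη]
    rw [zero_apply, zero_apply, add_zero, Finset.sum_const_zero]

section Curve

variable {η₀ : ℝ} {lam : ℝ → ℂ} {ζ : ℝ → Xline α} {ζs : ℝ → Xline (-α)}

namespace IsResonantCurve

theorem fourierInv_img (hp : Params a b c α) (hη₀ : 0 < η₀)
    (h : IsResonantCurve a b c α η₀ lam ζ ζs) {f : Xplane α} {φ₁ φ₂ : ℝ × ℝ → ℂ}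
    (h₁ : IsTest φ₁) (h₂ : IsTest φ₂) (e₁ : f.fn1 =ᵐ[volume] φ₁) (e₂ : f.fn2 =ᵐ[volume] φ₂)
    (y : ℝ) :
    (𝓕⁻ ((h.fiberFamily hp hη₀).img f : ℝ → Xline α) : ℝ → Xline α) y =
      modeSum ζ ζs η₀ φ₁ φ₂ y := by
  obtain ⟨B, hB⟩ := h.exists_modes_bound hp hη₀
  have hm : MapsTo (fun η => 2 * π * η) (modeSet η₀) (Icc (-η₀) η₀ \ {0}) := fun η hη => hη
  have hcm : ContinuousOn (fun η => 2 * π * η) (modeSet η₀) := by fun_prop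
  set p : Fin 2 → ℝ → ℂ := fun k η => prL ((gkStar ζ ζs k (2 * π * η)).fst.1 0)
    (fib α (f.fst.1 0) η) + prL (gkStar ζ ζs k (2 * π * η)).snd (fib α f.snd η) with hpd
  have hD : ∀ k, Integrable ((modeSet η₀).indicator fun η => p k η • gk ζ ζs k (2 * π * η)) := by
    intro k
    have i1 := integrable_rankOne (measurableSet_modeSet η₀) (R := η₀) (B := B)
      (fun η hη => notMem_modeSet hη)
      (continuousOn_prL ((lcmp (-α) 0).continuous.comp_continuousOn
        ((h.continuousOn_gkStar k).comp hcm hm)))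
      ((h.continuousOn_gk k).comp hcm hm)
      (fun η hη => (opNorm_prL_le _).trans <| (Xline.norm_fst0_le _).trans (hB _ hη.1 hη.2 k).2)
      (fun η hη => (hB _ hη.1 hη.2 k).1) (fib α (f.fst.1 0))
    have i2 := integrable_rankOne (measurableSet_modeSet η₀) (R := η₀) (B := B)
      (fun η hη => notMem_modeSet hη)
      (continuousOn_prL ((lcmpS (-α)).continuous.comp_continuousOn
        ((h.continuousOn_gkStar k).comp hcm hm)))
      ((h.continuousOn_gk k).comp hcm hm)
      (fun η hη => (opNorm_prL_le _).trans <| (WithLp.norm_snd_le _ _).trans (hB _ hη.1 hη.2 k).2)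
      (fun η hη => (hB _ hη.1 hη.2 k).1) (fib α f.snd)
    exact indicator_smul_add (V := Xline α)
      (p := fun η => prL ((gkStar ζ ζs k (2 * π * η)).fst.1 0) (fib α (f.fst.1 0) η))
      (q := fun η => prL (gkStar ζ ζs k (2 * π * η)).snd (fib α f.snd η))
      (g := fun η => gk ζ ζs k (2 * π * η)) i1 i2
  have hF : (h.fiberFamily hp hη₀).img f =ᵐ[volume] fun η => ∑ k : Fin 2,
      (modeSet η₀).indicator (fun η => p k η • gk ζ ζs k (2 * π * η)) η := by
    filter_upwards [(h.fiberFamily hp hη₀).img_ae f] with η h1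
    exact h1.trans (rankTwo_indicator_apply (modeSet η₀)
      (fun k η => prL ((gkStar ζ ζs k (2 * π * η)).fst.1 0))
      (fun k η => prL (gkStar ζ ζs k (2 * π * η)).snd)
      (fun k η => gk ζ ζs k (2 * π * η)) (fib α (f.fst.1 0)) (fib α f.snd) η)
  have hpc : ∀ k, ∀ᵐ η : ℝ, p k η =
      (sqrt (2 * π) : ℂ) * coeff ζ ζs φ₁ φ₂ k (2 * π * η) := by
    intro k
    filter_upwards [pairing_fourierY h₁ h₂ e₁ e₂] with η h1
    exact h1 _
  refine (fourierInv_sum (V := Xline α) hD hF y).trans ?_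
  rw [modeSum, Finset.smul_sum]
  exact Finset.sum_congr rfl fun k _ => integral_mode_eq (V := Xline α) hη₀ (hpc k)

/-- The operator with these fibers is given on test functions by the formula for the projection. -/
theorem isResonantProjection_op (hp : Params a b c α) (hη₀ : 0 < η₀)
    (h : IsResonantCurve a b c α η₀ lam ζ ζs) :
    IsResonantProjection ζ ζs η₀ (h.fiberFamily hp hη₀).op := by
  intro f φ₁ φ₂ h₁ h₂ e₁ e₂
  set A := h.fiberFamily hp hη₀ with hA
  filter_upwards [A.curry_op f, curryL2_ae (weighted_wt2 α) ((A.op f).fst.1 0),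
    curryL2_ae (weighted_wt2 α) (A.op f).snd] with y hy c1 c2
  have hm := h.fourierInv_img hp hη₀ h₁ h₂ e₁ e₂ y
  rw [← hA] at hm
  rw [hm] at hy
  rw [hy.1] at c1
  rw [hy.2] at c2
  filter_upwards [(ae_eq_weighted_iff (wt1 α).continuous).1 c1,
    (ae_eq_weighted_iff (wt1 α).continuous).1 c2] with z z1 z2
  exact ⟨z1.symm, z2.symm⟩

end IsResonantCurve

end Curve

/-! ### Density of test functions -/

theorem exists_L2w_test (α : ℝ) {φ : ℝ × ℝ → ℂ} (hφ : IsTest φ) :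
    ∃ F : L2w (wt2 α), F =ᵐ[volume] φ := by
  have hm : MemLp φ 2 (weighted (wt2 α)) := by
    rw [memLp_weighted_iff (wt2 α).continuous]
    exact (hφ.smooth_mul (contDiff_exp_fst α)).memLp
  exact ⟨hm.toLp φ, (ae_eq_weighted_iff (wt2 α).continuous).1 hm.coeFn_toLp⟩

theorem pd_ofFun_test {φ : ℝ × ℝ → ℂ} (hφ : IsTest φ) (v : ℝ × ℝ) :
    EqDistr (pd v (ofFun φ)) (ofFun fun x => fderiv ℝ φ x v) := by
  intro χ hχ
  have h := integral_mul_fderiv_eq_neg_fderiv_mul_of_integrable (μ := (volume : Measure (ℝ × ℝ)))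
    (f := φ) (g := χ) (v := v)
    (((hφ.fderiv v).1.continuous.mul hχ.1.continuous).integrable_of_hasCompactSupport
      hχ.2.mul_left)
    ((hφ.1.continuous.mul (hχ.fderiv v).1.continuous).integrable_of_hasCompactSupport
      hφ.2.mul_right)
    ((hφ.1.continuous.mul hχ.1.continuous).integrable_of_hasCompactSupport hφ.2.mul_right)
    (fun x _ => hφ.1.differentiable (by simp) x) (fun x _ => hχ.1.differentiable (by simp) x)
  change -(∫ x, φ x * fderiv ℝ χ x v) = ∫ x, fderiv ℝ φ x v * χ x
  rw [h, neg_neg]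

theorem exists_H1plane_test (α : ℝ) {φ : ℝ × ℝ → ℂ} (hφ : IsTest φ) :
    ∃ F : H1plane α, F.1 0 =ᵐ[volume] φ := by
  obtain ⟨F0, h0⟩ := exists_L2w_test α hφ
  obtain ⟨F1, h1⟩ := exists_L2w_test α (hφ.fderiv ((1 : ℝ), (0 : ℝ)))
  obtain ⟨F2, h2⟩ := exists_L2w_test α (hφ.fderiv ((0 : ℝ), (1 : ℝ)))
  have hm : (toLp 2 ![F0, F1, F2] : PiLp 2 (fun _ : Fin 3 => L2w (wt2 α))) ∈ H1plane α := by
    rw [mem_H1plane_iff_eqDistr]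
    change EqDistr (pd ((1 : ℝ), (0 : ℝ)) (ofFun F0)) (ofFun F1) ∧
      EqDistr (pd ((0 : ℝ), (1 : ℝ)) (ofFun F0)) (ofFun F2)
    rw [ofFun_congr h0, ofFun_congr h1, ofFun_congr h2]
    exact ⟨pd_ofFun_test hφ _, pd_ofFun_test hφ _⟩
  exact ⟨⟨_, hm⟩, h0⟩

/-- The test function on the plane with `U φ = conj (𝓕⁻ ψ)`. -/
def dualTest (α : ℝ) (ψ : E2 → ℂ) (p : ℝ × ℝ) : ℂ :=
  (exp (-(α * p.1)) : ℂ) * conj (ψ (toLp 2 p))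

theorem isTest_dualTest (α : ℝ) {ψ : E2 → ℂ} (hψ : IsTest ψ) : IsTest (dualTest α ψ) := by
  have := (isTest_comp_toLp hψ).conj.smooth_mul (contDiff_exp_fst (-α))
  simp only [neg_mul] at this
  exact this

theorem U_dualTest {ψ : E2 → ℂ} (hψ : IsTest ψ) {F : L2w (wt2 α)}
    (hF : F =ᵐ[volume] dualTest α ψ) :
    U α F =ᵐ[volume] fun ξ => conj ((𝓕⁻ ψ : E2 → ℂ) ξ) := by
  have hψ' := hψ.conj
  have e : toE2 (expMulLI (wt2 α) F) = (hψ'.memLp (p := 2)).toLp _ := by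
    refine Lp.ext ?_
    have h2 := (volume_preserving_ofLp ℝ ℝ).quasiMeasurePreserving.ae
      ((expMulLI_ae (wt2 α) F).and hF)
    filter_upwards [toE2_ae (expMulLI (wt2 α) F), h2, (hψ'.memLp (p := 2)).coeFn_toLp]
      with x h1 h2 h3
    rw [h1, h2.1, h2.2, h3, dualTest, ← mul_assoc, ← ofReal_mul, ← exp_add]
    change ((exp (α * x.ofLp.1 + -(α * x.ofLp.1)) : ℝ) : ℂ) * _ = _
    rw [add_neg_cancel, Real.exp_zero, Complex.ofReal_one, one_mul]
  have e2 : U α F = 𝓕 ((hψ'.memLp (p := 2) (μ := (volume : Measure E2))).toLp _) := by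
    rw [← e]; rfl
  rw [e2]
  filter_upwards [fourier_toLp_ae hψ'.integrable (hψ'.memLp (p := 2))] with ξ hξ
  rw [hξ, fourier_conj]

theorem eq_zero_of_inner_eq_zero {v : Hh} {g : E2 → ℝ} (hg : ∀ ξ, g ξ ≠ 0)
    (h : ∀ ψ : E2 → ℂ, IsTest ψ → ∃ w : Hh,
      (w =ᵐ[volume] fun ξ => (g ξ : ℂ) * conj ((𝓕⁻ ψ : E2 → ℂ) ξ)) ∧ inner ℂ w v = 0) :
    v = 0 := by
  have key : (fun ξ => (g ξ : ℂ) * v ξ) =ᵐ[volume] 0 := by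
    refine ae_eq_zero_of_forall_test fun ψ hψ => ?_
    obtain ⟨w, hw, h0⟩ := h ψ hψ
    have e : (fun ξ => inner ℂ (w ξ) (v ξ)) =ᵐ[volume] fun ξ =>
        ((g ξ : ℂ) * v ξ) * (𝓕⁻ ψ : E2 → ℂ) ξ := by
      filter_upwards [hw] with ξ hξ
      rw [hξ, RCLike.inner_apply, map_mul, conj_conj, conj_ofReal]
      ring
    exact ⟨(L2.integrable_inner w v).congr e, by rw [← integral_congr_ae e, ← h0, L2.inner_def]⟩
  refine Lp.ext ?_
  filter_upwards [key, Lp.coeFn_zero ℂ 2 (volume : Measure E2)] with ξ h1 h2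
  rw [h2]
  exact (mul_eq_zero.1 h1).resolve_left (by exact_mod_cast hg ξ)

theorem clm_eq_zero_of_dense {H V : Type*} [NormedAddCommGroup H] [InnerProductSpace ℂ H]
    [CompleteSpace H] [NormedAddCommGroup V] [NormedSpace ℂ V] {D : Set H}
    (hD : ∀ v : H, (∀ w ∈ D, inner ℂ w v = 0) → v = 0) {l : H →L[ℂ] V} (hl : ∀ w ∈ D, l w = 0) :
    l = 0 := by
  have hd : Dense (Submodule.span ℂ D : Set H) := by
    rw [Submodule.dense_iff_topologicalClosure_eq_top, Submodule.topologicalClosure_eq_top_iff,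
      Submodule.eq_bot_iff]
    intro v hv
    exact hD v fun w hw => (Submodule.mem_orthogonal _ _).1 hv w (Submodule.subset_span hw)
  exact ContinuousLinearMap.ext_on hd fun w hw => by rw [hl w hw, zero_apply]

/-- A bounded operator that vanishes on pairs of test functions is zero. -/
theorem clm_eq_zero_of_test {V : Type*} [NormedAddCommGroup V] [NormedSpace ℂ V]
    {l : Xplane α →L[ℂ] V} (hl : ∀ (f : Xplane α) (φ₁ φ₂ : ℝ × ℝ → ℂ), IsTest φ₁ → IsTest φ₂ →
      f.fn1 =ᵐ[volume] φ₁ → f.fn2 =ᵐ[volume] φ₂ → l f = 0) (u : Xplane α) : l u = 0 := by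
  have h0 : IsTest (fun _ : ℝ × ℝ => (0 : ℂ)) := ⟨contDiff_const, HasCompactSupport.zero⟩
  have z0 : ((0 : L2w (wt2 α)) : ℝ × ℝ → ℂ) =ᵐ[volume] fun _ => (0 : ℂ) :=
    (ae_eq_weighted_iff (wt2 α).continuous).1 (Lp.coeFn_zero ℂ 2 (weighted (wt2 α)))
  have l1 : (l.comp (symXfun α)).comp (ContinuousLinearMap.inl ℂ Hh Hh) = 0 := by
    refine clm_eq_zero_of_dense (D := {w | ∃ (F : H1plane α) (φ : ℝ × ℝ → ℂ), IsTest φ ∧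
      F.1 0 =ᵐ[volume] φ ∧ w = (symX α (toLp 2 (F, 0))).1}) ?_ ?_
    · intro v hv
      refine eq_zero_of_inner_eq_zero (g := N0 α) (fun ξ => (N0_pos α ξ).ne') fun ψ hψ => ?_
      obtain ⟨F, hF⟩ := exists_H1plane_test α (isTest_dualTest α hψ)
      refine ⟨_, ?_, hv _ ⟨F, _, isTest_dualTest α hψ, hF, rfl⟩⟩
      filter_upwards [symX_fst (toLp 2 (F, 0) : Xplane α), U_dualTest hψ hF] with ξ h1 h2
      rw [h1]
      exact congrArg _ h2
    · rintro w ⟨F, φ, hφ, hF, rfl⟩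
      have e : symXfun α ((symX α (toLp 2 (F, 0))).1, 0) = toLp 2 (F, 0) := by
        have e1 : (symX α (toLp 2 (F, 0))).2 = 0 := (symX_snd _).trans (map_zero (U α))
        rw [← e1]
        exact symXfun_symX _
      change l (symXfun α ((symX α (toLp 2 (F, 0))).1, 0)) = 0
      rw [e]
      exact hl _ φ _ hφ h0 hF z0
  have l2 : (l.comp (symXfun α)).comp (ContinuousLinearMap.inr ℂ Hh Hh) = 0 := by
    refine clm_eq_zero_of_dense (D := {w | ∃ (F : L2w (wt2 α)) (φ : ℝ × ℝ → ℂ), IsTest φ ∧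
      F =ᵐ[volume] φ ∧ w = U α F}) ?_ ?_
    · intro v hv
      refine eq_zero_of_inner_eq_zero (g := fun _ => 1) (fun ξ => one_ne_zero) fun ψ hψ => ?_
      obtain ⟨F, hF⟩ := exists_L2w_test α (isTest_dualTest α hψ)
      refine ⟨_, ?_, hv _ ⟨F, _, isTest_dualTest α hψ, hF, rfl⟩⟩
      filter_upwards [U_dualTest hψ hF] with ξ h2
      rw [h2, Complex.ofReal_one, one_mul]
    · rintro w ⟨F, φ, hφ, hF, rfl⟩
      have e : symXfun α (0, U α F) = toLp 2 (0, F) := by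
        refine WithLp.ofLp_injective 2 (Prod.ext ?_ ?_)
        · exact (symH1 α).map_zero
        · exact (U α).symm_apply_apply F
      change l (symXfun α (0, U α F)) = 0
      rw [e]
      exact hl _ _ φ h0 hφ z0 hF
  have e : u = symXfun α ((symX α u).1, 0) + symXfun α (0, (symX α u).2) := by
    rw [← map_add, Prod.mk_add_mk, add_zero, zero_add]
    exact (symXfun_symX u).symm
  rw [e, map_add]
  have e1 := congrArg (fun k => k (symX α u).1) l1
  have e2 := congrArg (fun k => k (symX α u).2) l2
  change l (symXfun α ((symX α u).1, 0)) = 0 at e1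
  change l (symXfun α (0, (symX α u).2)) = 0 at e2
  rw [e1, e2, add_zero]

theorem eq_of_ae_ae {F G : L2w (wt2 α)} (h : ∀ᵐ y : ℝ, ∀ᵐ z : ℝ, F (z, y) = G (z, y)) :
    F = G := by
  refine (curryL2 (weighted_wt2 α)).injective (Lp.ext ?_)
  filter_upwards [h, curryL2_ae (weighted_wt2 α) F, curryL2_ae (weighted_wt2 α) G] with y h1 h2 h3
  refine Lp.ext ?_
  filter_upwards [h2, h3, (ae_eq_weighted_iff (wt1 α).continuous).2 h1] with z e1 e2 e3
  rw [e1, e2, e3]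

theorem IsResonantProjection.unique {α η₀ : ℝ} {ζ : ℝ → Xline α} {ζs : ℝ → Xline (-α)}
    {P P' : Xplane α →L[ℂ] Xplane α} (h : IsResonantProjection ζ ζs η₀ P)
    (h' : IsResonantProjection ζ ζs η₀ P') : P = P' := by
  refine ContinuousLinearMap.ext fun u => sub_eq_zero.1 ?_
  refine clm_eq_zero_of_test (l := P - P') (fun f φ₁ φ₂ h₁ h₂ e₁ e₂ => ?_) u
  have a1 := h f φ₁ φ₂ h₁ h₂ e₁ e₂
  have a2 := h' f φ₁ φ₂ h₁ h₂ e₁ e₂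
  have e : P f = P' f := by
    have e0 : (P f).fst.1 0 = (P' f).fst.1 0 := eq_of_ae_ae (by
      filter_upwards [a1, a2] with y b1 b2
      filter_upwards [b1, b2] with z c1 c2
      exact c1.1.trans c2.1.symm)
    refine Xplane.ext_U (by rw [e0]) (eq_of_ae_ae ?_)
    filter_upwards [a1, a2] with y b1 b2
    filter_upwards [b1, b2] with z c1 c2
    exact c1.2.trans c2.2.symm
  exact sub_eq_zero.2 e

/-! ### The resolvent at high frequency -/

theorem norm_le_of_ae_le_sum {n : ℕ} (X : Hh) (Y : Fin n → Hh) {C : ℝ} (hC : 0 ≤ C)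
    (h : ∀ᵐ ξ, ‖X ξ‖ ≤ C * ∑ j, ‖Y j ξ‖) : ‖X‖ ≤ C * ∑ j, ‖Y j‖ := by
  let G : Fin n → Lp ℝ 2 (volume : Measure E2) := fun j => (memLp (Y j)).norm.toLp
  have hG : ∀ j, ‖G j‖ = ‖Y j‖ := fun j => by
    refine le_antisymm (norm_le_norm_of_ae_le ?_) (norm_le_norm_of_ae_le ?_) <;>
    · filter_upwards [(memLp (Y j)).norm.coeFn_toLp] with ξ hξ
      simp only [G]
      rw [hξ, norm_norm]
  have h1 : ‖X‖ ≤ ‖C • ∑ j, G j‖ := by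
    refine norm_le_norm_of_ae_le ?_
    have hs : ∀ᵐ ξ, ∀ j, G j ξ = ‖Y j ξ‖ :=
      ae_all_iff.2 fun j => (memLp (Y j)).norm.coeFn_toLp
    filter_upwards [h, hs, coeFn_smul C (∑ j, G j), Lp.coeFn_finsetSum Finset.univ G]
      with ξ a1 a2 a3 a4
    rw [a3, Pi.smul_apply, a4]
    simp only [Finset.sum_apply, a2]
    rw [smul_eq_mul, norm_eq_abs]
    exact a1.trans (le_abs_self _)
  refine h1.trans ?_
  rw [norm_smul, norm_of_nonneg hC]
  gcongr
  exact (norm_sum_le _ _).trans (by simp [hG])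

/-- Multiplication by `g` preserves `H⁻¹`: `g ψ = y₀ + ∂_z y₁ + ∂_y y₂` with `y₀, y₁, y₂`
bounded by the norm of `ψ` in `H⁻¹`. -/
theorem exists_mulZ_split {g : ℝ → ℝ} (hg : IsMult g) (hg' : IsMult (deriv g)) :
    ∃ K, 0 ≤ K ∧ ∀ ψ : L2w (wt2 α), ∃ Y : Fin 3 → Hh,
      (∀ i, ‖Y i‖ ≤ K * ‖fm (fun ξ => 1 / (N0 α ξ : ℂ)) (U α ψ)‖) ∧
      U α (mulZ α g ψ) =ᵐ[volume] fun ξ => Y 0 ξ + sz α ξ * Y 1 ξ + sy ξ * Y 2 ξ := by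
  refine ⟨‖mulZ α g‖ + ‖mulZ α (deriv g)‖, by positivity, fun ψ => ?_⟩
  set m₀ : E2 → ℂ := fun ξ => 1 / (N0 α ξ : ℂ) with hm₀
  set m₁ : E2 → ℂ := fun ξ => conj (sz α ξ) / (N0 α ξ : ℂ) with hm₁
  set m₂ : E2 → ℂ := fun ξ => conj (sy ξ) / (N0 α ξ : ℂ) with hm₂
  set m₃ : E2 → ℂ := fun ξ => sz α ξ / (N0 α ξ : ℂ) with hm₃
  set m₄ : E2 → ℂ := fun ξ => sy ξ / (N0 α ξ : ℂ) with hm₄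
  set e := fm m₀ (U α ψ)
  have h0 : MemLp m₀ ⊤ volume := memLp_one_div_N0 α
  have h1 : MemLp m₁ ⊤ volume := memLp_csz_div_N0 α
  have h2 : MemLp m₂ ⊤ volume := memLp_csy_div_N0 α
  have h3 : MemLp m₃ ⊤ volume := memLp_sz_div_N0 α
  have h4 : MemLp m₄ ⊤ volume := memLp_sy_div_N0 α
  set o0 : L2w (wt2 α) := (U α).symm (fm m₀ e)
  set o1 : L2w (wt2 α) := (U α).symm (fm m₁ e)
  set o2 : L2w (wt2 α) := (U α).symm (fm m₂ e)
  have hN1 : ∀ (z : ℂ) (ξ : E2), ‖z‖ ≤ N0 α ξ → ‖z / (N0 α ξ : ℂ)‖ ≤ 1 := fun z ξ hz => by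
    rw [norm_div, norm_real, norm_of_nonneg (N0_pos α ξ).le]
    exact (div_le_one (N0_pos α ξ)).2 hz
  have n0 : ‖o0‖ ≤ ‖e‖ := by
    simp only [o0, LinearIsometryEquiv.norm_map]
    exact (norm_fm_le zero_le_one (fun ξ => hN1 1 ξ (by simpa using one_le_N0 α ξ)) e).trans_eq (one_mul _)
  have n1 : ‖o1‖ ≤ ‖e‖ := by
    simp only [o1, LinearIsometryEquiv.norm_map]
    exact (norm_fm_le zero_le_one (fun ξ => hN1 _ ξ (by simpa using norm_sz_le α ξ)) e).trans_eq (one_mul _)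
  have n2 : ‖o2‖ ≤ ‖e‖ := by
    simp only [o2, LinearIsometryEquiv.norm_map]
    exact (norm_fm_le zero_le_one (fun ξ => hN1 _ ξ (by simpa using norm_sy_le α ξ)) e).trans_eq (one_mul _)
  set k1 : L2w (wt2 α) := (U α).symm (fm m₃ (fm m₁ (U α ψ)))
  set k2 : L2w (wt2 α) := (U α).symm (fm m₄ (fm m₂ (U α ψ)))
  have hk1 : U α k1 =ᵐ[volume] fun ξ => sz α ξ * U α o1 ξ := by
    simp only [k1, o1, LinearIsometryEquiv.apply_symm_apply]
    filter_upwards [fm_ae h3 (fm m₁ (U α ψ)),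
      fm_ae h1 (U α ψ), fm_ae h1 e, fm_ae h0 (U α ψ)] with ξ a1 a2 a3 a4
    rw [a1, a2, a3, a4]; simp only [hm₀, hm₁, hm₃]; ring
  have hk2 : U α k2 =ᵐ[volume] fun ξ => sy ξ * U α o2 ξ := by
    simp only [k2, o2, LinearIsometryEquiv.apply_symm_apply]
    filter_upwards [fm_ae h4 (fm m₂ (U α ψ)),
      fm_ae h2 (U α ψ), fm_ae h2 e, fm_ae h0 (U α ψ)] with ξ a1 a2 a3 a4
    rw [a1, a2, a3, a4]; simp only [hm₀, hm₂, hm₄]; ring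
  have hsum : ψ = o0 + k1 + k2 := by
    apply (U α).injective
    simp only [map_add, o0, k1, k2, LinearIsometryEquiv.apply_symm_apply]
    refine Lp.ext ?_
    filter_upwards [fm_ae h3 (fm m₁ (U α ψ)),
      fm_ae h1 (U α ψ), fm_ae h4 (fm m₂ (U α ψ)),
      fm_ae h2 (U α ψ), fm_ae h0 e, fm_ae h0 (U α ψ), coeFn_add (fm m₀ e
        + fm m₃
          (fm m₁ (U α ψ)))
        (fm m₄
          (fm m₂ (U α ψ))),
      coeFn_add (fm m₀ e) (fm m₃
          (fm m₁ (U α ψ)))]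
      with ξ a1 a2 a3 a4 a5 a6 a7 a8
    rw [a7, Pi.add_apply, a8, Pi.add_apply, a1, a2, a3, a4, a5, a6]
    have hN : (N0 α ξ : ℂ) ≠ 0 := by exact_mod_cast (N0_pos α ξ).ne'
    have hN2 : (N0 α ξ : ℂ) ^ 2 = 1 + sz α ξ * conj (sz α ξ)
        + sy ξ * conj (sy ξ) := by
      rw [Complex.mul_conj, Complex.mul_conj, normSq_eq_norm_sq, normSq_eq_norm_sq]
      exact_mod_cast N0_sq α ξ
    simp only [hm₀, hm₁, hm₂, hm₃, hm₄]
    field_simp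
    linear_combination (U α ψ ξ) * hN2
  refine ⟨![U α (mulZ α g o0) - U α (mulZ α (deriv g) o1), U α (mulZ α g o1), U α (mulZ α g o2)],
    ?_, ?_⟩
  · have m : ∀ (h : ℝ → ℝ) (o : L2w (wt2 α)), ‖o‖ ≤ ‖e‖ → ‖U α (mulZ α h o)‖ ≤ ‖mulZ α h‖ * ‖e‖ :=
      fun h o ho => by
        rw [LinearIsometryEquiv.norm_map]
        exact (le_opNorm _ _).trans (by gcongr)
    have hp : 0 ≤ ‖mulZ α (deriv g)‖ * ‖e‖ := by positivity
    intro i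
    fin_cases i
    · refine (norm_sub_le _ _).trans ?_
      linarith [m g o0 n0, m (deriv g) o1 n1]
    · exact (m g o1 n1).trans (by linarith)
    · exact (m g o2 n2).trans (by linarith)
  · have e1 : U α (mulZ α g ψ) = U α (mulZ α g o0) + U α (mulZ α g k1) + U α (mulZ α g k2) := by
      conv_lhs => rw [hsum]
      simp only [map_add]
    rw [e1]
    filter_upwards [U_mulZ_dz hg hg' hk1, U_mulZ_dy hg hg' hk2,
      coeFn_add (U α (mulZ α g o0) + U α (mulZ α g k1)) (U α (mulZ α g k2)),
      coeFn_add (U α (mulZ α g o0)) (U α (mulZ α g k1)),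
      coeFn_sub (U α (mulZ α g o0)) (U α (mulZ α (deriv g) o1))] with ξ a1 a2 a3 a4 a5
    rw [a3, Pi.add_apply, a4, Pi.add_apply, a1, a2]
    change _ = (U α (mulZ α g o0) - U α (mulZ α (deriv g) o1)) ξ + sz α ξ * (U α (mulZ α g o1)) ξ
      + sy ξ * (U α (mulZ α g o2)) ξ
    rw [a5, Pi.sub_apply]
    ring

theorem norm_le_two_mul_sq {N : ℝ} (hN : 1 ≤ N) {z y s : ℂ} (hz : ‖z‖ ≤ N) (hy : ‖y‖ ≤ N)
    (hs : ‖s‖ ≤ N ^ 2) (r₂ r₀ Z₀ Z₁ Z₂ Y₀ Y₁ Y₂ : ℂ) :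
    ‖-r₂ - s * r₀ - (Z₀ + z * Z₁ + y * Z₂) + 2 * z * (Y₀ + z * Y₁ + y * Y₂)‖ ≤
      2 * N ^ 2 * (‖r₂‖ + ‖r₀‖ + ‖Z₀‖ + ‖Z₁‖ + ‖Z₂‖ + ‖Y₀‖ + ‖Y₁‖ + ‖Y₂‖) := by
  have hN0 : 0 < N := by linarith
  have hNN : N ≤ N ^ 2 := by nlinarith
  have h1N : 1 ≤ N ^ 2 := hN.trans hNN
  have q1 : ‖s * r₀‖ ≤ N ^ 2 * ‖r₀‖ := by rw [norm_mul]; gcongr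
  have q2 : ‖Z₀ + z * Z₁ + y * Z₂‖ ≤ N ^ 2 * (‖Z₀‖ + ‖Z₁‖ + ‖Z₂‖) := by
    refine norm_add₃_le.trans ?_
    rw [norm_mul, norm_mul, mul_add, mul_add]
    gcongr
    · exact le_mul_of_one_le_left (norm_nonneg _) h1N
    · exact hz.trans hNN
    · exact hy.trans hNN
  have q3 : ‖2 * z * (Y₀ + z * Y₁ + y * Y₂)‖ ≤ 2 * N ^ 2 * (‖Y₀‖ + ‖Y₁‖ + ‖Y₂‖) := by
    rw [norm_mul, norm_mul, Complex.norm_ofNat]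
    have : ‖Y₀ + z * Y₁ + y * Y₂‖ ≤ N * (‖Y₀‖ + ‖Y₁‖ + ‖Y₂‖) := by
      refine norm_add₃_le.trans ?_
      rw [norm_mul, norm_mul, mul_add, mul_add]
      gcongr
      exact le_mul_of_one_le_left (norm_nonneg _) hN
    calc _ ≤ 2 * N * (N * (‖Y₀‖ + ‖Y₁‖ + ‖Y₂‖)) := by gcongr
      _ = _ := by ring
  have q4 : ‖r₂‖ ≤ N ^ 2 * ‖r₂‖ := le_mul_of_one_le_left (norm_nonneg _) h1N
  have q5 : 0 ≤ N ^ 2 * (‖r₂‖ + ‖r₀‖ + (‖Z₀‖ + ‖Z₁‖ + ‖Z₂‖)) := by positivity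
  refine (norm_add_le _ _).trans ?_
  have := norm_sub_le (-r₂ - s * r₀) (Z₀ + z * Z₁ + y * Z₂)
  have h5 := norm_sub_le (-r₂) (s * r₀)
  rw [norm_neg] at h5
  linarith

namespace Params

variable (hp : Params a b c α)
include hp

set_option maxHeartbeats 1000000 in
/-- The variable coefficients lose no derivative: `varOp` is bounded with respect to the norm of
`L²_α × H⁻¹_α`, which is weaker than that of `H¹_α × L²_α`. -/
theorem exists_varOp_bound : ∃ C, 0 ≤ C ∧ ∀ u : Xplane α, ‖varOp a b c α u‖ ≤
    C * (‖U α (u.fst.1 0)‖ + ‖fm (fun ξ => 1 / (N0 α ξ : ℂ)) (U α u.snd)‖) := by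
  have hr := isTanhPoly_rc a b c
  have hq := isTanhPoly_qc a b c
  obtain ⟨K, hK0, hK⟩ := exists_mulZ_split (α := α) hq.isMult hq.deriv.isMult
  obtain ⟨K', hK0', hK'⟩ := exists_mulZ_split (α := α) hq.deriv.isMult hq.deriv.deriv.isMult
  obtain ⟨δ, hδ, hδB⟩ := hp.exists_symB_bound
  set R := ‖mulZ α (rc a b c)‖
  set R' := ‖mulZ α (deriv (deriv (rc a b c)))‖
  refine ⟨2 / δ * (R' + R + 3 * K' + 3 * K), by positivity, fun u => ?_⟩
  set φ := u.fst.1 0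
  set e := fm (fun ξ => 1 / (N0 α ξ : ℂ)) (U α u.snd)
  obtain ⟨Y, hY, hYe⟩ := hK u.snd
  obtain ⟨Z, hZ, hZe⟩ := hK' u.snd
  set r0 := U α (mulZ α (rc a b c) φ)
  set r2 := U α (mulZ α (deriv (deriv (rc a b c))) φ)
  have hr0 : ‖r0‖ ≤ R * ‖U α φ‖ := by
    simp only [r0, LinearIsometryEquiv.norm_map]; exact le_opNorm _ _
  have hr2 : ‖r2‖ ≤ R' * ‖U α φ‖ := by
    simp only [r2, LinearIsometryEquiv.norm_map]; exact le_opNorm _ _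
  have key : ∀ᵐ ξ, ‖varOp a b c α u ξ‖ ≤ 2 / δ * ∑ j, ‖![r2, r0, Z 0, Z 1, Z 2, Y 0, Y 1, Y 2] j ξ‖ := by
    filter_upwards [hp.varOp_ae u, hYe, hZe,
      U_mulZ_dz hr.isMult hr.deriv.isMult (Xplane.U_dz u),
      U_mulZ_dz hr.deriv.isMult hr.deriv.deriv.isMult (Xplane.U_dz u),
      U_mulZ_dy hr.isMult hr.deriv.isMult (Xplane.U_dy u),
      coeFn_sub (U α (mulZ α (deriv (rc a b c)) (u.fst.1 1)))
        (U α (mulZ α (deriv (qc a b c)) u.snd)),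
      coeFn_add (U α (mulZ α (rc a b c) (u.fst.1 1))) ((2 : ℂ) • U α (mulZ α (qc a b c) u.snd)),
      coeFn_smul (2 : ℂ) (U α (mulZ α (qc a b c) u.snd))] with ξ a1 a2 a3 a4 a5 a6 a7 a8 a9
    have hv : varSym a b c u ξ = -r2 ξ - sp α ξ * r0 ξ
        - (Z 0 ξ + sz α ξ * Z 1 ξ + sy ξ * Z 2 ξ)
        + 2 * sz α ξ * (Y 0 ξ + sz α ξ * Y 1 ξ + sy ξ * Y 2 ξ) := by
      rw [varSym, map_sub, map_add, map_smul, a7, Pi.sub_apply, a8, Pi.add_apply, a9, Pi.smul_apply,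
        a2, a3, a4, a5, a6, smul_eq_mul, sp]
      ring
    have hN := N0_le_sq α ξ
    have h1N := one_le_N0_sq α ξ
    have hz := norm_sz_le α ξ
    have hy := norm_sy_le α ξ
    have hs := norm_sp_le α ξ
    have hNp := N0_pos α ξ
    rw [a1, norm_div, div_le_iff₀ (norm_pos_iff.2 (hp.symB_ne_zero ξ))]
    have t := norm_le_two_mul_sq (one_le_N0 α ξ) hz hy hs (r2 ξ) (r0 ξ) (Z 0 ξ) (Z 1 ξ) (Z 2 ξ)
      (Y 0 ξ) (Y 1 ξ) (Y 2 ξ)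
    rw [hv]
    refine t.trans ?_
    have hS : ∑ j, ‖![r2, r0, Z 0, Z 1, Z 2, Y 0, Y 1, Y 2] j ξ‖ =
        ‖r2 ξ‖ + ‖r0 ξ‖ + ‖Z 0 ξ‖ + ‖Z 1 ξ‖ + ‖Z 2 ξ‖ + ‖Y 0 ξ‖ + ‖Y 1 ξ‖ + ‖Y 2 ξ‖ := by
      rw [Fin.sum_univ_eight]; rfl
    rw [hS]
    set S := ‖r2 ξ‖ + ‖r0 ξ‖ + ‖Z 0 ξ‖ + ‖Z 1 ξ‖ + ‖Z 2 ξ‖ + ‖Y 0 ξ‖ + ‖Y 1 ξ‖ + ‖Y 2 ξ‖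
    have hS0 : 0 ≤ S := by positivity
    calc 2 * N0 α ξ ^ 2 * S = 2 / δ * S * (δ * N0 α ξ ^ 2) := by field_simp
      _ ≤ _ := by gcongr; exact hδB ξ
  refine (norm_le_of_ae_le_sum _ _ (by positivity) key).trans ?_
  rw [mul_assoc]
  gcongr
  have hS : ∑ j, ‖![r2, r0, Z 0, Z 1, Z 2, Y 0, Y 1, Y 2] j‖ =
      ‖r2‖ + ‖r0‖ + ‖Z 0‖ + ‖Z 1‖ + ‖Z 2‖ + ‖Y 0‖ + ‖Y 1‖ + ‖Y 2‖ := by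
    rw [Fin.sum_univ_eight]; rfl
  rw [hS]
  have := hY 0; have := hY 1; have := hY 2
  have := hZ 0; have := hZ 1; have := hZ 2
  have c1 : 0 ≤ (3 * K' + 3 * K) * ‖U α φ‖ := by positivity
  have c2 : 0 ≤ (R' + R) * ‖e‖ := by positivity
  change _ ≤ K * ‖e‖ at *
  nlinarith

set_option maxHeartbeats 1000000 in
/-- The pointwise estimate behind the bound for the resolvent: the wave operator with constant
coefficients factors into transport operators with symbols `x ± i γ s`, `s² = -Δ̂`, whose real parts
are bounded below because `|Im s| ≤ α`. -/
theorem exists_pointwise_bound {s₀ : ℝ} (hs : -s₀ < α * (c - sqrt (a / b))) :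
    ∃ C, 0 ≤ C ∧ ∀ (l : ℂ) (ξ : E2) (φ ψ V g1 g2 : ℂ), s₀ ≤ l.re →
      g1 = l * φ - (c * (sz α ξ * φ) + ψ) →
      g2 = l * ψ - (c * (sz α ξ * ψ) - sS a b α ξ * φ - V) →
      ‖ψ‖ + N0 α ξ * ‖φ‖ ≤ C * (N0 α ξ * ‖g1‖ + ‖g2‖ + ‖φ‖ + ‖V‖) := by
  set γ := sqrt (a / b)
  have hb := hp.b_pos
  have hab : 0 < a / b := div_pos hp.a_pos hb
  have hγ : 0 < γ := sqrt_pos.2 hab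
  have hγ2 : γ ^ 2 = a / b := sq_sqrt hab.le
  set d := α * (c - γ) + s₀
  have hd : 0 < d := by simp only [d]; linarith
  obtain ⟨R1, hR1, hR⟩ := hp.exists_sS_eq_add
  set k := sqrt (1 + 2 * α ^ 2)
  have hk : k ^ 2 = 1 + 2 * α ^ 2 := sq_sqrt (by positivity)
  refine ⟨(1 + 1 / γ) * (1 + R1 + γ) / d + k, by positivity, ?_⟩
  intro l ξ φ ψ V g1 g2 hl e1 e2
  obtain ⟨s, hs2⟩ := IsAlgClosed.exists_pow_nat_eq (sp α ξ) two_pos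
  have hre : s.re ^ 2 - s.im ^ 2 = fx ξ ^ 2 + fy ξ ^ 2 - α ^ 2 ∧ s.re * s.im = α * fx ξ := by
    have h1 := congrArg Complex.re (hs2.trans (sp_eq α ξ))
    have h2 := congrArg Complex.im (hs2.trans (sp_eq α ξ))
    simp [pow_two] at h1 h2
    constructor <;> nlinarith
  have him : |s.im| ≤ α := by
    refine abs_le_of_sq_le_sq ?_ hp.alpha_pos.le
    by_contra hlt
    push Not at hlt
    have h1 : (s.re * s.im) ^ 2 = α ^ 2 * fx ξ ^ 2 := by rw [hre.2]; ring
    have h2 : fx ξ ^ 2 < s.re ^ 2 := by nlinarith [hre.1, sq_nonneg (fy ξ)]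
    have h3 := sq_nonneg (fx ξ)
    have h4 := pow_pos hp.alpha_pos 2
    nlinarith
  have hsN : ‖s‖ ≤ N0 α ξ := by
    refine le_of_sq_le_sq ?_ (N0_pos α ξ).le
    rw [← norm_pow, hs2]; exact norm_sp_le α ξ
  have hNs : N0 α ξ ≤ ‖s‖ + k := by
    refine le_of_sq_le_sq ?_ (by positivity)
    have h1 : ‖s‖ ^ 2 = s.re ^ 2 + s.im ^ 2 := by
      rw [← normSq_eq_norm_sq, normSq_apply]; ring
    rw [N0_sq']
    have h2 : 0 ≤ ‖s‖ * k := by positivity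
    nlinarith [sq_nonneg s.im, hre.1]
  set x := l - c * sz α ξ
  have hx : x.re = l.re + c * α := by simp [x, sz_eq]
  obtain ⟨i1, i2⟩ := abs_le.1 him
  have hxp : d ≤ ‖x + γ * I * s‖ := by
    refine le_trans ?_ (re_le_norm _)
    simp [hx, d]
    nlinarith
  have hxm : d ≤ ‖x - γ * I * s‖ := by
    refine le_trans ?_ (re_le_norm _)
    simp [hx, d]
    nlinarith
  obtain ⟨ρ, hρ, hsS⟩ := hR ξ
  rw [← hγ2, ← hs2, ofReal_pow] at hsS
  set H := ‖g2‖ + R1 * ‖φ‖ + ‖V‖ + γ * (N0 α ξ * ‖g1‖)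
  have f1 : (x - γ * I * s) * (ψ + γ * I * s * φ) =
      g2 - ρ * φ - V + γ * I * s * g1 := by
    rw [e1, e2, hsS]; simp only [x]
    linear_combination (-(γ ^ 2 * s ^ 2 * φ)) * I_sq
  have f2 : (x + γ * I * s) * (ψ - γ * I * s * φ) =
      g2 - ρ * φ - V - γ * I * s * g1 := by
    rw [e1, e2, hsS]; simp only [x]
    linear_combination (-(γ ^ 2 * s ^ 2 * φ)) * I_sq
  have hr : ‖g2 - ρ * φ - V‖ ≤ ‖g2‖ + R1 * ‖φ‖ + ‖V‖ := by
    refine (norm_sub_le _ _).trans ?_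
    gcongr
    refine (norm_sub_le _ _).trans ?_
    rw [norm_mul]
    gcongr
  have hg : ‖γ * I * s * g1‖ ≤ γ * (N0 α ξ * ‖g1‖) := by
    simp only [norm_mul, norm_real, norm_I, mul_one, norm_of_nonneg hγ.le]
    rw [mul_assoc]
    gcongr
  have w1 : d * ‖ψ + γ * I * s * φ‖ ≤ H := by
    calc _ ≤ ‖x - γ * I * s‖ * ‖ψ + γ * I * s * φ‖ := by gcongr
      _ = ‖g2 - ρ * φ - V + γ * I * s * g1‖ := by rw [← norm_mul, f1]
      _ ≤ _ := (norm_add_le _ _).trans (by simp only [H]; linarith)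
  have w2 : d * ‖ψ - γ * I * s * φ‖ ≤ H := by
    calc _ ≤ ‖x + γ * I * s‖ * ‖ψ - γ * I * s * φ‖ := by gcongr
      _ = ‖g2 - ρ * φ - V - γ * I * s * g1‖ := by rw [← norm_mul, f2]
      _ ≤ _ := (norm_sub_le _ _).trans (by simp only [H]; linarith)
  have v1 : d * ‖ψ‖ ≤ H := by
    have : 2 * ‖ψ‖ ≤ ‖ψ + γ * I * s * φ‖ + ‖ψ - γ * I * s * φ‖ := by
      have := norm_add_le (ψ + γ * I * s * φ) (ψ - γ * I * s * φ)
      rwa [show ψ + γ * I * s * φ + (ψ - γ * I * s * φ) = 2 * ψ by ring, norm_mul,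
        Complex.norm_ofNat] at this
    nlinarith
  have v2 : d * (γ * (‖s‖ * ‖φ‖)) ≤ H := by
    have : 2 * (γ * (‖s‖ * ‖φ‖)) ≤
        ‖ψ + γ * I * s * φ‖ + ‖ψ - γ * I * s * φ‖ := by
      have := norm_sub_le (ψ + γ * I * s * φ) (ψ - γ * I * s * φ)
      rw [show ψ + γ * I * s * φ - (ψ - γ * I * s * φ)
        = 2 * (γ * I * s * φ) by ring] at this
      simp only [norm_mul, norm_real, norm_I, mul_one,
        norm_of_nonneg hγ.le, Complex.norm_ofNat] at this
      linarith
    nlinarith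
  have v1' : ‖ψ‖ ≤ H / d := by rw [le_div_iff₀ hd]; linarith
  have v2' : ‖s‖ * ‖φ‖ ≤ 1 / γ * (H / d) := by
    rw [div_mul_div_comm, one_mul, le_div_iff₀ (by positivity)]; linarith
  set S := N0 α ξ * ‖g1‖ + ‖g2‖ + ‖φ‖ + ‖V‖
  have hN0 := N0_pos α ξ
  have hH : H ≤ (1 + R1 + γ) * S := by
    have p1 : 0 ≤ N0 α ξ * ‖g1‖ := by positivity
    have := norm_nonneg g2; have := norm_nonneg φ; have := norm_nonneg V
    simp only [H, S]
    have q1 : 0 ≤ R1 * (N0 α ξ * ‖g1‖ + ‖g2‖ + ‖V‖) := by positivity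
    have q2 : 0 ≤ γ * (‖g2‖ + ‖φ‖ + ‖V‖) := by positivity
    nlinarith
  have hφS : ‖φ‖ ≤ S := by
    have p1 : 0 ≤ N0 α ξ * ‖g1‖ := by positivity
    have := norm_nonneg g2; have := norm_nonneg φ; have := norm_nonneg V
    simp only [S]; linarith
  calc ‖ψ‖ + N0 α ξ * ‖φ‖ ≤ ‖ψ‖ + (‖s‖ + k) * ‖φ‖ := by gcongr
    _ ≤ (1 + 1 / γ) * (H / d) + k * ‖φ‖ := by linarith
    _ ≤ (1 + 1 / γ) * ((1 + R1 + γ) * S / d) + k * S := by gcongr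
    _ = _ := by ring

end Params

/-- Elimination of the lower order quantities `x`, `y`, `v` for large `L`. -/
theorem le_of_high_frequency {C : ℝ} (hC : 1 ≤ C) {A B p q x y v L : ℝ} (hp : 0 ≤ p)
    (hq : 0 ≤ q) (hx : 0 ≤ x) (hy : 0 ≤ y)
    (hL : C ^ 2 + 8 * C ^ 2 * (1 + C) ≤ L)
    (h1 : A ≤ C * (p + q + x + v)) (h2 : B ≤ C * (p + q + x + v))
    (h3 : L * x ≤ C * (A + B + p)) (h4 : L * y ≤ C * (A + B + q + v)) (h5 : v ≤ C * (x + y)) :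
    A + B ≤ (4 * C + 1) * (p + q) := by
  have e1 : (8 * C ^ 2 * (1 + C)) * (x + y) ≤ 2 * C * (A + B) + C * (p + q) := by
    have := mul_le_mul_of_nonneg_right hL (add_nonneg hx hy)
    have h6 : C * v ≤ C * (C * (x + y)) := by gcongr
    nlinarith
  have e2 : 2 * C * (1 + C) * (x + y) ≤ (A + B) / 2 + (p + q) / 4 := by
    have : 4 * C * (2 * C * (1 + C) * (x + y)) ≤ 4 * C * ((A + B) / 2 + (p + q) / 4) := by
      nlinarith
    exact le_of_mul_le_mul_left this (by positivity)
  have e3 : A + B ≤ 2 * C * (p + q) + 2 * C * (1 + C) * (x + y) := by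
    have h6 : C * v ≤ C * (C * (x + y)) := by gcongr
    have h7 : C * x ≤ C * (x + y) := by gcongr; linarith
    nlinarith
  nlinarith

namespace Params

variable (hp : Params a b c α)
include hp

theorem exists_norm_sS_le : ∃ C, 0 ≤ C ∧ ∀ ξ, ‖sS a b α ξ‖ ≤ C * N0 α ξ ^ 2 := by
  obtain ⟨C, hC0, hC⟩ := hp.norm_sS_sub_le
  refine ⟨|a / b| + C, by positivity, fun ξ => ?_⟩
  have h1 := norm_le_norm_add_norm_sub' (sS a b α ξ) ((a / b : ℝ) * (N0 α ξ : ℂ) ^ 2)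
  rw [norm_mul, norm_pow, norm_real, norm_real, norm_eq_abs,
    norm_of_nonneg (N0_pos α ξ).le] at h1
  have h2 : C * N0 α ξ ≤ C * N0 α ξ ^ 2 := by gcongr; exact N0_le_sq α ξ
  linarith [hC ξ]

set_option maxHeartbeats 1000000 in
/-- To the right of `-α (c - (a / b)^{1/2})` the resolvent is bounded for large spectral
parameter. -/
theorem exists_bound_of_large {s₀ : ℝ} (hs : -s₀ < α * (c - sqrt (a / b))) :
    ∃ Λ M : ℝ, 0 ≤ M ∧ ∀ l : ℂ, s₀ ≤ l.re → Λ ≤ ‖l‖ → ∀ u f : Xplane α, LGraph a b c α u f →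
      ‖u‖ ≤ M * ‖l • u - f‖ := by
  obtain ⟨C1, hC1, h1⟩ := hp.exists_pointwise_bound hs
  obtain ⟨C2, hC2, h2⟩ := hp.exists_varOp_bound
  obtain ⟨C3, hC3, h3⟩ := hp.exists_norm_sS_le
  set C := 1 + C1 + C2 + C3 + |c|
  have hC : 1 ≤ C := by
    simp only [C]; have := abs_nonneg c; linarith
  have hC0 : 0 ≤ C := by linarith
  have hcC : |c| ≤ C := by simp only [C]; linarith
  have h3C : C3 ≤ C := by simp only [C]; have := abs_nonneg c; linarith
  have h1C : C1 ≤ C := by simp only [C]; have := abs_nonneg c; linarith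
  have h2C : C2 ≤ C := by simp only [C]; have := abs_nonneg c; linarith
  set K := ‖((symX α).symm : Hh × Hh →L[ℂ] Xplane α)‖
  set K' := ‖(symX α : Xplane α →L[ℂ] Hh × Hh)‖
  refine ⟨C ^ 2 + 8 * C ^ 2 * (1 + C), K * ((4 * C + 1) * (2 * K')), by positivity, ?_⟩
  intro l hl hΛ u f huf
  set g := l • u - f with hg
  obtain ⟨a1, a2⟩ := (hp.LGraph_iff u f).1 huf
  set φ := U α (u.fst.1 0)
  set ψ := U α u.snd
  set V := varOp a b c α u
  set e := fm (fun ξ => 1 / (N0 α ξ : ℂ)) ψ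
  set A := (symX α u).1
  set p := (symX α g).1
  set q := (symX α g).2
  have hq : q = U α g.snd := symX_snd g
  have g1 : U α (g.fst.1 0) =ᵐ[volume] fun ξ => l * φ ξ - (c * (sz α ξ * φ ξ) + ψ ξ) := by
    have : U α (g.fst.1 0) = l • φ - U α (f.fst.1 0) := by
      change U α (l • u.fst.1 0 - f.fst.1 0) = _
      rw [map_sub, map_smul]
    rw [this]
    filter_upwards [coeFn_sub (l • φ) (U α (f.fst.1 0)), coeFn_smul l φ, a1] with ξ b1 b2 b3
    rw [b1, Pi.sub_apply, b2, Pi.smul_apply, b3, smul_eq_mul]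
  have g2 : q =ᵐ[volume] fun ξ =>
      l * ψ ξ - (c * (sz α ξ * ψ ξ) - sS a b α ξ * φ ξ - V ξ) := by
    have : U α g.snd = l • ψ - U α f.snd := by
      change U α (l • u.snd - f.snd) = _
      rw [map_sub, map_smul]
    rw [hq, this]
    filter_upwards [coeFn_sub (l • ψ) (U α f.snd), coeFn_smul l ψ, a2] with ξ b1 b2 b3
    rw [b1, Pi.sub_apply, b2, Pi.smul_apply, b3, smul_eq_mul]
  have nN : ∀ ξ : E2, ‖(N0 α ξ : ℂ)‖ = N0 α ξ := fun ξ => by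
    rw [norm_real, norm_of_nonneg (N0_pos α ξ).le]
  have key : ∀ᵐ ξ, ‖ψ ξ‖ + ‖A ξ‖ ≤ C * (‖p ξ‖ + ‖q ξ‖ + ‖φ ξ‖ + ‖V ξ‖) := by
    filter_upwards [g1, g2, symX_fst u, symX_fst g] with ξ b1 b2 b3 b4
    have := h1 l ξ (φ ξ) (ψ ξ) (V ξ) (U α (g.fst.1 0) ξ) (q ξ) hl b1 b2
    rw [b3, b4, norm_mul, norm_mul, nN]
    refine this.trans ?_
    have := (N0_pos α ξ).le
    gcongr
  have s1 : ‖A‖ ≤ C * (‖p‖ + ‖q‖ + ‖φ‖ + ‖V‖) := by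
    have := norm_le_of_ae_le_sum A ![p, q, φ, V] hC0 (by
      filter_upwards [key] with ξ b1
      rw [Fin.sum_univ_four]
      exact (le_add_of_nonneg_left (norm_nonneg _)).trans b1)
    rwa [Fin.sum_univ_four] at this
  have s2 : ‖ψ‖ ≤ C * (‖p‖ + ‖q‖ + ‖φ‖ + ‖V‖) := by
    have := norm_le_of_ae_le_sum ψ ![p, q, φ, V] hC0 (by
      filter_upwards [key] with ξ b1
      rw [Fin.sum_univ_four]
      exact (le_add_of_nonneg_right (norm_nonneg _)).trans b1)
    rwa [Fin.sum_univ_four] at this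
  have s3 : ‖l‖ * ‖φ‖ ≤ C * (‖A‖ + ‖ψ‖ + ‖p‖) := by
    have := norm_le_of_ae_le_sum (l • φ) ![A, ψ, p] hC0 (by
      filter_upwards [g1, symX_fst u, symX_fst g, coeFn_smul l φ] with ξ b1 b2 b3 b4
      rw [Fin.sum_univ_three, b4, Pi.smul_apply, smul_eq_mul]
      change _ ≤ C * (‖A ξ‖ + ‖ψ ξ‖ + ‖p ξ‖)
      have e1 : l * φ ξ = U α (g.fst.1 0) ξ + (c * (sz α ξ * φ ξ) + ψ ξ) := by rw [b1]; ring
      have n1 : ‖c * (sz α ξ * φ ξ)‖ ≤ C * ‖A ξ‖ := by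
        rw [b2, norm_mul, norm_mul, norm_mul, nN, norm_real, norm_eq_abs]
        gcongr
        exact norm_sz_le α ξ
      have n2 : ‖U α (g.fst.1 0) ξ‖ ≤ C * ‖p ξ‖ := by
        rw [b3, norm_mul, nN, ← mul_assoc]
        exact le_mul_of_one_le_left (norm_nonneg _) (one_le_mul_of_one_le_of_one_le hC (one_le_N0 α ξ))
      have n3 : ‖ψ ξ‖ ≤ C * ‖ψ ξ‖ := le_mul_of_one_le_left (norm_nonneg _) hC
      rw [e1]
      have := norm_add_le (U α (g.fst.1 0) ξ) (c * (sz α ξ * φ ξ) + ψ ξ)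
      have := norm_add_le (c * (sz α ξ * φ ξ)) (ψ ξ)
      linarith)
    rwa [Fin.sum_univ_three, norm_smul] at this
  have s4 : ‖l‖ * ‖e‖ ≤ C * (‖A‖ + ‖ψ‖ + ‖q‖ + ‖V‖) := by
    have := norm_le_of_ae_le_sum (l • e) ![A, ψ, q, V] hC0 (by
      filter_upwards [g2, symX_fst u, coeFn_smul l e, fm_ae (memLp_one_div_N0 α) ψ]
        with ξ b1 b2 b3 b4
      rw [Fin.sum_univ_four, b3, Pi.smul_apply, smul_eq_mul, b4]
      change _ ≤ C * (‖A ξ‖ + ‖ψ ξ‖ + ‖q ξ‖ + ‖V ξ‖)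
      have e1 : l * (1 / (N0 α ξ : ℂ) * ψ ξ) =
          (q ξ + c * (sz α ξ * ψ ξ) - sS a b α ξ * φ ξ - V ξ) / (N0 α ξ : ℂ) := by rw [b1]; ring
      have hN := N0_pos α ξ
      have h1N := one_le_N0 α ξ
      rw [e1, norm_div, nN, div_le_iff₀ hN]
      have n1 : ‖c * (sz α ξ * ψ ξ)‖ ≤ C * ‖ψ ξ‖ * N0 α ξ := by
        rw [norm_mul, norm_mul, norm_real, norm_eq_abs]
        calc _ ≤ C * (N0 α ξ * ‖ψ ξ‖) := by gcongr; exact norm_sz_le α ξ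
          _ = _ := by ring
      have n2 : ‖sS a b α ξ * φ ξ‖ ≤ C * ‖A ξ‖ * N0 α ξ := by
        rw [b2, norm_mul, norm_mul, nN]
        calc _ ≤ (C * N0 α ξ ^ 2) * ‖φ ξ‖ := by
              gcongr; exact (h3 ξ).trans (by gcongr)
          _ = _ := by ring
      have hCN : 1 ≤ C * N0 α ξ := one_le_mul_of_one_le_of_one_le hC h1N
      have n3 : ‖q ξ‖ ≤ C * N0 α ξ * ‖q ξ‖ := le_mul_of_one_le_left (norm_nonneg _) hCN
      have n4 : ‖V ξ‖ ≤ C * N0 α ξ * ‖V ξ‖ := le_mul_of_one_le_left (norm_nonneg _) hCN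
      have m1 := norm_sub_le (q ξ + c * (sz α ξ * ψ ξ) - sS a b α ξ * φ ξ) (V ξ)
      have m2 := norm_sub_le (q ξ + c * (sz α ξ * ψ ξ)) (sS a b α ξ * φ ξ)
      have m3 := norm_add_le (q ξ) (c * (sz α ξ * ψ ξ))
      linarith)
    rwa [Fin.sum_univ_four, norm_smul] at this
  have s5 : ‖V‖ ≤ C * (‖φ‖ + ‖e‖) := (h2 u).trans (by gcongr)
  have fin := le_of_high_frequency hC (norm_nonneg p) (norm_nonneg q) (norm_nonneg φ)
    (norm_nonneg e) hΛ s1 s2 s3 s4 s5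
  have hu : ‖u‖ ≤ K * (‖A‖ + ‖ψ‖) := by
    calc ‖u‖ = ‖((symX α).symm : Hh × Hh →L[ℂ] Xplane α) (symX α u)‖ := by simp
      _ ≤ K * ‖symX α u‖ := le_opNorm _ _
      _ ≤ _ := by
        gcongr
        refine max_le (le_add_of_nonneg_right (norm_nonneg _)) ?_
        rw [symX_snd]
        exact le_add_of_nonneg_left (norm_nonneg _)
  have hg : ‖p‖ + ‖q‖ ≤ 2 * K' * ‖g‖ := by
    have h : ‖symX α g‖ ≤ K' * ‖g‖ :=
      le_opNorm (symX α : Xplane α →L[ℂ] Hh × Hh) g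
    have h1 : ‖p‖ ≤ ‖symX α g‖ := norm_fst_le _
    have h2 : ‖q‖ ≤ ‖symX α g‖ := norm_snd_le _
    linarith
  calc ‖u‖ ≤ K * ((4 * C + 1) * (2 * K' * ‖g‖)) := by
        refine hu.trans ?_
        gcongr
        exact fin.trans (by gcongr)
    _ = _ := by ring

end Params

/-! ### The decay estimate -/

/-- The resolvent of a restricted operator is bounded uniformly on compact subsets of the resolvent
set. -/
theorem exists_bound_of_isCompact {X : Type*} [NormedAddCommGroup X] [NormedSpace ℂ X]
    {L : X → X → Prop} {Z : Submodule ℂ X} (hZ : ∀ u ∈ Z, ∀ f, L u f → f ∈ Z) {S : Set ℂ}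
    (hS : IsCompact S) (hR : S ⊆ restrictedResolventSet L Z) :
    ∃ M : ℝ, 0 ≤ M ∧ ∀ l ∈ S, ∀ u ∈ Z, ∀ f, L u f → ‖u‖ ≤ M * ‖l • u - f‖ := by
  refine hS.induction_on (p := fun S => ∃ M : ℝ, 0 ≤ M ∧ ∀ l ∈ S, ∀ u ∈ Z, ∀ f, L u f →
    ‖u‖ ≤ M * ‖l • u - f‖) ⟨0, le_rfl, by simp⟩ ?_ ?_ ?_
  · rintro s t hst ⟨M, hM, h⟩
    exact ⟨M, hM, fun l hl => h l (hst hl)⟩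
  · rintro s t ⟨M, hM, h⟩ ⟨M', hM', h'⟩
    refine ⟨max M M', le_max_of_le_left hM, ?_⟩
    rintro l (hl | hl) u hu f huf
    · exact (h l hl u hu f huf).trans (by gcongr; exact le_max_left _ _)
    · exact (h' l hl u hu f huf).trans (by gcongr; exact le_max_right _ _)
  · intro l₀ hl₀
    obtain ⟨R, hR⟩ := hR hl₀
    set M := ‖R‖ + 1
    have hM : 0 < M := by positivity
    refine ⟨Metric.ball l₀ (1 / (2 * M)), mem_nhdsWithin_of_mem_nhds
      (Metric.ball_mem_nhds _ (by positivity)), 2 * M, by positivity, ?_⟩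
    intro l hl u hu f huf
    have hf := hZ u hu f huf
    have h1 : R (l₀ • (⟨u, hu⟩ : Z) - ⟨f, hf⟩) = ⟨u, hu⟩ := by
      rw [hR]
      simpa using huf
    have h2 : ‖u‖ ≤ M * ‖l₀ • u - f‖ := by
      have := R.le_opNorm (l₀ • (⟨u, hu⟩ : Z) - ⟨f, hf⟩)
      rw [h1] at this
      exact this.trans (mul_le_mul_of_nonneg_right (by simp [M]) (norm_nonneg _))
    have h3 : ‖l₀ • u - f‖ ≤ ‖l • u - f‖ + ‖l - l₀‖ * ‖u‖ := by
      rw [show l₀ • u - f = (l • u - f) - (l - l₀) • u by rw [sub_smul]; abel, ← norm_smul]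
      exact norm_sub_le _ _
    have h4 : M * (‖l - l₀‖ * ‖u‖) ≤ ‖u‖ / 2 := by
      have : ‖l - l₀‖ ≤ 1 / (2 * M) := by
        rw [← dist_eq_norm]; exact (Metric.mem_ball.1 hl).le
      calc _ ≤ M * (1 / (2 * M) * ‖u‖) := by gcongr
        _ = _ := by field_simp
    have h5 : M * ‖l₀ • u - f‖ ≤ M * (‖l • u - f‖ + ‖l - l₀‖ * ‖u‖) := by gcongr
    linarith

section Projection

variable {X : Type*} [NormedAddCommGroup X] [NormedSpace ℂ X] {P : X →L[ℂ] X}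

theorem mem_range_id_sub (hP : ∀ u, P (P u) = P u) (u : X) :
    u ∈ LinearMap.range (ContinuousLinearMap.id ℂ X - P).toLinearMap ↔ P u = 0 := by
  constructor
  · rintro ⟨v, rfl⟩
    simp [hP]
  · intro h
    exact ⟨u, by simp [h]⟩

theorem IsSemigroupGeneratedBy.mem_range_of_graph [CompleteSpace X] {L : X → X → Prop} {T : ℝ → X →L[ℂ] X}
    (hT : IsSemigroupGeneratedBy L T) (hP : ∀ u, P (P u) = P u)
    (hPL : ∀ u f, L u f → L (P u) (P f)) :
    ∀ u ∈ LinearMap.range (ContinuousLinearMap.id ℂ X - P).toLinearMap, ∀ f, L u f →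
      f ∈ LinearMap.range (ContinuousLinearMap.id ℂ X - P).toLinearMap := by
  intro u hu f huf
  rw [mem_range_id_sub hP] at hu ⊢
  have h := hPL u f huf
  rw [hu] at h
  exact hT.unique h ((hT.generator 0 0).2 (by simp))

end Projection

set_option maxHeartbeats 400000 in
/-- The decay estimate, for rates below `α (c - (a / b)^{1/2})`. -/
theorem Params.exists_decay (hp : Params a b c α) {P : Xplane α →L[ℂ] Xplane α}
    {T : ℝ → Xplane α →L[ℂ] Xplane α} (hT : IsSemigroupGeneratedBy (LGraph a b c α) T)
    (hP : ∀ u, P (P u) = P u) (hPL : ∀ u f, LGraph a b c α u f → LGraph a b c α (P u) (P f))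
    {β' : ℝ} (hβ : β' < α * (c - sqrt (a / b)))
    (hσ : ∀ l : ℂ, -β' ≤ l.re → l ∈ restrictedResolventSet (LGraph a b c α)
      (LinearMap.range (ContinuousLinearMap.id ℂ (Xplane α) - P).toLinearMap)) :
    ∃ C : ℝ, 0 < C ∧ ∀ t : ℝ, 0 ≤ t →
      ‖(T t).comp (ContinuousLinearMap.id ℂ (Xplane α) - P)‖ ≤ C * exp (-β' * t) := by
  obtain ⟨Λ, M, hM, h1⟩ := hp.exists_bound_of_large (s₀ := -β') (by simpa using hβ)
  obtain ⟨M', hM', h2⟩ := exists_bound_of_isCompact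
    (hT.mem_range_of_graph hP hPL)
    (S := Metric.closedBall 0 Λ ∩ {l : ℂ | -β' ≤ l.re})
    ((isCompact_closedBall _ _).inter_right (isClosed_le continuous_const Complex.continuous_re))
    fun l hl => hσ l hl.2
  refine hT.exists_decay _ (M := max M M') (fun x => by simp [hP]) (fun t ht x => ?_) ?_
  · have := hT.commute P hPL ht x
    simp [this]
  · intro l hl u f hu huf
    rcases le_or_gt Λ ‖l‖ with h | h
    · exact (h1 l hl h u f huf).trans (by gcongr; exact le_max_left _ _)
    · refine (h2 l ⟨by simpa using h.le, hl⟩ u ?_ f huf).trans (by gcongr; exact le_max_right _ _)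
      rw [mem_range_id_sub hP]
      simpa using hu

/-! ### Wave packets -/

theorem U_symm_ae {h : E2 → ℂ} (h1 : Integrable h) (h2 : MemLp h 2) {w : L2w (wt2 α)}
    (hw : U α w =ᵐ[volume] h) :
    expMulLI (wt2 α) w =ᵐ[volume] fun x : ℝ × ℝ => 𝓕⁻ h (toLp 2 x) := by
  have e1 : U α w = h2.toLp h := Lp.ext (hw.trans h2.coeFn_toLp.symm)
  have e2 : U α w = 𝓕 (toE2 (expMulLI (wt2 α) w)) := rfl
  have e3 : toE2 (expMulLI (wt2 α) w) = 𝓕⁻ (h2.toLp h) := by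
    rw [← e1, e2]
    exact ((Lp.fourierTransformₗᵢ E2 ℂ).symm_apply_apply _).symm
  have e4 := fourierInv_toLp_ae h1 h2
  rw [← e3] at e4
  have e5 := (toE2_ae (expMulLI (wt2 α) w)).symm.trans e4
  filter_upwards [(volume_preserving_toLp ℝ ℝ).quasiMeasurePreserving.ae e5] with x hx
  exact hx

theorem memLp_fourierInv {H : Type*} [NormedAddCommGroup H] [InnerProductSpace ℂ H]
    [CompleteSpace H] {V : Type*} [NormedAddCommGroup V] [InnerProductSpace ℝ V]
    [FiniteDimensional ℝ V] [MeasurableSpace V] [BorelSpace V] {Φ : V → H} (h1 : Integrable Φ)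
    (h2 : MemLp Φ 2) : MemLp (𝓕⁻ Φ) 2 :=
  (memLp (𝓕⁻ (h2.toLp Φ) : Lp H 2 (volume : Measure V))).ae_eq (fourierInv_toLp_ae h1 h2)

/-- The fibers of a function with product symbol. -/
theorem fib_tens {χ θ : ℝ → ℂ} (hχ1 : Integrable χ) (hχ2 : MemLp χ 2) (hθ1 : Integrable θ)
    (hθ2 : MemLp θ 2) (h1 : Integrable fun ξ : E2 => tens χ θ ξ.ofLp)
    (h2 : MemLp (fun ξ : E2 => tens χ θ ξ.ofLp) 2) {w : L2w (wt2 α)}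
    (hw : U α w =ᵐ[volume] fun ξ => tens χ θ ξ.ofLp) :
    ∃ X : L2w (wt1 α), fib α w =ᵐ[volume] fun η => θ η • X := by
  have hX : MemLp (fun z => (exp (-(α * z)) : ℂ) * 𝓕⁻ χ z) 2 (weighted (wt1 α)) := by
    rw [memLp_weighted_iff (wt1 α).continuous]
    refine (memLp_fourierInv hχ1 hχ2).ae_eq (.of_forall fun z => ?_)
    change _ = ((exp (α * z) : ℝ) : ℂ) * _
    rw [← mul_assoc, ← ofReal_mul, ← exp_add]
    simp
  set X := hX.toLp
  have hXae : X =ᵐ[volume] fun z => (exp (-(α * z)) : ℂ) * 𝓕⁻ χ z :=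
    (ae_eq_weighted_iff (wt1 α).continuous).1 hX.coeFn_toLp
  have hw2 : w =ᵐ[volume] fun x => ((exp (-(α * x.1)) : ℂ) * 𝓕⁻ χ x.1) * 𝓕⁻ θ x.2 := by
    filter_upwards [U_symm_ae h1 h2 hw, expMulLI_ae (wt2 α) w] with x e1 e2
    rw [e2, fourierInv_tens] at e1
    change ((exp (α * x.1) : ℝ) : ℂ) * w x = _ at e1
    have : ((exp (-(α * x.1)) : ℝ) : ℂ) * ((exp (α * x.1) : ℝ) : ℂ) = 1 := by
      rw [← ofReal_mul, ← exp_add]; simp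
    calc w x = (((exp (-(α * x.1)) : ℝ) : ℂ) * ((exp (α * x.1) : ℝ) : ℂ)) * w x := by
          rw [this, one_mul]
      _ = ((exp (-(α * x.1)) : ℝ) : ℂ) * (((exp (α * x.1) : ℝ) : ℂ) * w x) := by ring
      _ = _ := by rw [e1]; ring
  have hΦ1 : Integrable fun η => θ η • X := hθ1.smul_const X
  have hΦ2 : MemLp (fun η => θ η • X) 2 := by
    refine MemLp.of_le_mul (c := ‖X‖) hθ2 hΦ1.1 (.of_forall fun η => ?_)
    rw [norm_smul, mul_comm]
  have hinv : ∀ y, 𝓕⁻ (fun η => θ η • X) y = 𝓕⁻ θ y • X := fun y => by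
    rw [fourierInv_eq, fourierInv_eq, ← integral_smul_const]
    refine integral_congr_ae (.of_forall fun η => ?_)
    simp only [smul_assoc]
  have hcurry : curryL2 (weighted_wt2 α) w = 𝓕⁻ (hΦ2.toLp) := by
    refine Lp.ext ?_
    filter_upwards [curryL2_test_ae hw2, fourierInv_toLp_ae hΦ1 hΦ2] with y e1 e2
    rw [e2, hinv]
    refine Lp.ext ((ae_eq_weighted_iff (wt1 α).continuous).2 ?_)
    filter_upwards [e1, hXae, (ae_eq_weighted_iff (wt1 α).continuous).1 (coeFn_smul (𝓕⁻ θ y) X)]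
      with z a1 a2 a3
    rw [a1, a3, Pi.smul_apply, a2, smul_eq_mul]
    ring
  refine ⟨X, ?_⟩
  have : fib α w = hΦ2.toLp := by
    rw [fib_apply, hcurry]
    exact (Lp.fourierTransformₗᵢ ℝ (L2w (wt1 α))).apply_symm_apply _
  rw [this]
  exact hΦ2.coeFn_toLp

theorem FiberFamily.op_eq_zero (A : FiberFamily α) {u : Xplane α}
    (h0 : ∀ᵐ η, |η| ≤ A.R → fib α (u.fst.1 0) η = 0) (h1 : ∀ᵐ η, |η| ≤ A.R → fib α u.snd η = 0) :
    A.op u = 0 := by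
  have himg : A.img u =ᵐ[volume] A.img 0 := by
    rw [map_zero]
    filter_upwards [A.img_ae u, A.img_eq_zero u, h0, h1, Lp.coeFn_zero (Xline α) 2 (volume : Measure ℝ)]
      with η e1 e2 e3 e4 e5
    rw [e5]
    rcases le_or_gt |η| A.R with h | h
    · rw [e1, e3 h, e4 h, map_zero, map_zero, add_zero]; rfl
    · exact e2 h
  refine (Xplane.ext_fiber (A.isFiber_op u) ?_).trans (map_zero A.op)
  filter_upwards [himg, A.isFiber_op 0] with η e1 e2
  rwa [e1]

/-- The factor `e^{-2 π i n ξ₁}`, which shifts by `n` in the direction of `z`. -/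
def shiftSym (n : ℕ) (ξ : E2) : ℂ := (𝐞 (-(n * ξ.ofLp.1)) : ℂ)

theorem norm_shiftSym (n : ℕ) (ξ : E2) : ‖shiftSym n ξ‖ = 1 := Circle.norm_coe _

theorem continuous_shiftSym (n : ℕ) : Continuous (shiftSym n) := by
  unfold shiftSym
  fun_prop

theorem fourierInv_shiftSym (n : ℕ) (h : E2 → ℂ) (x : ℝ × ℝ) :
    𝓕⁻ (fun ξ => shiftSym n ξ * h ξ) (toLp 2 x) =
      𝓕⁻ h (toLp 2 (x.1 - n, x.2)) := by
  rw [fourierInv_eq, fourierInv_eq]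
  refine integral_congr_ae (.of_forall fun ξ => ?_)
  simp only [shiftSym, Circle.smul_def, smul_eq_mul, WithLp.prod_inner_apply]
  rw [← mul_assoc, ← Circle.coe_mul, ← AddChar.map_add_eq_mul]
  congr 3
  simp
  ring

/-- Functions shifted to infinity escape decaying coefficients. -/
theorem tendsto_mulZ_shift {g : ℝ → ℝ} (hg : IsMult g)
    (hg0 : Tendsto g (cocompact ℝ) (𝓝 0)) {h : E2 → ℂ} (h1 : Integrable h) (h2 : MemLp h 2)
    {w : ℕ → L2w (wt2 α)} (hw : ∀ n, U α (w n) =ᵐ[volume] fun ξ => shiftSym n ξ * h ξ) :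
    Tendsto (fun n => mulZ α g (w n)) atTop (𝓝 0) := by
  set W : ℝ × ℝ → ℂ := fun x => 𝓕⁻ h (toLp 2 x)
  have hW : MemLp W 2 volume :=
    (memLp_fourierInv h1 h2).comp_measurePreserving (volume_preserving_toLp ℝ ℝ)
  have hm1 : ∀ n, Integrable fun ξ => shiftSym n ξ * h ξ := fun n =>
    h1.bdd_mul (c := 1) (continuous_shiftSym n).aestronglyMeasurable
      (.of_forall fun ξ => (norm_shiftSym n ξ).le)
  have hm2 : ∀ n, MemLp (fun ξ => shiftSym n ξ * h ξ) 2 := fun n =>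
    h2.of_le_mul (c := 1) (hm1 n).1
      (.of_forall fun ξ => by rw [norm_mul, norm_shiftSym])
  have hshift : ∀ n : ℕ, MeasurePreserving (fun x : ℝ × ℝ => x + ((n : ℝ), (0 : ℝ)))
      volume volume := fun n => measurePreserving_add_right _ _
  obtain ⟨C, hC⟩ := hg.2
  have key : Tendsto (fun n => Lp.compMeasurePreserving _ (hshift n)
      (expMulLI (wt2 α) (mulZ α g (w n)))) atTop (𝓝 0) := by
    refine tendsto_Lp_of_dominated (fun x => C * ‖W x‖) (hW.norm.const_mul C)
      (G' := fun (n : ℕ) x => (g (x.1 + n) : ℂ) * W x) (g' := fun _ => 0)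
      (.of_forall fun n => ?_) (Lp.coeFn_zero _ _ _)
      (.of_forall fun n => Eventually.of_forall fun x => ?_)
      (.of_forall fun x => ?_)
    · have e1 : expMulLI (wt2 α) (mulZ α g (w n)) =ᵐ[volume]
          fun x => (g x.1 : ℂ) * W (x.1 - n, x.2) := by
        filter_upwards [expMulLI_ae (wt2 α) (mulZ α g (w n)), mulZ_ae hg (w n),
          expMulLI_ae (wt2 α) (w n), U_symm_ae (hm1 n) (hm2 n) (hw n)] with x a1 a2 a3 a4
        rw [a1, a2]
        rw [a3, fourierInv_shiftSym] at a4
        rw [mul_left_comm, a4]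
      refine (Lp.coeFn_compMeasurePreserving _ (hshift n)).trans ?_
      filter_upwards [(hshift n).quasiMeasurePreserving.ae e1] with x hx
      rw [Function.comp_apply, hx]
      simp
    · rw [sub_zero, norm_mul, norm_real, norm_eq_abs]
      gcongr
      exact hC _
    · have t1 : Tendsto (fun n : ℕ => g (x.1 + n)) atTop (𝓝 0) := by
        refine hg0.comp ?_
        refine Tendsto.mono_right ?_ atTop_le_cocompact
        exact tendsto_atTop_add_const_left _ _ tendsto_natCast_atTop_atTop
      have t2 := ((continuous_ofReal.tendsto 0).comp t1).mul_const (W x)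
      simpa using t2
  rw [tendsto_zero_iff_norm_tendsto_zero] at key ⊢
  refine key.congr fun n => ?_
  rw [Lp.norm_compMeasurePreserving, LinearIsometry.norm_map]

/-! ### The edge of the spectrum -/

/-- The case of a root with `0 ≤ Re μ ≤ τ`: a bound for its frequency `x`. -/
theorem sq_le_of_root {γ α τ R x Y p q r s : ℝ} (hp : 0 ≤ p) (hpτ : p ≤ τ)
    (hr : -R ≤ r ∧ r ≤ R) (hs : -R ≤ s ∧ s ≤ R)
    (hre : p ^ 2 - q ^ 2 = -(γ ^ 2 * (x ^ 2 + Y ^ 2 - α ^ 2)) - r)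
    (him : 2 * (p * q) = -(γ ^ 2 * (2 * α * x)) - s) (hx : R ≤ 2 * γ ^ 2 * α * x) :
    4 * γ ^ 2 * (γ ^ 2 * α ^ 2 - τ ^ 2) * x ^ 2 ≤
      4 * γ ^ 2 * α * R * x + 4 * τ ^ 2 * (τ ^ 2 + γ ^ 2 * Y ^ 2 + R) := by
  have w1 : (2 * γ ^ 2 * α * x - R) ^ 2 ≤ (2 * (p * q)) ^ 2 := by
    rw [← neg_sq (2 * (p * q))]
    refine pow_le_pow_left₀ (by linarith) ?_ 2
    linarith [hs.1]
  have hτ2 : p ^ 2 ≤ τ ^ 2 := by gcongr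
  have w2 : q ^ 2 ≤ τ ^ 2 + γ ^ 2 * (x ^ 2 + Y ^ 2) + R := by
    have : 0 ≤ γ ^ 2 * α ^ 2 := by positivity
    linarith [hr.2]
  have w3 : (2 * (p * q)) ^ 2 ≤ 4 * τ ^ 2 * (τ ^ 2 + γ ^ 2 * (x ^ 2 + Y ^ 2) + R) := by
    calc _ = 4 * p ^ 2 * q ^ 2 := by ring
      _ ≤ _ := by gcongr
  linarith [sq_nonneg R]

namespace Params

variable (hp : Params a b c α)
include hp

theorem alphaC_pos : 0 < alphaC a b c :=
  hp.alpha_pos.trans hp.alpha_lt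

theorem tendsto_qc : Tendsto (qc a b c) (cocompact ℝ) (𝓝 0) := by
  refine tendsto_of_le_sech (k := alphaC a b c / 2) (C := |(c ^ 2 - 1) / c|)
    (half_pos hp.alphaC_pos) (abs_nonneg _) fun z => ?_
  have h := one_sub_tanh_sq_nonneg (alphaC a b c / 2 * z)
  rw [qc_eq, abs_mul, abs_of_nonneg h]
  gcongr
  exact le_mul_of_one_le_left h (le_add_of_nonneg_right (abs_nonneg _))

theorem tendsto_deriv_qc : Tendsto (deriv (qc a b c)) (cocompact ℝ) (𝓝 0) := by
  have hk := half_pos hp.alphaC_pos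
  refine tendsto_of_le_sech (k := alphaC a b c / 2) (C := |(c ^ 2 - 1) / c| * (alphaC a b c))
    hk (mul_nonneg (abs_nonneg _) hp.alphaC_pos.le) fun z => ?_
  have h := one_sub_tanh_sq_nonneg (alphaC a b c / 2 * z)
  have ht : |tanh (alphaC a b c / 2 * z)| ≤ 1 := by
    rw [abs_le_one_iff_mul_self_le_one]; nlinarith
  rw [(hasDerivAt_qc a b c z).deriv, abs_mul, abs_mul, abs_mul, abs_mul, abs_of_nonneg h,
    abs_of_pos hk, abs_neg, abs_two]
  set s := 1 - tanh (alphaC a b c / 2 * z) ^ 2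
  have h2 : s ≤ (1 + |alphaC a b c / 2 * z|) * s :=
    le_mul_of_one_le_left h (le_add_of_nonneg_right (abs_nonneg _))
  calc |(c ^ 2 - 1) / c| * (2 * |tanh (alphaC a b c / 2 * z)| * s * (alphaC a b c / 2))
      ≤ |(c ^ 2 - 1) / c| * (2 * 1 * ((1 + |alphaC a b c / 2 * z|) * s) * (alphaC a b c / 2)) := by
        gcongr
    _ = _ := by ring

theorem tendsto_rc : Tendsto (rc a b c) (cocompact ℝ) (𝓝 0) := by
  have := hp.tendsto_qc.const_mul (-c)
  rwa [mul_zero] at this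

theorem tendsto_deriv_rc : Tendsto (deriv (rc a b c)) (cocompact ℝ) (𝓝 0) := by
  have e : deriv (rc a b c) = fun z => -c * deriv (qc a b c) z := by
    ext z
    exact ((((isTanhPoly_qc a b c).isMult.1.differentiable (by simp)) z).hasDerivAt.const_mul
      (-c)).deriv
  rw [e]
  have := hp.tendsto_deriv_qc.const_mul (-c)
  rwa [mul_zero] at this

/-- The terms with variable coefficients vanish in the limit of packets shifted to infinity. -/
theorem tendsto_varOp_shift {h k : E2 → ℂ}
    (hz1 : Integrable fun ξ => sz α ξ * h ξ) (hz2 : MemLp (fun ξ => sz α ξ * h ξ) 2)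
    (hy1 : Integrable fun ξ => sy ξ * h ξ) (hy2 : MemLp (fun ξ => sy ξ * h ξ) 2)
    (k1 : Integrable k) (k2 : MemLp k 2) {u : ℕ → Xplane α}
    (hu0 : ∀ n, U α ((u n).fst.1 0) =ᵐ[volume] fun ξ => shiftSym n ξ * h ξ)
    (hu1 : ∀ n, U α (u n).snd =ᵐ[volume] fun ξ => shiftSym n ξ * k ξ) :
    Tendsto (fun n => varOp a b c α (u n)) atTop (𝓝 0) := by
  have hz : ∀ n, U α ((u n).fst.1 1) =ᵐ[volume] fun ξ => shiftSym n ξ * (sz α ξ * h ξ) := fun n => by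
    filter_upwards [Xplane.U_dz (u n), hu0 n] with ξ e1 e2
    rw [e1, e2]; ring
  have hy : ∀ n, U α ((u n).fst.1 2) =ᵐ[volume] fun ξ => shiftSym n ξ * (sy ξ * h ξ) := fun n => by
    filter_upwards [Xplane.U_dy (u n), hu0 n] with ξ e1 e2
    rw [e1, e2]; ring
  have hq := isTanhPoly_qc a b c
  have hr := isTanhPoly_rc a b c
  have t1 := tendsto_mulZ_shift hr.deriv.isMult hp.tendsto_deriv_rc hz1 hz2 hz
  have t2 := tendsto_mulZ_shift hq.deriv.isMult hp.tendsto_deriv_qc k1 k2 hu1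
  have t3 := tendsto_mulZ_shift hr.isMult hp.tendsto_rc hz1 hz2 hz
  have t4 := tendsto_mulZ_shift hq.isMult hp.tendsto_qc k1 k2 hu1
  have t5 := tendsto_mulZ_shift hr.isMult hp.tendsto_rc hy1 hy2 hy
  have m : ∀ (g : E2 → ℂ) {w : ℕ → L2w (wt2 α)}, Tendsto w atTop (𝓝 0) →
      Tendsto (fun n => fm g (U α (w n))) atTop (𝓝 0) := fun g w hw => by
    have := (((fm g).continuous.comp (U α).continuous).tendsto 0).comp hw
    rwa [Function.comp_apply, map_zero, map_zero] at this
  have s1 := m (fun ξ => 1 / (1 + b * sp α ξ)) (by simpa using t1.sub t2)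
  have s2 := m (fun ξ => sz α ξ / (1 + b * sp α ξ)) (by simpa using t3.add (t4.const_smul (2 : ℂ)))
  have s3 := m (fun ξ => sy ξ / (1 + b * sp α ξ)) t5
  have := (s1.add s2).add s3
  rw [add_zero, add_zero] at this
  exact this

theorem continuous_sS : Continuous (sS a b α) := by
  have : Continuous (sp α) := by unfold sp sz sy; fun_prop
  unfold sS
  exact (this.mul (by fun_prop)).div (by fun_prop) hp.symB_ne_zero

set_option maxHeartbeats 1000000 in
/-- Roots of the symbol far to the right: `|Im (-Δ̂)^{1/2}| → α` as the frequency in `z` tends to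
infinity. -/
theorem exists_root {τ : ℝ} (hτ : τ < α * sqrt (a / b)) (y : ℝ) :
    ∃ (ν : E2) (μ : ℂ), ν.ofLp.2 = y ∧ μ ^ 2 = -sS a b α ν ∧ τ < μ.re := by
  have hb := hp.b_pos
  have hab : 0 < a / b := div_pos hp.a_pos hb
  set γ := sqrt (a / b)
  have hγ : 0 < γ := sqrt_pos.2 hab
  have hγ2 : γ ^ 2 = a / b := sq_sqrt hab.le
  have hα := hp.alpha_pos
  have exists_sqrt : ∀ z : ℂ, ∃ μ : ℂ, μ ^ 2 = z ∧ 0 ≤ μ.re := fun z => by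
    obtain ⟨s, hs⟩ := IsAlgClosed.exists_pow_nat_eq z two_pos
    rcases le_total 0 s.re with h | h
    · exact ⟨s, hs, h⟩
    · exact ⟨-s, by rw [neg_sq, hs], by simpa using h⟩
  rcases lt_or_ge τ 0 with h0 | h0
  · obtain ⟨μ, h1, h2⟩ := exists_sqrt (-sS a b α (toLp 2 (0, y)))
    exact ⟨_, μ, rfl, h1, h0.trans_le h2⟩
  obtain ⟨R1, hR1, hR⟩ := hp.exists_sS_eq_add
  set Y := 2 * π * y
  set K := 4 * τ ^ 2 * (τ ^ 2 + γ ^ 2 * Y ^ 2 + R1)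
  have hK : 0 ≤ K := by positivity
  set D := 4 * γ ^ 2 * (γ ^ 2 * α ^ 2 - τ ^ 2) with hD'
  have hD : 0 < D := by
    have : τ ^ 2 < (α * γ) ^ 2 := by gcongr
    have h3 : 0 < γ ^ 2 * α ^ 2 - τ ^ 2 := by nlinarith
    positivity
  set x := (4 * γ ^ 2 * α * R1 + K + 1) / D + R1 / (2 * γ ^ 2 * α) + 1
  have hx1 : 1 ≤ x := by
    have : 0 ≤ (4 * γ ^ 2 * α * R1 + K + 1) / D + R1 / (2 * γ ^ 2 * α) := by positivity
    simp only [x]; linarith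
  have hx2 : 4 * γ ^ 2 * α * R1 + K + 1 ≤ D * x := by
    have h1 : 4 * γ ^ 2 * α * R1 + K + 1 = D * ((4 * γ ^ 2 * α * R1 + K + 1) / D) := by
      field_simp
    rw [h1]
    gcongr
    have : 0 ≤ R1 / (2 * γ ^ 2 * α) := by positivity
    simp only [x]; linarith
  have hx3 : R1 ≤ 2 * γ ^ 2 * α * x := by
    have h1 : R1 = 2 * γ ^ 2 * α * (R1 / (2 * γ ^ 2 * α)) := by field_simp
    rw [h1]
    gcongr
    have : 0 ≤ (4 * γ ^ 2 * α * R1 + K + 1) / D := by positivity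
    simp only [x]; linarith
  set ν : E2 := toLp 2 (x / (2 * π), y)
  have hfx : fx ν = x := by
    have := Real.pi_pos
    simp only [fx, ν]; field_simp
  have hfy : fy ν = Y := rfl
  obtain ⟨μ, hμ, hμ0⟩ := exists_sqrt (-sS a b α ν)
  refine ⟨ν, μ, rfl, hμ, ?_⟩
  by_contra hle
  push Not at hle
  obtain ⟨ρ, hρ, hsS⟩ := hR ν
  rw [← hγ2, ofReal_pow] at hsS
  have hre : μ.re ^ 2 - μ.im ^ 2 = -(γ ^ 2 * (x ^ 2 + Y ^ 2 - α ^ 2)) - ρ.re := by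
    have := congrArg Complex.re hμ
    rw [hsS, sp_eq, hfx, hfy, ← ofReal_pow] at this
    simp [pow_two] at this
    nlinarith
  have him : 2 * (μ.re * μ.im) = -(γ ^ 2 * (2 * α * x)) - ρ.im := by
    have := congrArg Complex.im hμ
    rw [hsS, sp_eq, hfx, hfy, ← ofReal_pow] at this
    simp [pow_two] at this
    nlinarith
  have r1 := abs_le.1 ((Complex.abs_re_le_norm ρ).trans hρ)
  have r2 := abs_le.1 ((Complex.abs_im_le_norm ρ).trans hρ)
  have w4 : D * x ^ 2 ≤ 4 * γ ^ 2 * α * R1 * x + K :=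
    sq_le_of_root hμ0 hle r1 r2 hre him hx3
  have w5 : (4 * γ ^ 2 * α * R1 + K + 1) * x ≤ D * x ^ 2 := by
    calc _ ≤ D * x * x := by gcongr
      _ = _ := by ring
  nlinarith

end Params

section Packet

section General

variable {V : Type*} [NormedAddCommGroup V] [MeasurableSpace V] [BorelSpace V]
  [SecondCountableTopology V] {ρ : Measure V} [IsFiniteMeasureOnCompacts ρ]
  {B : Set V} (hB : IsCompact B) {m : V → ℂ} (hm : Continuous m)
include hB hm

theorem integrable_indicator_of_isCompact : Integrable (B.indicator m) ρ :=
  (integrable_indicator_iff hB.measurableSet).2 (hm.continuousOn.integrableOn_compact hB)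

theorem memLp_indicator_of_isCompact : MemLp (B.indicator m) 2 ρ := by
  rw [memLp_indicator_iff_restrict hB.measurableSet]
  obtain ⟨C, hC⟩ := hB.exists_bound_of_continuousOn hm.continuousOn
  have : IsFiniteMeasure (ρ.restrict B) := ⟨by simpa using hB.measure_lt_top⟩
  exact MemLp.of_bound hm.aestronglyMeasurable C
    ((ae_restrict_iff' hB.measurableSet).2 (Eventually.of_forall hC))

end General

variable {B : Set E2} (hB : IsCompact B) {m : E2 → ℂ} (hm : Continuous m)
include hB hm

/-- The packet with symbol `m` on `B`, shifted by `n`. -/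
theorem exists_packet (n : ℕ) :
    ∃ w : Hh, w =ᵐ[volume] fun ξ => shiftSym n ξ * B.indicator m ξ := by
  have h := memLp_indicator_of_isCompact (ρ := volume) hB ((continuous_shiftSym n).mul hm)
  refine ⟨h.toLp, h.coeFn_toLp.trans (.of_forall fun ξ => ?_)⟩
  by_cases hξ : ξ ∈ B
  · simp [hξ]
  · simp [hξ]

end Packet

theorem shiftSym_mul_indicator_prod (I J : Set ℝ) (n : ℕ) (k : ℂ) (ξ : E2) :
    shiftSym n ξ * (WithLp.ofLp ⁻¹' (I ×ˢ J)).indicator (fun _ => k) ξ =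
      tens (I.indicator fun s => (𝐞 (-(n * s)) : ℂ)) (J.indicator fun _ => k) ξ.ofLp := by
  by_cases h1 : ξ.ofLp.1 ∈ I
  · by_cases h2 : ξ.ofLp.2 ∈ J
    · rw [indicator_of_mem (show ξ ∈ WithLp.ofLp ⁻¹' (I ×ˢ J) from ⟨h1, h2⟩), tens,
        indicator_of_mem h1, indicator_of_mem h2, shiftSym]
    · rw [indicator_of_notMem (fun h : ξ ∈ WithLp.ofLp ⁻¹' (I ×ˢ J) => h2 h.2), tens,
        indicator_of_notMem h2, mul_zero, mul_zero]
  · rw [indicator_of_notMem (fun h : ξ ∈ WithLp.ofLp ⁻¹' (I ×ˢ J) => h1 h.1), tens,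
      indicator_of_notMem h1, mul_zero, zero_mul]

theorem isCompact_box {I J : Set ℝ} (hI : IsCompact I) (hJ : IsCompact J) :
    IsCompact (WithLp.ofLp ⁻¹' (I ×ˢ J) : Set E2) :=
  (prodContinuousLinearEquiv 2 ℝ ℝ ℝ).toHomeomorph.isCompact_preimage.2 (hI.prod hJ)

theorem fib_eq_zero_of_box {I J : Set ℝ} (hI : IsCompact I) (hJ : IsCompact J) {n : ℕ} {k : ℂ}
    {α : ℝ} {v : L2w (wt2 α)} (hv : U α v =ᵐ[volume] fun ξ =>
      shiftSym n ξ * (WithLp.ofLp ⁻¹' (I ×ˢ J)).indicator (fun _ => k) ξ) :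
    ∀ᵐ η, η ∉ J → fib α v η = 0 := by
  set χ : ℝ → ℂ := I.indicator fun s => (𝐞 (-(n * s)) : ℂ)
  set θ : ℝ → ℂ := J.indicator fun _ => k
  have hB := isCompact_box hI hJ
  have e : (fun ξ => shiftSym n ξ * (WithLp.ofLp ⁻¹' (I ×ˢ J)).indicator (fun _ => k) ξ) =
      fun ξ : E2 => tens χ θ ξ.ofLp := by
    ext ξ
    exact shiftSym_mul_indicator_prod I J n k ξ
  have e' : (fun ξ : E2 => tens χ θ ξ.ofLp) =
      (WithLp.ofLp ⁻¹' (I ×ˢ J)).indicator fun ξ => shiftSym n ξ * k := by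
    rw [← e]
    ext ξ
    by_cases hξ : ξ ∈ (WithLp.ofLp ⁻¹' (I ×ˢ J) : Set E2)
    · rw [indicator_of_mem hξ, indicator_of_mem hξ]
    · rw [indicator_of_notMem hξ, indicator_of_notMem hξ, mul_zero]
  have ck : Continuous fun ξ => shiftSym n ξ * k := (continuous_shiftSym n).mul continuous_const
  have cχ : Continuous fun s : ℝ => (𝐞 (-(n * s)) : ℂ) := by fun_prop
  have ck' : Continuous fun _ : ℝ => k := continuous_const
  rw [e] at hv
  obtain ⟨X, hX⟩ := fib_tens (integrable_indicator_of_isCompact hI cχ)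
    (memLp_indicator_of_isCompact hI cχ) (integrable_indicator_of_isCompact hJ ck')
    (memLp_indicator_of_isCompact hJ ck') (e' ▸ integrable_indicator_of_isCompact hB ck)
    (e' ▸ memLp_indicator_of_isCompact hB ck) hv
  filter_upwards [hX] with η h1 h2
  rw [h1, indicator_of_notMem h2, zero_smul]

namespace Params

variable (hp : Params a b c α)
include hp

set_option maxHeartbeats 1000000 in
/-- Approximate eigenvectors for `e = c s_z(ν) + μ`, `μ² = -s_S(ν)`, with frequencies in a small
neighborhood `B` of `ν`, shifted by `n`: the error consists of the variation of the symbols over `B`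
and of the terms with variable coefficients, which disappear as `n → ∞`. -/
theorem exists_approx {B : Set E2} (hB : IsCompact B) {ν : E2} {μ : ℂ}
    (hμ : μ ^ 2 = -sS a b α ν) {ε : ℝ} (hε : 0 ≤ ε)
    (h1 : ∀ ξ ∈ B, ‖(N0 α ξ : ℂ) * (c * (sz α ν - sz α ξ))‖ ≤ ε)
    (h2 : ∀ ξ ∈ B, ‖c * (sz α ν - sz α ξ) * μ + (sS a b α ξ - sS a b α ν)‖ ≤ ε) (n : ℕ) :
    ∃ (u f : Xplane α) (w : Hh), LGraph a b c α u f ∧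
      (U α (u.fst.1 0) =ᵐ[volume] fun ξ => shiftSym n ξ * B.indicator (fun _ => 1) ξ) ∧
      (U α u.snd =ᵐ[volume] fun ξ => shiftSym n ξ * B.indicator (fun _ => μ) ξ) ∧
      (w =ᵐ[volume] fun ξ => shiftSym n ξ * B.indicator (fun _ => 1) ξ) ∧
      ‖w‖ ≤ ‖symX α u‖ ∧
      ‖symX α ((c * sz α ν + μ) • u - f)‖ ≤ 2 * ε * ‖w‖ + ‖varOp a b c α u‖ := by
  have cN : Continuous fun ξ => (N0 α ξ : ℂ) := by unfold N0 sz sy; fun_prop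
  have csz : Continuous (sz α) := by unfold sz; fun_prop
  have csS := hp.continuous_sS
  have hN : ∀ ξ, (N0 α ξ : ℂ) ≠ 0 := fun ξ => by exact_mod_cast (N0_pos α ξ).ne'
  obtain ⟨w, hw⟩ := exists_packet hB (m := fun _ => 1) continuous_const n
  obtain ⟨w1, hw1⟩ := exists_packet hB cN n
  obtain ⟨f1, hf1⟩ := exists_packet hB (m := fun ξ => (N0 α ξ : ℂ) * (c * sz α ξ + μ))
    (cN.mul ((csz.const_mul (c : ℂ)).add_const μ)) n
  obtain ⟨f2, hf2⟩ := exists_packet hB (m := fun ξ => c * sz α ξ * μ - sS a b α ξ)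
    (((csz.const_mul (c : ℂ)).mul_const μ).sub csS) n
  obtain ⟨u, hu⟩ := (symX α).surjective (w1, μ • w)
  obtain ⟨f, hf⟩ := (symX α).surjective (f1, f2 - varOp a b c α u)
  have u0 : U α (u.fst.1 0) =ᵐ[volume] fun ξ => shiftSym n ξ * B.indicator (fun _ => 1) ξ := by
    have e := symX_fst u
    rw [hu] at e
    filter_upwards [e, hw1] with ξ e1 e2
    rw [e2] at e1
    refine mul_left_cancel₀ (hN ξ) ?_
    rw [← e1]
    by_cases hξ : ξ ∈ B
    · simp [hξ]; ring
    · simp [hξ]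
  have u1 : U α u.snd =ᵐ[volume] fun ξ => shiftSym n ξ * B.indicator (fun _ => μ) ξ := by
    rw [← symX_snd, hu]
    filter_upwards [coeFn_smul μ w, hw] with ξ e1 e2
    rw [e1, Pi.smul_apply, e2, smul_eq_mul]
    by_cases hξ : ξ ∈ B
    · simp [hξ]; ring
    · simp [hξ]
  have hgraph : LGraph a b c α u f := by
    rw [hp.LGraph_iff]
    constructor
    · have e := symX_fst f
      rw [hf] at e
      filter_upwards [e, hf1, u0, u1] with ξ e1 e2 e3 e4
      rw [e2] at e1
      refine mul_left_cancel₀ (hN ξ) ?_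
      rw [← e1, e3, e4]
      by_cases hξ : ξ ∈ B
      · simp [hξ]; ring
      · simp [hξ]
    · rw [← symX_snd f, hf]
      filter_upwards [coeFn_sub f2 (varOp a b c α u), hf2, u0, u1] with ξ e1 e2 e3 e4
      rw [e1, Pi.sub_apply, e2, e3, e4]
      by_cases hξ : ξ ∈ B
      · simp [hξ]; ring
      · simp [hξ]
  refine ⟨u, f, w, hgraph, u0, u1, hw, ?_, ?_⟩
  · refine le_trans ?_ (norm_fst_le (symX α u))
    rw [hu]
    refine norm_le_norm_of_ae_le ?_
    filter_upwards [hw, hw1] with ξ e1 e2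
    rw [e1, e2, norm_mul, norm_mul, norm_shiftSym, one_mul, one_mul]
    by_cases hξ : ξ ∈ B
    · simp only [hξ, indicator_of_mem, norm_one, norm_real]
      exact (one_le_N0 α ξ).trans (le_abs_self _)
    · simp [hξ]
  · rw [map_sub, map_smul, hu, hf]
    have n1 : ‖(c * sz α ν + μ) • w1 - f1‖ ≤ ε * ‖w‖ := by
      refine Lp.norm_le_mul_norm_of_ae_le_mul ?_
      filter_upwards [coeFn_sub ((c * sz α ν + μ) • w1) f1,
        coeFn_smul (c * sz α ν + μ) w1, hw, hw1, hf1] with ξ e1 e2 e3 e4 e5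
      rw [e1, Pi.sub_apply, e2, Pi.smul_apply, e3, e4, e5, smul_eq_mul]
      by_cases hξ : ξ ∈ B
      · simp only [hξ, indicator_of_mem]
        rw [norm_mul (shiftSym n ξ), norm_shiftSym, norm_one, mul_one, mul_one]
        refine le_trans (le_of_eq ?_) (h1 ξ hξ)
        rw [← one_mul ‖(N0 α ξ : ℂ) * (c * (sz α ν - sz α ξ))‖, ← norm_shiftSym n ξ, ← norm_mul]
        congr 1
        ring
      · simp [hξ]
    have n2 : ‖(c * sz α ν + μ) • μ • w - f2‖ ≤ ε * ‖w‖ := by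
      refine Lp.norm_le_mul_norm_of_ae_le_mul ?_
      filter_upwards [coeFn_sub ((c * sz α ν + μ) • μ • w) f2,
        coeFn_smul (c * sz α ν + μ) (μ • w), coeFn_smul μ w, hw, hf2] with ξ e1 e2 e3 e4 e5
      rw [e1, Pi.sub_apply, e2, Pi.smul_apply, e3, Pi.smul_apply, e4, e5, smul_eq_mul, smul_eq_mul]
      by_cases hξ : ξ ∈ B
      · simp only [hξ, indicator_of_mem]
        rw [norm_mul (shiftSym n ξ) 1, norm_shiftSym, norm_one]
        simp only [mul_one]
        refine le_trans (le_of_eq ?_) (h2 ξ hξ)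
        rw [← one_mul ‖c * (sz α ν - sz α ξ) * μ + (sS a b α ξ - sS a b α ν)‖,
          ← norm_shiftSym n ξ, ← norm_mul]
        congr 1
        linear_combination shiftSym n ξ * hμ
      · simp [hξ]
    have hε' : 0 ≤ ε * ‖w‖ := by positivity
    refine max_le ?_ ?_
    · change ‖(c * sz α ν + μ) • w1 - f1‖ ≤ _
      linarith [norm_nonneg (varOp a b c α u)]
    · change ‖(c * sz α ν + μ) • μ • w - (f2 - varOp a b c α u)‖ ≤ _
      rw [sub_sub_eq_add_sub, add_sub_right_comm]
      refine (norm_add_le _ _).trans ?_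
      linarith

set_option maxHeartbeats 1000000 in
/-- Packets with transverse frequencies outside the range of the resonant modes show that the part
of the spectrum complementary to these modes reaches up to `Re = -α (c - (a / b)^{1/2})`. -/
theorem le_of_resolvent (A : FiberFamily α) (hA : ∀ u, A.op (A.op u) = A.op u)
    (hAL : ∀ u f, LGraph a b c α u f → LGraph a b c α (A.op u) (A.op f))
    {T : ℝ → Xplane α →L[ℂ] Xplane α} (hT : IsSemigroupGeneratedBy (LGraph a b c α) T) {β : ℝ}
    (hσ : ∀ l : ℂ, -β < l.re → l ∈ restrictedResolventSet (LGraph a b c α)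
      (LinearMap.range (ContinuousLinearMap.id ℂ (Xplane α) - A.op).toLinearMap)) :
    β ≤ α * (c - sqrt (a / b)) := by
  by_contra hlt
  push Not at hlt
  obtain ⟨ν, μ, hν, hμ, hμre⟩ := hp.exists_root (τ := c * α - β) (by linarith) (|A.R| + 1)
  have he : -β < (c * sz α ν + μ).re := by
    simp [sz_eq]; linarith
  obtain ⟨M, hM0, hM⟩ := exists_bound_of_isCompact
    (hT.mem_range_of_graph hA hAL) (S := {c * sz α ν + μ}) isCompact_singleton
    (by simpa using hσ _ he)
  set K := ‖((symX α).symm : Hh × Hh →L[ℂ] Xplane α)‖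
  set K' := ‖(symX α : Xplane α →L[ℂ] Hh × Hh)‖
  set Q := K' * (M * K)
  have hQ : 0 ≤ Q := by positivity
  set ε := 1 / (4 * (Q + 1))
  have hε : 0 < ε := by positivity
  have cN : Continuous fun ξ => (N0 α ξ : ℂ) := by unfold N0 sz sy; fun_prop
  have csz : Continuous (sz α) := by unfold sz; fun_prop
  have csS := hp.continuous_sS
  have csy : Continuous sy := by unfold sy; fun_prop
  -- a box around `ν`, written in coordinates, on which the symbols are almost constant
  have hev : ∀ᶠ x : ℝ × ℝ in 𝓝 ν.ofLp,
      ‖(N0 α (toLp 2 x) : ℂ) * (c * (sz α ν - sz α (toLp 2 x)))‖ < ε ∧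
      ‖c * (sz α ν - sz α (toLp 2 x)) * μ + (sS a b α (toLp 2 x) - sS a b α ν)‖ < ε ∧
      |A.R| < x.2 := by
    have ct : Continuous (toLp 2 : ℝ × ℝ → E2) :=
      (prodContinuousLinearEquiv 2 ℝ ℝ ℝ).symm.continuous
    have c1 : Continuous fun x : ℝ × ℝ =>
        ‖(N0 α (toLp 2 x) : ℂ) * (c * (sz α ν - sz α (toLp 2 x)))‖ :=
      ((cN.comp ct).mul (continuous_const.mul (continuous_const.sub (csz.comp ct)))).norm
    have c2 : Continuous fun x : ℝ × ℝ =>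
        ‖c * (sz α ν - sz α (toLp 2 x)) * μ + (sS a b α (toLp 2 x) - sS a b α ν)‖ :=
      (((continuous_const.mul (continuous_const.sub (csz.comp ct))).mul continuous_const).add
        ((csS.comp ct).sub continuous_const)).norm
    have z1 := (c1.tendsto ν.ofLp).eventually_lt_const (u := ε) (by simpa using hε)
    have z2 := (c2.tendsto ν.ofLp).eventually_lt_const (u := ε) (by simpa using hε)
    have z3 := (continuous_snd.tendsto ν.ofLp).eventually_const_lt (u := |A.R|) (by
      rw [hν]; linarith)
    filter_upwards [z1, z2, z3] with x a1 a2 a3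
    exact ⟨a1, a2, a3⟩
  obtain ⟨δ, hδ, hbox⟩ := Metric.nhds_basis_closedBall.eventually_iff.1 hev
  set I := Metric.closedBall ν.ofLp.1 δ
  set J := Metric.closedBall ν.ofLp.2 δ
  have hIJ : I ×ˢ J = Metric.closedBall ν.ofLp δ := closedBall_prod_same _ _ _
  set B : Set E2 := WithLp.ofLp ⁻¹' (I ×ˢ J)
  have hB : IsCompact B := isCompact_box (isCompact_closedBall _ _) (isCompact_closedBall _ _)
  have hBmem : ∀ ξ ∈ B, ξ.ofLp ∈ Metric.closedBall ν.ofLp δ := fun ξ hξ => hIJ ▸ hξ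
  have hBpos : 0 < volume B := by
    rw [(volume_preserving_ofLp ℝ ℝ).measure_preimage
      ((measurableSet_closedBall.prod measurableSet_closedBall).nullMeasurableSet), hIJ]
    exact Metric.measure_closedBall_pos _ _ hδ
  choose u f w hg hu0 hu1 hw hwu herr using hp.exists_approx hB hμ hε.le
    (fun ξ hξ => (hbox (hBmem ξ hξ)).1.le) (fun ξ hξ => (hbox (hBmem ξ hξ)).2.1.le)
  have hJA : ∀ η ∈ J, A.R < |η| := fun η hη => by
    have h3 : (ν.ofLp.1, η) ∈ Metric.closedBall ν.ofLp δ := by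
      rw [← hIJ]; exact ⟨Metric.mem_closedBall_self hδ.le, hη⟩
    exact (le_abs_self _).trans_lt ((hbox h3).2.2.trans_le (le_abs_self _))
  -- all packets have the same positive norm
  have hwn : ∀ n, ‖w n‖ = ‖w 0‖ := fun n => by
    refine le_antisymm (norm_le_norm_of_ae_le ?_) (norm_le_norm_of_ae_le ?_) <;>
    · filter_upwards [hw n, hw 0] with ξ e1 e2
      rw [e1, e2, norm_mul, norm_mul, norm_shiftSym, norm_shiftSym]
  have hw0 : 0 < ‖w 0‖ := by
    rw [norm_pos_iff]
    intro h0
    have hz : ∀ᵐ ξ : E2, ξ ∉ B := by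
      have h0' : w 0 =ᵐ[volume] 0 := by rw [h0]; exact Lp.coeFn_zero _ _ _
      filter_upwards [hw 0, h0'] with ξ e1 e2 hξ
      rw [e1] at e2
      have : ‖shiftSym 0 ξ * B.indicator (fun _ => (1 : ℂ)) ξ‖ = 0 := by rw [e2]; simp
      rw [norm_mul, norm_shiftSym] at this
      simp [hξ] at this
    have hz' : volume B = 0 := by
      have := ae_iff.1 hz
      simpa using this
    exact hBpos.ne' hz'
  have ind : ∀ m : E2 → ℂ, (fun ξ => m ξ * B.indicator (fun _ => (1 : ℂ)) ξ) = B.indicator m :=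
    fun m => by
      ext ξ
      by_cases hξ : ξ ∈ B <;> simp [hξ]
  have hV : Tendsto (fun n => varOp a b c α (u n)) atTop (𝓝 0) :=
    hp.tendsto_varOp_shift (by rw [ind]; exact integrable_indicator_of_isCompact hB csz)
      (by rw [ind]; exact memLp_indicator_of_isCompact hB csz)
      (by rw [ind]; exact integrable_indicator_of_isCompact hB csy)
      (by rw [ind]; exact memLp_indicator_of_isCompact hB csy)
      (integrable_indicator_of_isCompact hB continuous_const)
      (memLp_indicator_of_isCompact hB continuous_const) hu0 hu1
  -- the packets are not seen by the projection
  have hAu : ∀ n, A.op (u n) = 0 := fun n => by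
    have key : ∀ (k : ℂ) (v : L2w (wt2 α)),
        (U α v =ᵐ[volume] fun ξ => shiftSym n ξ * B.indicator (fun _ => k) ξ) →
        ∀ᵐ η, |η| ≤ A.R → fib α v η = 0 := by
      intro k v hv
      filter_upwards [fib_eq_zero_of_box (isCompact_closedBall _ _) (isCompact_closedBall _ _) hv]
        with η h1 h2
      exact h1 fun hη => (hJA η hη).not_ge h2
    exact A.op_eq_zero (key 1 _ (hu0 n)) (key μ _ (hu1 n))
  have hfin : ∀ n, ‖w 0‖ / 2 ≤ Q * ‖varOp a b c α (u n)‖ := fun n => by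
    have h1 := hM _ (mem_singleton _) (u n) ((mem_range_id_sub hA _).2 (hAu n)) _ (hg n)
    set g := (c * sz α ν + μ) • u n - f n
    have h2 : ‖symX α (u n)‖ ≤ K' * ‖u n‖ :=
      le_opNorm (symX α : Xplane α →L[ℂ] Hh × Hh) _
    have h3 : ‖g‖ ≤ K * ‖symX α g‖ := by
      have := le_opNorm ((symX α).symm : Hh × Hh →L[ℂ] Xplane α) (symX α g)
      simpa using this
    have h4 : ‖w 0‖ ≤ Q * (2 * ε * ‖w 0‖ + ‖varOp a b c α (u n)‖) := by
      calc ‖w 0‖ = ‖w n‖ := (hwn n).symm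
        _ ≤ K' * ‖u n‖ := (hwu n).trans h2
        _ ≤ K' * (M * (K * (2 * ε * ‖w n‖ + ‖varOp a b c α (u n)‖))) := by
          gcongr
          refine h1.trans ?_
          gcongr
          refine h3.trans ?_
          gcongr
          exact herr n
        _ = _ := by rw [hwn n]; ring
    have h5 : Q * (2 * ε) ≤ 1 / 2 := by
      simp only [ε]
      rw [show Q * (2 * (1 / (4 * (Q + 1)))) = Q / (2 * (Q + 1)) by field_simp; norm_num,
        div_le_div_iff₀ (by positivity) (by norm_num)]
      linarith
    nlinarith
  have hlim := (hV.norm.const_mul Q)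
  rw [norm_zero, mul_zero] at hlim
  have := ge_of_tendsto' hlim hfin
  linarith

end Params

end BenneyLuke

end

theorem corollary1 (a b c α : ℝ) (ha : 0 < a) (hab : a < b) (hc : 1 < c)
    (hα : 0 < α) (hα' : α < alphaC a b c)
    (η₀ : ℝ) (hη₀ : 0 < η₀)
    (lam : ℝ → ℂ) (ζ : ℝ → Xline α) (ζs : ℝ → Xline (-α))
    (hres : IsResonantCurve a b c α η₀ lam ζ ζs) :
    (∃ P : Xplane α →L[ℂ] Xplane α, IsResonantProjection ζ ζs η₀ P) ∧
    (∃ T : ℝ → Xplane α →L[ℂ] Xplane α, IsSemigroupGeneratedBy (LGraph a b c α) T) ∧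
    ∀ (P : Xplane α →L[ℂ] Xplane α) (T : ℝ → Xplane α →L[ℂ] Xplane α),
      IsResonantProjection ζ ζs η₀ P →
      IsSemigroupGeneratedBy (LGraph a b c α) T →
      ∀ β : ℝ, 0 < β →
        restrictedSpectrum (LGraph a b c α)
            (LinearMap.range (ContinuousLinearMap.id ℂ (Xplane α) - P).toLinearMap)
          ⊆ {l : ℂ | l.re ≤ -β} →
        ∀ β' : ℝ, β' < β → ∃ C : ℝ, 0 < C ∧ ∀ t : ℝ, 0 ≤ t →
          ‖(T t).comp (ContinuousLinearMap.id ℂ (Xplane α) - P)‖ ≤ C * Real.exp (-β' * t) := by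
  have hp : Params a b c α := ⟨ha, hab, hc, hα, hα'⟩
  set A := hres.fiberFamily hp hη₀
  have hA := hres.isResonantProjection_op hp hη₀
  refine ⟨⟨A.op, hA⟩, hp.exists_semigroup, ?_⟩
  intro P T hP hT β _ hσ β' hβ'
  obtain rfl : P = A.op := hP.unique hA
  have hAA : ∀ u, A.op (A.op u) = A.op u :=
    A.op_op (Eventually.of_forall fun η x => hres.act_act hp hη₀ η x)
  have hAL : ∀ u f, LGraph a b c α u f → LGraph a b c α (A.op u) (A.op f) := fun u f huf =>
    A.LGraph_op (Eventually.of_forall fun η x y hxy => hres.act_graph hp hη₀ η hxy) huf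
  have hres' : ∀ l : ℂ, -β < l.re → l ∈ restrictedResolventSet (LGraph a b c α)
      (LinearMap.range (ContinuousLinearMap.id ℂ (Xplane α) - A.op).toLinearMap) := by
    intro l hl
    by_contra h
    exact absurd (hσ h) (not_le.2 hl)
  have hβ := hp.le_of_resolvent A hAA hAL hT hres'
  exact hp.exists_decay hT hAA hAL (hβ'.trans_le hβ) fun l hl =>
    hres' l ((neg_lt_neg hβ').trans_le hl)
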